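/- Throughout, $k$ is a field of characteristic $0$ and repeated indices are summed. \textbf{The category $\mathcal B$.} An object is a finite-dimensional Lie bialgebra $L=H\ltimes V$ with basis $H_i$ of $H$ and $X^\mu$ of $V$ such that $$[H_i,H_k]=C^m_{ik}H_m,\quad [H_i,X^\mu]=A_{i\nu}^{\ \mu}X^\nu,\quad [X^\mu,X^\nu]=0,$$ $$\delta(X^\mu)=\gamma^\mu_{\rho\sigma}X^\rho\otimes X^\sigma,\quad \delta(H_i)=\alpha_{\rho i}^{\ k}(X^\rho\otimes H_k-H_k\otimes X^\rho),$$ where $C$ and $\gamma$ are skew-symmetric and satisfy the Jacobi identity, the $A_i$ define a representation of $H$ on $V$, the $\alpha_\rho$ define a representation of the Lie algebra $V^*$ (with structure constants $\gamma$) on $H^*$, and $$A_{i\nu}^{\ \mu}\gamma^\nu_{\rho\sigma}-\gamma^\mu_{\nu\sigma}A_{i\rho}^{\ \nu}-\gamma^\mu_{\rho\nu}A_{i\sigma}^{\ \nu}=A_{k\sigma}^{\ \mu}\alpha_{\rho i}^{\ k}-A_{k\rho}^{\ \mu}\alpha_{\sigma i}^{\ k},$$ $$\alpha_{\mu m}^{\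 k}C^m_{ij}-C^k_{im}\alpha_{\mu j}^{\ m}-C^k_{mj}\alpha_{\mu i}^{\ m}=\alpha_{\nu j}^{\ k}A_{i\mu}^{\ \nu}-\alpha_{\nu i}^{\ k}A_{j\mu}^{\ \nu}.$$ Morphisms are the linear maps that respect the Lie brackets of $L$ and of $L^*$ and commute with the involution $\sigma=(-1)_H\oplus(+1)_V$. \textbf{Quantum algebras.} Let $\gamma$ be a Lie algebra structure on $V^*$ and $\alpha$ a representation of $V^*$ on $H^*$, as above. Let $D^\mu(X',X'')$ be the Campbell--Hausdorff series of $V^*$, and let $\alpha\cdot X$, $\gamma\cdot X$ be the matrices $(\alpha\cdot X)^k_i=\alpha_{\rho i}^{\ k}X^\rho$, $(\gamma\cdot X)^\mu_\nu=\gamma^\mu_{\sigma\nu}X^\sigma$. A quantum algebra of type $(\gamma,\alpha)$, with structure series $C(X)^m_{ik}$, $A(X)_i^\mu\in k[[X^1,X^2,\dots]]$ in the variables $X^\mu$, is a topological Hopf algebra $U$ with elements $H_i,X^\mu$ such that: $U$ is complete and separated in the $I$-adic topology, where $I$ is the two-sided ideal generated by the $X^\mu$; for every $N$ the ordered monomials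 in the $X^\mu$ of degree $<N$ times the ordered monomials in the $H_i$ form a basis of $U/I^N$; $$[X^\mu,X^\nu]=0,\qquad [H_i,H_k]=C(X)^m_{ik}H_m,\qquad [H_i,X^\mu]=A(X)_i^\mu ;$$ $$\Delta(X^\mu)=D^\mu(X\otimes1,1\otimes X),\qquad \Delta(H_i)=(e^{\alpha\cdot X})^k_i\otimes H_k+H_i\otimes 1 .$$ (The coproduct takes values in the completed tensor product.) It is a quantization of $L\in\mathcal B$ if $\gamma,\alpha$ are those of $L$, and $C(0)^m_{ik}=C^m_{ik}$, $\ \partial A_i^\mu/\partial X^\nu(0)=A_{i\nu}^{\ \mu}$. Let $\mathcal H$ be the subcategory of topological Hopf algebras whose objects are the quantum algebras (of any type, each with the spans of its $H_i$ and of its $X^\mu$), and whose morphisms are the continuous Hopf algebra homomorphisms that map the span of the $H_i$ into the span of the $H_i$, and the span of the $X^\mu$ into the span of the $X^\mu$. \textbf{Theorem.} (1) Every $L\in\mathcal B$ has a quantization. Any two quantizations of $L$ are isomorphic by a unique isomorphism of topological Hopf algebras that maps the generators $H_i$, $X^\mu$ of one to those of the other. (2) In any quantization of $L$, the series $C(X)^m_{ik}$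 are the constants $C^m_{ik}$, and $$A(X)=\frac{\gamma''\cdot X}{e^{\gamma''\cdot X}-1}\,\hat A(X),\qquad \hat A(X)_i^\mu=\Bigl(\frac{e^{\alpha'\cdot X+\gamma''\cdot X}-1}{\alpha'\cdot X+\gamma''\cdot X}\Bigr)^{k\mu}_{i\nu}A_{k\rho}^{\ \nu}X^\rho ,$$ where primed matrices act on the index of $H$ and doubly primed ones on the index of $V$. Here $\hat A$ is a formal $1$-cocycle of the Lie group $\exp V^*$, $$\hat A(D(\xi,\zeta))_i^\mu=(e^{\alpha\cdot\xi})^k_i\,(e^{\gamma\cdot\xi})^\mu_\nu\,\hat A(\zeta)_k^\nu+\hat A(\xi)_i^\mu,$$ with differential $A_{i\nu}^{\ \mu}$ at the identity. (3) There is a functor $F\colon\mathcal B\to\mathcal H$ such that $F(L)$ is a quantization of $L$ and, for each morphism $\varphi\colon L\to L'$, the map $F(\varphi)$ is given on the generators $H_i$, $X^\mu$ by the same formulas as $\varphi$. The functor is onto $\mathcal H$: every object of $\mathcal H$ is isomorphic to some $F(L)$, and every morphism $F(L)\to F(L')$ in $\mathcal H$ is $F(\varphi)$ for some $\varphi$.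 -/

import Mathlib

open scoped TensorProduct Nat
open CategoryTheory

universe u

noncomputable section

/-! ## Inhomogeneous Lie bialgebras -/

/-- The coalgebra half of an inhomogeneous Lie bialgebra, i.e. the Lie algebra `L* = V* ⋉ H*`:
`γ ρ σ μ = γ^μ_{ρσ}` are the structure constants of the Lie algebra `V*`,
`α ρ i k = α_{ρ i}^k` are the matrices of a representation of `V*` on `H*`,
`ζ_ρ · η^k = ∑ i, α_{ρ i}^k η^i`. -/
structure CoStructure (k : Type u) [Field k] (n m : ℕ) where
  γ : Fin m → Fin m → Fin m → k
  α : Fin m → Fin n → Fin n → k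
  γ_skew : ∀ ρ σ μ, γ ρ σ μ = -γ σ ρ μ
  γ_jacobi : ∀ ρ σ τ μ,
    ∑ ν, (γ ρ σ ν * γ ν τ μ + γ σ τ ν * γ ν ρ μ + γ τ ρ ν * γ ν σ μ) = 0
  α_rep : ∀ ρ σ j l,
    ∑ i, (α σ i l * α ρ j i - α ρ i l * α σ j i) = ∑ μ, γ ρ σ μ * α μ j l

/-- An object of the category `B`: an inhomogeneous Lie bialgebra `L = H ⋉ V`, given in bases
`H_i` of `H` and `X^μ` of `V` by
`[H_i, H_j] = ∑ C i j l H_l`, `[H_i, X^μ] = ∑ A i ν μ X^ν`, `[X^μ, X^ν] = 0`,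
`δ(X^μ) = ∑ γ ρ σ μ X^ρ ⊗ X^σ`, `δ(H_i) = ∑ α ρ i l (X^ρ ⊗ H_l - H_l ⊗ X^ρ)`.
So `C i j l = C^l_{ij}` and `A i ν μ = A_{i ν}^μ`. -/
structure InhomLieBialgebra (k : Type u) [Field k] where
  n : ℕ
  m : ℕ
  co : CoStructure k n m
  C : Fin n → Fin n → Fin n → k
  A : Fin n → Fin m → Fin m → k
  C_skew : ∀ i j l, C i j l = -C j i l
  C_jacobi : ∀ i j p l,
    ∑ q, (C i j q * C q p l + C j p q * C q i l + C p i q * C q j l) = 0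
  A_rep : ∀ i j ρ μ,
    ∑ ν, (A j ν μ * A i ρ ν - A i ν μ * A j ρ ν) = ∑ l, C i j l * A l ρ μ
  cond1 : ∀ i ρ σ μ,
    ∑ ν, (A i ν μ * co.γ ρ σ ν - co.γ ν σ μ * A i ρ ν - co.γ ρ ν μ * A i σ ν) =
      ∑ l, (A l σ μ * co.α ρ i l - A l ρ μ * co.α σ i l)
  cond2 : ∀ i j μ l,
    ∑ q, (co.α μ q l * C i j q - C i q l * co.α μ j q - C q j l * co.α μ i q) =
      ∑ ν, (co.α ν j l * A i μ ν - co.α ν i l * A j μ ν)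

namespace InhomLieBialgebra

variable {k : Type u} [Field k]

/-- The underlying vector space of `L`; the first summand is `H`, the second one is `V`. -/
abbrev Space (L : InhomLieBialgebra k) : Type u := (Fin L.n → k) × (Fin L.m → k)

/-- The basis vector `H_i` of `L`. -/
def basisH (L : InhomLieBialgebra k) (i : Fin L.n) : L.Space := (Pi.single i 1, 0)

/-- The basis vector `X^μ` of `L`. -/
def basisX (L : InhomLieBialgebra k) (μ : Fin L.m) : L.Space := (0, Pi.single μ 1)

/-- The Lie bracket of `L`. -/
def bracket (L : InhomLieBialgebra k) (x y : L.Space) : L.Space :=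
  (fun l => ∑ i, ∑ j, x.1 i * y.1 j * L.C i j l,
   fun ν => ∑ i, ∑ μ, (x.1 i * y.2 μ - y.1 i * x.2 μ) * L.A i ν μ)

/-- The Lie cobracket of `L` (the transpose of the Lie bracket of `L*`). -/
def cobracket (L : InhomLieBialgebra k) (x : L.Space) : L.Space ⊗[k] L.Space :=
  ∑ μ, x.2 μ • ∑ ρ, ∑ σ, L.co.γ ρ σ μ • (L.basisX ρ ⊗ₜ[k] L.basisX σ) +
  ∑ i, x.1 i • ∑ ρ, ∑ l, L.co.α ρ i l •
    (L.basisX ρ ⊗ₜ[k] L.basisH l - L.basisH l ⊗ₜ[k] L.basisX ρ)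

/-- The involution `σ` of `L`: `-1` on `H` and `+1` on `V`. -/
def invol (L : InhomLieBialgebra k) (x : L.Space) : L.Space := (-x.1, x.2)

/-- Morphisms of `B`: linear maps respecting the Lie brackets of `L` and `L*` and commuting with
the involutions. -/
@[ext]
structure Hom (L M : InhomLieBialgebra k) where
  toLin : L.Space →ₗ[k] M.Space
  map_bracket : ∀ x y, toLin (L.bracket x y) = M.bracket (toLin x) (toLin y)
  map_cobracket : ∀ x, TensorProduct.map toLin toLin (L.cobracket x) = M.cobracket (toLin x)
  map_invol : ∀ x, toLin (L.invol x) = M.invol (toLin x)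

instance : Category (InhomLieBialgebra k) where
  Hom L M := Hom L M
  id L := ⟨LinearMap.id, fun _ _ => rfl, fun x => by simp, fun _ => rfl⟩
  comp f g := ⟨g.toLin ∘ₗ f.toLin,
    fun x y => by simp [f.map_bracket, g.map_bracket],
    fun x => by
      rw [TensorProduct.map_comp, LinearMap.comp_apply, f.map_cobracket, g.map_cobracket]
      rfl,
    fun x => by simp [f.map_invol, g.map_invol]⟩

end InhomLieBialgebra

/-! ## Formal series -/

/-- `f(M) = ∑ c_r M^r` for a power series `f = ∑ c_r t^r` and a square matrix `M` of formal series
without constant terms. The entries of `M ^ r` have no terms of degree less than `r`, so only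
finitely many `r` contribute to each coefficient. -/
def matrixSeries {k : Type u} [Field k] {τ ι : Type} [Fintype ι] [DecidableEq ι]
    (f : PowerSeries k) (M : Matrix ι ι (MvPowerSeries τ k)) : Matrix ι ι (MvPowerSeries τ k) :=
  Matrix.of fun i j (d : τ →₀ ℕ) => ∑ r ∈ Finset.range (d.degree + 1),
    PowerSeries.coeff r f * MvPowerSeries.coeff d ((M ^ r) i j)

/-- The series `e^t`. -/
def expSeries (k : Type u) [Field k] : PowerSeries k :=
  PowerSeries.mk fun r => ((r ! : ℕ) : k)⁻¹

/-- The series `(e^t - 1) / t`. -/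
def expQuotSeries (k : Type u) [Field k] : PowerSeries k :=
  PowerSeries.mk fun r => (((r + 1)! : ℕ) : k)⁻¹

/-- The series `t / (e^t - 1)`. -/
def toddSeries (k : Type u) [Field k] : PowerSeries k := (expQuotSeries k)⁻¹

namespace CoStructure

variable {k : Type u} [Field k] {n m : ℕ}

/-- The Lie bracket of `V* ⊗ R`, where `R` is a ring of formal series. -/
def bracketV (co : CoStructure k n m) {τ : Type} (u v : Fin m → MvPowerSeries τ k) :
    Fin m → MvPowerSeries τ k :=
  fun μ => ∑ ρ, ∑ σ, co.γ ρ σ μ • (u ρ * v σ)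

/-- The iterated bracket `[a₁, [a₂, … [a_{r-1}, a_r]]]`. -/
def nestedBracket (co : CoStructure k n m) {τ : Type} :
    List (Fin m → MvPowerSeries τ k) → Fin m → MvPowerSeries τ k
  | [] => 0
  | [a] => a
  | a :: b :: l => co.bracketV a (co.nestedBracket (b :: l))

/-- The homogeneous part of degree `N` of the Campbell-Hausdorff series of `V*`
in the two generic points `X' = (X (inl μ))` and `X'' = (X (inr μ))` of `V*`,
by Dynkin's formula
`∑_r (-1)^(r-1)/r ∑ [X'^{p₁} X''^{q₁} … X'^{p_r} X''^{q_r}] / (N · ∏ p_i! q_i!)`,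
the inner sum being over all `p_i, q_i` with `p_i + q_i > 0` and `∑ (p_i + q_i) = N`. -/
def campbellHausdorffPart (co : CoStructure k n m) (N : ℕ) :
    Fin m → MvPowerSeries (Fin m ⊕ Fin m) k :=
  ∑ r ∈ Finset.Icc 1 N,
    ∑ p ∈ (Fintype.piFinset fun _ : Fin r =>
        Finset.range (N + 1) ×ˢ Finset.range (N + 1)).filter
        (fun p => (∀ i, 0 < (p i).1 + (p i).2) ∧ ∑ i, ((p i).1 + (p i).2) = N),
      ((-1 : k) ^ (r + 1) / ((r : k) * (N : k)) *
          ∏ i, ((((p i).1 ! * (p i).2 ! : ℕ) : k))⁻¹) •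
        co.nestedBracket (List.ofFn fun i =>
          List.replicate (p i).1 (fun μ => MvPowerSeries.X (Sum.inl μ)) ++
          List.replicate (p i).2 (fun μ => MvPowerSeries.X (Sum.inr μ))).flatten

/-- The Campbell-Hausdorff series `D^μ(X', X'')` of the Lie algebra `V*`. -/
def campbellHausdorff (co : CoStructure k n m) (μ : Fin m) : MvPowerSeries (Fin m ⊕ Fin m) k :=
  fun d => MvPowerSeries.coeff d (co.campbellHausdorffPart d.degree μ)

/-- The matrix `α·X`, with `(α·X) i l = (α·X)^l_i = ∑ ρ, α_{ρ i}^l X^ρ`. -/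
def alphaX (co : CoStructure k n m) : Matrix (Fin n) (Fin n) (MvPowerSeries (Fin m) k) :=
  Matrix.of fun i l => ∑ ρ, co.α ρ i l • MvPowerSeries.X ρ

/-- The matrix `γ·X` of the adjoint representation of `V*`,
`(γ·X) μ ν = (γ·X)^μ_ν = ∑ σ, γ^μ_{σν} X^σ`. -/
def gammaX (co : CoStructure k n m) : Matrix (Fin m) (Fin m) (MvPowerSeries (Fin m) k) :=
  Matrix.of fun μ ν => ∑ σ, co.γ σ ν μ • MvPowerSeries.X σ

/-- The matrix `e^{α·X}`, with `expAlpha i l = (e^{α·X})^l_i`. -/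
def expAlpha (co : CoStructure k n m) : Matrix (Fin n) (Fin n) (MvPowerSeries (Fin m) k) :=
  matrixSeries (expSeries k) co.alphaX

/-- The matrix `e^{γ·X}` of the adjoint action of the group `exp V*` on `V*`. -/
def expGamma (co : CoStructure k n m) : Matrix (Fin m) (Fin m) (MvPowerSeries (Fin m) k) :=
  matrixSeries (expSeries k) co.gammaX

/-- The matrix `α'·X + γ''·X`, acting on tensors with indices `(i, μ)`. -/
def alphaGammaX (co : CoStructure k n m) :
    Matrix (Fin n × Fin m) (Fin n × Fin m) (MvPowerSeries (Fin m) k) :=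
  Matrix.kroneckerMap (· * ·) co.alphaX 1 + Matrix.kroneckerMap (· * ·) 1 co.gammaX

/-- `a` is a (formal) 1-cocycle of the Lie group `exp V*` with values in `Hom(H*, V*)`:
`a(ξ∘ζ)_i^μ = ∑ (e^{α·ξ})^l_i Ad(ξ)^μ_ν a(ζ)_l^ν + a(ξ)_i^μ`.
The group multiplication is the Campbell-Hausdorff series. -/
def IsGroupCocycle (co : CoStructure k n m) (a : Fin n → Fin m → MvPowerSeries (Fin m) k) :
    Prop :=
  ∀ i μ, MvPowerSeries.subst co.campbellHausdorff (a i μ) =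
    ∑ l, ∑ ν,
      MvPowerSeries.subst
          (fun ρ => (MvPowerSeries.X (Sum.inl ρ) : MvPowerSeries (Fin m ⊕ Fin m) k))
          (co.expAlpha i l * co.expGamma μ ν) *
        MvPowerSeries.subst
          (fun ρ => (MvPowerSeries.X (Sum.inr ρ) : MvPowerSeries (Fin m ⊕ Fin m) k)) (a l ν) +
      MvPowerSeries.subst
        (fun ρ => (MvPowerSeries.X (Sum.inl ρ) : MvPowerSeries (Fin m ⊕ Fin m) k)) (a i μ)

end CoStructure

namespace InhomLieBialgebra

variable {k : Type u} [Field k]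

/-- `Â(X)_i^μ`, where
`Â = ((e^{α'·X + γ''·X} - 1) / (α'·X + γ''·X)) (A_{kρ}^ν X^ρ)`. -/
def cocycle (L : InhomLieBialgebra k) (i : Fin L.n) (μ : Fin L.m) :
    MvPowerSeries (Fin L.m) k :=
  ∑ l, ∑ ν, matrixSeries (expQuotSeries k) L.co.alphaGammaX (i, μ) (l, ν) *
    ∑ ρ, L.A l ρ ν • MvPowerSeries.X ρ

/-- `A(X)_i^μ`, where `A(X) = (γ''·X / (e^{γ''·X} - 1)) Â(X)`; the matrix on the right-hand side is
the differential at the identity of the right translation by the point `X`. -/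
def seriesA (L : InhomLieBialgebra k) (i : Fin L.n) (μ : Fin L.m) :
    MvPowerSeries (Fin L.m) k :=
  ∑ ν, matrixSeries (toddSeries k) L.co.gammaX μ ν * L.cocycle i ν

/-- The constant series `C^l_{ij}`. -/
def seriesC (L : InhomLieBialgebra k) (i j l : Fin L.n) : MvPowerSeries (Fin L.m) k :=
  MvPowerSeries.C (L.C i j l)

end InhomLieBialgebra

/-! ## Complete Hopf algebras -/

/-- The image of `t ∈ U ⊗ U` in `U/I^N ⊗ U/I^N`. -/
def approxTensor (k : Type u) [Field k] {U : Type u} [Ring U] [Algebra k U] (I : Ideal U)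
    [I.IsTwoSided] (N : ℕ) : U ⊗[k] U →ₐ[k] (U ⧸ I ^ N) ⊗[k] (U ⧸ I ^ N) :=
  Algebra.TensorProduct.map (Ideal.Quotient.mkₐ k (I ^ N)) (Ideal.Quotient.mkₐ k (I ^ N))

/-- A topological Hopf algebra over `k` whose topology is the `I`-adic one for a two-sided ideal
`I`, and which is complete and separated. The completed tensor square of the carrier `U` is the
inverse limit of the algebras `U/I^N ⊗ U/I^N`, so a comultiplication is a compatible sequence of
algebra maps `comul N : U → U/I^N ⊗ U/I^N`. An element `t` of `U ⊗ U` with the same image as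
`Δ(u)` in `U/I^N ⊗ U/I^N` is an approximation of order `N` to `Δ(u)`; the axioms say that
the maps `Δ ⊗ id`, `id ⊗ Δ`, `ε ⊗ id`, `id ⊗ ε`, `S * id`, `id * S`, extended by continuity, satisfy
the usual identities. -/
structure AdicHopfAlgebra (k : Type u) [Field k] where
  carrier : Type u
  [ring : Ring carrier]
  [algebra : Algebra k carrier]
  I : Ideal carrier
  [twoSided : I.IsTwoSided]
  separated : ∀ u : carrier, (∀ N, u ∈ I ^ N) → u = 0
  complete : ∀ u : ℕ → carrier, (∀ N, u (N + 1) - u N ∈ I ^ N) → ∃ v, ∀ N, v - u N ∈ I ^ N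
  comul : ∀ N : ℕ, carrier →ₐ[k] (carrier ⧸ I ^ N) ⊗[k] (carrier ⧸ I ^ N)
  counit : carrier →ₐ[k] k
  antipode : carrier →ₗ[k] carrier
  comul_compat : ∀ (M N : ℕ), N ≤ M → ∀ (u : carrier) (t : carrier ⊗[k] carrier),
    approxTensor k I M t = comul M u →
    approxTensor k I N t = comul N u
  comul_continuous : ∀ N, ∃ M, ∀ u ∈ I ^ M, comul N u = 0
  counit_continuous : ∃ M, ∀ u ∈ I ^ M, counit u = 0
  antipode_continuous : ∀ N, ∃ M, ∀ u ∈ I ^ M, antipode u ∈ I ^ N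
  coassoc : ∀ (N : ℕ) (u : carrier), ∃ M₀, ∀ M ≥ M₀, ∀ t : carrier ⊗[k] carrier,
    approxTensor k I M t = comul M u →
    Algebra.TensorProduct.assoc k k k _ _ _
        (Algebra.TensorProduct.map (comul N) (Ideal.Quotient.mkₐ k (I ^ N)) t) =
      Algebra.TensorProduct.map (Ideal.Quotient.mkₐ k (I ^ N)) (comul N) t
  counit_left : ∀ (N : ℕ) (u : carrier), ∃ M₀, ∀ M ≥ M₀, ∀ t : carrier ⊗[k] carrier,
    approxTensor k I M t = comul M u →
    Algebra.TensorProduct.lid k carrier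
      (Algebra.TensorProduct.map counit (AlgHom.id k carrier) t) - u ∈ I ^ N
  counit_right : ∀ (N : ℕ) (u : carrier), ∃ M₀, ∀ M ≥ M₀, ∀ t : carrier ⊗[k] carrier,
    approxTensor k I M t = comul M u →
    Algebra.TensorProduct.rid k k carrier
      (Algebra.TensorProduct.map (AlgHom.id k carrier) counit t) - u ∈ I ^ N
  antipode_left : ∀ (N : ℕ) (u : carrier), ∃ M₀, ∀ M ≥ M₀, ∀ t : carrier ⊗[k] carrier,
    approxTensor k I M t = comul M u →
    LinearMap.mul' k carrier (TensorProduct.map antipode LinearMap.id t) -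
      algebraMap k carrier (counit u) ∈ I ^ N
  antipode_right : ∀ (N : ℕ) (u : carrier), ∃ M₀, ∀ M ≥ M₀, ∀ t : carrier ⊗[k] carrier,
    approxTensor k I M t = comul M u →
    LinearMap.mul' k carrier (TensorProduct.map LinearMap.id antipode t) -
      algebraMap k carrier (counit u) ∈ I ^ N

attribute [instance] AdicHopfAlgebra.ring AdicHopfAlgebra.algebra AdicHopfAlgebra.twoSided

namespace AdicHopfAlgebra

variable {k : Type u} [Field k]

/-- Morphisms: continuous algebra maps `Φ` with `ε ∘ Φ = ε` and `(Φ ⊗ Φ) ∘ Δ = Δ ∘ Φ`. -/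
@[ext]
structure Hom (U W : AdicHopfAlgebra k) where
  toAlg : U.carrier →ₐ[k] W.carrier
  continuous : ∀ N, ∃ M, ∀ u ∈ U.I ^ M, toAlg u ∈ W.I ^ N
  map_counit : ∀ u, W.counit (toAlg u) = U.counit u
  map_comul : ∀ (N : ℕ) (u : U.carrier), ∃ M₀, ∀ M ≥ M₀, ∀ t,
    approxTensor k U.I M t = U.comul M u →
      approxTensor k W.I N (Algebra.TensorProduct.map toAlg toAlg t) = W.comul N (toAlg u)

instance : Category (AdicHopfAlgebra k) where
  Hom U W := Hom U W
  id U := ⟨AlgHom.id k U.carrier, fun N => ⟨N, fun _ h => h⟩, fun _ => rfl, fun N u =>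
    ⟨N, fun M hM t ht => by simpa using U.comul_compat M N hM u t ht⟩⟩
  comp f g := ⟨g.toAlg.comp f.toAlg,
    fun N => by
      obtain ⟨M, hM⟩ := g.continuous N
      obtain ⟨M₁, h⟩ := f.continuous M
      exact ⟨M₁, fun u hu => hM _ (h u hu)⟩,
    fun u => by simp [f.map_counit, g.map_counit],
    fun N u => by
      obtain ⟨M, hM⟩ := g.map_comul N (f.toAlg u)
      obtain ⟨M₁, h⟩ := f.map_comul M u
      refine ⟨M₁, fun M₂ hM₂ t ht => ?_⟩
      have := hM M le_rfl _ (h M₂ hM₂ t ht)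
      rw [Algebra.TensorProduct.map_comp]
      exact this⟩

end AdicHopfAlgebra

/-! ## Quantum algebras -/

/-- The ordered monomial `x₁^{d₁} x₂^{d₂} ⋯ x_r^{d_r}`. -/
def orderedMonomial {U : Type u} [Ring U] {r : ℕ} (x : Fin r → U) (d : Fin r →₀ ℕ) : U :=
  (List.ofFn fun j => x j ^ d j).prod

/-- The value at `x` of the part of degree less than `N` of a formal series `f`. If all `x_j` lie in
`I`, this is `f(x)` modulo `I ^ N`. -/
def truncEval {k : Type u} [Field k] {U : Type u} [Ring U] [Algebra k U] {r : ℕ}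
    (N : ℕ) (f : MvPowerSeries (Fin r) k) (x : Fin r → U) : U :=
  ∑ a ∈ Finset.range N, ∑ d ∈ Finset.finsuppAntidiag Finset.univ a,
    MvPowerSeries.coeff d f • orderedMonomial x d

/-- The complete Hopf algebra `U` is generated by the `h i = H_i` and the `x μ = X^μ`, with the
commutation relations `[X^μ, X^ν] = 0`, `[H_i, H_j] = ∑ C(X)^l_{ij} H_l`,
`[H_i, X^μ] = A(X)_i^μ`, where `Cs i j l = C(X)^l_{ij}` and `As i μ = A(X)_i^μ` are formal series,
and with the coproduct `Δ(X^μ) = D^μ(X ⊗ 1, 1 ⊗ X)`,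
`Δ(H_i) = ∑ (e^{α·X})^l_i ⊗ H_l + H_i ⊗ 1`. The topology is the `X`-adic one, and the algebra has
the same size as `U(H)[[X]]`: the ordered monomials in the `X^μ` and the `H_i` are a topological
basis. -/
structure IsQuantumAlgebra {k : Type u} [Field k] {n m : ℕ} (co : CoStructure k n m)
    (Cs : Fin n → Fin n → Fin n → MvPowerSeries (Fin m) k)
    (As : Fin n → Fin m → MvPowerSeries (Fin m) k)
    (U : AdicHopfAlgebra k) (h : Fin n → U.carrier) (x : Fin m → U.carrier) : Prop where
  ideal_eq : U.I = Ideal.span {y | ∃ a b μ, y = a * x μ * b}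
  basis_indep : ∀ N, LinearIndependent k
    fun p : {d : Fin m →₀ ℕ // d.degree < N} × (Fin n →₀ ℕ) =>
      Ideal.Quotient.mkₐ k (U.I ^ N) (orderedMonomial x p.1 * orderedMonomial h p.2)
  basis_span : ∀ N, Submodule.span k (Set.range
    fun p : {d : Fin m →₀ ℕ // d.degree < N} × (Fin n →₀ ℕ) =>
      Ideal.Quotient.mkₐ k (U.I ^ N) (orderedMonomial x p.1 * orderedMonomial h p.2)) = ⊤
  comm_xx : ∀ μ ν, x μ * x ν - x ν * x μ = 0
  comm_hh : ∀ N i j, h i * h j - h j * h i - ∑ l, truncEval N (Cs i j l) x * h l ∈ U.I ^ N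
  comm_hx : ∀ N i μ, h i * x μ - x μ * h i - truncEval N (As i μ) x ∈ U.I ^ N
  comul_x : ∀ N μ, U.comul N (x μ) =
    ∑ a ∈ Finset.range N, ∑ d ∈ Finset.finsuppAntidiag Finset.univ a,
    ∑ b ∈ Finset.range N, ∑ e ∈ Finset.finsuppAntidiag Finset.univ b,
      MvPowerSeries.coeff (Finsupp.sumElim d e) (co.campbellHausdorff μ) •
        (Ideal.Quotient.mkₐ k (U.I ^ N) (orderedMonomial x d) ⊗ₜ[k]
          Ideal.Quotient.mkₐ k (U.I ^ N) (orderedMonomial x e))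
  comul_h : ∀ N i, U.comul N (h i) =
    ∑ l, Ideal.Quotient.mkₐ k (U.I ^ N) (truncEval N (co.expAlpha i l) x) ⊗ₜ[k]
        Ideal.Quotient.mkₐ k (U.I ^ N) (h l) +
      Ideal.Quotient.mkₐ k (U.I ^ N) (h i) ⊗ₜ[k] 1

/-- The classical limits: `C(0) = C` and `∂A(0)/∂X = A`. -/
def HasClassicalLimit {k : Type u} [Field k] (L : InhomLieBialgebra k)
    (Cs : Fin L.n → Fin L.n → Fin L.n → MvPowerSeries (Fin L.m) k)
    (As : Fin L.n → Fin L.m → MvPowerSeries (Fin L.m) k) : Prop :=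
  (∀ i j l, MvPowerSeries.constantCoeff (Cs i j l) = L.C i j l) ∧
  (∀ i μ ν, MvPowerSeries.coeff (Finsupp.single ν 1) (As i μ) = L.A i ν μ)

/-- `U`, with the generators `h` and `x`, is a quantization of `L`. -/
def IsQuantization {k : Type u} [Field k] (L : InhomLieBialgebra k) (U : AdicHopfAlgebra k)
    (h : Fin L.n → U.carrier) (x : Fin L.m → U.carrier) : Prop :=
  ∃ Cs As, IsQuantumAlgebra L.co Cs As U h x ∧ HasClassicalLimit L Cs As

/-- An object of the subcategory of quantum algebras: a Hopf algebra `U` with subspaces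
`spanH`, `spanX` spanned by generators `H_i` and `X^μ`, whose coproduct and commutation relations
are of the form of `IsQuantumAlgebra`, for some structure of a Lie algebra on `V*`,
some representation of it on `H*`, and some formal series `C(X)` and `A(X)`. -/
structure QuantumAlgebra (k : Type u) [Field k] where
  hopf : AdicHopfAlgebra k
  spanH : Submodule k hopf.carrier
  spanX : Submodule k hopf.carrier
  exists_generators : ∃ (n m : ℕ) (co : CoStructure k n m)
    (Cs : Fin n → Fin n → Fin n → MvPowerSeries (Fin m) k)
    (As : Fin n → Fin m → MvPowerSeries (Fin m) k)
    (h : Fin n → hopf.carrier) (x : Fin m → hopf.carrier),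
    IsQuantumAlgebra co Cs As hopf h x ∧
      Submodule.span k (Set.range h) = spanH ∧ Submodule.span k (Set.range x) = spanX

namespace QuantumAlgebra

variable {k : Type u} [Field k]

/-- Morphisms of quantum algebras: morphisms of Hopf algebras which are linear on the
generators `H_i`, and linear on the generators `X^μ`. -/
@[ext]
structure Hom (P Q : QuantumAlgebra k) where
  toHopf : P.hopf ⟶ Q.hopf
  map_spanH : ∀ y ∈ P.spanH, AdicHopfAlgebra.Hom.toAlg toHopf y ∈ Q.spanH
  map_spanX : ∀ y ∈ P.spanX, AdicHopfAlgebra.Hom.toAlg toHopf y ∈ Q.spanX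

instance : Category (QuantumAlgebra k) where
  Hom P Q := Hom P Q
  id P := ⟨𝟙 P.hopf, fun _ h => h, fun _ h => h⟩
  comp f g := ⟨f.toHopf ≫ g.toHopf,
    fun y hy => g.map_spanH _ (f.map_spanH y hy),
    fun y hy => g.map_spanX _ (f.map_spanX y hy)⟩

/-- The underlying algebra map of a morphism. -/
def algMap {P Q : QuantumAlgebra k} (f : P ⟶ Q) : P.hopf.carrier →ₐ[k] Q.hopf.carrier :=
  AdicHopfAlgebra.Hom.toAlg (Hom.toHopf f)

/-- The inclusion of the subcategory of quantum algebras into Hopf algebras. -/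
def toHopfAlgebra (k : Type u) [Field k] : QuantumAlgebra k ⥤ AdicHopfAlgebra k where
  obj P := P.hopf
  map f := Hom.toHopf f

end QuantumAlgebra

end

noncomputable section
set_option linter.unusedSectionVars false

local notation "PS" => MvPowerSeries
open Finset (sum_congr sum_comm mul_sum sum_sub_distrib sum_add_distrib smul_sum sum_mul sum_smul
  sum_ite_eq sum_eq_single sum_neg_distrib sum_eq_zero mem_univ finsuppAntidiag sum_mul_sum
  sum_const_zero sum_eq_single_of_mem)
open Matrix (mulVec mulVec_mulVec one_mulVec sub_mulVec kroneckerMap kroneckerMap_apply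
  mulVec_zero mulVec_sum mulVec_smul mulVec_add mulVec_neg mul_apply one_apply)
open Ideal.Quotient (mkₐ eq_zero_iff_mem)
open Algebra.TensorProduct (tmul_mul_tmul map_tmul includeLeft includeRight)
open TensorProduct (tmul_sum sum_tmul tmul_smul tmul_add add_tmul tmul_sub sub_tmul zero_tmul
  tmul_zero smul_tmul')
open Finsupp (single sumElim)
open Submodule (span subset_span)
open MvPowerSeries
local notation "tmap" => Algebra.TensorProduct.map
open Finset.HasAntidiagonal (mem_antidiagonal)
open QuantumAlgebra (algMap)
open InhomLieBialgebra (basisH basisX)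
open DFunLike (congr_fun)
variable {k : Type u} [Field k] [CharZero k] {n m : ℕ} {τ : Type}

namespace InhomQuant

section DegIdeal

variable {σ : Type}

/-- The ideal of formal series without terms of degree less than `N`. -/
def degIdeal (k : Type u) [Field k] (τ : Type) (N : ℕ) : Ideal (PS τ k) where
  carrier := {f | ∀ d, d.degree < N → coeff d f = 0}
  add_mem' ha hb d hd := by rw [map_add, ha d hd, hb d hd, add_zero]
  zero_mem' d _ := by simp
  smul_mem' c f hf d hd := by
    classical
    rw [smul_eq_mul, coeff_mul]
    refine sum_eq_zero fun p hp => ?_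
    rw [hf p.2, mul_zero]
    rw [← mem_antidiagonal.1 hp, map_add] at hd
    omega

/-- A family of formal series without constant terms. -/
abbrev InMax {σ : Type*} (v : σ → PS τ k) : Prop := ∀ i, v i ∈ degIdeal k τ 1

theorem mem_degIdeal {N : ℕ} {f : PS τ k} :
    f ∈ degIdeal k τ N ↔ ∀ d, d.degree < N → coeff d f = 0 := Iff.rfl

theorem degIdeal_mono {M N : ℕ} (h : N ≤ M) : degIdeal k τ M ≤ degIdeal k τ N :=
  fun _ hf d hd => hf d (hd.trans_le h)

theorem mem_degIdeal_zero (f : PS τ k) : f ∈ degIdeal k τ 0 := fun _ h => absurd h (by simp)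

theorem mul_mem_degIdeal {M N : ℕ} {f g : PS τ k} (hf : f ∈ degIdeal k τ M)
    (hg : g ∈ degIdeal k τ N) : f * g ∈ degIdeal k τ (M + N) := by
  classical
  intro d hd
  rw [coeff_mul]
  refine sum_eq_zero fun p hp => ?_
  rw [← mem_antidiagonal.1 hp, map_add] at hd
  by_cases h : p.1.degree < M
  · rw [hf _ h, zero_mul]
  · rw [hg p.2 (by omega), mul_zero]

theorem smul_mem_degIdeal {N : ℕ} (c : k) {f : PS τ k} (hf : f ∈ degIdeal k τ N) :
    c • f ∈ degIdeal k τ N := by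
  rw [MvPowerSeries.smul_eq_C_mul]; exact Ideal.mul_mem_left _ _ hf

theorem pow_mem_degIdeal {f : PS τ k} (hf : f ∈ degIdeal k τ 1) (r : ℕ) :
    f ^ r ∈ degIdeal k τ r := by
  induction r with
  | zero => exact mem_degIdeal_zero _
  | succ r ih => rw [pow_succ]; exact mul_mem_degIdeal ih hf

theorem mem_degIdeal_one {f : PS τ k} : f ∈ degIdeal k τ 1 ↔ constantCoeff f = 0 := by
  constructor
  · intro h; simpa using h 0 (by simp)
  · intro h d hd
    have : d = 0 := (Finsupp.degree_eq_zero_iff d).1 (by omega)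
    subst this; simpa using h

theorem X_mem_degIdeal (i : τ) : (X i : PS τ k) ∈ degIdeal k τ 1 :=
  mem_degIdeal_one.2 (by simp)

theorem monomial_mem_degIdeal (d : τ →₀ ℕ) (c : k) : monomial d c ∈ degIdeal k τ d.degree := by
  classical
  intro e he
  rw [coeff_monomial, if_neg]
  rintro rfl; omega

theorem eq_zero_of_mem_degIdeal {f : PS τ k} (h : ∀ N, f ∈ degIdeal k τ N) : f = 0 := by
  ext d
  exact h (d.degree + 1) d (Nat.lt_succ_self _)

theorem eq_of_sub_mem_degIdeal {f g : PS τ k} (h : ∀ N, f - g ∈ degIdeal k τ N) :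
    f = g := sub_eq_zero.1 (eq_zero_of_mem_degIdeal h)

theorem sub_truncTotal_mem_degIdeal [Finite τ] (N : ℕ) (f : PS τ k) :
    f - (truncTotal N f : MvPolynomial τ k) ∈ degIdeal k τ N := by
  intro d hd
  rw [map_sub, MvPolynomial.coeff_coe, coeff_truncTotal _ hd, sub_self]

variable {u : σ → PS τ k}

theorem hasSubst_of_mem [Finite σ] (hu : InMax u) :
    HasSubst u := hasSubst_of_constantCoeff_zero fun i => mem_degIdeal_one.1 (hu i)

theorem monomial_eq_prod [Fintype σ] (d : σ →₀ ℕ) (c : k) :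
    (monomial d c : PS σ k) = c • ∏ i, X i ^ d i := by
  have := congrArg (fun p : MvPolynomial σ k => (p : PS σ k))
    (MvPolynomial.monomial_eq (s := d) (a := c))
  simp only [MvPolynomial.coe_monomial] at this
  rw [this, MvPowerSeries.smul_eq_C_mul, Finsupp.prod_fintype _ _ (by simp)]
  simp only [MvPolynomial.coe_mul, MvPolynomial.coe_C]
  congr 1
  exact (map_prod MvPolynomial.coeToMvPowerSeries.ringHom _ _).trans (by simp)

theorem prod_pow_mem_degIdeal [Fintype σ]
    (hu : InMax u) (d : σ →₀ ℕ) : ∏ i, u i ^ d i ∈ degIdeal k τ d.degree := by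
  classical
  rw [Finsupp.degree_eq_sum]
  have : ∀ s : Finset σ, ∏ i ∈ s, u i ^ d i ∈ degIdeal k τ (∑ i ∈ s, d i) := by
    intro s
    induction s using Finset.induction_on with
    | empty => exact mem_degIdeal_zero _
    | insert a s ha ih =>
      rw [Finset.prod_insert ha, Finset.sum_insert ha]
      exact mul_mem_degIdeal (pow_mem_degIdeal (hu a) _) ih
  exact this _

theorem subst_mem_degIdeal [Finite σ]
    (hu : InMax u) {N : ℕ} {f : PS σ k} (hf : f ∈ degIdeal k σ N) :
    subst u f ∈ degIdeal k τ N := by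
  have := Fintype.ofFinite σ
  intro e he
  rw [coeff_subst (hasSubst_of_mem hu)]
  refine finsum_eq_zero_of_forall_eq_zero fun d => ?_
  by_cases hd : d.degree < N
  · rw [hf d hd, zero_smul]
  · rw [Finsupp.prod_fintype _ _ (by simp), prod_pow_mem_degIdeal hu d e (by omega), smul_zero]

/-- A linear map between spaces of formal series that is continuous and vanishes on monomials is
zero. -/
theorem linearMap_eq_zero_of_monomial [Finite σ] (T : PS σ k →ₗ[k] PS τ k)
    (hT : ∀ N, ∃ M, ∀ f ∈ degIdeal k σ M, T f ∈ degIdeal k τ N)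
    (h : ∀ p : MvPolynomial σ k, T p = 0) : T = 0 := by
  ext1 f
  refine eq_zero_of_mem_degIdeal fun N => ?_
  obtain ⟨M, hM⟩ := hT N
  have := hM _ (sub_truncTotal_mem_degIdeal M f)
  rwa [map_sub, h, sub_zero] at this

theorem subst_C' (u : σ → PS τ k) (c : k) : subst u (C c : PS σ k) = C c := subst_C c

theorem subst_sum {ι : Type*} (hu : HasSubst u) (s : Finset ι)
    (f : ι → PS σ k) : subst u (∑ i ∈ s, f i) = ∑ i ∈ s, subst u (f i) := by
  simp only [← coe_substAlgHom hu, map_sum]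

theorem subst_neg (hu : HasSubst u) (f : PS σ k) : subst u (-f) = -subst u f := by
  simp only [← coe_substAlgHom hu, map_neg]

theorem subst_one (hu : HasSubst u) : subst u (1 : PS σ k) = 1 := by
  simp only [← coe_substAlgHom hu, map_one]

theorem subst_zero (hu : HasSubst u) : subst u (0 : PS σ k) = 0 := by
  simp only [← coe_substAlgHom hu, map_zero]

end DegIdeal

section VectorField

variable {σ : Type} [Fintype τ]

/-- The vector field with components `c`. -/
def vectorField (c : τ → PS τ k) : Derivation k (PS τ k) (PS τ k) :=
  ∑ i, c i • pderiv k i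

theorem vectorField_apply (c : τ → PS τ k) (f : PS τ k) :
    vectorField c f = ∑ i, c i * pderiv k i f := by
  rw [vectorField, ← Derivation.coeFnAddMonoidHom_apply, map_sum, Finset.sum_apply]
  rfl

@[simp] theorem vectorField_X (c : τ → PS τ k) (i : τ) : vectorField c (X i) = c i := by
  classical
  simp [vectorField_apply, pderiv_X, Pi.single_apply]

theorem pderiv_mem_degIdeal {N : ℕ} {f : PS τ k} (hf : f ∈ degIdeal k τ (N + 1)) (i : τ) :
    pderiv k i f ∈ degIdeal k τ N := by
  intro d hd
  rw [coeff_pderiv, hf _ (by rw [map_add, Finsupp.degree_single]; omega), zero_mul]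

theorem vectorField_mem_degIdeal (c : τ → PS τ k) {N : ℕ} {f : PS τ k}
    (hf : f ∈ degIdeal k τ (N + 1)) : vectorField c f ∈ degIdeal k τ N := by
  rw [vectorField_apply]
  exact sum_mem fun i _ => Ideal.mul_mem_left _ _ (pderiv_mem_degIdeal hf i)

theorem vectorField_mem_degIdeal' {c : τ → PS τ k} (hc : InMax c)
    {N : ℕ} {f : PS τ k} (hf : f ∈ degIdeal k τ N) :
    vectorField c f ∈ degIdeal k τ N := by
  rw [vectorField_apply]
  refine sum_mem fun i _ => ?_
  cases N with
  | zero => exact mem_degIdeal_zero _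
  | succ N => rw [add_comm]; exact mul_mem_degIdeal (hc i) (pderiv_mem_degIdeal hf i)

theorem derivation_subst_polynomial [Fintype σ] (D : Derivation k (PS τ k) (PS τ k))
    {u : σ → PS τ k} (hu : HasSubst u) (p : MvPolynomial σ k) :
    D (subst u (p : PS σ k)) = ∑ i, subst u (pderiv k i (p : PS σ k)) * D (u i) := by
  classical
  induction p using MvPolynomial.induction_on with
  | C a =>
    rw [MvPolynomial.coe_C, subst_C']
    simp only [pderiv_C, subst_zero hu, zero_mul, sum_const_zero]
    rw [show (C a : PS τ k) = algebraMap k _ a from rfl, Derivation.map_algebraMap]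
  | add p q hp hq =>
    simp only [MvPolynomial.coe_add, subst_add hu, map_add, hp, hq, add_mul, sum_add_distrib]
  | mul_X p j hp =>
    simp only [MvPolynomial.coe_mul, MvPolynomial.coe_X, subst_mul hu, Derivation.leibniz,
      subst_add hu, smul_eq_mul, hp, subst_X hu, add_mul, sum_add_distrib, mul_sum]
    congr 1
    · rw [sum_eq_single j]
      · simp [subst_one hu]
      · intro b _ hb
        simp [hb.symm, subst_zero hu]
      · simp
    · exact sum_congr rfl fun i _ => by ring

theorem vectorField_subst [Fintype σ] (c : τ → PS τ k) {u : σ → PS τ k}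
    (hu : InMax u) (f : PS σ k) :
    vectorField c (subst u f) = ∑ i, subst u (pderiv k i f) * vectorField c (u i) := by
  have hs := hasSubst_of_mem hu
  have := linearMap_eq_zero_of_monomial (σ := σ) (τ := τ) (k := k)
    ((vectorField c).toLinearMap ∘ₗ (substAlgHom hs).toLinearMap -
      ∑ i, LinearMap.mulRight k (vectorField c (u i)) ∘ₗ (substAlgHom hs).toLinearMap ∘ₗ
        (pderiv k i).toLinearMap)
    (fun N => ⟨N + 1, fun f hf => ?_⟩) (fun p => ?_)
  · have := LinearMap.congr_fun this f
    simpa [sub_eq_zero, coe_substAlgHom, LinearMap.sum_apply] using this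
  · simp only [LinearMap.sub_apply, LinearMap.sum_apply, LinearMap.comp_apply]
    refine sub_mem ?_ (sum_mem fun i _ => ?_)
    · exact vectorField_mem_degIdeal _ (by
        simpa [coe_substAlgHom] using subst_mem_degIdeal hu hf)
    · simp only [LinearMap.mulRight_apply]
      refine Ideal.mul_mem_right _ _ ?_
      simpa [coe_substAlgHom] using subst_mem_degIdeal hu (pderiv_mem_degIdeal hf i)
  · simpa [sub_eq_zero, coe_substAlgHom, LinearMap.sum_apply] using
      derivation_subst_polynomial (vectorField c) hs p

theorem derivation_apply_eq (c : τ → PS τ k) (f : PS τ k) :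
    vectorField c f = ∑ i, pderiv k i f * c i := by
  rw [vectorField_apply]; exact sum_congr rfl fun i _ => mul_comm _ _

theorem pderiv_comm (i j : τ) (f : PS τ k) :
    pderiv k i (pderiv k j f) = pderiv k j (pderiv k i f) := by
  classical
  ext d
  simp only [coeff_pderiv]
  rw [add_right_comm]
  by_cases h : i = j
  · subst h; ring
  · simp [h, Ne.symm h]; ring

/-- The Euler vector field. -/
def euler (k : Type u) [Field k] (τ : Type) [Fintype τ] :
    Derivation k (PS τ k) (PS τ k) := vectorField X

theorem coeff_euler (d : τ →₀ ℕ) (f : PS τ k) : coeff d (euler k τ f) = d.degree * coeff d f := by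
  classical
  rw [euler, vectorField_apply, map_sum, Finsupp.degree_eq_sum, Nat.cast_sum, sum_mul]
  refine sum_congr rfl fun i _ => ?_
  rw [X, coeff_monomial_mul]
  split_ifs with h
  · have h1 : d - single i 1 + single i 1 = d := tsub_add_cancel_of_le h
    rw [coeff_pderiv, h1, one_mul, mul_comm]
    congr 1
    conv_rhs => rw [← h1]
    simp
  · have : d i = 0 := by
      by_contra h0
      exact h (Finsupp.single_le_iff.2 (Nat.one_le_iff_ne_zero.2 h0))
    simp [this]

theorem euler_pderiv (i : τ) (f : PS τ k) :
    euler k τ (pderiv k i f) + pderiv k i f = pderiv k i (euler k τ f) := by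
  ext d
  simp only [map_add, coeff_pderiv, coeff_euler, Finsupp.degree_single, Nat.cast_add, Nat.cast_one]
  ring

@[simp] theorem euler_X (i : τ) : euler k τ (X i) = X i := vectorField_X _ _

/-- Uniqueness for the equation `(E + c) Y = F(Y)`, where `F` raises the order. -/
theorem eq_zero_of_euler {ι : Type*} (c : ℕ) (Y : ι → PS τ k) (h0 : c ≠ 0 ∨ InMax Y)
    (h : ∀ N, (∀ i, Y i ∈ degIdeal k τ N) → ∀ i, euler k τ (Y i) + (c : k) • Y i ∈ degIdeal k τ
      (N + 1)) :
    Y = 0 := by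
  have key : ∀ N, ∀ i, Y i ∈ degIdeal k τ N := by
    intro N
    induction N with
    | zero => exact fun i => mem_degIdeal_zero _
    | succ N ih =>
      intro i d hd
      have := h N ih i d hd
      rw [map_add, coeff_euler, coeff_smul, ← add_mul, ← Nat.cast_add, mul_eq_zero] at this
      rcases this with h1 | h1
      · have h2 : d.degree + c = 0 := by exact_mod_cast h1
        rcases h0 with h0 | h0
        · omega
        · exact h0 i d (by omega)
      · exact h1
  funext i
  exact eq_zero_of_mem_degIdeal fun N => key N i

theorem eq_zero_of_euler_linear {ι : Type*} [Fintype ι] (c : ℕ) (Y : ι → PS τ k)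
    (h0 : c ≠ 0 ∨ InMax Y) (B : Matrix ι ι (PS τ k))
    (hB : ∀ i j, B i j ∈ degIdeal k τ 1)
    (h : ∀ i, euler k τ (Y i) + (c : k) • Y i = ∑ j, B i j * Y j) : Y = 0 :=
  eq_zero_of_euler c Y h0 fun N hN i => by
    rw [h i, add_comm]
    exact sum_mem fun j _ => mul_mem_degIdeal (hB i j) (hN j)

theorem euler_mem_degIdeal_one (f : PS τ k) : euler k τ f ∈ degIdeal k τ 1 := by
  rw [mem_degIdeal_one, ← coeff_zero_eq_constantCoeff_apply, coeff_euler]; simp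

theorem mem_degIdeal_of_euler {N : ℕ} {f : PS τ k}
    (h0 : f ∈ degIdeal k τ 1) (h : euler k τ f ∈ degIdeal k τ N) : f ∈ degIdeal k τ N := by
  intro d hd
  have := h d hd
  rw [coeff_euler, mul_eq_zero] at this
  rcases this with h1 | h1
  · exact h0 d (by have : d.degree = 0 := by exact_mod_cast h1
                   omega)
  · exact h1

theorem subst_X_self (f : PS τ k) : subst (X : τ → PS τ k) f = f := by rw [subst_self]; rfl

end VectorField

section MatrixSeries

variable {σ : Type} {ι κ l : Type} [Fintype ι] [DecidableEq ι] [Fintype κ]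
  [DecidableEq κ]

variable {m n : Type*}

/-- All entries of `A` have order at least `N`. -/
def MatMem (N : ℕ) (A : Matrix m n (PS τ k)) : Prop :=
  ∀ i j, A i j ∈ degIdeal k τ N

variable {N : ℕ}

theorem MatMem.add {A B : Matrix m n (PS τ k)} (hA : MatMem N A)
    (hB : MatMem N B) : MatMem N (A + B) := fun i j => add_mem (hA i j) (hB i j)

theorem MatMem.neg {A : Matrix m n (PS τ k)} (hA : MatMem N A) :
    MatMem N (-A) := fun i j => neg_mem (hA i j)

theorem MatMem.sub {A B : Matrix m n (PS τ k)} (hA : MatMem N A)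
    (hB : MatMem N B) : MatMem N (A - B) := fun i j => sub_mem (hA i j) (hB i j)

theorem MatMem.smul {A : Matrix m n (PS τ k)} (c : k)
    (hA : MatMem N A) : MatMem N (c • A) := fun i j => smul_mem_degIdeal c (hA i j)

theorem MatMem.zero (A : Matrix m n (PS τ k)) : MatMem 0 A :=
  fun _ _ => mem_degIdeal_zero _

theorem MatMem.mul {M N : ℕ} {A : Matrix m ι (PS τ k)}
    {B : Matrix ι n (PS τ k)} (hA : MatMem M A) (hB : MatMem N B) :
    MatMem (M + N) (A * B) := fun i j => by
  rw [mul_apply]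
  exact sum_mem fun s _ => mul_mem_degIdeal (hA i s) (hB s j)

theorem MatMem.mul_left (A : Matrix m ι (PS τ k)) {B : Matrix ι n (PS τ k)} (hB : MatMem N B) :
    MatMem N (A * B) := by simpa using (MatMem.zero A).mul hB

theorem MatMem.mul_right {A : Matrix m ι (PS τ k)} (hA : MatMem N A) (B : Matrix ι n (PS τ k)) :
    MatMem N (A * B) := by simpa using hA.mul (MatMem.zero B)

theorem MatMem.sum {m n s : Type*} (S : Finset s) (A : s → Matrix m n (PS τ k))
    (hA : ∀ i ∈ S, MatMem N (A i)) : MatMem N (∑ i ∈ S, A i) := fun i j => by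
  rw [Matrix.sum_apply]
  exact sum_mem fun s hs => hA s hs i j

theorem MatMem.pow {A : Matrix ι ι (PS τ k)} (hA : MatMem 1 A) (r : ℕ) : MatMem r (A ^ r) := by
  induction r with
  | zero => exact MatMem.zero _
  | succ r ih => rw [pow_succ]; exact ih.mul hA

theorem eq_of_matMem_sub {A B : Matrix m n (PS τ k)} (h : ∀ N, MatMem N (A - B)) : A = B := by
  ext1 i j
  exact eq_of_sub_mem_degIdeal fun N => h N i j

theorem coeff_matrixSeries_def (f : PowerSeries k) (M : Matrix ι ι (PS τ k)) (i j : ι)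
    (d : τ →₀ ℕ) : coeff d (matrixSeries f M i j) = ∑ r ∈ Finset.range (d.degree + 1),
      PowerSeries.coeff r f * coeff d ((M ^ r) i j) := rfl

variable {M : Matrix ι ι (PS τ k)}

theorem coeff_matrixSeries (f : PowerSeries k)
    (hM : MatMem 1 M) (i j : ι) {d : τ →₀ ℕ} {n : ℕ} (hd : d.degree < n) :
    coeff d (matrixSeries f M i j) =
      ∑ r ∈ Finset.range n, PowerSeries.coeff r f * coeff d ((M ^ r) i j) := by
  rw [coeff_matrixSeries_def]
  refine Finset.sum_subset (Finset.range_mono hd) fun r _ hr => ?_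
  rw [hM.pow r i j d (by simpa using hr), mul_zero]

/-- `f(M)` is approximated by `p(M)` for any polynomial `p` approximating `f`. -/
theorem matrixSeries_sub_aeval {f : PowerSeries k}
    (hM : MatMem 1 M) {p : Polynomial k} (hp : ∀ r < N, p.coeff r = PowerSeries.coeff r f) :
    MatMem N (matrixSeries f M - Polynomial.aeval M p) := by
  intro i j d hd
  rw [Matrix.sub_apply, map_sub, sub_eq_zero,
    coeff_matrixSeries f hM i j (lt_of_lt_of_le hd (le_max_left N (p.natDegree + 1))),
    Polynomial.aeval_eq_sum_range' (lt_of_lt_of_le (Nat.lt_succ_self _) (le_max_right N _)),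
    Matrix.sum_apply, map_sum]
  refine sum_congr rfl fun r _ => ?_
  rw [Matrix.smul_apply, coeff_smul]
  by_cases h : r < N
  · rw [hp r h]
  · rw [hM.pow r i j d (by omega), mul_zero, mul_zero]

theorem matrixSeries_sub_aeval_trunc (f : PowerSeries k) (hM : MatMem 1 M) (N : ℕ) :
    MatMem N (matrixSeries f M - Polynomial.aeval M (PowerSeries.trunc N f)) :=
  matrixSeries_sub_aeval hM fun r hr => by rw [PowerSeries.coeff_trunc, if_pos hr]

theorem matrixSeries_coe (p : Polynomial k)
    (hM : MatMem 1 M) : matrixSeries (p : PowerSeries k) M = Polynomial.aeval M p :=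
  eq_of_matMem_sub fun _ => matrixSeries_sub_aeval hM fun r _ => by simp

theorem matrixSeries_add (f g : PowerSeries k) (M : Matrix ι ι (PS τ k)) :
    matrixSeries (f + g) M = matrixSeries f M + matrixSeries g M := by
  ext i j d
  rw [Matrix.add_apply, map_add]
  simp only [coeff_matrixSeries_def, map_add, add_mul, sum_add_distrib]

theorem matrixSeries_mul (f g : PowerSeries k)
    (hM : MatMem 1 M) : matrixSeries (f * g) M = matrixSeries f M * matrixSeries g M := by
  refine eq_of_matMem_sub fun N => ?_
  have h1 := matrixSeries_sub_aeval (f := f * g) hM (N := N)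
    (p := PowerSeries.trunc N f * PowerSeries.trunc N g) fun r hr => by
      rw [PowerSeries.coeff_mul_eq_coeff_trunc_mul_trunc f g hr, ← Polynomial.coe_mul,
        Polynomial.coeff_coe]
  have h2 := matrixSeries_sub_aeval_trunc f hM N
  have h3 := matrixSeries_sub_aeval_trunc g hM N
  have := (h1.sub (h2.mul_right (matrixSeries g M))).sub
    (h3.mul_left (Polynomial.aeval M (PowerSeries.trunc N f)))
  convert this using 1
  rw [map_mul]
  noncomm_ring

theorem matrixSeries_one (hM : MatMem 1 M) : matrixSeries (1 : PowerSeries k) M = 1 := by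
  simpa using matrixSeries_coe (1 : Polynomial k) hM

theorem matrixSeries_X (hM : MatMem 1 M) : matrixSeries (PowerSeries.X : PowerSeries k) M = M := by
  simpa using matrixSeries_coe (Polynomial.X : Polynomial k) hM

theorem matrixSeries_C (c : k) (hM : MatMem 1 M) : matrixSeries (PowerSeries.C c) M = c • 1 := by
  simpa [Algebra.algebraMap_eq_smul_one] using matrixSeries_coe (Polynomial.C c) hM

theorem matrixSeries_smul (c : k) (f : PowerSeries k) (M : Matrix ι ι (PS τ k)) :
    matrixSeries (c • f) M = c • matrixSeries f M := by
  ext i j d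
  rw [Matrix.smul_apply, coeff_smul]
  simp [coeff_matrixSeries_def, mul_sum, mul_assoc]

theorem matrixSeries_sub (f g : PowerSeries k) (M : Matrix ι ι (PS τ k)) :
    matrixSeries (f - g) M = matrixSeries f M - matrixSeries g M := by
  rw [eq_sub_iff_add_eq, ← matrixSeries_add, sub_add_cancel]

/-- `M ↦ f(M)` as a homomorphism in `f`. -/
def matrixSeriesHom (hM : MatMem 1 M) : PowerSeries k →ₐ[k] Matrix ι ι (PS τ k) :=
  AlgHom.ofLinearMap
    { toFun := fun f => matrixSeries f M
      map_add' := fun f g => matrixSeries_add f g M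
      map_smul' := fun c f => matrixSeries_smul c f M }
    (matrixSeries_one hM) (fun f g => matrixSeries_mul f g hM)

theorem matrixSeriesHom_apply (hM : MatMem 1 M)
    (f : PowerSeries k) : matrixSeriesHom hM f = matrixSeries f M := rfl

theorem matrixSeries_sub_coeff_zero (f : PowerSeries k)
    (hM : MatMem 1 M) : MatMem 1 (matrixSeries f M - PowerSeries.constantCoeff f • 1) := by
  have := matrixSeries_sub_aeval (f := f) hM (N := 1)
    (p := Polynomial.C (PowerSeries.constantCoeff f)) fun r hr => by
      obtain rfl : r = 0 := by omega
      simp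
  simpa [Algebra.algebraMap_eq_smul_one] using this

theorem matMem_matrixSeries (f : PowerSeries k) (hf : PowerSeries.constantCoeff f = 0) (hM :
    MatMem 1 M) : MatMem 1 (matrixSeries f M) := by
  simpa [hf] using matrixSeries_sub_coeff_zero f hM

theorem matMem_aeval_sub {M M' : Matrix ι ι (PS τ k)} (h : MatMem N (M - M')) (p : Polynomial k) :
    MatMem N (Polynomial.aeval M p - Polynomial.aeval M' p) := by
  have hpow : ∀ r, MatMem N (M ^ r - M' ^ r) := by
    intro r
    induction r with
    | zero => intro i j; simp
    | succ r ih =>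
      have := (ih.mul_right M).add (h.mul_left (M' ^ r))
      rw [pow_succ, pow_succ]
      convert this using 1
      noncomm_ring
  rw [Polynomial.aeval_eq_sum_range, Polynomial.aeval_eq_sum_range, ← sum_sub_distrib]
  refine MatMem.sum _ _ fun r _ => ?_
  rw [← smul_sub]
  exact (hpow r).smul _

theorem matMem_matrixSeries_sub (f : PowerSeries k) {M M' : Matrix ι ι (PS τ k)}
    (hM : MatMem 1 M) (hM' : MatMem 1 M') (h : MatMem N (M - M')) :
    MatMem N (matrixSeries f M - matrixSeries f M') := by
  have := ((matrixSeries_sub_aeval_trunc f hM N).add (matMem_aeval_sub h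
    (PowerSeries.trunc N f))).sub
    (matrixSeries_sub_aeval_trunc f hM' N)
  convert this using 1
  abel

theorem matrixSeries_intertwine (f : PowerSeries k)
    {M' : Matrix κ κ (PS τ k)} (hM : MatMem 1 M) (hM' : MatMem 1 M')
    {P : Matrix κ ι (PS τ k)} (h : P * M = M' * P) :
    P * matrixSeries f M = matrixSeries f M' * P := by
  have hp : ∀ p : Polynomial k, P * Polynomial.aeval M p = Polynomial.aeval M' p * P := by
    intro p
    have hpow : ∀ r : ℕ, P * M ^ r = M' ^ r * P := by
      intro r
      induction r with
      | zero => simp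
      | succ r ih => rw [pow_succ, ← Matrix.mul_assoc, ih, Matrix.mul_assoc, h, ← Matrix.mul_assoc,
          pow_succ]
    rw [Polynomial.aeval_eq_sum_range, Polynomial.aeval_eq_sum_range, Matrix.mul_sum,
      Matrix.sum_mul]
    exact sum_congr rfl fun r _ => by rw [Matrix.mul_smul, hpow, Matrix.smul_mul]
  refine eq_of_matMem_sub fun N => ?_
  have := ((matrixSeries_sub_aeval_trunc f hM N).mul_left P).sub
    ((matrixSeries_sub_aeval_trunc f hM' N).mul_right P)
  convert this using 1
  rw [Matrix.mul_sub, Matrix.sub_mul, hp]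
  abel

theorem MatMem.map_subst [Finite σ] {u : σ → PS τ k} (hu : InMax u) {M : Matrix m n (PS σ k)}
    (hM : MatMem N M) : MatMem N (M.map (subst u)) := fun i j =>
  subst_mem_degIdeal hu (hM i j)

theorem map_subst_mul {u : σ → PS τ k} (hu : HasSubst u)
    (A : Matrix m ι (PS σ k)) (B : Matrix ι n (PS σ k)) :
    (A * B).map (subst u) = A.map (subst u) * B.map (subst u) := by
  ext1 i j
  simp [mul_apply, subst_sum hu, subst_mul hu]

theorem matrixSeries_map_subst [Finite σ] {u : σ → PS τ k}
    (hu : InMax u) (f : PowerSeries k) {M : Matrix ι ι (PS σ k)}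
    (hM : MatMem 1 M) : (matrixSeries f M).map (subst u) = matrixSeries f (M.map (subst u)) := by
  have hs := hasSubst_of_mem hu
  have hp : ∀ p : Polynomial k, (Polynomial.aeval M p).map (subst u) =
      Polynomial.aeval (M.map (subst u)) p := by
    intro p
    have := Polynomial.aeval_algHom_apply ((substAlgHom hs).mapMatrix (m := ι)) M p
    simpa [coe_substAlgHom] using this.symm
  refine eq_of_matMem_sub fun N => ?_
  have := ((matrixSeries_sub_aeval_trunc f hM N).map_subst hu).sub
    (matrixSeries_sub_aeval_trunc f (hM.map_subst hu) N)
  convert this using 1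
  rw [← hp]
  ext1 i j
  simp [subst_sub hs]

theorem matrixSeries_subst {g : PowerSeries k} (hg : PowerSeries.constantCoeff g = 0)
    (f : PowerSeries k) (hM : MatMem 1 M) :
    matrixSeries (f.subst g) M = matrixSeries f (matrixSeries g M) := by
  have hs : PowerSeries.HasSubst g := PowerSeries.HasSubst.of_constantCoeff_zero' hg
  have hgM := matMem_matrixSeries g hg hM
  have hp : ∀ p : Polynomial k, matrixSeries ((p : PowerSeries k).subst g) M =
      Polynomial.aeval (matrixSeries g M) p := by
    intro p
    rw [PowerSeries.subst_coe hs]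
    exact (Polynomial.aeval_algHom_apply (matrixSeriesHom hM) g p).symm
  refine eq_of_matMem_sub fun N => ?_
  obtain ⟨q, hq⟩ : (PowerSeries.X : PowerSeries k) ^ N ∣ f - PowerSeries.trunc N f := by
    rw [PowerSeries.X_pow_dvd_iff]
    intro r hr
    simp [PowerSeries.coeff_trunc, hr]
  obtain ⟨g', hg'⟩ : (PowerSeries.X : PowerSeries k) ∣ g := PowerSeries.X_dvd_iff.2 hg
  have h1 : MatMem N (matrixSeries ((f - PowerSeries.trunc N f).subst g) M) := by
    rw [hq, PowerSeries.subst_mul hs, PowerSeries.subst_pow hs, PowerSeries.subst_X hs,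
      matrixSeries_mul _ _ hM]
    refine MatMem.mul_right ?_ _
    rw [← matrixSeriesHom_apply hM, map_pow, matrixSeriesHom_apply]
    exact hgM.pow N
  rw [PowerSeries.subst_sub hs, matrixSeries_sub, hp] at h1
  have := h1.sub (matrixSeries_sub_aeval_trunc f hgM N)
  convert this using 1
  abel

section Derivation

/-- A derivation applied to the entries of a matrix. -/
def mapD (D : Derivation k (PS τ k) (PS τ k))
    (A : Matrix m n (PS τ k)) : Matrix m n (PS τ k) := A.map D

theorem mapD_apply (D : Derivation k (PS τ k) (PS τ k))
    (A : Matrix m n (PS τ k)) (i : m) (j : n) : mapD D A i j = D (A i j) := rfl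

theorem mapD_mul (D : Derivation k (PS τ k) (PS τ k))
    (A : Matrix m ι (PS τ k)) (B : Matrix ι n (PS τ k)) :
    mapD D (A * B) = mapD D A * B + A * mapD D B := by
  ext1 i j
  simp only [mapD_apply, mul_apply, Matrix.add_apply, map_sum, Derivation.leibniz,
    smul_eq_mul, sum_add_distrib]
  rw [add_comm]
  congr 1
  exact sum_congr rfl fun _ _ => mul_comm _ _

theorem mapD_sub (D : Derivation k (PS τ k) (PS τ k))
    (A B : Matrix m n (PS τ k)) : mapD D (A - B) = mapD D A - mapD D B := by
  ext1 i j; simp [mapD_apply]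

theorem mapD_one (D : Derivation k (PS τ k) (PS τ k)) : mapD D (1 : Matrix ι ι (PS τ k)) = 0 := by
  ext1 i j; simp [mapD_apply, one_apply]; split_ifs <;> simp

/-- If the entries of `M` are homogeneous of degree one, then `E f(M) = (t f')(M)`. -/
theorem euler_matrixSeries [Fintype τ] (f : PowerSeries k)
    (hM : MatMem 1 M) (hE : mapD (euler k τ) M = M) :
    mapD (euler k τ) (matrixSeries f M) =
      matrixSeries (PowerSeries.X * PowerSeries.derivative k f) M := by
  have hpow : ∀ r : ℕ, mapD (euler k τ) (M ^ r) = (r : k) • M ^ r := by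
    intro r
    induction r with
    | zero => simp [mapD_one]
    | succ r ih =>
      rw [pow_succ, mapD_mul, ih, hE, Matrix.smul_mul, Nat.cast_succ, add_smul, one_smul]
  ext1 i j; ext1 d
  rw [mapD_apply, coeff_euler, coeff_matrixSeries f hM i j (Nat.lt_succ_self _),
    coeff_matrixSeries _ hM i j (Nat.lt_succ_self _), mul_sum]
  refine sum_congr rfl fun r _ => ?_
  have h1 := congrArg (coeff d) (congrFun (congrFun (hpow r) i) j)
  rw [mapD_apply, coeff_euler, Matrix.smul_apply, coeff_smul] at h1
  have h2 : PowerSeries.coeff r (PowerSeries.X * PowerSeries.derivative k f) =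
      r * PowerSeries.coeff r f := by
    cases r with
    | zero => simp
    | succ r => rw [PowerSeries.coeff_succ_X_mul, PowerSeries.coeff_derivative]; push_cast; ring
  rw [h2]
  linear_combination PowerSeries.coeff r f * h1

end Derivation

end MatrixSeries

section PowerSeriesIdentities

variable (k : Type u) [Field k] [CharZero k]

theorem derivative_expSeries : PowerSeries.derivative k (expSeries k) = expSeries k := by
  ext r
  rw [PowerSeries.coeff_derivative, expSeries, PowerSeries.coeff_mk, PowerSeries.coeff_mk,
    Nat.factorial_succ]
  have : ((r : k) + 1) ≠ 0 := by exact_mod_cast Nat.succ_ne_zero r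
  have : ((r ! : ℕ) : k) ≠ 0 := by exact_mod_cast Nat.factorial_ne_zero r
  push_cast
  field_simp

theorem expSeries_eq : expSeries k = 1 + PowerSeries.X * expQuotSeries k := by
  ext r
  cases r with
  | zero => simp [expSeries]
  | succ r => simp [PowerSeries.coeff_succ_X_mul, expSeries, expQuotSeries, PowerSeries.coeff_one]

theorem X_mul_derivative_expQuotSeries :
    PowerSeries.X * PowerSeries.derivative k (expQuotSeries k) + expQuotSeries k =
      1 + PowerSeries.X * expQuotSeries k := by
  rw [← expSeries_eq, ← derivative_expSeries]
  conv_rhs => rw [expSeries_eq]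
  simp [Derivation.leibniz]

theorem constantCoeff_expSeries : PowerSeries.constantCoeff (expSeries k) = 1 := by
  simp [expSeries, ← PowerSeries.coeff_zero_eq_constantCoeff_apply]

theorem constantCoeff_expQuotSeries : PowerSeries.constantCoeff (expQuotSeries k) = 1 := by
  simp [expQuotSeries, ← PowerSeries.coeff_zero_eq_constantCoeff_apply]

theorem toddSeries_mul_expQuotSeries : toddSeries k * expQuotSeries k = 1 :=
  PowerSeries.inv_mul_cancel _ (by rw [constantCoeff_expQuotSeries]; exact one_ne_zero)

theorem constantCoeff_toddSeries : PowerSeries.constantCoeff (toddSeries k) = 1 := by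
  have := congrArg PowerSeries.constantCoeff (toddSeries_mul_expQuotSeries k)
  simpa [constantCoeff_expQuotSeries] using this

end PowerSeriesIdentities

section Rep

variable {σ : Type} {ι : Type} [Fintype ι] [DecidableEq ι]

/-- The matrix `∑ u_ρ β_ρ`. -/
def repMat (β : Fin m → Matrix ι ι k) (u : Fin m → PS τ k) :
    Matrix ι ι (PS τ k) := Matrix.of fun i j => ∑ ρ, β ρ i j • u ρ

theorem repMat_apply (β : Fin m → Matrix ι ι k) (u : Fin m → PS τ k) (i j : ι) :
    repMat β u i j = ∑ ρ, β ρ i j • u ρ := rfl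

theorem repMat_add (β : Fin m → Matrix ι ι k) (u v : Fin m → PS τ k) :
    repMat β (u + v) = repMat β u + repMat β v := by
  ext1 i j; simp [repMat_apply, sum_add_distrib]

theorem repMat_neg (β : Fin m → Matrix ι ι k) (u : Fin m → PS τ k) :
    repMat β (-u) = -repMat β u := by
  ext1 i j; simp [repMat_apply]

theorem repMat_sub (β : Fin m → Matrix ι ι k) (u v : Fin m → PS τ k) :
    repMat β (u - v) = repMat β u - repMat β v := by
  rw [sub_eq_add_neg, repMat_add, repMat_neg, sub_eq_add_neg]

theorem repMat_sum {s : Type*} (S : Finset s) (β : Fin m → Matrix ι ι k)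
    (c : s → PS τ k) (u : s → Fin m → PS τ k) :
    repMat β (∑ a ∈ S, c a • u a) = ∑ a ∈ S, c a • repMat β (u a) := by
  ext1 i j
  simp only [repMat_apply, Matrix.sum_apply, Matrix.smul_apply, Finset.sum_apply, Pi.smul_apply,
    smul_sum, smul_eq_mul, mul_sum]
  rw [sum_comm]
  exact sum_congr rfl fun _ _ => sum_congr rfl fun _ _ => (mul_smul_comm _ _ _).symm

variable {u : Fin m → PS τ k}

theorem matMem_repMat (β : Fin m → Matrix ι ι k) {N : ℕ}
    (hu : ∀ ρ, u ρ ∈ degIdeal k τ N) : MatMem N (repMat β u) := fun i j => by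
  rw [repMat_apply]
  exact sum_mem fun ρ _ => smul_mem_degIdeal _ (hu ρ)

theorem mapD_repMat (D : Derivation k (PS τ k) (PS τ k))
    (β : Fin m → Matrix ι ι k) (u : Fin m → PS τ k) :
    mapD D (repMat β u) = repMat β fun ρ => D (u ρ) := by
  ext1 i j; simp [mapD_apply, repMat_apply, map_sum]

variable {v : σ → PS τ k}

theorem repMat_map_subst (hv : HasSubst v) (β : Fin m → Matrix ι ι k) (u : Fin m → PS σ k) :
    (repMat β u).map (subst v) = repMat β fun ρ => subst v (u ρ) := by
  ext1 i j; simp [repMat_apply, subst_sum hv, subst_smul hv]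

variable (co : CoStructure k n m)

/-- The matrices `β` form a representation of the Lie algebra `V*`. -/
def IsRep (β : Fin m → Matrix ι ι k) : Prop :=
  ∀ ρ σ, β ρ * β σ - β σ * β ρ = ∑ μ, co.γ ρ σ μ • β μ

/-- The matrices of the adjoint representation. -/
def adj (σ : Fin m) : Matrix (Fin m) (Fin m) k :=
  Matrix.of fun μ ν => co.γ σ ν μ

theorem isRep_adj : IsRep co (adj co) := by
  intro ρ σ
  ext μ τ
  have := co.γ_jacobi ρ σ τ μ
  rw [Matrix.sub_apply, mul_apply, mul_apply, Matrix.sum_apply,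
    ← sum_sub_distrib, ← sub_eq_zero, ← sum_sub_distrib, ← neg_eq_zero, ← this,
    ← sum_neg_distrib]
  refine sum_congr rfl fun ν _ => ?_
  simp only [adj, Matrix.of_apply, Matrix.smul_apply, smul_eq_mul]
  rw [co.γ_skew ν τ μ, co.γ_skew τ ρ ν, co.γ_skew ν ρ μ, co.γ_skew ν σ μ]
  ring

theorem isRep_alpha : IsRep co (fun ρ => Matrix.of fun i l => co.α ρ i l) := by
  intro ρ σ
  ext j l
  rw [Matrix.sub_apply, mul_apply, mul_apply, Matrix.sum_apply, ← sum_sub_distrib]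
  refine Eq.trans (sum_congr rfl fun i _ => ?_) (co.α_rep ρ σ j l)
  simp only [Matrix.of_apply]
  ring

/-- The bracket of `V* ⊗ k[[τ]]` as a bilinear map. -/
def brk : (Fin m → PS τ k) →ₗ[PS τ k] (Fin m → PS τ k) →ₗ[PS τ k] (Fin m → PS τ k) :=
  LinearMap.mk₂ _ co.bracketV (fun u v w => by
      funext μ; simp [CoStructure.bracketV, add_mul, sum_add_distrib])
    (fun c u v => by funext μ; simp [CoStructure.bracketV, mul_sum, mul_assoc])
    (fun u v w => by funext μ; simp [CoStructure.bracketV, mul_add, sum_add_distrib])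
    (fun c u v => by funext μ; simp [CoStructure.bracketV, mul_sum, mul_left_comm])

theorem brk_apply (u v : Fin m → PS τ k) (μ : Fin m) :
    brk co u v μ = ∑ ρ, ∑ σ, co.γ ρ σ μ • (u ρ * v σ) := rfl

theorem ad_mulVec (u v : Fin m → PS τ k) : (repMat (adj co) u).mulVec v = brk co u v := by
  funext μ
  simp only [mulVec, dotProduct, repMat_apply, brk_apply, adj, Matrix.of_apply,
    sum_mul, smul_mul_assoc]
  exact sum_comm

theorem brk_skew (u v : Fin m → PS τ k) : brk co u v = -brk co v u := by
  funext μ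
  rw [Pi.neg_apply, brk_apply, brk_apply, ← sum_neg_distrib, sum_comm]
  refine sum_congr rfl fun σ _ => ?_
  rw [← sum_neg_distrib]
  refine sum_congr rfl fun ρ _ => ?_
  rw [co.γ_skew, neg_smul, mul_comm]

theorem brk_self (co : CoStructure k n m) (u : Fin m → PS τ k) : brk co u u = 0 := by
  have h := brk_skew co u u
  have h2 : (2 : k) • brk co u u = 0 := by rw [two_smul]; nth_rewrite 2 [h]; simp
  simpa using h2

/-- A representation maps brackets to commutators. -/
theorem repMat_brk {co : CoStructure k n m} {β : Fin m → Matrix ι ι k} (hβ : IsRep co β)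
    (u v : Fin m → PS τ k) :
    repMat β (brk co u v) = repMat β u * repMat β v - repMat β v * repMat β u := by
  ext1 i j
  have h : ∀ ρ σ, ∑ l, (β ρ i l * β σ l j - β σ i l * β ρ l j) = ∑ μ, co.γ ρ σ μ * β μ i j := by
    intro ρ σ
    have := congrFun (congrFun (hβ ρ σ) i) j
    simpa [mul_apply, Matrix.sum_apply, sum_sub_distrib] using this
  have e1 : ∀ u v : Fin m → PS τ k, (repMat β u * repMat β v) i j =
      ∑ ρ, ∑ σ, (∑ l, β ρ i l * β σ l j) • (u ρ * v σ) := by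
    intro u v
    simp only [mul_apply, repMat_apply, sum_mul_sum, sum_smul]
    rw [sum_comm]
    refine sum_congr rfl fun ρ _ => ?_
    rw [sum_comm]
    refine sum_congr rfl fun σ _ => sum_congr rfl fun l _ => ?_
    rw [smul_mul_smul_comm]
  have e2 : (repMat β v * repMat β u) i j = ∑ ρ, ∑ σ, (∑ l, β σ i l * β ρ l j) • (u ρ * v σ) := by
    rw [e1, sum_comm]
    simp only [mul_comm]
  rw [Matrix.sub_apply, e1, e2, repMat_apply, ← sum_sub_distrib]
  simp only [← sum_sub_distrib, ← sub_smul, h]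
  simp only [brk_apply, smul_sum, smul_smul, sum_smul]
  rw [sum_comm]
  refine sum_congr rfl fun ρ _ => ?_
  rw [sum_comm]
  refine sum_congr rfl fun σ _ => sum_congr rfl fun μ _ => ?_
  rw [mul_comm]

theorem brk_jacobi (u v w : Fin m → PS τ k) :
    brk co (brk co u v) w = brk co u (brk co v w) - brk co v (brk co u w) := by
  simp only [← ad_mulVec]
  rw [ad_mulVec co u v, repMat_brk (isRep_adj co), sub_mulVec, mulVec_mulVec, mulVec_mulVec]

theorem derivation_brk (D : Derivation k (PS τ k) (PS τ k))
    (co : CoStructure k n m) (u v : Fin m → PS τ k) :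
    (fun μ => D (brk co u v μ)) = brk co (fun μ => D (u μ)) v + brk co u (fun μ => D (v μ)) := by
  funext μ
  simp only [brk_apply, map_sum, Pi.add_apply, ← sum_add_distrib, Derivation.map_smul,
    Derivation.leibniz, smul_eq_mul]
  refine sum_congr rfl fun ρ _ => sum_congr rfl fun σ _ => ?_
  rw [← smul_add, mul_comm (v σ), add_comm]

theorem brk_mem {u v : Fin m → PS τ k} {M N : ℕ}
    (hu : ∀ ρ, u ρ ∈ degIdeal k τ M) (hv : ∀ ρ, v ρ ∈ degIdeal k τ N) (μ : Fin m) :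
    brk co u v μ ∈ degIdeal k τ (M + N) := by
  rw [brk_apply]
  exact sum_mem fun ρ _ => sum_mem fun σ _ => smul_mem_degIdeal _ (mul_mem_degIdeal (hu ρ) (hv σ))

theorem subst_brk (hv : HasSubst v) (co : CoStructure k n m) (u w : Fin m → PS σ k) (μ : Fin m) :
    subst v (brk co u w μ) = brk co (fun ρ => subst v (u ρ)) (fun ρ => subst v (w ρ)) μ := by
  simp only [brk_apply, subst_sum hv, subst_smul hv, subst_mul hv]

/-- The matrix `exp(β(u))`. -/
def expRep (β : Fin m → Matrix ι ι k) (u : Fin m → PS τ k) :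
    Matrix ι ι (PS τ k) := matrixSeries (expSeries k) (repMat β u)

/-- The differential `(e^{ad u} - 1) / ad u` of the exponential map at `u`, translated to the
identity from the right. -/
def Theta (u : Fin m → PS τ k) :
    Matrix (Fin m) (Fin m) (PS τ k) := matrixSeries (expQuotSeries k) (repMat (adj co) u)

/-- The inverse of `Theta`. -/
def ThetaInv (u : Fin m → PS τ k) :
    Matrix (Fin m) (Fin m) (PS τ k) := matrixSeries (toddSeries k) (repMat (adj co) u)

theorem expRep_map_subst [Finite σ] (hv : InMax v)
    (β : Fin m → Matrix ι ι k) {u : Fin m → PS σ k} (hu : InMax u) :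
    (expRep β u).map (subst v) = expRep β fun ρ => subst v (u ρ) := by
  rw [expRep, matrixSeries_map_subst hv _ (matMem_repMat β hu), repMat_map_subst
    (hasSubst_of_mem hv)]
  rfl

theorem Theta_map_subst [Finite σ] (hv : InMax v)
    (co : CoStructure k n m) {u : Fin m → PS σ k} (hu : InMax u) :
    (Theta co u).map (subst v) = Theta co fun ρ => subst v (u ρ) := by
  rw [Theta, matrixSeries_map_subst hv _ (matMem_repMat _ hu), repMat_map_subst
    (hasSubst_of_mem hv)]
  rfl

theorem ThetaInv_map_subst [Finite σ] (hv : InMax v)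
    (co : CoStructure k n m) {u : Fin m → PS σ k} (hu : InMax u) :
    (ThetaInv co u).map (subst v) = ThetaInv co fun ρ => subst v (u ρ) := by
  rw [ThetaInv, matrixSeries_map_subst hv _ (matMem_repMat _ hu),
    repMat_map_subst (hasSubst_of_mem hv)]
  rfl

theorem ThetaInv_mul_Theta (hu : InMax u) : ThetaInv co u * Theta co u = 1 := by
  rw [ThetaInv, Theta, ← matrixSeries_mul _ _ (matMem_repMat _ hu), toddSeries_mul_expQuotSeries,
    matrixSeries_one (matMem_repMat _ hu)]

theorem Theta_mul_ThetaInv (hu : InMax u) : Theta co u * ThetaInv co u = 1 := by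
  rw [ThetaInv, Theta, ← matrixSeries_mul _ _ (matMem_repMat _ hu), mul_comm,
    toddSeries_mul_expQuotSeries, matrixSeries_one (matMem_repMat _ hu)]

theorem matrixSeries_mulVec_of_eq_zero (f : PowerSeries k) {M : Matrix ι ι (PS τ k)}
    (hM : MatMem 1 M) {v : ι → PS τ k} (hv : M.mulVec v = 0) :
    (matrixSeries f M).mulVec v = PowerSeries.constantCoeff f • v := by
  rw [PowerSeries.eq_shift_mul_X_add_const f, matrixSeries_add, matrixSeries_mul _ _ hM,
    matrixSeries_X hM, matrixSeries_C _ hM, Matrix.add_mulVec, ← mulVec_mulVec, hv]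
  funext i
  simp [Matrix.smul_mulVec]

theorem Theta_mulVec_self (hu : InMax u) : (Theta co u).mulVec u = u := by
  rw [Theta, matrixSeries_mulVec_of_eq_zero _ (matMem_repMat _ hu), constantCoeff_expQuotSeries,
    one_smul]
  rw [ad_mulVec, brk_self]

theorem mapD_euler_repMat_X (β : Fin m → Matrix ι ι k) :
    mapD (euler k (Fin m)) (repMat β X) = repMat β X := by
  rw [mapD_repMat]; simp

theorem euler_expRep_X (β : Fin m → Matrix ι ι k) :
    mapD (euler k (Fin m)) (expRep β X) = repMat β X * expRep β X := by
  have h := matMem_repMat β (X_mem_degIdeal (k := k) (τ := Fin m))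
  rw [expRep, euler_matrixSeries _ h (mapD_euler_repMat_X β), derivative_expSeries,
    matrixSeries_mul _ _ h, matrixSeries_X h]

theorem euler_Theta_X :
    mapD (euler k (Fin m)) (Theta co X) + Theta co X = 1 + repMat (adj co) X * Theta co X := by
  have h := matMem_repMat (adj co) (X_mem_degIdeal (k := k) (τ := Fin m))
  rw [Theta, euler_matrixSeries _ h (mapD_euler_repMat_X _), ← matrixSeries_add,
    X_mul_derivative_expQuotSeries, matrixSeries_add, matrixSeries_one h, matrixSeries_mul _ _ h,
    matrixSeries_X h]

/-- The components of the right-invariant Maurer-Cartan form. -/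
def theta (ρ : Fin m) : Fin m → PS (Fin m) k :=
  fun μ => Theta co X μ ρ

theorem euler_theta (ρ : Fin m) : (fun μ => euler k (Fin m) (theta co ρ μ)) =
      Pi.single ρ 1 + brk co X (theta co ρ) - theta co ρ := by
  funext μ
  have := congrFun (congrFun (euler_Theta_X co) μ) ρ
  rw [Matrix.add_apply, Matrix.add_apply, mapD_apply] at this
  rw [Pi.sub_apply, Pi.add_apply, ← ad_mulVec, eq_sub_iff_add_eq]
  refine this.trans ?_
  congr 1
  rw [one_apply, Pi.single_apply]

theorem pderiv_X_fun (ρ : Fin m) : (fun μ => pderiv k ρ (X μ : PS (Fin m) k)) = Pi.single ρ 1 := by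
  funext μ
  rw [pderiv_X]

/-- The Maurer-Cartan equation. -/
theorem maurerCartan_X (ρ σ : Fin m) :
    (fun μ => pderiv k ρ (theta co σ μ)) - (fun μ => pderiv k σ (theta co ρ μ)) =
      brk co (theta co ρ) (theta co σ) := by
  rw [← sub_eq_zero]
  refine eq_zero_of_euler_linear 2 _ (Or.inl two_ne_zero) (repMat (adj co) X)
    (matMem_repMat _ X_mem_degIdeal) fun μ => ?_
  have h1 : ∀ ρ σ : Fin m, (fun μ => euler k (Fin m) (pderiv k ρ (theta co σ μ))) =
      brk co (Pi.single ρ 1) (theta co σ) + brk co X (fun μ => pderiv k ρ (theta co σ μ)) -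
        2 • (fun μ => pderiv k ρ (theta co σ μ)) := by
    intro ρ σ
    have h2 := derivation_brk (pderiv k ρ) co X (theta co σ)
    rw [pderiv_X_fun] at h2
    rw [← h2]
    funext μ
    have h3 := euler_pderiv ρ (theta co σ μ)
    rw [congrFun (euler_theta co σ) μ, Pi.sub_apply, Pi.add_apply, map_sub, map_add] at h3
    have h4 : pderiv k ρ ((Pi.single σ 1 : Fin m → PS (Fin m) k) μ) = 0 := by
      rw [Pi.single_apply]; split_ifs <;> simp
    rw [h4, zero_add] at h3
    simp only [Pi.sub_apply, Pi.smul_apply]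
    rw [eq_sub_iff_add_eq, two_smul, ← add_assoc, h3]
    ring
  have h5 : (fun μ => euler k (Fin m) (brk co (theta co ρ) (theta co σ) μ)) =
      brk co (Pi.single ρ 1) (theta co σ) - brk co (Pi.single σ 1) (theta co ρ) +
        brk co X (brk co (theta co ρ) (theta co σ)) - 2 • brk co (theta co ρ) (theta co σ) := by
    rw [derivation_brk, euler_theta, euler_theta, brk_skew co (Pi.single σ 1)]
    simp only [map_add, map_sub, LinearMap.add_apply, LinearMap.sub_apply]
    rw [brk_jacobi co X]
    abel
  have h6 : (fun μ => euler k (Fin m) (((fun μ => pderiv k ρ (theta co σ μ)) -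
      (fun μ => pderiv k σ (theta co ρ μ)) - brk co (theta co ρ) (theta co σ)) μ)) =
      brk co X ((fun μ => pderiv k ρ (theta co σ μ)) -
      (fun μ => pderiv k σ (theta co ρ μ)) - brk co (theta co ρ) (theta co σ)) -
      2 • ((fun μ => pderiv k ρ (theta co σ μ)) -
      (fun μ => pderiv k σ (theta co ρ μ)) - brk co (theta co ρ) (theta co σ)) := by
    have : (fun μ => euler k (Fin m) (((fun μ => pderiv k ρ (theta co σ μ)) -
      (fun μ => pderiv k σ (theta co ρ μ)) - brk co (theta co ρ) (theta co σ)) μ)) =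
      (fun μ => euler k (Fin m) (pderiv k ρ (theta co σ μ))) -
      (fun μ => euler k (Fin m) (pderiv k σ (theta co ρ μ))) -
      (fun μ => euler k (Fin m) (brk co (theta co ρ) (theta co σ) μ)) := by
      funext μ; simp
    rw [this, h1, h1, h5]
    simp only [map_sub]
    abel
  generalize (fun μ => pderiv k ρ (theta co σ μ)) - (fun μ => pderiv k σ (theta co ρ μ)) -
    brk co (theta co ρ) (theta co σ) = Y at h6 ⊢
  have h7 := congrFun h6 μ
  rw [Pi.sub_apply, ← ad_mulVec] at h7
  rw [h7, Pi.smul_apply, ← Nat.cast_smul_eq_nsmul k, sub_add_cancel]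
  rfl

/-- The derivative of the exponential in a representation. -/
theorem pderiv_expRep_X {co : CoStructure k n m} {β : Fin m → Matrix ι ι k} (hβ : IsRep co β)
    (ρ : Fin m) : mapD (pderiv k ρ) (expRep β X) = repMat β (theta co ρ) * expRep β X := by
  rw [← sub_eq_zero]
  set Y := mapD (pderiv k ρ) (expRep β X) - repMat β (theta co ρ) * expRep β X with hY
  have hE : mapD (euler k (Fin m)) Y + Y = repMat β X * Y := by
    have h1 : mapD (euler k (Fin m)) (mapD (pderiv k ρ) (expRep β X)) +
        mapD (pderiv k ρ) (expRep β X) =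
        repMat β (Pi.single ρ 1) * expRep β X + repMat β X * mapD (pderiv k ρ) (expRep β X) := by
      rw [← pderiv_X_fun, ← mapD_repMat, ← mapD_mul, ← euler_expRep_X]
      ext1 i j
      exact euler_pderiv ρ _
    have h2 : mapD (euler k (Fin m)) (repMat β (theta co ρ)) =
        repMat β (Pi.single ρ 1) + (repMat β X * repMat β (theta co ρ) -
          repMat β (theta co ρ) * repMat β X) - repMat β (theta co ρ) := by
      rw [mapD_repMat, euler_theta, repMat_sub, repMat_add, repMat_brk hβ]
    have h3 := mapD_mul (euler k (Fin m)) (repMat β (theta co ρ)) (expRep β X)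
    rw [h2, euler_expRep_X] at h3
    rw [hY, mapD_sub, h3, eq_sub_of_add_eq h1]
    noncomm_ring
  ext1 i j
  have := eq_zero_of_euler_linear 1 (fun i => Y i j) (Or.inl one_ne_zero) (repMat β X)
    (matMem_repMat _ X_mem_degIdeal) fun i => by
      have := congrFun (congrFun hE i) j
      rw [Matrix.add_apply, mapD_apply, mul_apply] at this
      simpa using this
  exact congrFun this i

section Pullback

variable [Fintype τ]

variable (co : CoStructure k n m)

/-- The logarithmic derivative of `exp u` along the vector field `c`. -/
def logDeriv (c : τ → PS τ k) (u : Fin m → PS τ k) :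
    Fin m → PS τ k := (Theta co u).mulVec fun ρ => vectorField c (u ρ)

variable {u : Fin m → PS τ k}

theorem logDeriv_eq_sum (c : τ → PS τ k) (hu : InMax u) :
    logDeriv co c u = ∑ ρ, vectorField c (u ρ) • fun μ => subst u (theta co ρ μ) := by
  funext μ
  rw [Finset.sum_apply, logDeriv, mulVec, dotProduct]
  refine sum_congr rfl fun ρ _ => ?_
  have := congrFun (congrFun (Theta_map_subst hu co X_mem_degIdeal) μ) ρ
  simp only [subst_X (hasSubst_of_mem hu)] at this
  rw [Pi.smul_apply, smul_eq_mul, mul_comm]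
  exact congrArg _ this.symm

theorem expRep_eq_map_subst (β : Fin m → Matrix ι ι k)
    (hu : InMax u) : expRep β u = (expRep β X).map (subst u) := by
  rw [expRep_map_subst hu β X_mem_degIdeal]
  simp only [subst_X (hasSubst_of_mem hu)]

theorem vectorField_expRep {co : CoStructure k n m} {β : Fin m → Matrix ι ι k} (hβ : IsRep co β)
    (c : τ → PS τ k) (hu : InMax u) :
    mapD (vectorField c) (expRep β u) = repMat β (logDeriv co c u) * expRep β u := by
  have hs := hasSubst_of_mem hu
  rw [logDeriv_eq_sum co c hu, repMat_sum, Matrix.sum_mul, expRep_eq_map_subst β hu]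
  have h : ∀ ρ, repMat β (fun μ => subst u (theta co ρ μ)) * (expRep β X).map (subst u) =
      (mapD (pderiv k ρ) (expRep β X)).map (subst u) := by
    intro ρ
    rw [pderiv_expRep_X hβ, map_subst_mul hs, repMat_map_subst hs]
  simp only [Matrix.smul_mul, h]
  ext1 i j
  rw [mapD_apply, Matrix.map_apply, vectorField_subst c hu, Matrix.sum_apply]
  exact sum_congr rfl fun ρ _ => mul_comm _ _

theorem maurerCartan (c c' : τ → PS τ k) (hu : InMax u) :
    (fun μ => vectorField c (logDeriv co c' u μ)) - (fun μ => vectorField c' (logDeriv co c u μ)) =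
      (Theta co u).mulVec (fun ρ => vectorField c (vectorField c' (u ρ)) -
        vectorField c' (vectorField c (u ρ))) + brk co (logDeriv co c u) (logDeriv co c' u) := by
  have hs := hasSubst_of_mem hu
  have hT : ∀ μ ρ, Theta co u μ ρ = subst u (theta co ρ μ) := by
    intro μ ρ
    have := congrFun (congrFun (Theta_map_subst hu co X_mem_degIdeal) μ) ρ
    simp only [subst_X hs] at this
    exact this.symm
  have h1 : ∀ (c c' : τ → PS τ k) (μ : Fin m), vectorField c (logDeriv co c' u μ) =
      ∑ ρ, Theta co u μ ρ * vectorField c (vectorField c' (u ρ)) +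
      ∑ ρ, ∑ σ, (vectorField c (u σ) * vectorField c' (u ρ)) *
        subst u (pderiv k σ (theta co ρ μ)) := by
    intro c c' μ
    rw [logDeriv, mulVec, dotProduct, map_sum, ← sum_add_distrib]
    refine sum_congr rfl fun ρ _ => ?_
    rw [Derivation.leibniz, smul_eq_mul, smul_eq_mul]
    congr 1
    rw [hT, vectorField_subst c hu, mul_sum]
    exact sum_congr rfl fun σ _ => by ring
  have h2 : ∀ μ, brk co (logDeriv co c u) (logDeriv co c' u) μ =
      ∑ ρ, ∑ σ, (vectorField c (u σ) * vectorField c' (u ρ)) *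
        (subst u (pderiv k σ (theta co ρ μ)) - subst u (pderiv k ρ (theta co σ μ))) := by
    intro μ
    rw [logDeriv_eq_sum co c hu, logDeriv_eq_sum co c' hu]
    simp only [map_sum, map_smul, LinearMap.sum_apply, LinearMap.smul_apply, Finset.sum_apply,
      Pi.smul_apply, smul_eq_mul]
    refine sum_congr rfl fun ρ _ => ?_
    rw [mul_sum]
    refine sum_congr rfl fun σ _ => ?_
    have := congrFun (maurerCartan_X co σ ρ) μ
    rw [Pi.sub_apply] at this
    rw [← subst_sub hs, this, subst_brk hs]
    ring
  funext μ
  rw [Pi.sub_apply, Pi.add_apply, h1, h1, h2, mulVec, dotProduct]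
  simp only [mul_sub, sum_sub_distrib]
  rw [sum_comm (f := fun ρ σ => (vectorField c' (u σ) * vectorField c (u ρ)) *
    subst u (pderiv k σ (theta co ρ μ)))]
  simp only [mul_comm (vectorField c' _) (vectorField c _)]
  ring

/-- A power series `u` without constant term is determined by the logarithmic derivative of
`exp u` along the Euler field. -/
theorem eq_of_logDeriv_euler {P Q : Fin m → PS τ k} (hP : InMax P) (hQ : InMax Q)
    (h : logDeriv co X P = logDeriv co X Q) : P = Q := by
  have hE : ∀ {P : Fin m → PS τ k}, (InMax P) →
      (fun ρ => euler k τ (P ρ)) = (ThetaInv co P).mulVec (logDeriv co X P) := by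
    intro P hP
    rw [logDeriv, mulVec_mulVec, ThetaInv_mul_Theta co hP, one_mulVec]
    rfl
  rw [← sub_eq_zero]
  refine eq_zero_of_euler 0 _ (Or.inr fun ρ => sub_mem (hP ρ) (hQ ρ)) fun N hN ρ => ?_
  have h1 : euler k τ ((P - Q) ρ) = ((ThetaInv co P - ThetaInv co Q).mulVec
    (logDeriv co X P)) ρ := by
    have e1 := congrFun (hE hP) ρ
    have e2 := congrFun (hE hQ) ρ
    rw [← h] at e2
    rw [sub_mulVec, Pi.sub_apply, Pi.sub_apply, map_sub, ← e1, ← e2]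
  rw [Nat.cast_zero, zero_smul, add_zero, h1]
  rw [mulVec, dotProduct]
  refine sum_mem fun σ _ => mul_mem_degIdeal ?_ ?_
  · refine matMem_matrixSeries_sub _ (matMem_repMat _ hP) (matMem_repMat _ hQ) ?_ ρ σ
    rw [← repMat_sub]
    exact matMem_repMat _ hN
  · rw [logDeriv, mulVec, dotProduct]
    exact sum_mem fun _ _ => Ideal.mul_mem_left _ _ (euler_mem_degIdeal_one (τ := τ) (k := k) _)

end Pullback

end Rep

section LogSeries

variable (k : Type u) [Field k] [CharZero k]

/-- The series `log(1 + s) / s`. -/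
def logQuotSeries : PowerSeries k := PowerSeries.mk fun r => (-1) ^ r / ((r : k) + 1)

theorem derivative_X_mul_logQuotSeries :
    (1 + PowerSeries.X) * PowerSeries.derivative k (PowerSeries.X * logQuotSeries k) = 1 := by
  have h : PowerSeries.derivative k (PowerSeries.X * logQuotSeries k) =
      PowerSeries.mk fun r => (-1 : k) ^ r := by
    ext r
    have : ((r : k) + 1) ≠ 0 := by exact_mod_cast Nat.succ_ne_zero r
    rw [PowerSeries.coeff_derivative, PowerSeries.coeff_succ_X_mul, logQuotSeries,
      PowerSeries.coeff_mk, PowerSeries.coeff_mk]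
    field_simp
  rw [h]
  ext r
  cases r with
  | zero => simp
  | succ r => simp [add_mul, PowerSeries.coeff_succ_X_mul, PowerSeries.coeff_one, pow_succ]

theorem constantCoeff_expSeries_sub_one : PowerSeries.constantCoeff (expSeries k - 1) = 0 := by
  simp [constantCoeff_expSeries]

theorem expQuotSeries_mul_logQuotSeries_subst :
    expQuotSeries k * (logQuotSeries k).subst (expSeries k - 1) = 1 := by
  have hs : PowerSeries.HasSubst (expSeries k - 1) :=
    PowerSeries.HasSubst.of_constantCoeff_zero' (constantCoeff_expSeries_sub_one k)
  have hX : (PowerSeries.X * logQuotSeries k).subst (expSeries k - 1) =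
      PowerSeries.X * (expQuotSeries k * (logQuotSeries k).subst (expSeries k - 1)) := by
    rw [PowerSeries.subst_mul hs, PowerSeries.subst_X hs]
    nth_rewrite 1 [expSeries_eq]
    ring
  have h1 := congrArg (PowerSeries.subst (expSeries k - 1)) (derivative_X_mul_logQuotSeries k)
  rw [PowerSeries.subst_mul hs, PowerSeries.subst_add hs, PowerSeries.subst_X hs,
    ← PowerSeries.coe_substAlgHom hs, map_one, PowerSeries.coe_substAlgHom, add_sub_cancel] at h1
  have h2 : (PowerSeries.X * logQuotSeries k).subst (expSeries k - 1) = PowerSeries.X := by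
    refine PowerSeries.derivative.ext ?_ ?_
    · have h3 : PowerSeries.derivative k (expSeries k - 1) = expSeries k := by
        rw [map_sub, derivative_expSeries]; simp
      rw [PowerSeries.derivative_subst hs, h3, PowerSeries.derivative_X, mul_comm, h1]
    · rw [hX]; simp
  rw [hX] at h2
  exact PowerSeries.X_mul_cancel (by rw [h2, mul_one])

end LogSeries

section Dynkin

variable (co : CoStructure k n m)

theorem nestedBracket_cons (a : Fin m → PS τ k) {l : List (Fin m → PS τ k)}
    (hl : l ≠ []) : co.nestedBracket (a :: l) = brk co a (co.nestedBracket l) := by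
  cases l with
  | nil => exact absurd rfl hl
  | cons b l => rfl

theorem nestedBracket_replicate_append (a : Fin m → PS τ k) (p : ℕ)
    {l : List (Fin m → PS τ k)} (hl : l ≠ []) :
    co.nestedBracket (List.replicate p a ++ l) =
      (repMat (adj co) a ^ p).mulVec (co.nestedBracket l) := by
  induction p with
  | zero => simp
  | succ p ih =>
    rw [List.replicate_succ, List.cons_append, nestedBracket_cons _ _ (by simp [hl]), ih,
      ← ad_mulVec, mulVec_mulVec, pow_succ']

theorem nestedBracket_replicate (a : Fin m → PS τ k) (p : ℕ) :
    co.nestedBracket (List.replicate (p + 1) a) = if p = 0 then a else 0 := by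
  cases p with
  | zero => rfl
  | succ p =>
    rw [List.replicate_succ', nestedBracket_replicate_append _ _ _ (by simp),
      show co.nestedBracket [a] = a from rfl, pow_succ, ← mulVec_mulVec, ad_mulVec, brk_self]
    simp

theorem euler_nestedBracket [Fintype τ] (l : List (Fin m → PS τ k))
    (h : ∀ a ∈ l, (fun μ => euler k τ (a μ)) = a) :
    (fun μ => euler k τ (co.nestedBracket l μ)) = (l.length : k) • co.nestedBracket l := by
  induction l with
  | nil => funext μ; simp [CoStructure.nestedBracket]
  | cons a l ih =>
    by_cases hl : l = []
    · subst hl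
      simpa [CoStructure.nestedBracket] using h
    · rw [nestedBracket_cons co a hl, derivation_brk, h a (by simp),
        ih fun b hb => h b (by simp [hb])]
      rw [show (l.length : k) • co.nestedBracket l =
        (C (l.length : k) : PS τ k) • co.nestedBracket l from by
          funext μ; simp [MvPowerSeries.smul_eq_C_mul], map_smul]
      funext μ
      simp [MvPowerSeries.smul_eq_C_mul, add_mul]
      ring

/-- The first generic point of `V*`. -/
def XL (k : Type u) [Field k] (m : ℕ) (μ : Fin m) : PS (Fin m ⊕ Fin m) k := X (Sum.inl μ)

/-- The second generic point of `V*`. -/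
def XR (k : Type u) [Field k] (m : ℕ) (μ : Fin m) : PS (Fin m ⊕ Fin m) k := X (Sum.inr μ)

theorem XL_mem (μ : Fin m) : XL k m μ ∈ degIdeal k _ 1 := X_mem_degIdeal _

theorem XR_mem (μ : Fin m) : XR k m μ ∈ degIdeal k _ 1 := X_mem_degIdeal _

/-- The block `X'^p X''^q`. -/
def block (k : Type u) [Field k] (m : ℕ) (s : ℕ × ℕ) : List (Fin m → PS (Fin m ⊕ Fin m) k) :=
  List.replicate s.1 (XL k m) ++ List.replicate s.2 (XR k m)

/-- The coefficient `1 / (p! q!)`. -/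
def blockCoeff (k : Type u) [Field k] (s : ℕ × ℕ) : k := (((s.1 ! * s.2 ! : ℕ) : k))⁻¹

theorem sum_nestedBracket_blocks (S : Finset (ℕ × ℕ)) (hS : ∀ s ∈ S, 0 < s.1 + s.2) (r : ℕ) :
    ∑ p ∈ Fintype.piFinset fun _ : Fin (r + 1) => S, (∏ i, blockCoeff k (p i)) •
      co.nestedBracket (List.ofFn fun i => block k m (p i)).flatten =
    ((∑ s ∈ S, blockCoeff k s • (repMat (adj co) (XL k m) ^ s.1 *
        repMat (adj co) (XR k m) ^ s.2)) ^ r).mulVec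
      (∑ s ∈ S, blockCoeff k s • co.nestedBracket (block k m s)) := by
  induction r with
  | zero =>
    rw [pow_zero, one_mulVec]
    refine Finset.sum_nbij' (fun p => p 0) (fun s _ => s) ?_ ?_ ?_ ?_ ?_
    · intro p hp; exact Fintype.mem_piFinset.1 hp 0
    · intro s hs; exact Fintype.mem_piFinset.2 fun _ => hs
    · intro p hp; funext i; obtain rfl : i = 0 := Fin.ext (by omega)
      rfl
    · intro s hs; rfl
    · intro p hp; simp
  | succ r ih =>
    rw [pow_succ', ← mulVec_mulVec, ← ih]
    have : ∀ (A : ℕ × ℕ → Matrix (Fin m) (Fin m) (PS (Fin m ⊕ Fin m) k))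
        (v : Fin m → PS (Fin m ⊕ Fin m) k),
        (∑ s ∈ S, A s).mulVec v = ∑ s ∈ S, (A s).mulVec v := fun A v => by
      funext i
      simp only [mulVec, dotProduct, Matrix.sum_apply, Finset.sum_apply, sum_mul]
      exact sum_comm
    rw [this]
    simp only [mulVec_sum]
    rw [← Finset.sum_product' (s := S) (t := Fintype.piFinset fun _ : Fin (r + 1) => S)
      (f := fun s p => (blockCoeff k s • (repMat (adj co) (XL k m) ^ s.1 *
        repMat (adj co) (XR k m) ^ s.2)).mulVec ((∏ i, blockCoeff k (p i)) •
      co.nestedBracket (List.ofFn fun i => block k m (p i)).flatten))]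
    refine Finset.sum_nbij' (fun p => (p 0, Fin.tail p)) (fun q => Fin.cons q.1 q.2) ?_ ?_ ?_ ?_ ?_
    · intro p hp
      have := Fintype.mem_piFinset.1 hp
      exact Finset.mem_product.2 ⟨this 0, Fintype.mem_piFinset.2 fun i => this i.succ⟩
    · intro q hq
      have := Finset.mem_product.1 hq
      refine Fintype.mem_piFinset.2 fun i => ?_
      refine Fin.cases ?_ (fun i => ?_) i
      · exact this.1
      · exact Fintype.mem_piFinset.1 this.2 i
    · intro p hp; exact Fin.cons_self_tail p
    · intro q hq; rfl
    · intro p hp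
      have hp0 := Fintype.mem_piFinset.1 hp
      have hne : (List.ofFn fun i => block k m (p (Fin.succ i))).flatten ≠ [] := by
        rw [List.ofFn_succ, List.flatten_cons]
        intro h
        have h1 := hS _ (hp0 (Fin.succ 0))
        have h2 := congrArg List.length (List.append_eq_nil_iff.1 h).1
        simp [block] at h2
        simp at h1
        omega
      rw [Fin.prod_univ_succ, List.ofFn_succ, List.flatten_cons, block, List.append_assoc,
        nestedBracket_replicate_append _ _ _ (by simp at hne ⊢; intro _; exact hne),
        nestedBracket_replicate_append _ _ _ hne, mulVec_mulVec,
        Matrix.smul_mulVec, mulVec_smul, smul_smul]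
      rfl

theorem nestedBracket_block (s : ℕ × ℕ) (hs : 0 < s.1 + s.2) : co.nestedBracket (block k m s) =
      if s.2 = 0 then (if s.1 = 1 then XL k m else 0)
      else if s.2 = 1 then (repMat (adj co) (XL k m) ^ s.1).mulVec (XR k m) else 0 := by
  obtain ⟨p, q⟩ := s
  rcases q with _ | q
  · obtain ⟨p, rfl⟩ : ∃ p', p = p' + 1 := ⟨p - 1, by simp at hs; omega⟩
    simp only [block, List.replicate_zero, List.append_nil, nestedBracket_replicate]
    simp
  · rw [block, nestedBracket_replicate_append _ _ _ (by simp), nestedBracket_replicate]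
    by_cases hq : q = 0
    · simp [hq]
    · simp [hq]

/-- Nonempty blocks of degree at most `N` in each variable. -/
def blocks (N : ℕ) : Finset (ℕ × ℕ) :=
  (Finset.range (N + 1) ×ˢ Finset.range (N + 1)).filter fun s => 0 < s.1 + s.2

/-- The truncated exponential series of a matrix. -/
def truncExp {ι : Type} [Fintype ι] [DecidableEq ι] (N : ℕ) (M : Matrix ι ι (PS τ k)) :
    Matrix ι ι (PS τ k) := ∑ p ∈ Finset.range (N + 1), ((p ! : ℕ) : k)⁻¹ • M ^ p

theorem truncExp_sub_mem {ι : Type} [Fintype ι] [DecidableEq ι] (N : ℕ)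
    {M : Matrix ι ι (PS τ k)} (hM : MatMem 1 M) :
    MatMem (N + 1) (matrixSeries (expSeries k) M - truncExp N M) := by
  have := matrixSeries_sub_aeval_trunc (expSeries k) hM (N + 1)
  convert this using 2
  rw [truncExp, Polynomial.aeval_eq_sum_range' (PowerSeries.natDegree_trunc_lt _ _)]
  refine sum_congr rfl fun p hp => ?_
  rw [PowerSeries.coeff_trunc, if_pos (Finset.mem_range.1 hp), expSeries, PowerSeries.coeff_mk]

theorem sum_blocks_mul (N : ℕ) : ∑ s ∈ blocks N, blockCoeff k s • (repMat (adj co) (XL k m) ^ s.1 *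
    repMat (adj co) (XR k m) ^ s.2) =
    truncExp N (repMat (adj co) (XL k m)) * truncExp N (repMat (adj co) (XR k m)) - 1 := by
  rw [eq_sub_iff_add_eq, truncExp, truncExp, sum_mul_sum, ← Finset.sum_product']
  have h : ∀ s : ℕ × ℕ, ((s.1 ! : ℕ) : k)⁻¹ • repMat (adj co) (XL k m) ^ s.1 *
      ((s.2 ! : ℕ) : k)⁻¹ • repMat (adj co) (XR k m) ^ s.2 = blockCoeff k s •
        (repMat (adj co) (XL k m) ^ s.1 * repMat (adj co) (XR k m) ^ s.2) := fun s => by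
    rw [smul_mul_smul_comm, blockCoeff, Nat.cast_mul, mul_inv]
  simp only [h]
  rw [blocks, ← Finset.sum_filter_add_sum_filter_not
    (Finset.range (N + 1) ×ˢ Finset.range (N + 1)) (fun s : ℕ × ℕ => 0 < s.1 + s.2),
    sum_eq_single_of_mem (s := Finset.filter (fun s : ℕ × ℕ => ¬ 0 < s.1 + s.2) _) (0, 0)]
  · simp [blockCoeff]
  · simp
  · intro s hs h0
    refine absurd (Prod.ext ?_ ?_) h0
    all_goals have := (Finset.mem_filter.1 hs).2; simp at this ⊢; omega

theorem sum_blocks_nestedBracket {N : ℕ} (hN : 0 < N) :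
    ∑ s ∈ blocks N, blockCoeff k s • co.nestedBracket (block k m s) =
      XL k m + (truncExp N (repMat (adj co) (XL k m))).mulVec (XR k m) := by
  have h1 : ∀ s ∈ blocks N, blockCoeff k s • co.nestedBracket (block k m s) =
      (if s = (1, 0) then XL k m else 0) +
      if s.2 = 1 then (((s.1 ! : ℕ) : k)⁻¹ • repMat (adj co) (XL k m) ^ s.1).mulVec (XR k m)
        else 0 := by
    rintro ⟨p, q⟩ hs
    rw [nestedBracket_block co _ (Finset.mem_filter.1 hs).2]
    by_cases hq : q = 0
    · subst hq
      by_cases hp : p = 1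
      · simp [hp, blockCoeff]
      · simp [hp]
    · by_cases hq1 : q = 1
      · simp [hq1, blockCoeff, Matrix.smul_mulVec]
      · simp [hq, hq1]
  rw [sum_congr rfl h1, sum_add_distrib, Finset.sum_ite_eq']
  congr 1
  · rw [if_pos]
    simp [blocks]
    omega
  · rw [← Finset.sum_filter]
    have h2 : ∀ v : Fin m → PS (Fin m ⊕ Fin m) k,
        (truncExp N (repMat (adj co) (XL k m))).mulVec v = ∑ p ∈ Finset.range (N + 1),
          (((p ! : ℕ) : k)⁻¹ • repMat (adj co) (XL k m) ^ p).mulVec v := fun v => by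
      funext i
      simp only [truncExp, mulVec, dotProduct, Matrix.sum_apply, Finset.sum_apply, sum_mul]
      exact sum_comm
    rw [h2]
    refine Finset.sum_nbij' (fun s => s.1) (fun p => (p, 1)) ?_ ?_ ?_ ?_ ?_
    · rintro ⟨p, q⟩ h; simp [blocks] at h ⊢; omega
    · intro p h; simp [blocks] at h ⊢; omega
    · rintro ⟨p, q⟩ h; simp at h; simp [h.2]
    · intro p h; rfl
    · intro p h; rfl

theorem coeff_campbellHausdorff (μ : Fin m) (d : Fin m ⊕ Fin m →₀ ℕ) :
    coeff d (co.campbellHausdorff μ) = coeff d (co.campbellHausdorffPart d.degree μ) := rfl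

/-- The adjoint action of `exp X' exp X''`. -/
def adExpProd : Matrix (Fin m) (Fin m) (PS (Fin m ⊕ Fin m) k) :=
  expRep (adj co) (XL k m) * expRep (adj co) (XR k m)

/-- The logarithmic derivative of `exp X' exp X''` along the Euler field. -/
def eulerProd : Fin m → PS (Fin m ⊕ Fin m) k :=
  XL k m + (expRep (adj co) (XL k m)).mulVec (XR k m)

theorem mulVec_mem {ι κ : Type} [Fintype ι] {M N : ℕ}
    {A : Matrix κ ι (PS τ k)} (hA : MatMem M A) {v : ι → PS τ k}
    (hv : ∀ i, v i ∈ degIdeal k τ N) (i : κ) : A.mulVec v i ∈ degIdeal k τ (M + N) := by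
  rw [mulVec, dotProduct]
  exact sum_mem fun j _ => mul_mem_degIdeal (hA i j) (hv j)

theorem eulerProd_mem (μ : Fin m) : eulerProd (k := k) co μ ∈ degIdeal k _ 1 := by
  refine add_mem (XL_mem μ) ?_
  simpa using mulVec_mem (MatMem.zero (expRep (adj co) (XL k m))) XR_mem μ

theorem matMem_expRep_sub_one {ι : Type} [Fintype ι] [DecidableEq ι] (β : Fin m → Matrix ι ι k)
    {u : Fin m → PS τ k} (hu : InMax u) :
    MatMem 1 (expRep β u - 1) := by
  simpa [constantCoeff_expSeries, expRep] using
    matrixSeries_sub_coeff_zero (expSeries k) (matMem_repMat β hu)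

theorem matMem_adExpProd_sub_one : MatMem 1 (adExpProd (k := k) co - 1) := by
  have := ((matMem_expRep_sub_one (k := k) (adj co) XL_mem).mul_right (expRep (adj co)
    (XR k m))).add
    (matMem_expRep_sub_one (k := k) (adj co) XR_mem)
  convert this using 1
  rw [adExpProd]; noncomm_ring

theorem coeff_sum_nestedBracket (N r : ℕ) (hN : 0 < N) (μ : Fin m) (d : Fin m ⊕ Fin m →₀ ℕ)
    (hd : d.degree = N) :
    ∑ p ∈ (Fintype.piFinset fun _ : Fin (r + 1) =>
        Finset.range (N + 1) ×ˢ Finset.range (N + 1)).filter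
        (fun p => (∀ i, 0 < (p i).1 + (p i).2) ∧ ∑ i, ((p i).1 + (p i).2) = N),
      (∏ i, blockCoeff k (p i)) *
        coeff d (co.nestedBracket (List.ofFn fun i => block k m (p i)).flatten μ) =
    coeff d ((((adExpProd co - 1) ^ r).mulVec (eulerProd co)) μ) := by
  have h1 : ∀ p ∈ Fintype.piFinset (fun _ : Fin (r + 1) => blocks N),
      p ∉ (Fintype.piFinset fun _ : Fin (r + 1) =>
        Finset.range (N + 1) ×ˢ Finset.range (N + 1)).filter
        (fun p => (∀ i, 0 < (p i).1 + (p i).2) ∧ ∑ i, ((p i).1 + (p i).2) = N) →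
      (∏ i, blockCoeff k (p i)) *
        coeff d (co.nestedBracket (List.ofFn fun i => block k m (p i)).flatten μ) = 0 := by
    intro p hp hp'
    have hp0 := Fintype.mem_piFinset.1 hp
    have hsum : ∑ i, ((p i).1 + (p i).2) ≠ N := by
      intro h
      refine hp' (Finset.mem_filter.2 ⟨Fintype.mem_piFinset.2 fun i => ?_, fun i => ?_, h⟩)
      · exact (Finset.mem_filter.1 (hp0 i)).1
      · exact (Finset.mem_filter.1 (hp0 i)).2
    have hE := congrFun (euler_nestedBracket co (List.ofFn fun i => block k m (p i)).flatten
      (fun a ha => by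
        simp only [List.mem_flatten, List.mem_ofFn, block] at ha
        obtain ⟨_, ⟨i, rfl⟩, ha⟩ := ha
        rcases List.mem_append.1 ha with ha | ha
        · rw [List.eq_of_mem_replicate ha]; funext μ; exact euler_X _
        · rw [List.eq_of_mem_replicate ha]; funext μ; exact euler_X _)) μ
    have hc := congrArg (coeff d) hE
    have hlen : (List.ofFn fun i => block k m (p i)).flatten.length = ∑ i, ((p i).1 + (p i).2) := by
      simp [List.length_flatten, List.map_ofFn, List.sum_ofFn, block, Function.comp_def,
        -List.ofFn_succ]
    rw [coeff_euler, hd, Pi.smul_apply, coeff_smul, hlen, ← sub_eq_zero, ← sub_mul,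
      mul_eq_zero, sub_eq_zero] at hc
    rcases hc with hc | hc
    · exact absurd (by exact_mod_cast hc.symm) hsum
    · rw [hc, mul_zero]
  rw [Finset.sum_subset (fun p hp => ?_) h1]
  · have h2 := congrFun (sum_nestedBracket_blocks co (blocks N)
      (fun s hs => (Finset.mem_filter.1 hs).2) r) μ
    rw [sum_blocks_mul, sum_blocks_nestedBracket co hN] at h2
    have h3 := congrArg (coeff d) h2
    rw [Finset.sum_apply, map_sum] at h3
    simp only [Pi.smul_apply, coeff_smul] at h3
    refine h3.trans ?_
    have hW : MatMem (N + 1) ((adExpProd co - 1) - (truncExp N (repMat (adj co) (XL k m)) *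
        truncExp N (repMat (adj co) (XR k m)) - 1)) := by
      have e1 := truncExp_sub_mem N (matMem_repMat (adj co) (XL_mem (k := k)))
      have e2 := truncExp_sub_mem N (matMem_repMat (adj co) (XR_mem (k := k)))
      have := (e1.mul_right (truncExp N (repMat (adj co) (XR k m)))).add
        (e2.mul_left (expRep (adj co) (XL k m)))
      convert this using 1
      rw [adExpProd, expRep, expRep]; noncomm_ring
    have hpow := matMem_aeval_sub hW (Polynomial.X ^ r)
    simp only [map_pow, Polynomial.aeval_X] at hpow
    have hb : ∀ i, (eulerProd co - (XL k m + (truncExp N (repMat (adj co) (XL k m))).mulVec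
        (XR k m))) i ∈ degIdeal k _ (N + 1) := by
      intro i
      have e1 := truncExp_sub_mem N (matMem_repMat (adj co) (XL_mem (k := k)))
      have := mulVec_mem e1 (fun i => mem_degIdeal_zero (XR k m i)) i
      rw [eulerProd, add_sub_add_left_eq_sub, ← sub_mulVec]
      exact this
    have hfin := add_mem (mulVec_mem hpow (fun i => mem_degIdeal_zero (eulerProd co i)) μ)
      (degIdeal_mono (by omega) (mulVec_mem (MatMem.zero ((truncExp N (repMat (adj co) (XL k m)) *
        truncExp N (repMat (adj co) (XR k m)) - 1) ^ r)) hb μ)) d (by rw [hd]; exact N.lt_succ_self)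
    rw [sub_mulVec, Matrix.mulVec_sub, Pi.sub_apply, Pi.sub_apply, sub_add_sub_cancel,
      map_sub, sub_eq_zero] at hfin
    exact hfin.symm
  · have := Finset.mem_filter.1 hp
    exact Fintype.mem_piFinset.2 fun i => Finset.mem_filter.2
      ⟨Fintype.mem_piFinset.1 this.1 i, this.2.1 i⟩

theorem campbellHausdorff_mem (μ : Fin m) : co.campbellHausdorff μ ∈ degIdeal k _ 1 := by
  intro d hd
  have : d.degree = 0 := by omega
  rw [coeff_campbellHausdorff, this]
  simp [CoStructure.campbellHausdorffPart]

theorem euler_campbellHausdorff : (fun μ => euler k _ (co.campbellHausdorff μ)) =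
    (matrixSeries (logQuotSeries k) (adExpProd co - 1)).mulVec (eulerProd co) := by
  funext μ; ext1 d
  by_cases hN : d.degree = 0
  · have := mulVec_mem (MatMem.zero (matrixSeries (logQuotSeries k) (adExpProd co - 1)))
      (eulerProd_mem (k := k) co) μ d (by omega)
    rw [this, coeff_euler, hN]; simp
  have hN' : (d.degree : k) ≠ 0 := by exact_mod_cast hN
  have h1 : coeff d ((matrixSeries (logQuotSeries k) (adExpProd co - 1)).mulVec (eulerProd co) μ) =
      ∑ r ∈ Finset.range d.degree, (-1) ^ r / ((r : k) + 1) *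
        coeff d ((((adExpProd co - 1) ^ r).mulVec (eulerProd co)) μ) := by
    have e1 := matrixSeries_sub_aeval_trunc (logQuotSeries k) (matMem_adExpProd_sub_one (k := k) co)
      d.degree
    have e2 := mulVec_mem e1 (eulerProd_mem co) μ d (Nat.lt_succ_self _)
    rw [sub_mulVec, Pi.sub_apply, map_sub, sub_eq_zero] at e2
    obtain ⟨n', hn'⟩ : ∃ n', d.degree = n' + 1 := ⟨d.degree - 1, by omega⟩
    rw [e2, Polynomial.aeval_eq_sum_range' (n := d.degree)
      (by rw [hn']; exact PowerSeries.natDegree_trunc_lt _ _)]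
    simp only [mulVec, dotProduct, Matrix.sum_apply, sum_mul, map_sum]
    rw [sum_comm]
    refine sum_congr rfl fun r hr => ?_
    rw [mul_sum]
    refine sum_congr rfl fun i _ => ?_
    rw [PowerSeries.coeff_trunc, if_pos (Finset.mem_range.1 hr), logQuotSeries,
      PowerSeries.coeff_mk,
      Matrix.smul_apply, smul_mul_assoc, coeff_smul]
  rw [h1, coeff_euler, coeff_campbellHausdorff, CoStructure.campbellHausdorffPart,
    Finset.sum_apply, map_sum, mul_sum]
  have h2 : ∀ f : ℕ → k, ∑ r ∈ Finset.Icc 1 d.degree, f r = ∑ r ∈ Finset.range d.degree, f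
    (r + 1) := by
    intro f
    rw [Finset.range_eq_Ico, Finset.sum_Ico_add' f 0 d.degree 1]
    rfl
  rw [h2]
  refine sum_congr rfl fun r _ => ?_
  rw [← coeff_sum_nestedBracket co d.degree r (Nat.pos_of_ne_zero hN) μ d rfl, Finset.sum_apply,
    map_sum, mul_sum, mul_sum]
  refine sum_congr rfl fun p _ => ?_
  rw [Pi.smul_apply, coeff_smul]
  have hr : ((r : k) + 1) ≠ 0 := by exact_mod_cast Nat.succ_ne_zero r
  have : ∏ i, ((((p i).1 ! * (p i).2 ! : ℕ) : k))⁻¹ = ∏ i, blockCoeff k (p i) := rfl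
  rw [this]
  change _ * (_ * coeff d (co.nestedBracket (List.ofFn fun i => block k m (p i)).flatten μ)) = _
  push_cast
  rw [pow_succ, pow_succ]
  field_simp

end Dynkin

section GroupLaw

variable {σ : Type} {ι : Type} [Fintype ι]
  [DecidableEq ι] (co : CoStructure k n m)

theorem mapD_mulVec {p q : Type} [Fintype q] (D : Derivation k (PS τ k) (PS τ k))
    (A : Matrix p q (PS τ k)) (v : q → PS τ k) :
    (fun i => D (A.mulVec v i)) = (mapD D A).mulVec v + A.mulVec (fun j => D (v j)) := by
  funext i
  simp only [mulVec, dotProduct, map_sum, Derivation.leibniz, smul_eq_mul, Pi.add_apply,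
    mapD_apply, sum_add_distrib]
  rw [add_comm]
  congr 1
  exact sum_congr rfl fun _ _ => mul_comm _ _

theorem subst_mulVec {p q : Type} [Fintype q] {w : σ → PS τ k} (hw : HasSubst w)
    (A : Matrix p q (PS σ k)) (v : q → PS σ k) (i : p) :
    subst w (A.mulVec v i) = (A.map (subst w)).mulVec (fun j => subst w (v j)) i := by
  simp [mulVec, dotProduct, subst_sum hw, subst_mul hw]

variable {β : Fin m → Matrix ι ι k}

theorem expRep_mul_repMat_X {co : CoStructure k n m} (hβ : IsRep co β)
    (σ : Fin m) : expRep β X * repMat β (Pi.single σ 1) =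
      repMat β ((expRep (adj co) X).mulVec (Pi.single σ 1)) * expRep β X := by
  rw [← sub_eq_zero]
  set e := (expRep (adj co) X).mulVec (Pi.single σ (1 : PS (Fin m) k)) with he
  set Y := expRep β X * repMat β (Pi.single σ 1) - repMat β e * expRep β X with hY
  have hEe : (fun μ => euler k (Fin m) (e μ)) = brk co X e := by
    rw [he, mapD_mulVec, euler_expRep_X, ← ad_mulVec, mulVec_mulVec]
    have : (fun j => euler k (Fin m) ((Pi.single σ 1 : Fin m → PS (Fin m) k) j)) = 0 := by
      funext j; rw [Pi.single_apply]; split_ifs <;> simp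
    rw [this, mulVec_zero, add_zero]
  have h0 : mapD (euler k (Fin m)) (repMat β (Pi.single σ (1 : PS (Fin m) k))) = 0 := by
    rw [mapD_repMat]
    have : (fun j => euler k (Fin m) ((Pi.single σ 1 : Fin m → PS (Fin m) k) j)) = 0 := by
      funext j; rw [Pi.single_apply]; split_ifs <;> simp
    rw [this]; ext1 i j; simp [repMat_apply]
  have hE : mapD (euler k (Fin m)) Y = repMat β X * Y := by
    rw [hY, mapD_sub, mapD_mul, mapD_mul, h0, euler_expRep_X, mapD_repMat, hEe, repMat_brk hβ]
    noncomm_ring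
  have h1 : MatMem 1 Y := by
    have e1 := matMem_expRep_sub_one β (X_mem_degIdeal (k := k) (τ := Fin m))
    have e2 : ∀ i, (e - (Pi.single σ 1 : Fin m → PS (Fin m) k)) i ∈ degIdeal k
      (Fin m) 1 := fun i => by
      have := mulVec_mem (matMem_expRep_sub_one (adj co) (X_mem_degIdeal (k := k) (τ := Fin m)))
        (fun i => mem_degIdeal_zero ((Pi.single σ 1 : Fin m → PS (Fin m) k) i)) i
      rwa [sub_mulVec, one_mulVec] at this
    have e3 := ((e1.mul_right (repMat β (Pi.single σ 1))).sub (e1.mul_left (repMat β e))).sub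
      (matMem_repMat β e2)
    convert e3 using 1
    rw [hY, repMat_sub]; noncomm_ring
  ext1 i j
  have := eq_zero_of_euler_linear 0 (fun i => Y i j) (Or.inr fun i => h1 i j) (repMat β X)
    (matMem_repMat _ X_mem_degIdeal) fun i => by
      have := congrFun (congrFun hE i) j
      rw [mapD_apply, mul_apply] at this
      simpa using this
  exact congrFun this i

variable {u : Fin m → PS τ k}

/-- `e^{β(u)} β(v) e^{-β(u)} = β(e^{ad u} v)`. -/
theorem expRep_mul_repMat [Fintype τ] {co : CoStructure k n m} (hβ : IsRep co β) (hu : InMax u) (v :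
    Fin m → PS τ k) :
    expRep β u * repMat β v = repMat β ((expRep (adj co) u).mulVec v) * expRep β u := by
  have hs := hasSubst_of_mem hu
  have h : ∀ σ : Fin m, expRep β u * repMat β (Pi.single σ 1) =
      repMat β ((expRep (adj co) u).mulVec (Pi.single σ 1)) * expRep β u := by
    intro σ
    have := congrArg (fun A => A.map (subst u)) (expRep_mul_repMat_X hβ σ)
    have hsing : (fun ρ => subst u ((Pi.single σ 1 : Fin m → PS (Fin m) k) ρ)) =
        (Pi.single σ 1 : Fin m → PS τ k) := by
      funext ρ; rw [Pi.single_apply, Pi.single_apply]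
      split_ifs
      · exact subst_one hs
      · exact subst_zero hs
    simp only [map_subst_mul hs, repMat_map_subst hs, subst_mulVec hs, ← expRep_eq_map_subst _ hu,
      hsing] at this
    exact this
  have hv : v = ∑ σ, v σ • (Pi.single σ 1 : Fin m → PS τ k) := by
    funext i; simp [Finset.sum_apply, Pi.single_apply]
  rw [hv, mulVec_sum, repMat_sum]
  simp only [mulVec_smul]
  rw [repMat_sum, Matrix.mul_sum, Matrix.sum_mul]
  exact sum_congr rfl fun σ _ => by rw [Matrix.mul_smul, h, Matrix.smul_mul]

theorem expRep_adj_brk [Fintype τ] (hu : InMax u)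
    (v w : Fin m → PS τ k) : (expRep (adj co) u).mulVec (brk co v w) =
      brk co ((expRep (adj co) u).mulVec v) ((expRep (adj co) u).mulVec w) := by
  rw [← ad_mulVec, mulVec_mulVec, expRep_mul_repMat (isRep_adj co) hu, ← mulVec_mulVec, ad_mulVec]

theorem logDeriv_X_of_euler [Fintype τ]
    (hu : InMax u) (hE : ∀ ρ, euler k τ (u ρ) = u ρ) : logDeriv co X u = u := by
  have : (fun ρ => vectorField X (u ρ)) = u := funext hE
  rw [logDeriv, this, Theta_mulVec_self co hu]

theorem euler_adExpProd (hβ : IsRep co β) :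
    mapD (euler k _) (expRep β (XL k m) * expRep β (XR k m)) =
      repMat β (eulerProd co) * (expRep β (XL k m) * expRep β (XR k m)) := by
  rw [mapD_mul, euler, vectorField_expRep hβ _ XL_mem, vectorField_expRep hβ _ XR_mem,
    logDeriv_X_of_euler co XL_mem (fun _ => euler_X _), logDeriv_X_of_euler co XR_mem
        (fun _ => euler_X _),
    ← Matrix.mul_assoc (expRep β (XL k m)), expRep_mul_repMat hβ XL_mem, eulerProd, repMat_add]
  noncomm_ring

theorem expQuot_mul_logQuot {M : Matrix ι ι (PS τ k)} (hM : MatMem 1 M) :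
    matrixSeries (expQuotSeries k) M *
      matrixSeries (logQuotSeries k) (matrixSeries (expSeries k) M - 1) = 1 := by
  have : matrixSeries (expSeries k) M - 1 = matrixSeries (expSeries k - 1) M := by
    rw [matrixSeries_sub, matrixSeries_one hM]
  rw [this, ← matrixSeries_subst (constantCoeff_expSeries_sub_one k) _ hM,
    ← matrixSeries_mul _ _ hM, expQuotSeries_mul_logQuotSeries_subst, matrixSeries_one hM]

theorem expRep_adj_campbellHausdorff_aux (N : ℕ) :
    MatMem N (expRep (adj co) co.campbellHausdorff - adExpProd co) ∧
      ∀ μ, (logDeriv co X co.campbellHausdorff - eulerProd co) μ ∈ degIdeal k _ (N + 1) := by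
  have hD := campbellHausdorff_mem co
  have hlog : ∀ N, MatMem N (expRep (adj co) co.campbellHausdorff - adExpProd co) →
      ∀ μ, (logDeriv co X co.campbellHausdorff - eulerProd co) μ ∈ degIdeal k _ (N + 1) := by
    intro N h μ
    have h1 : logDeriv co X co.campbellHausdorff - eulerProd co =
        (Theta co co.campbellHausdorff * (matrixSeries (logQuotSeries k) (adExpProd co - 1) -
          matrixSeries (logQuotSeries k) (expRep (adj co) co.campbellHausdorff - 1))).mulVec
          (eulerProd co) := by
      have e1 : (fun ρ => vectorField X (co.campbellHausdorff ρ)) =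
        (matrixSeries (logQuotSeries k) (adExpProd co - 1)).mulVec (eulerProd co) :=
          euler_campbellHausdorff co
      have e2 : Theta co co.campbellHausdorff *
        matrixSeries (logQuotSeries k) (expRep (adj co) co.campbellHausdorff - 1) = 1 :=
          expQuot_mul_logQuot (matMem_repMat _ hD)
      rw [Matrix.mul_sub, e2, sub_mulVec, one_mulVec, logDeriv, e1, mulVec_mulVec]
    rw [h1]
    refine mulVec_mem (MatMem.mul_left _ (matMem_matrixSeries_sub _ (matMem_adExpProd_sub_one co)
      (matMem_expRep_sub_one _ hD) ?_)) (eulerProd_mem co) μ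
    convert h.neg using 1
    abel
  suffices h : MatMem N (expRep (adj co) co.campbellHausdorff - adExpProd co) from ⟨h, hlog N h⟩
  induction N with
  | zero => exact MatMem.zero _
  | succ N ih =>
    have h1 : MatMem 1 (expRep (adj co) co.campbellHausdorff - adExpProd co) := by
      have := (matMem_expRep_sub_one (adj co) hD).sub (matMem_adExpProd_sub_one co)
      convert this using 1; abel
    have hE : mapD (euler k _) (expRep (adj co) co.campbellHausdorff - adExpProd co) =
        repMat (adj co) (logDeriv co X co.campbellHausdorff - eulerProd co) *
          expRep (adj co) co.campbellHausdorff +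
        repMat (adj co) (eulerProd co) * (expRep (adj co) co.campbellHausdorff - adExpProd co) := by
      rw [mapD_sub, adExpProd, euler_adExpProd co (isRep_adj co), euler,
        vectorField_expRep (isRep_adj co) _ hD, repMat_sub]
      noncomm_ring
    intro i j
    refine mem_degIdeal_of_euler (h1 i j) ?_
    rw [← mapD_apply (euler k _), hE]
    refine ((matMem_repMat _ (hlog N ih)).mul_right _).add ?_ i j
    rw [add_comm N]
    exact (matMem_repMat _ (eulerProd_mem co)).mul ih

theorem logDeriv_campbellHausdorff : logDeriv co X co.campbellHausdorff = eulerProd co := by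
  funext μ
  refine eq_of_sub_mem_degIdeal fun N => ?_
  exact degIdeal_mono (Nat.le_succ N) ((expRep_adj_campbellHausdorff_aux co N).2 μ)

theorem expRep_campbellHausdorff {co : CoStructure k n m} (hβ : IsRep co β) :
    expRep β co.campbellHausdorff = expRep β (XL k m) * expRep β (XR k m) := by
  have hD := campbellHausdorff_mem co
  rw [← sub_eq_zero]
  set Y := expRep β co.campbellHausdorff - expRep β (XL k m) * expRep β (XR k m) with hY
  have h1 : MatMem 1 Y := by
    have := ((matMem_expRep_sub_one β hD).sub
      ((matMem_expRep_sub_one (k := k) β XL_mem).mul_right (expRep β (XR k m)))).sub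
      (matMem_expRep_sub_one (k := k) β XR_mem)
    convert this using 1
    rw [hY]; noncomm_ring
  have hE : mapD (euler k _) Y = repMat β (eulerProd co) * Y := by
    rw [hY, mapD_sub, euler_adExpProd co hβ, euler, vectorField_expRep hβ _ hD,
      logDeriv_campbellHausdorff]
    noncomm_ring
  ext1 i j
  have := eq_zero_of_euler_linear 0 (fun i => Y i j) (Or.inr fun i => h1 i j)
    (repMat β (eulerProd co)) (matMem_repMat _ (eulerProd_mem co)) fun i => by
      have := congrFun (congrFun hE i) j
      rw [mapD_apply, mul_apply] at this
      simpa using this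
  exact congrFun this i

theorem vectorField_single [Fintype τ] [DecidableEq τ] (i : τ) (f : PS τ k) :
    vectorField (Pi.single i 1) f = pderiv k i f := by
  rw [vectorField_apply, sum_eq_single i]
  · simp
  · intro j _ hj; simp [Pi.single_eq_of_ne hj]
  · simp

theorem euler_logDeriv_single [Fintype τ] [DecidableEq τ] (i : τ) (hu : InMax u) :
    (fun μ => euler k τ (logDeriv co (Pi.single i 1) u μ)) + logDeriv co (Pi.single i 1) u =
      (fun μ => pderiv k i (logDeriv co X u μ)) +
        brk co (logDeriv co X u) (logDeriv co (Pi.single i 1) u) := by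
  have h := maurerCartan co X (Pi.single i 1) hu
  have h1 : (fun ρ => vectorField X (vectorField (Pi.single i 1) (u ρ)) -
      vectorField (Pi.single i 1) (vectorField X (u ρ))) =
      -fun ρ => vectorField (Pi.single i 1) (u ρ) := by
    funext ρ
    simp only [Pi.neg_apply, vectorField_single]
    have := euler_pderiv i (u ρ)
    rw [euler] at this
    rw [← this]; ring
  rw [h1, mulVec_neg] at h
  simp only [vectorField_single i] at h
  have h2 : (Theta co u).mulVec (fun ρ => pderiv k i (u ρ)) = logDeriv co (Pi.single i 1) u := by
    rw [logDeriv]; simp only [vectorField_single]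
  rw [h2, sub_eq_iff_eq_add] at h
  rw [euler, h]
  abel

theorem logDeriv_single_campbellHausdorff (i : Fin m ⊕ Fin m) :
    logDeriv co (Pi.single i 1) co.campbellHausdorff = logDeriv co (Pi.single i 1) (XL k m) +
      (expRep (adj co) (XL k m)).mulVec (logDeriv co (Pi.single i 1) (XR k m)) := by
  have hD := campbellHausdorff_mem co
  set a := logDeriv co (Pi.single i 1) (XL k m) with ha
  set t := logDeriv co (Pi.single i 1) (XR k m) with ht
  set e := expRep (adj co) (XL k m) with he
  have hEa := euler_logDeriv_single co i (XL_mem (k := k) (m := m))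
  have hEt := euler_logDeriv_single co i (XR_mem (k := k) (m := m))
  have hED := euler_logDeriv_single co i hD
  rw [logDeriv_X_of_euler co XL_mem (fun _ => euler_X _), ← ha] at hEa
  rw [logDeriv_X_of_euler co XR_mem (fun _ => euler_X _), ← ht] at hEt
  rw [logDeriv_campbellHausdorff] at hED
  have hEe : mapD (euler k _) e = repMat (adj co) (XL k m) * e := by
    rw [he, euler, vectorField_expRep (isRep_adj co) _ XL_mem,
      logDeriv_X_of_euler co XL_mem (fun _ => euler_X _)]
  have hde : mapD (pderiv k i) e = repMat (adj co) a * e := by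
    have := vectorField_expRep (isRep_adj co) (Pi.single i 1) (XL_mem (k := k) (m := m))
    rw [← ha, ← he] at this
    rw [← this]
    ext1 μ ν
    exact (vectorField_single i _).symm
  have hdb : (fun μ => pderiv k i (eulerProd co μ)) = (fun μ => pderiv k i (XL k m μ)) +
      (brk co a (e.mulVec (XR k m)) + e.mulVec (fun μ => pderiv k i (XR k m μ))) := by
    have h1 : (fun μ => pderiv k i (eulerProd co μ)) = (fun μ => pderiv k i (XL k m μ)) +
      fun μ => pderiv k i (e.mulVec (XR k m) μ) := by
      funext μ; rw [eulerProd]; simp [he]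
    rw [h1, mapD_mulVec, hde, ← ad_mulVec, mulVec_mulVec]
  have hEs : (fun μ => euler k _ ((a + e.mulVec t) μ)) + (a + e.mulVec t) =
      (fun μ => pderiv k i (eulerProd co μ)) + brk co (eulerProd co) (a + e.mulVec t) := by
    have h1 : (fun μ => euler k _ ((a + e.mulVec t) μ)) = (fun μ => euler k _ (a μ)) +
      fun μ => euler k _ (e.mulVec t μ) := by funext μ; simp
    have h2 : (fun μ => euler k _ (t μ)) = (fun μ => pderiv k i (XR k m μ)) +
      brk co (XR k m) t - t := eq_sub_of_add_eq hEt
    have h3 : (fun μ => euler k _ (a μ)) = (fun μ => pderiv k i (XL k m μ)) +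
      brk co (XL k m) a - a := eq_sub_of_add_eq hEa
    rw [h1, mapD_mulVec, h2, h3, hdb, hEe, ← mulVec_mulVec, ad_mulVec, Matrix.mulVec_sub,
      mulVec_add, he, expRep_adj_brk co XL_mem, ← he, eulerProd, ← he]
    rw [brk_skew co a]
    simp only [map_add, LinearMap.add_apply]
    abel
  rw [← sub_eq_zero]
  refine eq_zero_of_euler_linear 1 _ (Or.inl one_ne_zero) (repMat (adj co) (eulerProd co))
    (matMem_repMat _ (eulerProd_mem co)) fun μ => ?_
  have h4 := congrFun hED μ
  have h5 := congrFun hEs μ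
  have h6 : (brk co (eulerProd co) (logDeriv co (Pi.single i 1) co.campbellHausdorff -
      (a + e.mulVec t))) μ = ∑ j, repMat (adj co) (eulerProd co) μ j *
        (logDeriv co (Pi.single i 1) co.campbellHausdorff - (a + e.mulVec t)) j := by
    rw [← ad_mulVec]; rfl
  rw [← h6, map_sub, Pi.sub_apply, Pi.sub_apply, Nat.cast_one, one_smul, map_sub]
  simp only [Pi.add_apply] at h4 h5 ⊢
  linear_combination h4 - h5

theorem logDeriv_subst [Fintype σ] [DecidableEq σ] [Fintype τ] (c : τ → PS τ k)
    {w : σ → PS τ k} (hw : InMax w) {P : Fin m → PS σ k}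
    (hP : InMax P) :
    logDeriv co c (fun ρ => subst w (P ρ)) =
      ∑ i, vectorField c (w i) • fun μ => subst w (logDeriv co (Pi.single i 1) P μ) := by
  have hs := hasSubst_of_mem hw
  funext μ
  simp only [logDeriv, ← Theta_map_subst hw co hP, Matrix.map_apply, Finset.sum_apply,
    Pi.smul_apply,
    smul_eq_mul, vectorField_single, mulVec, dotProduct, vectorField_subst c hw, mul_sum,
        subst_sum hs, subst_mul hs]
  rw [sum_comm]
  exact sum_congr rfl fun _ _ => sum_congr rfl fun _ _ => by ring

/-- The product of `exp U` and `exp V` in logarithmic coordinates. -/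
def chComp (U V : Fin m → PS τ k) (μ : Fin m) : PS τ k :=
  subst (Sum.elim U V) (co.campbellHausdorff μ)

variable {U V : Fin m → PS τ k}

theorem sumElim_mem (hU : InMax U)
    (hV : InMax V) (i : Fin m ⊕ Fin m) : Sum.elim U V i ∈ degIdeal k τ 1 := by
  rcases i with i | i
  · exact hU i
  · exact hV i

theorem chComp_mem (hU : InMax U) (hV : InMax V) (μ : Fin m) : chComp co U V μ ∈ degIdeal k τ 1 :=
  subst_mem_degIdeal (sumElim_mem hU hV) (campbellHausdorff_mem co μ)

theorem subst_XL (hU : InMax U)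
    (hV : InMax V) : (fun ρ => subst (Sum.elim U V) (XL k m ρ)) = U := by
  funext ρ; rw [XL, subst_X (hasSubst_of_mem (sumElim_mem hU hV))]; rfl

theorem subst_XR (hU : InMax U)
    (hV : InMax V) : (fun ρ => subst (Sum.elim U V) (XR k m ρ)) = V := by
  funext ρ; rw [XR, subst_X (hasSubst_of_mem (sumElim_mem hU hV))]; rfl

theorem logDeriv_chComp [Fintype τ] (c : τ → PS τ k) (hU : InMax U) (hV : InMax V) :
    logDeriv co c (chComp co U V) =
      logDeriv co c U + (expRep (adj co) U).mulVec (logDeriv co c V) := by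
  have hw := sumElim_mem hU hV
  have hs := hasSubst_of_mem hw
  have h1 := logDeriv_subst co c hw (campbellHausdorff_mem co)
  have h2 := logDeriv_subst co c hw (XL_mem (k := k) (m := m))
  have h3 := logDeriv_subst co c hw (XR_mem (k := k) (m := m))
  rw [subst_XL hU hV] at h2
  rw [subst_XR hU hV] at h3
  have h4 := expRep_map_subst hw (adj co) (XL_mem (k := k) (m := m))
  rw [subst_XL hU hV] at h4
  refine h1.trans ?_
  rw [h2, h3, mulVec_sum, ← sum_add_distrib]
  refine sum_congr rfl fun i _ => ?_
  rw [mulVec_smul, ← smul_add]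
  congr 1
  funext μ
  rw [logDeriv_single_campbellHausdorff, Pi.add_apply, subst_add hs, subst_mulVec hs, h4]
  rfl

theorem expRep_chComp [Fintype τ] {co : CoStructure k n m} (hβ : IsRep co β)
    (hU : InMax U) (hV : InMax V) :
    expRep β (chComp co U V) = expRep β U * expRep β V := by
  have hw := sumElim_mem hU hV
  have h1 := expRep_map_subst hw β (campbellHausdorff_mem co)
  rw [expRep_campbellHausdorff hβ, map_subst_mul (hasSubst_of_mem hw),
    expRep_map_subst hw β XL_mem, expRep_map_subst hw β XR_mem, subst_XL hU hV,
        subst_XR hU hV] at h1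
  exact h1.symm

theorem chComp_assoc [Fintype τ] {U V W : Fin m → PS τ k} (hU : InMax U) (hV : InMax V)
    (hW : InMax W) :
    chComp co (chComp co U V) W = chComp co U (chComp co V W) := by
  have hUV := chComp_mem co hU hV
  have hVW := chComp_mem co hV hW
  refine eq_of_logDeriv_euler co (chComp_mem co hUV hW) (chComp_mem co hU hVW) ?_
  rw [logDeriv_chComp co X hUV hW, logDeriv_chComp co X hU hV, logDeriv_chComp co X hU hVW,
    logDeriv_chComp co X hV hW, expRep_chComp (isRep_adj co) hU hV, mulVec_add,
    mulVec_mulVec, add_assoc]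

theorem zero_mem' (ρ : Fin m) : (0 : Fin m → PS τ k) ρ ∈ degIdeal k τ 1 := zero_mem _

theorem logDeriv_zero [Fintype τ] (c : τ → PS τ k) : logDeriv co c (0 : Fin m → PS τ k) = 0 := by
  rw [logDeriv]
  have : (fun ρ => vectorField c ((0 : Fin m → PS τ k) ρ)) = 0 := by funext ρ; simp
  rw [this, mulVec_zero]

theorem expRep_zero (β : Fin m → Matrix ι ι k) : expRep β (0 : Fin m → PS τ k) = 1 := by
  have h0 : repMat β (0 : Fin m → PS τ k) = 0 := by ext1 i j; simp [repMat_apply]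
  have hM : MatMem 1 (0 : Matrix ι ι (PS τ k)) := fun i j => zero_mem _
  rw [expRep, h0, expSeries_eq, matrixSeries_add, matrixSeries_mul _ _ hM, matrixSeries_X hM,
    matrixSeries_one hM, zero_mul, add_zero]

theorem chComp_zero_right [Fintype τ] {U : Fin m → PS τ k} (hU : InMax U) : chComp co U 0 = U := by
  refine eq_of_logDeriv_euler co (chComp_mem co hU zero_mem') hU ?_
  rw [logDeriv_chComp co X hU zero_mem', logDeriv_zero, mulVec_zero, add_zero]

theorem chComp_zero_left [Fintype τ] {V : Fin m → PS τ k} (hV : InMax V) : chComp co 0 V = V := by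
  refine eq_of_logDeriv_euler co (chComp_mem co zero_mem' hV) hV ?_
  rw [logDeriv_chComp co X zero_mem' hV, logDeriv_zero, expRep_zero, one_mulVec, zero_add]

theorem neg_X_mem [Fintype τ] (i : τ) : (-X : τ → PS τ k) i ∈ degIdeal k τ 1 :=
  neg_mem (X_mem_degIdeal i)

theorem chComp_X_neg : chComp co (X : Fin m → PS (Fin m) k) (-X) = 0 := by
  have h1 : logDeriv co X (X : Fin m → PS (Fin m) k) = X :=
    logDeriv_X_of_euler co X_mem_degIdeal euler_X
  have h2 : logDeriv co X (-X : Fin m → PS (Fin m) k) = -X :=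
    logDeriv_X_of_euler co neg_X_mem fun ρ => by
      change euler k _ (-X ρ) = -X ρ
      rw [map_neg, euler_X]
  refine eq_of_logDeriv_euler co (chComp_mem co X_mem_degIdeal neg_X_mem) zero_mem' ?_
  rw [logDeriv_chComp co X X_mem_degIdeal neg_X_mem, logDeriv_zero, h1, h2, mulVec_neg,
    expRep, matrixSeries_mulVec_of_eq_zero _ (matMem_repMat _ X_mem_degIdeal)
    (by rw [ad_mulVec, brk_self]), constantCoeff_expSeries, one_smul, add_neg_cancel]

theorem subst_chComp [Finite σ] {w : σ → PS τ k} (hw : InMax w) {U V : Fin m → PS σ k}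
    (hU : InMax U) (hV : InMax V) (μ : Fin m) :
    subst w (chComp co U V μ) = chComp co (fun ρ => subst w (U ρ)) (fun ρ => subst w (V ρ)) μ := by
  rw [chComp, subst_comp_subst_apply (hasSubst_of_mem (sumElim_mem hU hV)) (hasSubst_of_mem hw),
    chComp]
  congr 1
  funext i
  rcases i with i | i <;> rfl

/-- The Campbell-Hausdorff series up to second order. -/
theorem coeff_chComp_of_degree_eq_two [Fintype τ] (hU : InMax U) (hV : InMax V)
    (eU : ∀ μ, euler k τ (U μ) = U μ) (eV : ∀ μ, euler k τ (V μ) = V μ) {c : τ →₀ ℕ}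
    (hc : c.degree = 2) (μ : Fin m) :
    2 * coeff c (chComp co U V μ) = coeff c (brk co U V μ) := by
  have hD := chComp_mem co hU hV
  set D := chComp co U V with hDdef
  set E : Fin m → PS τ k := fun μ => euler k τ (D μ) with hEdef
  have h2 : ∀ {d : τ →₀ ℕ} (_ : d.degree < 2) ρ, coeff d ((E - D) ρ) = 0 := fun {d} hd ρ => by
    rw [Pi.sub_apply, map_sub, hEdef, coeff_euler]
    rcases (by omega : d.degree = 0 ∨ d.degree = 1) with h | h
    · rw [hD ρ d (by omega), mul_zero, sub_zero]
    · rw [h, Nat.cast_one, one_mul, sub_self]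
  have hz : ∀ {u : Fin m → PS τ k} (_ : ∀ μ, euler k τ (u μ) = u μ), coeff c (u μ) =
    0 := fun e => by
    have := congrArg (coeff c) (e μ)
    rw [coeff_euler, hc, Nat.cast_two] at this
    linear_combination this
  have h3 : c.degree < 2 + 1 := by omega
  have hb : coeff c (brk co D E μ) = 0 := by
    rw [← sub_add_cancel E D, map_add, brk_self, add_zero]
    exact brk_mem co hD (fun ρ d hd => h2 hd ρ) μ c h3
  have h := congrArg (coeff c) (congrFun (logDeriv_chComp co X hU hV) μ)
  have hT := mulVec_mem (matrixSeries_sub_aeval (f := expQuotSeries k)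
    (matMem_repMat (adj co) hD) (N := 2) (p := 1 + Polynomial.C (2 : k)⁻¹ * Polynomial.X)
    fun r hr => by interval_cases r <;> simp [expQuotSeries, Polynomial.coeff_one])
    (fun μ => euler_mem_degIdeal_one (D μ)) μ c h3
  have hX := mulVec_mem (matrixSeries_sub_aeval (f := expSeries k)
    (matMem_repMat (adj co) hU) (N := 2) (p := 1 + Polynomial.X)
    fun r hr => by interval_cases r <;> simp [expSeries, Polynomial.coeff_one, Polynomial.coeff_X])
    hV μ c h3
  rw [sub_mulVec, Pi.sub_apply, map_sub, sub_eq_zero] at hT hX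
  rw [logDeriv_X_of_euler co hU eU, logDeriv_X_of_euler co hV eV, Pi.add_apply, map_add, hz eU,
    zero_add] at h
  refine Eq.trans ?_ ((hT.symm.trans h).trans (hX.trans ?_))
  · rw [map_add, map_one, map_mul, Polynomial.aeval_X, Polynomial.aeval_C,
      Algebra.algebraMap_eq_smul_one, smul_one_mul, Matrix.add_mulVec, one_mulVec,
      Matrix.smul_mulVec, ad_mulVec, Pi.add_apply, Pi.smul_apply, map_add, map_smul, hb,
      smul_zero, add_zero, coeff_euler, hc, Nat.cast_two]
  · rw [map_add, map_one, Polynomial.aeval_X, Matrix.add_mulVec, one_mulVec, ad_mulVec,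
      Pi.add_apply, map_add, hz eV, zero_add]

end GroupLaw

section Natural

variable {n' m' : ℕ}
  {co : CoStructure k n m} {co' : CoStructure k n' m'}

/-- A matrix of constants as a matrix of series. -/
def constMat {p q : Type} (f : Matrix p q k) : Matrix p q (PS τ k) := f.map C

theorem derivation_constMat_mulVec {p q : Type} [Fintype q]
    (D : Derivation k (PS τ k) (PS τ k)) (f : Matrix p q k)
    (v : q → PS τ k) :
    (fun i => D ((constMat f).mulVec v i)) = (constMat f).mulVec fun j => D (v j) := by
  funext i
  simp [constMat, mulVec, dotProduct, ← MvPowerSeries.smul_eq_C_mul]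

theorem constMat_mulVec_mem {p q : Type} [Fintype q] (f : Matrix p q k) {N : ℕ}
    {v : q → PS τ k} (hv : ∀ j, v j ∈ degIdeal k τ N) (i : p) :
    (constMat f).mulVec v i ∈ degIdeal k τ N := by
  simpa using mulVec_mem (MatMem.zero (constMat f)) hv i

/-- `f` is a homomorphism of Lie algebras from `V'*` to `V*`. -/
def IsLieMap (co : CoStructure k n m) (co' : CoStructure k n' m') (f : Matrix (Fin m) (Fin m') k) :
    Prop := ∀ ρ' σ' μ, ∑ ρ, ∑ σ, co.γ ρ σ μ * (f ρ ρ' * f σ σ') = ∑ ν, f μ ν * co'.γ ρ' σ' ν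

variable {f : Matrix (Fin m) (Fin m') k}

theorem brk_constMat (hf : IsLieMap co co' f) (u v : Fin m' → PS τ k) :
    brk co ((constMat f).mulVec u) ((constMat f).mulVec v) = (constMat f).mulVec (brk co' u v) := by
  funext μ
  have e1 : ∀ (w : Fin m' → PS τ k) (ρ : Fin m), (constMat f).mulVec w ρ = ∑ ρ', f ρ ρ' • w ρ' := by
    intro w ρ
    simp [constMat, mulVec, dotProduct, ← MvPowerSeries.smul_eq_C_mul]
  rw [brk_apply, e1]
  have e2 : ∀ ρ σ, (co.γ ρ σ μ • ((constMat f).mulVec u ρ * (constMat f).mulVec v σ) :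
      PS τ k) = ∑ ρ', ∑ σ', (co.γ ρ σ μ * (f ρ ρ' * f σ σ')) • (u ρ' * v σ') := by
    intro ρ σ
    rw [e1, e1, sum_mul_sum, smul_sum]
    refine sum_congr rfl fun ρ' _ => ?_
    rw [smul_sum]
    refine sum_congr rfl fun σ' _ => ?_
    rw [smul_mul_smul_comm, smul_smul]
  simp only [e2, brk_apply, smul_sum, smul_smul]
  have e3 : ∑ ρ, ∑ σ, ∑ ρ', ∑ σ', (co.γ ρ σ μ * (f ρ ρ' * f σ σ')) • (u ρ' * v σ') =
      ∑ ρ', ∑ σ', (∑ ρ, ∑ σ, co.γ ρ σ μ * (f ρ ρ' * f σ σ')) • (u ρ' * v σ') := by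
    simp only [sum_smul]
    have s1 : ∀ ρ, ∑ σ, ∑ ρ', ∑ σ', (co.γ ρ σ μ * (f ρ ρ' * f σ σ')) • (u ρ' * v σ') =
        ∑ ρ', ∑ σ', ∑ σ, (co.γ ρ σ μ * (f ρ ρ' * f σ σ')) • (u ρ' * v σ') := by
      intro ρ
      rw [sum_comm]
      exact sum_congr rfl fun _ _ => sum_comm
    simp only [s1]
    rw [sum_comm]
    exact sum_congr rfl fun _ _ => sum_comm
  rw [e3]
  simp only [hf _ _ μ, sum_smul]
  have s2 : ∀ ρ', ∑ σ', ∑ ν, (f μ ν * co'.γ ρ' σ' ν) • (u ρ' * v σ') =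
      ∑ ν, ∑ σ', (f μ ν * co'.γ ρ' σ' ν) • (u ρ' * v σ') := fun _ => sum_comm
  simp only [s2]
  exact sum_comm

theorem ad_constMat (hf : IsLieMap co co' f) (u : Fin m' → PS τ k) : constMat (τ := τ) f *
      repMat (adj co') u = repMat (adj co) ((constMat f).mulVec u) * constMat (τ := τ) f := by
  refine Matrix.ext_of_mulVec_single fun i => ?_
  rw [← mulVec_mulVec, ← mulVec_mulVec, ad_mulVec, ad_mulVec, brk_constMat hf]

theorem series_constMat (g : PowerSeries k) (hf : IsLieMap co co' f)
    {u : Fin m' → PS τ k} (hu : InMax u) :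
    constMat (τ := τ) f * matrixSeries g (repMat (adj co') u) =
      matrixSeries g (repMat (adj co) ((constMat f).mulVec u)) * constMat (τ := τ) f :=
  matrixSeries_intertwine g (matMem_repMat _ hu) (matMem_repMat _ (constMat_mulVec_mem f hu))
    (ad_constMat hf u)

theorem logDeriv_constMat [Fintype τ] (hf : IsLieMap co co' f)
    (c : τ → PS τ k) {u : Fin m' → PS τ k} (hu : InMax u) :
    logDeriv co c ((constMat f).mulVec u) = (constMat f).mulVec (logDeriv co' c u) := by
  rw [logDeriv, derivation_constMat_mulVec, mulVec_mulVec, logDeriv, mulVec_mulVec,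
    Theta, Theta, series_constMat _ hf hu]

theorem chComp_constMat [Fintype τ] (hf : IsLieMap co co' f) {U V : Fin m' → PS τ k} (hU : InMax U)
    (hV : InMax V) :
    chComp co ((constMat f).mulVec U) ((constMat f).mulVec V) =
      (constMat f).mulVec (chComp co' U V) := by
  have hU' := constMat_mulVec_mem f hU
  have hV' := constMat_mulVec_mem f hV
  refine eq_of_logDeriv_euler co (chComp_mem co hU' hV')
    (constMat_mulVec_mem f (chComp_mem co' hU hV)) ?_
  rw [logDeriv_chComp co X hU' hV', logDeriv_constMat hf X hU, logDeriv_constMat hf X hV,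
    logDeriv_constMat hf X (chComp_mem co' hU hV), logDeriv_chComp co' X hU hV, mulVec_mulVec,
    expRep, ← series_constMat _ hf hU, mulVec_add, mulVec_mulVec, expRep]

end Natural

section Cocycle

variable {σ : Type} {ι : Type} [Fintype ι]
  [DecidableEq ι] {co : CoStructure k n m}

/-- `∑ a_ρ u_ρ`. -/
def linVec (a : Fin m → ι → k) (u : Fin m → PS τ k) (i : ι) : PS τ k :=
  ∑ ρ, a ρ i • u ρ

/-- `a` is a 1-cocycle of the Lie algebra `V*`. -/
def IsLieCocycle (co : CoStructure k n m) (β : Fin m → Matrix ι ι k) (a : Fin m → ι → k) : Prop :=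
  ∀ ρ σ i, ∑ j, (β ρ i j * a σ j - β σ i j * a ρ j) = ∑ μ, co.γ ρ σ μ * a μ i

/-- The representation `[[β, a], [0, 0]]`. -/
def extRep (β : Fin m → Matrix ι ι k) (a : Fin m → ι → k) (ρ : Fin m) :
    Matrix (ι ⊕ Unit) (ι ⊕ Unit) k := Matrix.fromBlocks (β ρ) (Matrix.of fun i _ => a ρ i) 0 0

theorem isRep_extRep {β : Fin m → Matrix ι ι k} (hβ : IsRep co β) {a : Fin m → ι → k}
    (ha : IsLieCocycle co β a) : IsRep co (extRep β a) := by
  intro ρ σ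
  have h := hβ ρ σ
  ext i j
  rcases i with i | i <;> rcases j with j | j
  · have := congrFun (congrFun h i) j
    simpa [extRep, Matrix.fromBlocks_multiply, Matrix.sum_apply] using this
  · have := ha ρ σ i
    simpa [extRep, Matrix.fromBlocks_multiply, Matrix.sum_apply, mul_apply,
      sum_sub_distrib] using this
  · simp [extRep, Matrix.fromBlocks_multiply, Matrix.sum_apply]
  · simp [extRep, Matrix.fromBlocks_multiply, Matrix.sum_apply]

/-- The group cocycle `((e^β - 1) / β) a`. -/
def cocycleOf (β : Fin m → Matrix ι ι k) (a : Fin m → ι → k) (u : Fin m → PS τ k) :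
    ι → PS τ k := (matrixSeries (expQuotSeries k) (repMat β u)).mulVec (linVec a u)

variable {u : Fin m → PS τ k}

theorem linVec_mem (a : Fin m → ι → k) {N : ℕ}
    (hu : ∀ ρ, u ρ ∈ degIdeal k τ N) (i : ι) : linVec a u i ∈ degIdeal k τ N :=
  sum_mem fun ρ _ => smul_mem_degIdeal _ (hu ρ)

theorem cocycleOf_mem (β : Fin m → Matrix ι ι k) (a : Fin m → ι → k) (hu : InMax u) (i : ι) :
    cocycleOf β a u i ∈ degIdeal k τ 1 := by
  have := mulVec_mem (MatMem.zero (matrixSeries (expQuotSeries k) (repMat β u))) (linVec_mem a hu) i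
  rw [Nat.zero_add] at this
  exact this

/-- The inclusion of the first block. -/
def inlMat (ι : Type) [DecidableEq ι] (τ : Type) (k : Type u) [Field k] :
    Matrix (ι ⊕ Unit) ι (PS τ k) := Matrix.fromRows 1 0

theorem repMat_extRep_mul_inl (β : Fin m → Matrix ι ι k) (a : Fin m → ι → k) (u : Fin m → PS τ k) :
    inlMat ι τ k * repMat β u = repMat (extRep β a) u * inlMat ι τ k := by
  have : repMat (extRep β a) u = Matrix.fromBlocks (repMat β u) (Matrix.of fun i _ => linVec a u i)
      0 0 := by
    ext1 i j
    rcases i with i | i <;> rcases j with j | j <;> simp [repMat_apply, extRep, linVec]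
  rw [this, inlMat, Matrix.fromRows_mul, Matrix.fromBlocks_mul_fromRows]
  simp

theorem expRep_extRep_inl (β : Fin m → Matrix ι ι k) (a : Fin m → ι → k) (hu : InMax u) (f :
    PowerSeries k)
    (x : ι ⊕ Unit) (j : ι) :
    matrixSeries f (repMat (extRep β a) u) x (Sum.inl j) =
      (inlMat ι τ k * matrixSeries f (repMat β u)) x j := by
  rw [matrixSeries_intertwine f (matMem_repMat _ hu) (matMem_repMat _ hu)
    (repMat_extRep_mul_inl β a u), mul_apply, sum_eq_single (Sum.inl j)]
  · simp [inlMat]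
  · rintro (b | b) _ hb
    · simp [inlMat, one_apply, show b ≠ j from fun h => hb (by rw [h])]
    · simp [inlMat]
  · simp

theorem expRep_extRep_inl_inl (β : Fin m → Matrix ι ι k) (a : Fin m → ι → k) (hu : InMax u) (i j :
    ι) :
    expRep (extRep β a) u (Sum.inl i) (Sum.inl j) = expRep β u i j := by
  rw [expRep, expRep_extRep_inl β a hu]
  simp [inlMat, mul_apply, one_apply, expRep]

theorem expRep_extRep_inr (β : Fin m → Matrix ι ι k) (a : Fin m → ι → k) (hu : InMax u) (x :
    ι ⊕ Unit) :
    expRep (extRep β a) u x (Sum.inr ()) = Sum.elim (cocycleOf β a u) (fun _ => 1) x := by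
  have hM := matMem_repMat (extRep β a) hu
  rw [expRep, expSeries_eq, mul_comm, matrixSeries_add, matrixSeries_mul _ _ hM, matrixSeries_X hM,
    matrixSeries_one hM, Matrix.add_apply, mul_apply, Fintype.sum_sum_type]
  simp only [expRep_extRep_inl β a hu]
  rcases x with i | i
  · simp [repMat_apply, extRep, inlMat, mul_apply, one_apply, cocycleOf, linVec, mulVec, dotProduct]
  · simp [repMat_apply, extRep, inlMat, mul_apply, one_apply]

theorem cocycleOf_chComp [Fintype τ] {β : Fin m → Matrix ι ι k} (hβ : IsRep co β)
    {a : Fin m → ι → k} (ha : IsLieCocycle co β a) {U V : Fin m → PS τ k}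
    (hU : InMax U) (hV : InMax V) :
    cocycleOf β a (chComp co U V) = (expRep β U).mulVec (cocycleOf β a V) + cocycleOf β a U := by
  funext i
  have h := congrFun (congrFun (expRep_chComp (isRep_extRep hβ ha) hU hV) (Sum.inl i)) (Sum.inr ())
  rw [mul_apply, Fintype.sum_sum_type, expRep_extRep_inr β a (chComp_mem co hU hV)] at h
  simpa [expRep_extRep_inr β a hU, expRep_extRep_inr β a hV, expRep_extRep_inl_inl β a hU,
    mulVec, dotProduct] using h

theorem vectorField_cocycleOf [Fintype τ] {β : Fin m → Matrix ι ι k} (hβ : IsRep co β)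
    {a : Fin m → ι → k} (ha : IsLieCocycle co β a) (c : τ → PS τ k) (hu : InMax u) :
    (fun i => vectorField c (cocycleOf β a u i)) =
      (repMat β (logDeriv co c u)).mulVec (cocycleOf β a u) + linVec a (logDeriv co c u) := by
  funext i
  have h := congrFun (congrFun (vectorField_expRep (isRep_extRep hβ ha) c hu) (Sum.inl i))
    (Sum.inr ())
  rw [mul_apply, Fintype.sum_sum_type, mapD_apply, expRep_extRep_inr β a hu] at h
  simpa [expRep_extRep_inr β a hu, repMat_apply, extRep, mulVec, dotProduct, linVec] using h

theorem cocycleOf_sub_linVec_mem (β : Fin m → Matrix ι ι k) (a : Fin m → ι → k) (hu : InMax u) (i :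
    ι) :
    cocycleOf β a u i - linVec a u i ∈ degIdeal k τ 2 := by
  have h1 := matrixSeries_sub_coeff_zero (expQuotSeries k) (matMem_repMat β hu)
  rw [constantCoeff_expQuotSeries, one_smul] at h1
  have := mulVec_mem h1 (linVec_mem a hu) i
  rwa [sub_mulVec, one_mulVec] at this

theorem linVec_subst {w : σ → PS τ k} (hw : HasSubst w) (a : Fin m → ι → k)
    (u : Fin m → PS σ k) (i : ι) :
    subst w (linVec a u i) = linVec a (fun ρ => subst w (u ρ)) i := by
  simp [linVec, subst_sum hw, subst_smul hw]

theorem cocycleOf_subst [Finite σ] {w : σ → PS τ k} (hw : InMax w)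
    (β : Fin m → Matrix ι ι k) (a : Fin m → ι → k)
    {u : Fin m → PS σ k} (hu : InMax u) (i : ι) :
    subst w (cocycleOf β a u i) = cocycleOf β a (fun ρ => subst w (u ρ)) i := by
  have hs := hasSubst_of_mem hw
  rw [cocycleOf, subst_mulVec hs, matrixSeries_map_subst hw _ (matMem_repMat β hu),
    repMat_map_subst hs]
  simp only [linVec_subst hs]
  rfl

/-- The matrices of the representation on `H*`. -/
def alphaRep (co : CoStructure k n m) (ρ : Fin m) : Matrix (Fin n) (Fin n) k :=
  Matrix.of fun i l => co.α ρ i l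

theorem isRep_alphaRep (co : CoStructure k n m) : IsRep co (alphaRep co) := isRep_alpha co

/-- The matrices of the representation on tensors with indices `(i, μ)`. -/
def tensorRep (co : CoStructure k n m) (ρ : Fin m) : Matrix (Fin n × Fin m) (Fin n × Fin m) k :=
  kroneckerMap (· * ·) (alphaRep co ρ) 1 + kroneckerMap (· * ·) 1 (adj co ρ)

theorem isRep_tensorRep (co : CoStructure k n m) : IsRep co (tensorRep co) := by
  intro ρ σ
  have h1 := isRep_alphaRep co ρ σ
  have h2 := isRep_adj co ρ σ
  have e : ∀ A B : Matrix (Fin n) (Fin n) k, ∀ C D : Matrix (Fin m) (Fin m) k,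
      kroneckerMap (· * ·) A C * kroneckerMap (· * ·) B D =
        kroneckerMap (· * ·) (A * B) (C * D) := fun A B C D =>
    (Matrix.mul_kronecker_mul A B C D).symm
  have : tensorRep co ρ * tensorRep co σ - tensorRep co σ * tensorRep co ρ =
      kroneckerMap (· * ·) (alphaRep co ρ * alphaRep co σ - alphaRep co σ * alphaRep co ρ)
        (1 : Matrix (Fin m) (Fin m) k) +
      kroneckerMap (· * ·) (1 : Matrix (Fin n) (Fin n) k)
        (adj co ρ * adj co σ - adj co σ * adj co ρ) := by
    simp only [tensorRep, mul_add, add_mul, e, one_mul, mul_one]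
    ext ⟨i, μ⟩ ⟨j, ν⟩
    simp only [Matrix.sub_apply, Matrix.add_apply, kroneckerMap_apply]
    ring
  rw [this, h1, h2]
  ext ⟨i, μ⟩ ⟨j, ν⟩
  simp only [tensorRep, Matrix.add_apply, kroneckerMap_apply, Matrix.sum_apply,
    Matrix.smul_apply, smul_eq_mul, sum_mul, mul_sum, ← sum_add_distrib]
  exact sum_congr rfl fun _ _ => by ring

theorem repMat_tensorRep_apply (co : CoStructure k n m) (u : Fin m → PS τ k)
    (i l : Fin n) (μ ν : Fin m) : repMat (tensorRep co) u (i, μ) (l, ν) =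
      repMat (alphaRep co) u i l * (1 : Matrix (Fin m) (Fin m) (PS τ k)) μ ν +
        (1 : Matrix (Fin n) (Fin n) (PS τ k)) i l * repMat (adj co) u μ ν := by
  simp only [repMat_apply, tensorRep, Matrix.add_apply, kroneckerMap_apply, add_smul,
    sum_add_distrib, one_apply]
  congr 1
  · split_ifs <;> simp
  · split_ifs <;> simp

theorem alphaGammaX_eq (co : CoStructure k n m) : co.alphaGammaX = repMat (tensorRep co) X := by
  ext1 ⟨i, μ⟩ ⟨l, ν⟩
  rw [repMat_tensorRep_apply]
  rfl

theorem repMat_tensorRep_mulVec (co : CoStructure k n m) (u : Fin m → PS τ k)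
    (w : Fin n × Fin m → PS τ k) (i : Fin n) :
    (fun μ => (repMat (tensorRep co) u).mulVec w (i, μ)) =
      ∑ l, repMat (alphaRep co) u i l • (fun μ => w (l, μ)) + brk co u fun μ => w (i, μ) := by
  funext μ
  rw [mulVec, dotProduct, Fintype.sum_prod_type, Pi.add_apply, ← ad_mulVec, mulVec,
    dotProduct, Finset.sum_apply]
  simp only [repMat_tensorRep_apply, add_mul, sum_add_distrib, one_apply, mul_ite,
    mul_one, mul_zero, ite_mul, one_mul, zero_mul, sum_ite_eq, mem_univ, if_true,
    Pi.smul_apply, smul_eq_mul]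
  congr 1
  rw [sum_comm]
  simp

theorem expRep_tensorRep_X (co : CoStructure k n m) (i l : Fin n) (μ ν : Fin m) :
    expRep (tensorRep co) X (i, μ) (l, ν) = co.expAlpha i l * co.expGamma μ ν := by
  set K : Matrix (Fin n × Fin m) (Fin n × Fin m) (PS (Fin m) k) :=
    kroneckerMap (· * ·) (expRep (alphaRep co) X) (expRep (adj co) X) with hK
  have hX := X_mem_degIdeal (k := k) (τ := Fin m)
  suffices h : expRep (tensorRep co) X = K by rw [h]; rfl
  rw [← sub_eq_zero]
  have hEK : mapD (euler k (Fin m)) K = repMat (tensorRep co) X * K := by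
    ext1 ⟨i, μ⟩ ⟨l, ν⟩
    have e1 := congrFun (congrFun (euler_expRep_X (alphaRep co)) i) l
    have e2 := congrFun (congrFun (euler_expRep_X (adj co)) μ) ν
    rw [mapD_apply] at e1 e2
    rw [mapD_apply, mul_apply (M := repMat (tensorRep co) X), Fintype.sum_prod_type, hK,
      kroneckerMap_apply, Derivation.leibniz, e1, e2]
    simp only [repMat_tensorRep_apply, add_mul, sum_add_distrib, one_apply, mul_ite,
      mul_one, mul_zero, ite_mul, one_mul, zero_mul, sum_ite_eq, mem_univ, if_true,
      kroneckerMap_apply, smul_eq_mul]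
    rw [sum_comm (s := (Finset.univ : Finset (Fin n)))]
    simp only [sum_ite_eq, mem_univ, if_true, mul_apply, mul_sum]
    rw [add_comm]
    congr 1 <;> exact sum_congr rfl fun _ _ => by ring
  have h1 : MatMem 1 (expRep (tensorRep co) X - K) := by
    have e1 := matMem_expRep_sub_one (alphaRep co) hX
    have e2 := matMem_expRep_sub_one (adj co) hX
    have e3 : MatMem 1 (K - 1) := by
      rintro ⟨i, μ⟩ ⟨l, ν⟩
      have e4 := add_mem (Ideal.mul_mem_right (expRep (adj co) X μ ν) _ (e1 i l))
        (Ideal.mul_mem_left _ ((1 : Matrix (Fin n) (Fin n) (PS (Fin m) k)) i l) (e2 μ ν))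
      convert e4 using 1
      simp only [hK, Matrix.sub_apply, kroneckerMap_apply]
      have : (1 : Matrix (Fin n × Fin m) (Fin n × Fin m) (PS (Fin m) k)) (i, μ) (l, ν) =
        (1 : Matrix (Fin n) (Fin n) (PS (Fin m) k)) i l *
        (1 : Matrix (Fin m) (Fin m) (PS (Fin m) k)) μ ν := by
        simp only [one_apply, Prod.mk.injEq]
        split_ifs <;> simp_all
      rw [this]; ring
    have := (matMem_expRep_sub_one (tensorRep co) hX).sub e3
    convert this using 1
    abel
  have hE : mapD (euler k (Fin m)) (expRep (tensorRep co) X - K) =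
      repMat (tensorRep co) X * (expRep (tensorRep co) X - K) := by
    rw [mapD_sub, hEK, euler_expRep_X, Matrix.mul_sub]
  ext1 i j
  have := eq_zero_of_euler_linear 0 (fun i => (expRep (tensorRep co) X - K) i j)
    (Or.inr fun i => h1 i j) (repMat (tensorRep co) X) (matMem_repMat _ hX) fun i => by
      have := congrFun (congrFun hE i) j
      rw [mapD_apply, mul_apply] at this
      simpa using this
  exact congrFun this i

theorem isLieCocycle_tensorRep_iff {co : CoStructure k n m} {A : Fin n → Fin m → Fin m → k} :
    IsLieCocycle co (tensorRep co) (fun ρ p => A p.1 ρ p.2) ↔ ∀ i ρ σ μ,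
      ∑ ν, (A i ν μ * co.γ ρ σ ν - co.γ ν σ μ * A i ρ ν - co.γ ρ ν μ * A i σ ν) =
        ∑ l, (A l σ μ * co.α ρ i l - A l ρ μ * co.α σ i l) := by
  have e : ∀ i μ ρ σ, ∑ j, tensorRep co ρ (i, μ) j * A j.1 σ j.2 =
      ∑ l, co.α ρ i l * A l σ μ + ∑ ν, co.γ ρ ν μ * A i σ ν := by
    intro i μ ρ σ
    rw [Fintype.sum_prod_type]
    simp only [tensorRep, Matrix.add_apply, kroneckerMap_apply, alphaRep, adj,
      Matrix.of_apply, add_mul, sum_add_distrib, one_apply, mul_ite, mul_one,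
      mul_zero, ite_mul, one_mul, zero_mul, sum_ite_eq, mem_univ, if_true]
    congr 1
    rw [sum_comm]
    simp
  have key : ∀ i ρ σ μ, (∑ j, (tensorRep co ρ (i, μ) j * A j.1 σ j.2 -
        tensorRep co σ (i, μ) j * A j.1 ρ j.2) = ∑ ν, co.γ ρ σ ν * A i ν μ) ↔
      ∑ ν, (A i ν μ * co.γ ρ σ ν - co.γ ν σ μ * A i ρ ν - co.γ ρ ν μ * A i σ ν) =
        ∑ l, (A l σ μ * co.α ρ i l - A l ρ μ * co.α σ i l) := by
    intro i ρ σ μ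
    rw [sum_sub_distrib, e, e]
    simp only [sum_sub_distrib]
    have e1 : ∑ ν, co.γ σ ν μ * A i ρ ν = -∑ ν, co.γ ν σ μ * A i ρ ν := by
      rw [← sum_neg_distrib]
      exact sum_congr rfl fun ν _ => by rw [co.γ_skew]; ring
    rw [e1]
    simp only [mul_comm (A _ _ _)]
    constructor <;> intro h <;> linear_combination -h
  constructor
  · intro h i ρ σ μ
    exact (key i ρ σ μ).1 (h ρ σ (i, μ))
  · rintro h ρ σ ⟨i, μ⟩
    exact (key i ρ σ μ).2 (h i ρ σ μ)

end Cocycle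

section InhomLieBialgebra

variable (L : InhomLieBialgebra k)

/-- The 1-cocycle `V* → H* ⊗ V*` given by `A`. -/
def linCocycle (ρ : Fin L.m) (p : Fin L.n × Fin L.m) : k := L.A p.1 ρ p.2

theorem isLieCocycle_linCocycle : IsLieCocycle L.co (tensorRep L.co) (linCocycle L) :=
  isLieCocycle_tensorRep_iff.2 L.cond1

theorem cocycle_eq (i : Fin L.n) (μ : Fin L.m) :
    L.cocycle i μ = cocycleOf (tensorRep L.co) (linCocycle L) X (i, μ) := by
  rw [cocycleOf, mulVec, dotProduct, Fintype.sum_prod_type, ← alphaGammaX_eq]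
  rfl

theorem cocycle_mem (i : Fin L.n) (μ : Fin L.m) : L.cocycle i μ ∈ degIdeal k _ 1 := by
  rw [cocycle_eq]; exact cocycleOf_mem _ _ X_mem_degIdeal _

theorem coeff_cocycle (i : Fin L.n) (μ ν : Fin L.m) :
    coeff (single ν 1) (L.cocycle i μ) = L.A i ν μ := by
  have h := cocycleOf_sub_linVec_mem (tensorRep L.co) (linCocycle L)
    (X_mem_degIdeal (k := k) (τ := Fin L.m)) (i, μ) (single ν 1) (by simp)
  rw [map_sub, sub_eq_zero, ← cocycle_eq] at h
  rw [h, linVec, map_sum, sum_eq_single ν]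
  · simp [linCocycle, coeff_X]
  · intro b _ hb
    simp [coeff_X, Finsupp.single_left_inj, hb.symm]
  · simp

theorem chComp_XL_XR {n m : ℕ} (co : CoStructure k n m) : chComp co (XL k m) (XR k m) =
    co.campbellHausdorff := by
  funext μ
  have : Sum.elim (XL k m) (XR k m) = (X : _ → PS (Fin m ⊕ Fin m) k) := by
    funext i; rcases i with i | i <;> rfl
  rw [chComp, this, subst_X_self]

theorem isGroupCocycle_cocycle : L.co.IsGroupCocycle L.cocycle := by
  intro i μ
  have hX := X_mem_degIdeal (k := k) (τ := Fin L.m)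
  have hs : ∀ {w : Fin L.m → PS (Fin L.m ⊕ Fin L.m) k}, (InMax w) →
      ∀ i μ, subst w (L.cocycle i μ) = cocycleOf (tensorRep L.co) (linCocycle L) w (i, μ) := by
    intro w hw i μ
    rw [cocycle_eq, cocycleOf_subst hw _ _ hX]
    simp only [subst_X (hasSubst_of_mem hw)]
  have h := congrFun (cocycleOf_chComp (isRep_tensorRep L.co) (isLieCocycle_linCocycle L)
    (XL_mem (k := k) (m := L.m)) (XR_mem (k := k) (m := L.m))) (i, μ)
  rw [chComp_XL_XR, ← hs (campbellHausdorff_mem L.co), Pi.add_apply, ← hs XL_mem, mulVec,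
    dotProduct, Fintype.sum_prod_type] at h
  refine h.trans ?_
  congr 1
  refine sum_congr rfl fun l _ => sum_congr rfl fun ν _ => ?_
  rw [← hs XR_mem, ← expRep_tensorRep_X]
  congr 1
  have := congrFun (congrFun (expRep_map_subst (XL_mem (k := k) (m := L.m)) (tensorRep L.co) hX)
    (i, μ)) (l, ν)
  simp only [subst_X (hasSubst_of_mem (XL_mem (k := k) (m := L.m)))] at this
  exact this.symm

end InhomLieBialgebra

section VectorFields

variable (L : InhomLieBialgebra k)

/-- The action of `H_i` on `V*`-valued series. -/
def actA (i : Fin L.n) : (Fin L.m → PS τ k) →ₗ[PS τ k] (Fin L.m → PS τ k) :=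
  Matrix.mulVecLin (constMat (τ := τ) (Matrix.of fun μ ρ => L.A i ρ μ))

theorem actA_apply (i : Fin L.n) (u : Fin L.m → PS τ k) (μ : Fin L.m) :
    actA L i u μ = ∑ ρ, L.A i ρ μ • u ρ := by
  simp [actA, constMat, mulVec, dotProduct, smul_eq_C_mul]

theorem derivation_actA (D : Derivation k (PS τ k) (PS τ k)) (i : Fin L.n) (u : Fin L.m → PS τ k) :
    (fun μ => D (actA L i u μ)) = actA L i fun μ => D (u μ) :=
  derivation_constMat_mulVec D _ u

theorem actA_mem (i : Fin L.n) {N : ℕ} {u : Fin L.m → PS τ k}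
    (hu : ∀ μ, u μ ∈ degIdeal k τ N) (μ : Fin L.m) : actA L i u μ ∈ degIdeal k τ N :=
  constMat_mulVec_mem _ hu μ

theorem actA_brk (j : Fin L.n) (u w : Fin L.m → PS τ k) :
    actA L j (brk L.co u w) = brk L.co (actA L j u) w + brk L.co u (actA L j w) +
      ∑ l, repMat (alphaRep L.co) u j l • actA L l w -
      ∑ l, repMat (alphaRep L.co) w j l • actA L l u := by
  funext μ
  have e1 : actA L j (brk L.co u w) μ =
      ∑ ρ, ∑ σ, (∑ ν, L.A j ν μ * L.co.γ ρ σ ν) • (u ρ * w σ) := by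
    simp only [actA_apply, brk_apply, smul_sum, smul_smul, sum_smul]
    rw [sum_comm]
    exact sum_congr rfl fun _ _ => sum_comm
  have e2 : brk L.co (actA L j u) w μ =
      ∑ ρ, ∑ σ, (∑ ν, L.co.γ ν σ μ * L.A j ρ ν) • (u ρ * w σ) := by
    simp only [actA_apply, brk_apply, sum_mul, smul_mul_assoc, smul_sum, smul_smul, sum_smul]
    refine (sum_congr rfl fun _ _ => sum_comm).trans ?_
    rw [sum_comm]
    refine (sum_congr rfl fun _ _ => sum_comm).trans ?_
    rw [sum_comm]
  have e3 : brk L.co u (actA L j w) μ =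
      ∑ ρ, ∑ σ, (∑ ν, L.co.γ ρ ν μ * L.A j σ ν) • (u ρ * w σ) := by
    simp only [actA_apply, brk_apply, mul_sum, mul_smul_comm, smul_sum, smul_smul, sum_smul]
    exact sum_congr rfl fun _ _ => sum_comm
  have e4 : ∀ u w : Fin L.m → PS τ k, (∑ l, repMat (alphaRep L.co) u j l • actA L l w) μ =
      ∑ ρ, ∑ σ, (∑ l, L.A l σ μ * L.co.α ρ j l) • (u ρ * w σ) := by
    intro u w
    simp only [Finset.sum_apply, Pi.smul_apply, actA_apply, repMat_apply, alphaRep, Matrix.of_apply,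
      smul_eq_mul, mul_sum, smul_mul_assoc, mul_smul_comm, sum_smul,
      smul_smul]
    rw [sum_comm]
    refine (sum_congr rfl fun _ _ => sum_comm).trans ?_
    rw [sum_comm]
  have e5 : (∑ l, repMat (alphaRep L.co) w j l • actA L l u) μ =
      ∑ ρ, ∑ σ, (∑ l, L.A l ρ μ * L.co.α σ j l) • (u ρ * w σ) := by
    rw [e4, sum_comm]
    exact sum_congr rfl fun _ _ => sum_congr rfl fun _ _ => by rw [mul_comm (w _)]
  rw [Pi.sub_apply, Pi.add_apply, Pi.add_apply, e1, e2, e3, e4, e5]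
  simp only [← sum_add_distrib, ← sum_sub_distrib, ← add_smul, ← sub_smul]
  refine sum_congr rfl fun ρ _ => sum_congr rfl fun σ _ => ?_
  have h := L.cond1 j ρ σ μ
  simp only [sum_sub_distrib] at h
  congr 1
  simp only [sum_add_distrib]
  linear_combination h

theorem actA_comm (i j : Fin L.n) (u : Fin L.m → PS τ k) :
    actA L j (actA L i u) - actA L i (actA L j u) = ∑ l, (C (L.C i j l) : PS τ k) • actA L l u := by
  funext μ
  have e : ∀ i j, actA L j (actA L i u) μ = ∑ ρ, (∑ ν, L.A j ν μ * L.A i ρ ν) • u ρ := by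
    intro i j
    simp only [actA_apply, smul_sum, smul_smul, sum_smul]
    exact sum_comm
  rw [Pi.sub_apply, e, e, ← sum_sub_distrib, Finset.sum_apply]
  simp only [Pi.smul_apply, actA_apply, smul_eq_mul, ← smul_eq_C_mul, smul_sum, smul_smul]
  rw [sum_comm]
  refine sum_congr rfl fun ρ _ => ?_
  rw [← sub_smul, ← sum_smul, ← L.A_rep, sum_sub_distrib]

theorem alpha_actA (i j l : Fin L.n) (u : Fin L.m → PS τ k) :
    repMat (alphaRep L.co) (actA L i u) j l - repMat (alphaRep L.co) (actA L j u) i l =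
      ∑ q, (C (L.C i j q) * repMat (alphaRep L.co) u q l - repMat (alphaRep L.co) u j q * C
        (L.C i q l)
        - repMat (alphaRep L.co) u i q * C (L.C q j l)) := by
  have e : ∀ i j, repMat (alphaRep L.co) (actA L i u) j l =
      ∑ μ, (∑ ν, L.co.α ν j l * L.A i μ ν) • u μ := by
    intro i j
    simp only [repMat_apply, actA_apply, alphaRep, Matrix.of_apply, smul_sum, smul_smul, sum_smul]
    exact sum_comm
  rw [e, e, ← sum_sub_distrib]
  simp only [repMat_apply, alphaRep, Matrix.of_apply, mul_comm _ (C _), ← smul_eq_C_mul,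
    smul_sum, smul_smul, ← sum_sub_distrib, ← sub_smul]
  rw [sum_comm]
  refine sum_congr rfl fun μ _ => ?_
  rw [← sum_smul, ← L.cond2]
  congr 1
  exact sum_congr rfl fun _ _ => by ring

/-- `Â_i`. -/
def cocycleVec (i : Fin L.n) : Fin L.m → PS (Fin L.m) k := L.cocycle i

theorem cocycleVec_mem (i : Fin L.n) (μ : Fin L.m) : cocycleVec L i μ ∈ degIdeal k _ 1 :=
  cocycle_mem L i μ

theorem seriesA_eq (i : Fin L.n) : L.seriesA i = (ThetaInv L.co X).mulVec (cocycleVec L i) := rfl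

theorem Theta_mulVec_seriesA (i : Fin L.n) : (Theta L.co X).mulVec (L.seriesA i) =
    cocycleVec L i := by
  rw [seriesA_eq, mulVec_mulVec, Theta_mul_ThetaInv _ X_mem_degIdeal, one_mulVec]

theorem seriesA_mem (i : Fin L.n) (μ : Fin L.m) : L.seriesA i μ ∈ degIdeal k _ 1 := by
  have := mulVec_mem (MatMem.zero (ThetaInv L.co X)) (cocycleVec_mem L i) μ
  rwa [Nat.zero_add] at this

theorem logDeriv_seriesA (i : Fin L.n) : logDeriv L.co (L.seriesA i) X = cocycleVec L i := by
  rw [logDeriv]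
  simp only [vectorField_X]
  exact Theta_mulVec_seriesA L i

variable (co : CoStructure k n m)

theorem logDeriv_X_X : logDeriv co X (X : _ → PS (Fin m) k) = X := by
  rw [logDeriv]
  simp only [vectorField_X]
  exact Theta_mulVec_self _ X_mem_degIdeal

theorem vectorField_cocycleVec (c : Fin L.m → PS (Fin L.m) k) (i : Fin L.n) :
    (fun μ => vectorField c (cocycleVec L i μ)) =
      ∑ l, repMat (alphaRep L.co) (logDeriv L.co c X) i l • cocycleVec L l +
        brk L.co (logDeriv L.co c X) (cocycleVec L i) + actA L i (logDeriv L.co c X) := by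
  have h := vectorField_cocycleOf (isRep_tensorRep L.co) (isLieCocycle_linCocycle L) c
    (X_mem_degIdeal (k := k) (τ := Fin L.m))
  have h2 := repMat_tensorRep_mulVec L.co (logDeriv L.co c X)
    (cocycleOf (tensorRep L.co) (linCocycle L) X) i
  funext μ
  have h1 := congrFun h (i, μ)
  rw [Pi.add_apply, congrFun h2 μ, ← cocycle_eq] at h1
  simp only [← cocycle_eq] at h1
  rw [Pi.add_apply, actA_apply]
  exact h1

theorem euler_cocycleVec (i : Fin L.n) : (fun μ => euler k _ (cocycleVec L i μ)) =
      ∑ l, repMat (alphaRep L.co) X i l • cocycleVec L l + brk L.co X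
        (cocycleVec L i) + actA L i X := by
  have := vectorField_cocycleVec L X i
  rwa [logDeriv_X_X] at this

/-- `C_{ij}^l - α(Â_i)_j^l + α(Â_j)_i^l`. -/
def twistedC (i j l : Fin L.n) : PS (Fin L.m) k :=
  C (L.C i j l) - repMat (alphaRep L.co) (cocycleVec L i) j l +
    repMat (alphaRep L.co) (cocycleVec L j) i l

theorem euler_repMat_cocycleVec (i j l : Fin L.n) :
    euler k _ (repMat (alphaRep L.co) (cocycleVec L i) j l) =
      ∑ s, repMat (alphaRep L.co) X i s * repMat (alphaRep L.co) (cocycleVec L s) j l +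
      (∑ s, repMat (alphaRep L.co) X j s * repMat (alphaRep L.co) (cocycleVec L i) s l -
      ∑ s, repMat (alphaRep L.co) (cocycleVec L i) j s * repMat (alphaRep L.co) X s l) +
      repMat (alphaRep L.co) (actA L i X) j l := by
  have h := congrFun (congrFun (mapD_repMat (euler k _) (alphaRep L.co) (cocycleVec L i)) j) l
  rw [mapD_apply, euler_cocycleVec, repMat_add, repMat_add, repMat_sum,
    repMat_brk (isRep_alphaRep L.co)] at h
  simpa [Matrix.add_apply, Matrix.sum_apply, mul_apply] using h

theorem euler_twistedC (i j l : Fin L.n) :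
    euler k _ (twistedC L i j l) = ∑ s, repMat (alphaRep L.co) X i s * twistedC L s j l +
      ∑ s, repMat (alphaRep L.co) X j s * twistedC L i s l -
      ∑ s, twistedC L i j s * repMat (alphaRep L.co) X s l := by
  have h := alpha_actA L i j l (X : Fin L.m → PS (Fin L.m) k)
  have hC : euler k (Fin L.m) (C (L.C i j l)) = 0 := (euler k (Fin L.m)).map_algebraMap _
  simp only [twistedC]
  rw [map_add, map_sub, euler_repMat_cocycleVec, euler_repMat_cocycleVec, hC]
  simp only [mul_add, mul_sub, add_mul, sub_mul, sum_add_distrib, sum_sub_distrib] at h ⊢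
  linear_combination -h

theorem expAlpha_eq : co.expAlpha = expRep (alphaRep co) X := rfl

theorem euler_expAlpha (j q : Fin n) :
    euler k _ (co.expAlpha j q) = ∑ s, repMat (alphaRep co) X j s * co.expAlpha s q := by
  have := congrFun (congrFun (euler_expRep_X (k := k) (alphaRep co)) j) q
  rwa [mapD_apply, mul_apply] at this

theorem constantCoeff_expAlpha (j q : Fin n) :
    constantCoeff (co.expAlpha j q) = (1 : Matrix (Fin n) (Fin n) k) j q := by
  have := mem_degIdeal_one.1 (matMem_expRep_sub_one (alphaRep co) (X_mem_degIdeal (k := k)) j q)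
  rw [Matrix.sub_apply, map_sub, sub_eq_zero] at this
  refine this.trans ?_
  rw [one_apply, one_apply]
  split_ifs <;> simp

theorem eq_of_euler_tensor {p : ℕ} {ι : Type*} {a : Matrix (Fin p) (Fin p) (PS (Fin m) k)}
    (ha : MatMem 1 a) {P Q : Fin p → Fin p → ι → PS (Fin m) k}
    (hP : ∀ i j q, euler k _ (P i j q) = ∑ s, a i s * P s j q + ∑ s, a j s * P i s q)
    (hQ : ∀ i j q, euler k _ (Q i j q) = ∑ s, a i s * Q s j q + ∑ s, a j s * Q i s q)
    (h0 : ∀ i j q, constantCoeff (P i j q) = constantCoeff (Q i j q)) : P = Q := by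
  have := eq_zero_of_euler 0 (fun t : Fin p × Fin p × ι => P t.1 t.2.1 t.2.2 - Q t.1 t.2.1 t.2.2)
    (Or.inr fun t => by rw [mem_degIdeal_one, map_sub, h0, sub_self]) fun N hN t => by
      rw [Nat.cast_zero, zero_smul, add_zero, add_comm N, map_sub, hP, hQ, add_sub_add_comm,
        ← sum_sub_distrib, ← sum_sub_distrib]
      simp only [← mul_sub]
      exact add_mem (sum_mem fun s _ => mul_mem_degIdeal (ha _ s) (hN (s, t.2)))
        (sum_mem fun s _ => mul_mem_degIdeal (ha _ s) (hN (t.1, s, t.2.2)))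
  funext i j q
  exact sub_eq_zero.1 (congrFun this (i, j, q))

theorem twistedC_mul_expAlpha (i j q : Fin L.n) : ∑ l, twistedC L i j l * L.co.expAlpha l q =
      ∑ l, ∑ p, L.co.expAlpha i l * L.co.expAlpha j p * C (L.C l p q) := by
  set a := repMat (alphaRep L.co) (X : Fin L.m → PS (Fin L.m) k) with ha
  have haX : MatMem 1 a := matMem_repMat _ X_mem_degIdeal
  have hP : ∀ i j q, euler k _ (∑ l, twistedC L i j l * L.co.expAlpha l q) =
      ∑ s, a i s * ∑ l, twistedC L s j l * L.co.expAlpha l q +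
      ∑ s, a j s * ∑ l, twistedC L i s l * L.co.expAlpha l q := by
    intro i j q
    have e1 : ∀ l, euler k _ (twistedC L i j l * L.co.expAlpha l q) =
        ∑ s, a i s * (twistedC L s j l * L.co.expAlpha l q) +
        ∑ s, a j s * (twistedC L i s l * L.co.expAlpha l q) +
        (∑ s, twistedC L i j l * (a l s * L.co.expAlpha s q) -
          ∑ s, twistedC L i j s * (a s l * L.co.expAlpha l q)) := by
      intro l
      rw [Derivation.leibniz, euler_expAlpha, euler_twistedC, smul_eq_mul, smul_eq_mul, ← ha]
      have r1 : ∀ i' t : Fin L.n → PS (Fin L.m) k, ∑ s, i' s * (t s * L.co.expAlpha l q) =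
          (∑ s, i' s * t s) * L.co.expAlpha l q := fun i' t => by
        rw [sum_mul]; exact sum_congr rfl fun _ _ => by ring
      rw [r1 (a i), r1 (a j), r1 (twistedC L i j) (fun s => a s l), ← mul_sum]
      ring
    rw [map_sum]
    simp only [e1, sum_add_distrib, sum_sub_distrib, mul_sum]
    rw [sum_comm (f := fun l s => twistedC L i j l * (a l s * L.co.expAlpha s q)), sub_self,
      add_zero, sum_comm, add_right_inj, sum_comm]
  have hQ : ∀ i j q, euler k _ (∑ l, ∑ p, L.co.expAlpha i l * L.co.expAlpha j p * C (L.C l p q)) =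
      ∑ s, a i s * ∑ l, ∑ p, L.co.expAlpha s l * L.co.expAlpha j p * C (L.C l p q) +
      ∑ s, a j s * ∑ l, ∑ p, L.co.expAlpha i l * L.co.expAlpha s p * C (L.C l p q) := by
    intro i j q
    have hC : ∀ c : k, euler k (Fin L.m) (C c) = 0 := fun c => (euler k (Fin L.m)).map_algebraMap c
    have e1 : ∀ l p, euler k _ (L.co.expAlpha i l * L.co.expAlpha j p * C (L.C l p q)) =
        ∑ s, a i s * (L.co.expAlpha s l * L.co.expAlpha j p * C (L.C l p q)) +
        ∑ s, a j s * (L.co.expAlpha i l * L.co.expAlpha s p * C (L.C l p q)) := by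
      intro l p
      rw [Derivation.leibniz, Derivation.leibniz, euler_expAlpha, euler_expAlpha, hC, smul_zero,
        zero_add, smul_eq_mul, smul_eq_mul, smul_eq_mul, mul_add, mul_sum, mul_sum,
        mul_sum, mul_sum, add_comm]
      congr 1 <;> exact sum_congr rfl fun s _ => by rw [← ha]; ring
    simp only [map_sum, e1, sum_add_distrib, mul_sum]
    have e3 : ∀ f : Fin L.n → Fin L.n → Fin L.n → PS (Fin L.m) k,
        ∑ l, ∑ p, ∑ s, f l p s = ∑ s, ∑ l, ∑ p, f l p s := fun f =>
      (sum_congr rfl fun _ _ => sum_comm).trans sum_comm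
    refine congrArg₂ (· + ·) ?_ ?_
    · rw [e3]
    · rw [e3]
  refine congrFun (congrFun (congrFun (eq_of_euler_tensor haX hP hQ fun i j q => ?_) i) j) q
  have hc : ∀ i j l, constantCoeff (repMat (alphaRep L.co) (cocycleVec L i) j l) = 0 :=
    fun i j l => mem_degIdeal_one.1 (matMem_repMat _ (cocycleVec_mem L i) j l)
  simp [twistedC, hc, constantCoeff_expAlpha, one_apply]

theorem vectorField_expAlpha (i j q : Fin L.n) : vectorField (L.seriesA i) (L.co.expAlpha j q) =
    ∑ l, repMat (alphaRep L.co) (cocycleVec L i) j l * L.co.expAlpha l q := by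
  have h := congrFun (congrFun (vectorField_expRep (isRep_alphaRep L.co) (L.seriesA i)
    (X_mem_degIdeal (k := k) (τ := Fin L.m))) j) q
  rwa [logDeriv_seriesA, mapD_apply, mul_apply] at h

theorem structure_expAlpha (i j q : Fin L.n) : ∑ l, C (L.C i j l) * L.co.expAlpha l q =
    ∑ l, ∑ p, L.co.expAlpha i l * L.co.expAlpha j p * C (L.C l p q) +
      vectorField (L.seriesA i) (L.co.expAlpha j q) -
      vectorField (L.seriesA j) (L.co.expAlpha i q) := by
  rw [vectorField_expAlpha, vectorField_expAlpha, ← twistedC_mul_expAlpha,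
    ← sum_add_distrib, ← sum_sub_distrib]
  exact sum_congr rfl fun l _ => by rw [twistedC]; ring

theorem brk_add_left (u v w : Fin m → PS τ k) :
    brk co (u + v) w = brk co u w + brk co v w := by rw [map_add, LinearMap.add_apply]

theorem brk_sum_left {ι : Type*} (co : CoStructure k n m) (S : Finset ι) (c : ι → PS τ k)
    (u : ι → Fin m → PS τ k) (w : Fin m → PS τ k) :
    brk co (∑ i ∈ S, c i • u i) w = ∑ i ∈ S, c i • brk co (u i) w := by
  rw [map_sum, LinearMap.sum_apply]
  simp only [map_smul, LinearMap.smul_apply]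

theorem brk_sum_right {ι : Type*} (co : CoStructure k n m) (S : Finset ι) (c : ι → PS τ k)
    (u : ι → Fin m → PS τ k) (w : Fin m → PS τ k) :
    brk co w (∑ i ∈ S, c i • u i) = ∑ i ∈ S, c i • brk co w (u i) := by
  simp only [map_sum, map_smul]

theorem brk_cocycleVec_eq (i j : Fin L.n) :
    brk L.co (cocycleVec L i) (cocycleVec L j) + actA L j (cocycleVec L i) -
      actA L i (cocycleVec L j) = ∑ l, twistedC L i j l • cocycleVec L l := by
  set a := repMat (alphaRep L.co) (X : Fin L.m → PS (Fin L.m) k) with ha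
  set b := fun i => repMat (alphaRep L.co) (cocycleVec L i) with hb
  have haX : MatMem 1 a := matMem_repMat _ X_mem_degIdeal
  let K : Fin L.n → Fin L.n → Fin L.m → PS (Fin L.m) k := fun i j =>
    brk L.co (cocycleVec L i) (cocycleVec L j) + actA L j (cocycleVec L i) -
      actA L i (cocycleVec L j) - ∑ l, twistedC L i j l • cocycleVec L l
  have hA : ∀ i j, (fun μ => euler k _ (actA L j (cocycleVec L i) μ)) =
      ∑ s, a i s • actA L j (cocycleVec L s) + (brk L.co (actA L j X) (cocycleVec L i) +
        brk L.co X (actA L j (cocycleVec L i)) + ∑ l, a j l • actA L l (cocycleVec L i) -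
        ∑ l, b i j l • actA L l X) + actA L j (actA L i X) := by
    intro i j
    rw [derivation_actA, euler_cocycleVec, map_add, map_add, map_sum, actA_brk]
    simp only [map_smul]
    rfl
  have hB : ∀ i j, (fun μ => euler k _ (brk L.co (cocycleVec L i) (cocycleVec L j) μ)) =
      ∑ s, a i s • brk L.co (cocycleVec L s) (cocycleVec L j) +
        ∑ s, a j s • brk L.co (cocycleVec L i) (cocycleVec L s) +
        brk L.co X (brk L.co (cocycleVec L i) (cocycleVec L j)) +
        brk L.co (actA L i X) (cocycleVec L j) - brk L.co (actA L j X) (cocycleVec L i) := by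
    intro i j
    rw [derivation_brk, euler_cocycleVec, euler_cocycleVec, brk_add_left, brk_add_left, map_add,
      map_add, brk_sum_left, brk_sum_right, brk_jacobi, brk_skew _ (cocycleVec L i) (actA L j X)]
    abel
  have hG : ∀ i j, (fun μ => euler k _ ((∑ l, twistedC L i j l • cocycleVec L l) μ)) =
      ∑ s, a i s • (∑ l, twistedC L s j l • cocycleVec L l) +
      ∑ s, a j s • (∑ l, twistedC L i s l • cocycleVec L l) +
      brk L.co X (∑ l, twistedC L i j l • cocycleVec L l) + ∑ l, twistedC L i j l • actA L l X := by
    intro i j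
    have e1 : (fun μ => euler k _ ((∑ l, twistedC L i j l • cocycleVec L l) μ)) =
        ∑ l, (euler k _ (twistedC L i j l) • cocycleVec L l +
          twistedC L i j l • fun μ => euler k _ (cocycleVec L l μ)) := by
      funext μ
      simp only [Finset.sum_apply, Pi.add_apply, Pi.smul_apply, smul_eq_mul, map_sum,
        Derivation.leibniz]
      exact sum_congr rfl fun _ _ => by ring
    rw [e1]
    have e2 : ∀ l, euler k _ (twistedC L i j l) • cocycleVec L l +
          (twistedC L i j l • fun μ => euler k _ (cocycleVec L l μ)) =
        (∑ s, a i s • (twistedC L s j l • cocycleVec L l) +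
        ∑ s, a j s • (twistedC L i s l • cocycleVec L l)) +
        (∑ s, twistedC L i j l • (a l s • cocycleVec L s) -
          ∑ s, twistedC L i j s • (a s l • cocycleVec L l)) +
        (twistedC L i j l • brk L.co X (cocycleVec L l) + twistedC L i j l • actA L l X) := by
      intro l
      rw [euler_twistedC, euler_cocycleVec, smul_add, smul_add, sub_smul, add_smul, sum_smul,
        sum_smul, sum_smul, smul_sum]
      simp only [mul_smul]
      abel
    simp only [e2, sum_add_distrib, sum_sub_distrib, smul_sum]
    rw [sum_comm (f := fun l s => twistedC L i j l • a l s • cocycleVec L s), sub_self,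
      add_zero, brk_sum_right, sum_comm,
      sum_comm (f := fun l s => a j s • (twistedC L i s l • cocycleVec L l))]
    abel
  have hK : ∀ i j, (fun μ => euler k _ (K i j μ)) =
      ∑ s, a i s • K s j + ∑ s, a j s • K i s + brk L.co X (K i j) := by
    intro i j
    have e1 : (fun μ => euler k _ (K i j μ)) =
        (fun μ => euler k _ (brk L.co (cocycleVec L i) (cocycleVec L j) μ)) +
        (fun μ => euler k _ (actA L j (cocycleVec L i) μ)) -
        (fun μ => euler k _ (actA L i (cocycleVec L j) μ)) -
        (fun μ => euler k _ ((∑ l, twistedC L i j l • cocycleVec L l) μ)) := by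
      funext μ
      simp only [K, Pi.sub_apply, Pi.add_apply, map_sub, map_add]
    have e2 : ∑ l, twistedC L i j l • actA L l X = actA L j (actA L i X) - actA L i (actA L j X) -
        ∑ l, b i j l • actA L l X + ∑ l, b j i l • actA L l X := by
      rw [actA_comm, ← sum_sub_distrib, ← sum_add_distrib]
      exact sum_congr rfl fun l _ => by rw [twistedC, add_smul, sub_smul]
    rw [e1, hB, hA, hA, hG, e2]
    simp only [K, smul_sub, smul_add, sum_sub_distrib, sum_add_distrib, map_sub, map_add]
    abel
  have h0 := eq_zero_of_euler 0 (fun t : Fin L.n × Fin L.n × Fin L.m => K t.1 t.2.1 t.2.2)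
    (Or.inr fun t => by
      have h1 := cocycleVec_mem L
      refine sub_mem (sub_mem (add_mem ?_ (actA_mem _ _ (h1 _) _)) (actA_mem _ _ (h1 _) _)) ?_
      · exact degIdeal_mono one_le_two (brk_mem _ (h1 _) (h1 _) _)
      · rw [Finset.sum_apply]
        exact sum_mem fun l _ => Ideal.mul_mem_left _ _ (h1 _ _)) fun N hN t => by
      have := congrFun (hK t.1 t.2.1) t.2.2
      rw [Nat.cast_zero, zero_smul, add_zero, add_comm N]
      refine this ▸ add_mem (add_mem ?_ ?_) (brk_mem _ X_mem_degIdeal (fun μ => hN (t.1, t.2.1,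
        μ)) _)
      · rw [Finset.sum_apply]
        exact sum_mem fun s _ => mul_mem_degIdeal (haX _ s) (hN (s, t.2))
      · rw [Finset.sum_apply]
        exact sum_mem fun s _ => mul_mem_degIdeal (haX _ s) (hN (t.1, s, t.2.2))
  rw [← sub_eq_zero]
  funext μ
  exact congrFun h0 (i, j, μ)

theorem vectorField_seriesA_comm (i j : Fin L.n) (μ : Fin L.m) :
    vectorField (L.seriesA i) (L.seriesA j μ) - vectorField (L.seriesA j) (L.seriesA i μ) =
      ∑ l, C (L.C i j l) * L.seriesA l μ := by
  have h := maurerCartan L.co (L.seriesA i) (L.seriesA j) (X_mem_degIdeal (k := k) (τ := Fin L.m))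
  rw [logDeriv_seriesA, logDeriv_seriesA, vectorField_cocycleVec, vectorField_cocycleVec,
    logDeriv_seriesA, logDeriv_seriesA, brk_skew _ (cocycleVec L j)] at h
  simp only [vectorField_X] at h
  have h2 := brk_cocycleVec_eq L i j
  have e2 : ∑ l, twistedC L i j l • cocycleVec L l =
      ∑ l, (C (L.C i j l) : PS (Fin L.m) k) • cocycleVec L l -
      ∑ l, repMat (alphaRep L.co) (cocycleVec L i) j l • cocycleVec L l +
      ∑ l, repMat (alphaRep L.co) (cocycleVec L j) i l • cocycleVec L l := by
    rw [← sum_sub_distrib, ← sum_add_distrib]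
    exact sum_congr rfl fun l _ => by rw [twistedC, add_smul, sub_smul]
  rw [e2] at h2
  have h3 : (Theta L.co X).mulVec (fun ρ => vectorField (L.seriesA i) (L.seriesA j ρ) -
      vectorField (L.seriesA j) (L.seriesA i ρ)) =
      ∑ l, (C (L.C i j l) : PS (Fin L.m) k) • cocycleVec L l := by
    linear_combination (exp := 1) h2 - h
  have h4 := congrArg (ThetaInv L.co X).mulVec h3
  rw [mulVec_mulVec, ThetaInv_mul_Theta _ X_mem_degIdeal, one_mulVec, mulVec_sum] at h4
  simp only [mulVec_smul, ← seriesA_eq] at h4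
  have := congrFun h4 μ
  rw [Finset.sum_apply] at this
  exact this

end VectorFields

section GroupCocycle

variable {co : CoStructure k n m}
  {ι : Type} [Fintype ι] [DecidableEq ι]

theorem vectorField_comm [Fintype τ] (c c' : τ → PS τ k) (f : PS τ k) :
    vectorField c (vectorField c' f) - vectorField c' (vectorField c f) =
      vectorField (fun i => vectorField c (c' i) - vectorField c' (c i)) f := by
  have e : ∀ c c' : τ → PS τ k, vectorField c (vectorField c' f) =
      ∑ j, vectorField c (c' j) * pderiv k j f + ∑ i, ∑ j, c i * c' j * pderiv k i
        (pderiv k j f) := by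
    intro c c'
    rw [vectorField_apply c' f, map_sum]
    simp only [Derivation.leibniz, smul_eq_mul, sum_add_distrib]
    rw [add_comm]
    congr 1
    · exact sum_congr rfl fun _ _ => mul_comm _ _
    · simp only [vectorField_apply, mul_sum]
      rw [sum_comm]
      exact sum_congr rfl fun _ _ => sum_congr rfl fun _ _ => by ring
  have e2 : ∑ i, ∑ j, c i * c' j * pderiv k i (pderiv k j f) =
      ∑ i, ∑ j, c' i * c j * pderiv k i (pderiv k j f) := by
    rw [sum_comm]
    exact sum_congr rfl fun _ _ => sum_congr rfl fun _ _ => by rw [pderiv_comm]; ring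
  rw [e, e, e2, vectorField_apply]
  simp only [sub_mul, sum_sub_distrib]
  ring

theorem subst_zero_fun [Finite τ] {σ : Type} (f : PS τ k) :
    subst (0 : τ → PS σ k) f = C (constantCoeff f) := by
  have hs : HasSubst (0 : τ → PS σ k) :=
    hasSubst_of_mem fun _ => zero_mem _
  ext e
  rw [coeff_subst hs, finsum_eq_single _ 0]
  · classical
    simp [coeff_C, coeff_one]
  · intro d hd
    obtain ⟨i, hi⟩ := Finsupp.ne_iff.1 hd
    rw [Finsupp.prod, Finset.prod_eq_zero (i := i) (Finsupp.mem_support_iff.2 hi)]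
    · simp
    · simp only [Pi.zero_apply]
      exact zero_pow hi

theorem matrixSeries_zero (f : PowerSeries k) :
    matrixSeries f (0 : Matrix ι ι (PS τ k)) = PowerSeries.constantCoeff f • 1 := by
  ext1 i j
  have := congrFun (matrixSeries_mulVec_of_eq_zero f
    (M := (0 : Matrix ι ι (PS τ k))) (fun _ _ => zero_mem _)
    (v := Pi.single j 1) (Matrix.zero_mulVec _)) i
  rw [Matrix.mulVec_single_one] at this
  simpa [one_apply, Pi.single_apply] using this

/-- A 1-cocycle of the formal group with values in the representation `β`. -/
def IsCocycle (co : CoStructure k n m) (β : Fin m → Matrix ι ι k) (z : ι → PS (Fin m) k) : Prop :=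
  (fun i => subst co.campbellHausdorff (z i)) =
    (expRep β (XL k m)).mulVec (fun i => subst (XR k m) (z i)) + fun i => subst (XL k m) (z i)

/-- The linear part of `z`. -/
def linPart (z : ι → PS (Fin m) k) (ρ : Fin m) (i : ι) : k :=
  coeff (single ρ 1) (z i)

theorem IsCocycle.vectorField_eq {β : Fin m → Matrix ι ι k} (hβ : IsRep co β)
    {z : ι → PS (Fin m) k} (hz : IsCocycle co β z) (c : Fin m → PS (Fin m) k) :
    (fun i => vectorField c (z i)) =
      (repMat β (logDeriv co c X)).mulVec z + linVec (linPart z) (logDeriv co c X) := by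
  set ω := logDeriv co c X with hω
  let s : Fin m ⊕ Fin m → PS (Fin m) k := Sum.elim 0 X
  have hs1 : InMax s := sumElim_mem (zero_mem') X_mem_degIdeal
  have hs := hasSubst_of_mem hs1
  have hR := XR_mem (k := k) (m := m)
  have hL := XL_mem (k := k) (m := m)
  have sL : (fun ρ => subst s (XL k m ρ)) = 0 := subst_XL zero_mem' X_mem_degIdeal
  have sR : (fun ρ => subst s (XR k m ρ)) = X := subst_XR zero_mem' X_mem_degIdeal
  have ssR : ∀ f : PS (Fin m) k, subst s (subst (XR k m) f) = f := by
    intro f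
    rw [subst_comp_subst_apply (hasSubst_of_mem hR) hs, sR, subst_X_self]
  have ssL : ∀ f : PS (Fin m) k, subst s (subst (XL k m) f) = C (constantCoeff f) := by
    intro f
    rw [subst_comp_subst_apply (hasSubst_of_mem hL) hs, sL, subst_zero_fun]
  have ssD : ∀ f : PS (Fin m) k, subst s (subst co.campbellHausdorff f) = f := by
    intro f
    have : (fun ρ => subst s (co.campbellHausdorff ρ)) = X := chComp_zero_left co X_mem_degIdeal
    rw [subst_comp_subst_apply (hasSubst_of_mem (campbellHausdorff_mem co)) hs, this, subst_X_self]
  let d : Fin m ⊕ Fin m → PS (Fin m ⊕ Fin m) k :=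
    Sum.elim (fun ρ => subst (XR k m) (ω ρ)) 0
  have dL : ∀ ρ, vectorField d (XL k m ρ) = subst (XR k m) (ω ρ) := fun ρ =>
    vectorField_X _ _
  have dR : ∀ ρ, vectorField d (XR k m ρ) = 0 := fun ρ => vectorField_X _ _
  have expX0 : ∀ (f : PowerSeries k) {ι : Type} [Fintype ι] [DecidableEq ι] (β : Fin m →
    Matrix ι ι k),
      PowerSeries.constantCoeff f = 1 →
      (matrixSeries f (repMat β (XL k m))).map (subst s) = 1 := by
    intro f ι _ _ β hf
    rw [matrixSeries_map_subst hs1 f (matMem_repMat β hL), repMat_map_subst hs, sL]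
    have h0 : repMat β (0 : Fin m → PS (Fin m) k) = 0 := by ext1 i j; simp [repMat_apply]
    rw [h0, matrixSeries_zero, hf, one_smul]
  have ωL : ∀ μ, subst s (logDeriv co d (XL k m) μ) = ω μ := by
    intro μ
    rw [logDeriv, subst_mulVec hs, Theta, expX0 _ _ (constantCoeff_expQuotSeries k), one_mulVec,
      dL, ssR]
  have ωR : logDeriv co d (XR k m) = 0 := by rw [logDeriv]; simp only [dR]; exact mulVec_zero _
  have ωD : (fun ρ => subst s (vectorField d (co.campbellHausdorff ρ))) = c := by
    have h1 := logDeriv_chComp co d hL hR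
    rw [chComp_XL_XR, ωR, mulVec_zero, add_zero] at h1
    have h2 : (Theta co X).mulVec (fun ρ => subst s (vectorField d (co.campbellHausdorff ρ))) =
        (Theta co X).mulVec c := by
      have h3 : (fun μ => subst s (logDeriv co d co.campbellHausdorff μ)) = ω := by
        rw [h1]; funext μ; exact ωL μ
      have h4 : (Theta co X).mulVec c = ω := by rw [hω, logDeriv]; simp only [vectorField_X]
      rw [h4, ← h3]
      funext μ
      rw [logDeriv, subst_mulVec hs, Theta_map_subst hs1 co (campbellHausdorff_mem co)]
      congr 2
      exact (chComp_zero_left co X_mem_degIdeal).symm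
    have h5 := congrArg (ThetaInv co X).mulVec h2
    rwa [mulVec_mulVec, mulVec_mulVec, ThetaInv_mul_Theta _ X_mem_degIdeal,
      one_mulVec, one_mulVec] at h5
  funext i
  have h := congrArg (fun f => subst s (vectorField d f)) (congrFun hz i)
  have e1 : subst s (vectorField d (subst co.campbellHausdorff (z i))) = vectorField c (z i) := by
    rw [vectorField_subst d (campbellHausdorff_mem co), subst_sum hs, derivation_apply_eq]
    refine sum_congr rfl fun ρ _ => ?_
    rw [subst_mul hs, ssD, congrFun ωD ρ]
  have e2 : subst s (vectorField d (subst (XL k m) (z i))) = linVec (linPart z) ω i := by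
    rw [vectorField_subst d hL, subst_sum hs]
    refine sum_congr rfl fun ρ _ => ?_
    rw [subst_mul hs, ssL, dL, ssR, ← smul_eq_C_mul]
    congr 1
    rw [← coeff_zero_eq_constantCoeff_apply, coeff_pderiv]
    simp [linPart]
  have e3 : (fun i => subst s (vectorField d
      ((expRep β (XL k m)).mulVec (fun i => subst (XR k m) (z i)) i))) = (repMat β ω).mulVec z := by
    have h1 := mapD_mulVec (vectorField d) (expRep β (XL k m)) (fun i => subst (XR k m) (z i))
    have h2 : (fun j => vectorField d (subst (XR k m) (z j))) = 0 := by
      funext j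
      rw [vectorField_subst d hR]
      simp [dR]
    rw [h2, mulVec_zero, add_zero, vectorField_expRep hβ _ hL] at h1
    funext i
    rw [congrFun h1 i, subst_mulVec hs, map_subst_mul hs, repMat_map_subst hs, expRep,
      expX0 _ _ (constantCoeff_expSeries k), mul_one]
    simp only [ωL, ssR]
  simp only [Pi.add_apply] at h
  rw [e1, map_add, subst_add hs, e2, congrFun e3 i] at h
  exact h

theorem linVec_single (a : Fin m → ι → k) (ρ : Fin m) :
    linVec a (Pi.single ρ 1 : Fin m → PS τ k) = fun i => C (a ρ i) := by
  funext i
  rw [linVec, sum_eq_single ρ]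
  · simp [smul_eq_C_mul]
  · intro b _ hb; simp [hb]
  · simp

theorem IsCocycle.eq_cocycleOf {β : Fin m → Matrix ι ι k} (hβ : IsRep co β)
    {z : ι → PS (Fin m) k} (hz : IsCocycle co β z) (hz0 : InMax z)
    (ha : IsLieCocycle co β (linPart z)) : z = cocycleOf β (linPart z) X := by
  have h1 := hz.vectorField_eq hβ X
  have h2 := vectorField_cocycleOf hβ ha X (X_mem_degIdeal (k := k) (τ := Fin m))
  rw [logDeriv_X_X] at h1 h2
  have h3 := eq_zero_of_euler_linear 0 (fun i => z i - cocycleOf β (linPart z) X i)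
    (Or.inr fun i => sub_mem (hz0 i) (cocycleOf_mem β _ X_mem_degIdeal i)) (repMat β X)
    (matMem_repMat _ X_mem_degIdeal) fun i => by
      have e1 := congrFun h1 i
      have e2 := congrFun h2 i
      rw [Nat.cast_zero, zero_smul, add_zero, map_sub]
      refine (congrArg₂ (· - ·) e1 e2).trans ?_
      rw [Pi.add_apply, Pi.add_apply, add_sub_add_right_eq_sub, ← Pi.sub_apply, ← Matrix.mulVec_sub]
      rfl
  funext i
  exact sub_eq_zero.1 (congrFun h3 i)

theorem IsCocycle.isLieCocycle {β : Fin m → Matrix ι ι k} (hβ : IsRep co β)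
    {z : ι → PS (Fin m) k} (hz : IsCocycle co β z) : IsLieCocycle co β (linPart z) := by
  intro ρ σ i
  let w : Fin m → Fin m → PS (Fin m) k := fun ρ => (ThetaInv co X).mulVec (Pi.single ρ 1)
  have hw : ∀ ρ, logDeriv co (w ρ) X = Pi.single ρ 1 := by
    intro ρ
    rw [logDeriv]
    simp only [vectorField_X]
    rw [mulVec_mulVec, Theta_mul_ThetaInv _ X_mem_degIdeal, one_mulVec]
  have hD : ∀ (D : Derivation k (PS (Fin m) k) (PS (Fin m) k)) (ρ : Fin m),
      (fun μ => D ((Pi.single ρ 1 : Fin m → PS (Fin m) k) μ)) = 0 := by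
    intro D ρ
    funext μ
    rcases eq_or_ne μ ρ with rfl | h
    · simp
    · simp [h]
  have hz1 : ∀ ρ, (fun i => vectorField (w ρ) (z i)) =
      (repMat β (Pi.single ρ 1)).mulVec z + linVec (linPart z) (Pi.single ρ 1) := by
    intro ρ
    have := hz.vectorField_eq hβ (w ρ)
    rwa [hw] at this
  have hz2 : ∀ ρ σ, (fun i => vectorField (w ρ) (vectorField (w σ) (z i))) =
      (repMat β (Pi.single σ 1)).mulVec ((repMat β (Pi.single ρ 1)).mulVec z +
        linVec (linPart z) (Pi.single ρ 1)) := by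
    intro ρ σ
    have e1 : (fun i => vectorField (w ρ) (vectorField (w σ) (z i))) =
        fun i => vectorField (w ρ) ((repMat β (Pi.single σ 1)).mulVec z i) := by
      funext i
      rw [congrFun (hz1 σ) i, Pi.add_apply, map_add, linVec_single]
      have : vectorField (w ρ) (C (linPart z σ i)) = 0 :=
        (vectorField (w ρ)).map_algebraMap _
      rw [this, add_zero]
    rw [e1, mapD_mulVec, mapD_repMat, hD, hz1]
    have : repMat β (0 : Fin m → PS (Fin m) k) = 0 := by ext1 i j; simp [repMat_apply]
    rw [this, Matrix.zero_mulVec, zero_add]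
  have hmc := maurerCartan co (w ρ) (w σ) (X_mem_degIdeal (k := k) (τ := Fin m))
  rw [hw, hw, hD, hD, sub_zero] at hmc
  simp only [vectorField_X] at hmc
  set c : Fin m → PS (Fin m) k := fun μ =>
    vectorField (w ρ) (w σ μ) - vectorField (w σ) (w ρ μ) with hc
  have hcl : logDeriv co c X = -brk co (Pi.single ρ 1) (Pi.single σ 1) := by
    rw [logDeriv]
    simp only [vectorField_X]
    exact eq_neg_of_add_eq_zero_left hmc.symm
  have h1 := hz.vectorField_eq hβ c
  have h2 : (fun i => vectorField c (z i)) =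
      (fun i => vectorField (w ρ) (vectorField (w σ) (z i))) -
      fun i => vectorField (w σ) (vectorField (w ρ) (z i)) := by
    funext i
    exact (vectorField_comm _ _ _).symm
  rw [h2, hz2, hz2, hcl, repMat_neg, repMat_brk hβ, mulVec_add, mulVec_add,
    mulVec_mulVec, mulVec_mulVec, Matrix.neg_mulVec, sub_mulVec] at h1
  have h3 : (repMat β (Pi.single σ 1)).mulVec (linVec (linPart z) (Pi.single ρ 1)) -
      (repMat β (Pi.single ρ 1)).mulVec (linVec (linPart z) (Pi.single σ 1)) =
      linVec (linPart z) (-brk co (Pi.single ρ 1) (Pi.single σ 1 : Fin m → PS (Fin m) k)) := by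
    linear_combination (exp := 1) h1
  have h4 := congrArg constantCoeff (congrFun h3 i)
  have e1 : ∀ ρ σ, constantCoeff (((repMat β (Pi.single σ 1)).mulVec
      (linVec (linPart z) (Pi.single ρ 1 : Fin m → PS (Fin m) k))) i) =
      ∑ j, β σ i j * linPart z ρ j := by
    intro ρ σ
    rw [linVec_single, mulVec, dotProduct, map_sum]
    refine sum_congr rfl fun j _ => ?_
    have : repMat β (Pi.single σ 1 : Fin m → PS (Fin m) k) i j = C (β σ i j) := by
      rw [repMat_apply, sum_eq_single σ]
      · simp [smul_eq_C_mul]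
      · intro b _ hb; simp [hb]
      · simp
    rw [this, map_mul, constantCoeff_C, constantCoeff_C]
  have e2 : ∀ μ, brk co (Pi.single ρ 1) (Pi.single σ 1 : Fin m → PS (Fin m) k) μ =
      C (co.γ ρ σ μ) := by
    intro μ
    rw [brk_apply, sum_eq_single ρ, sum_eq_single σ]
    · simp [smul_eq_C_mul]
    · intro b _ hb; simp [hb]
    · simp
    · intro b _ hb; simp [hb]
    · simp
  rw [Pi.sub_apply, map_sub, e1, e1, linVec, map_sum] at h4
  simp only [Pi.neg_apply, e2, smul_neg, map_neg, smul_eq_C_mul, map_mul, constantCoeff_C,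
    sum_neg_distrib] at h4
  rw [sum_sub_distrib, ← neg_sub, h4, neg_neg]
  exact sum_congr rfl fun _ _ => mul_comm _ _

end GroupCocycle

section Comultiplication

variable (co : CoStructure k n m)
  (As : Fin n → Fin m → PS (Fin m) k)

/-- The vector field on `exp V* × exp V*` which corresponds to the coproduct of `H_i`. -/
def comulField (i : Fin n) : Fin m ⊕ Fin m → PS (Fin m ⊕ Fin m) k :=
  Sum.elim (fun μ => subst (XL k m) (As i μ))
    fun μ => ∑ l, subst (XL k m) (co.expAlpha i l) * subst (XR k m) (As l μ)

/-- `Θ(X) A(X)`. -/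
def thetaA (p : Fin n × Fin m) : PS (Fin m) k := (Theta co X).mulVec (As p.1) p.2

theorem subst_thetaA {τ : Type} {u : Fin m → PS τ k} (hu : InMax u)
    (i : Fin n) : (fun μ => subst u (thetaA co As (i, μ))) =
      (Theta co u).mulVec fun μ => subst u (As i μ) := by
  have hs := hasSubst_of_mem hu
  funext μ
  rw [thetaA, subst_mulVec hs, Theta_map_subst hu co X_mem_degIdeal]
  simp only [subst_X hs]

theorem expRep_tensorRep_mulVec (z : Fin n × Fin m → PS (Fin m ⊕ Fin m) k) (i : Fin n) :
    (fun μ => (expRep (tensorRep co) (XL k m)).mulVec z (i, μ)) = (expRep (adj co) (XL k m)).mulVec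
        (∑ l, subst (XL k m) (co.expAlpha i l) • fun μ => z (l, μ)) := by
  have hL := XL_mem (k := k) (m := m)
  have hs := hasSubst_of_mem hL
  funext μ
  rw [expRep_eq_map_subst _ hL, expRep_eq_map_subst _ hL, mulVec, dotProduct,
    Fintype.sum_prod_type, sum_comm, mulVec, dotProduct]
  refine sum_congr rfl fun ν _ => ?_
  rw [Finset.sum_apply, mul_sum]
  refine sum_congr rfl fun l _ => ?_
  rw [Matrix.map_apply, Matrix.map_apply, expRep_tensorRep_X, subst_mul hs, Pi.smul_apply,
    smul_eq_mul]
  change _ = subst (XL k m) (co.expGamma μ ν) * _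
  ring

theorem logDeriv_comulField (i : Fin n) :
    logDeriv co (comulField co As i) co.campbellHausdorff = fun μ =>
      (expRep (tensorRep co) (XL k m)).mulVec (fun p => subst (XR k m) (thetaA co As p)) (i, μ) +
        subst (XL k m) (thetaA co As (i, μ)) := by
  have hL := XL_mem (k := k) (m := m)
  have hR := XR_mem (k := k) (m := m)
  have h := logDeriv_chComp co (comulField co As i) hL hR
  have eL : logDeriv co (comulField co As i) (XL k m) =
      fun μ => subst (XL k m) (thetaA co As (i, μ)) := by
    rw [logDeriv, subst_thetaA co As hL]
    congr 1
    funext μ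
    exact vectorField_X _ _
  have eR : logDeriv co (comulField co As i) (XR k m) =
      ∑ l, subst (XL k m) (co.expAlpha i l) • fun μ => subst (XR k m) (thetaA co As (l, μ)) := by
    simp only [logDeriv, subst_thetaA co As hR, ← mulVec_smul, ← mulVec_sum]
    congr 1
    funext μ
    refine (vectorField_X _ _).trans ?_
    rw [Finset.sum_apply]
    rfl
  rw [chComp_XL_XR, eL, eR, ← expRep_tensorRep_mulVec co
    (fun p => subst (XR k m) (thetaA co As p)) i] at h
  rw [h, add_comm]
  rfl

theorem comulField_iff : (∀ i μ, vectorField (comulField co As i) (co.campbellHausdorff μ) =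
    subst co.campbellHausdorff (As i μ)) ↔ IsCocycle co (tensorRep co) (thetaA co As) := by
  have hD := campbellHausdorff_mem co
  have key : ∀ i, ((fun μ => vectorField (comulField co As i) (co.campbellHausdorff μ)) =
      fun μ => subst co.campbellHausdorff (As i μ)) ↔
      (fun μ => subst co.campbellHausdorff (thetaA co As (i, μ))) = fun μ =>
      (expRep (tensorRep co) (XL k m)).mulVec (fun p => subst (XR k m) (thetaA co As p)) (i, μ) +
        subst (XL k m) (thetaA co As (i, μ)) := by
    intro i
    rw [← logDeriv_comulField, subst_thetaA co As hD, logDeriv]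
    refine ⟨fun h => by rw [h], fun h => ?_⟩
    have := congrArg (ThetaInv co co.campbellHausdorff).mulVec h
    rw [mulVec_mulVec, mulVec_mulVec, ThetaInv_mul_Theta _ hD, one_mulVec, one_mulVec] at this
    exact this.symm
  constructor
  · intro h
    funext ⟨i, μ⟩
    exact congrFun ((key i).1 (funext (h i))) μ
  · intro h i μ
    exact congrFun ((key i).2 (funext fun μ => congrFun h (i, μ))) μ

theorem thetaA_sub_mem (hA : ∀ i μ, As i μ ∈ degIdeal k _ 1) (i : Fin n) (μ : Fin m) :
    thetaA co As (i, μ) - As i μ ∈ degIdeal k _ 2 := by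
  have h1 := matrixSeries_sub_coeff_zero (expQuotSeries k)
    (matMem_repMat (adj co) (X_mem_degIdeal (k := k) (τ := Fin m)))
  rw [constantCoeff_expQuotSeries, one_smul] at h1
  have := mulVec_mem h1 (hA i) μ
  rwa [sub_mulVec, one_mulVec] at this

theorem linPart_thetaA (hA : ∀ i μ, As i μ ∈ degIdeal k _ 1) :
    linPart (thetaA co As) = fun ρ p => coeff (single ρ 1) (As p.1 p.2) := by
  funext ρ ⟨i, μ⟩
  have := thetaA_sub_mem co As hA i μ (single ρ 1) (by simp)
  rwa [map_sub, sub_eq_zero] at this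

variable (L : InhomLieBialgebra k)

theorem thetaA_seriesA (i : Fin L.n) (μ : Fin L.m) : thetaA L.co L.seriesA (i, μ) = L.cocycle i μ :=
  congrFun (Theta_mulVec_seriesA L i) μ

theorem isCocycle_seriesA : IsCocycle L.co (tensorRep L.co) (thetaA L.co L.seriesA) := by
  have hX := X_mem_degIdeal (k := k) (τ := Fin L.m)
  have hz : thetaA L.co L.seriesA = cocycleOf (tensorRep L.co) (linCocycle L) X := by
    funext ⟨i, μ⟩
    rw [thetaA_seriesA, cocycle_eq]
  have h := cocycleOf_chComp (isRep_tensorRep L.co) (isLieCocycle_linCocycle L)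
    (XL_mem (k := k) (m := L.m)) (XR_mem (k := k) (m := L.m))
  have hs : ∀ {w : Fin L.m → PS (Fin L.m ⊕ Fin L.m) k}, (InMax w) →
      (fun p => subst w (cocycleOf (tensorRep L.co) (linCocycle L) X p)) =
        cocycleOf (tensorRep L.co) (linCocycle L) w := by
    intro w hw
    funext p
    rw [cocycleOf_subst hw _ _ hX]
    simp only [subst_X (hasSubst_of_mem hw)]
  rw [IsCocycle, hz, hs (campbellHausdorff_mem L.co), hs XR_mem, hs XL_mem, ← chComp_XL_XR, h]

theorem vectorField_campbellHausdorff (i : Fin L.n) (μ : Fin L.m) :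
    vectorField (comulField L.co L.seriesA i) (L.co.campbellHausdorff μ) =
      subst L.co.campbellHausdorff (L.seriesA i μ) :=
  (comulField_iff L.co L.seriesA).2 (isCocycle_seriesA L) i μ

theorem coeff_seriesA (i : Fin L.n) (μ ν : Fin L.m) :
    coeff (single ν 1) (L.seriesA i μ) = L.A i ν μ := by
  have := congrFun (congrFun (linPart_thetaA L.co L.seriesA (seriesA_mem L)) ν) (i, μ)
  rw [← this, linPart, thetaA_seriesA, coeff_cocycle]

theorem eq_seriesA {As : Fin L.n → Fin L.m → PS (Fin L.m) k} (hA : ∀ i μ, As i μ ∈ degIdeal k _ 1)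
    (h : ∀ i μ, vectorField (comulField L.co As i) (L.co.campbellHausdorff μ) =
      subst L.co.campbellHausdorff (As i μ))
    (hl : ∀ i μ ν, coeff (single ν 1) (As i μ) = L.A i ν μ) : As = L.seriesA := by
  have hz := (comulField_iff L.co As).1 h
  have hlin : linPart (thetaA L.co As) = linCocycle L := by
    rw [linPart_thetaA _ _ hA]
    funext ρ p
    exact hl _ _ _
  have hz0 : ∀ p, thetaA L.co As p ∈ degIdeal k _ 1 := fun ⟨i, μ⟩ => by
    have := add_mem (degIdeal_mono one_le_two (thetaA_sub_mem L.co As hA i μ)) (hA i μ)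
    rwa [sub_add_cancel] at this
  have h1 := hz.eq_cocycleOf (isRep_tensorRep L.co) hz0 (by
    rw [hlin]; exact isLieCocycle_linCocycle L)
  rw [hlin] at h1
  funext i
  have h2 : (Theta L.co X).mulVec (As i) = cocycleVec L i := by
    funext μ
    have := congrFun h1 (i, μ)
    rw [← cocycle_eq] at this
    exact this
  rw [seriesA_eq, ← h2, mulVec_mulVec, ThetaInv_mul_Theta _ X_mem_degIdeal, one_mulVec]

end Comultiplication

section Antipode

theorem hasSubst_neg_X : HasSubst (-X : Fin m → PS (Fin m) k) :=
  hasSubst_of_mem neg_X_mem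

theorem expAlpha_mul_neg (co : CoStructure k n m) :
    co.expAlpha * co.expAlpha.map (subst (-X)) = 1 := by
  have h := expRep_chComp (isRep_alphaRep co) (X_mem_degIdeal (k := k) (τ := Fin m)) neg_X_mem
  rw [chComp_X_neg, expRep_zero] at h
  rw [h, expAlpha_eq, ← expRep_eq_map_subst _ neg_X_mem]

theorem neg_mul_expAlpha (co : CoStructure k n m) :
    co.expAlpha.map (subst (-X)) * co.expAlpha = 1 :=
  mul_eq_one_comm.1 (expAlpha_mul_neg co)

variable (L : InhomLieBialgebra k)

theorem seriesA_neg_aux (i : Fin L.n) :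
    ∑ l, L.co.expAlpha i l • (fun μ => subst (-X) (L.seriesA l μ)) + L.seriesA i = 0 := by
  have hX := X_mem_degIdeal (k := k) (τ := Fin L.m)
  have hN := neg_X_mem (k := k) (τ := Fin L.m)
  have hs := hasSubst_neg_X (k := k) (m := L.m)
  have h1 : cocycleVec L i = (expRep (adj L.co) X).mulVec ((Theta L.co (-X)).mulVec
    (L.seriesA i)) := by
    have h := logDeriv_chComp L.co (L.seriesA i) hX hN
    have h2 : logDeriv L.co (L.seriesA i) (-X) = -(Theta L.co (-X)).mulVec (L.seriesA i) := by
      rw [logDeriv, ← mulVec_neg]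
      congr 1
      funext μ
      rw [Pi.neg_apply, map_neg, vectorField_X]
      rfl
    rw [chComp_X_neg, logDeriv_zero, logDeriv_seriesA, h2, mulVec_neg] at h
    exact (eq_of_sub_eq_zero (by rw [sub_eq_add_neg]; exact h.symm))
  have h2 : (fun μ => (expRep (tensorRep L.co) X).mulVec
      (cocycleOf (tensorRep L.co) (linCocycle L) (-X)) (i, μ)) =
      (expRep (adj L.co) X).mulVec ((Theta L.co (-X)).mulVec
        (∑ l, L.co.expAlpha i l • (fun μ => subst (-X) (L.seriesA l μ)))) := by
    have e : ∀ l μ, cocycleOf (tensorRep L.co) (linCocycle L) (-X) (l, μ) =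
        (Theta L.co (-X)).mulVec (fun μ => subst (-X) (L.seriesA l μ)) μ := by
      intro l μ
      rw [← congrFun (subst_thetaA L.co L.seriesA hN l) μ, thetaA_seriesA, cocycle_eq,
        cocycleOf_subst hN _ _ hX]
      simp only [subst_X hs]
    funext μ
    rw [mulVec, dotProduct, Fintype.sum_prod_type, sum_comm, mulVec_sum, mulVec, dotProduct]
    refine sum_congr rfl fun ν _ => ?_
    rw [Finset.sum_apply, mul_sum]
    refine sum_congr rfl fun l _ => ?_
    rw [expRep_tensorRep_X, e, mulVec_smul, Pi.smul_apply, smul_eq_mul]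
    change _ = L.co.expGamma μ ν * _
    ring
  have h3 := cocycleOf_chComp (isRep_tensorRep L.co) (isLieCocycle_linCocycle L) hX hN
  have h4 : cocycleOf (tensorRep L.co) (linCocycle L) (0 : Fin L.m → PS (Fin L.m) k) = 0 := by
    rw [cocycleOf]
    have : linVec (linCocycle L) (0 : Fin L.m → PS (Fin L.m) k) = 0 := by funext p; simp [linVec]
    rw [this, mulVec_zero]
  rw [chComp_X_neg, h4] at h3
  have h5 : (expRep (adj L.co) X).mulVec ((Theta L.co (-X)).mulVec
      (∑ l, L.co.expAlpha i l • (fun μ => subst (-X) (L.seriesA l μ)) + L.seriesA i)) = 0 := by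
    rw [mulVec_add, mulVec_add, ← h1, ← h2]
    funext μ
    have := congrFun h3 (i, μ)
    rw [Pi.add_apply, ← cocycle_eq] at this
    exact this.symm
  have h6 := expRep_chComp (isRep_adj L.co) hN hX
  have h7 := expRep_chComp (isRep_adj L.co) hX hN
  rw [chComp_X_neg, expRep_zero] at h7
  have h8 := congrArg (fun v => (ThetaInv L.co (-X)).mulVec ((expRep (adj L.co) (-X)).mulVec v)) h5
  simp only [mulVec_mulVec, mulVec_zero] at h8
  rw [← Matrix.mul_assoc, ← Matrix.mul_assoc, Matrix.mul_assoc (ThetaInv _ _),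
    mul_eq_one_comm.1 h7.symm, Matrix.mul_one, ThetaInv_mul_Theta _ hN, one_mulVec] at h8
  exact h8

theorem seriesA_neg (i : Fin L.n) (μ : Fin L.m) : subst (-X) (L.seriesA i μ) =
    -∑ l, subst (-X) (L.co.expAlpha i l) * L.seriesA l μ := by
  have h : ∀ l, L.seriesA l μ = -∑ p, L.co.expAlpha l p * subst (-X) (L.seriesA p μ) := by
    intro l
    have := congrFun (seriesA_neg_aux L l) μ
    rw [Pi.add_apply, Finset.sum_apply] at this
    exact eq_neg_of_add_eq_zero_right this
  have hu := neg_mul_expAlpha L.co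
  rw [sum_congr rfl fun l _ => congrArg (subst (-X) (L.co.expAlpha i l) * ·) (h l)]
  simp only [mul_neg, sum_neg_distrib, neg_neg, mul_sum]
  rw [sum_comm]
  have e : ∀ p, ∑ l, subst (-X) (L.co.expAlpha i l) *
      (L.co.expAlpha l p * subst (-X) (L.seriesA p μ)) =
      (1 : Matrix (Fin L.n) (Fin L.n) (PS (Fin L.m) k)) i p * subst (-X) (L.seriesA p μ) := by
    intro p
    rw [← hu, mul_apply, sum_mul]
    exact sum_congr rfl fun _ _ => by rw [Matrix.map_apply, mul_assoc]
  simp only [e, one_apply]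
  simp only [ite_mul, one_mul, zero_mul, sum_ite_eq, mem_univ, if_true]

theorem subst_neg_vectorField (i : Fin L.n) (f : PS (Fin L.m) k) :
    subst (-X) (vectorField (L.seriesA i) f) =
      ∑ l, subst (-X) (L.co.expAlpha i l) * vectorField (L.seriesA l) (subst (-X) f) := by
  have hs := hasSubst_neg_X (k := k) (m := L.m)
  have e : ∀ l, vectorField (L.seriesA l) (subst (-X) f) =
      -∑ μ, subst (-X) (pderiv k μ f) * L.seriesA l μ := by
    intro l
    rw [vectorField_subst _ neg_X_mem, ← sum_neg_distrib]
    refine sum_congr rfl fun μ _ => ?_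
    rw [Pi.neg_apply, map_neg, vectorField_X, mul_neg]
  rw [vectorField_apply, subst_sum hs]
  simp only [subst_mul hs, seriesA_neg, e, neg_mul, mul_neg, sum_neg_distrib, sum_mul, mul_sum]
  rw [sum_comm]
  congr 1
  exact sum_congr rfl fun _ _ => sum_congr rfl fun _ _ => by ring

theorem structure_expAlpha_neg (i j q : Fin L.n) :
    ∑ l, C (L.C i j l) * subst (-X) (L.co.expAlpha l q) =
      ∑ l, ∑ p, subst (-X) (L.co.expAlpha i l) * subst (-X) (L.co.expAlpha j p) * C (L.C l p q) +
      ∑ l, subst (-X) (L.co.expAlpha i l) *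
        vectorField (L.seriesA l) (subst (-X) (L.co.expAlpha j q)) -
      ∑ l, subst (-X) (L.co.expAlpha j l) *
        vectorField (L.seriesA l) (subst (-X) (L.co.expAlpha i q)) := by
  have hs := hasSubst_neg_X (k := k) (m := L.m)
  have h := congrArg (subst (-X : Fin L.m → PS (Fin L.m) k)) (structure_expAlpha L i j q)
  rw [sub_eq_add_neg, subst_add hs, subst_add hs, subst_neg hs, subst_sum hs, subst_sum hs,
    subst_neg_vectorField, subst_neg_vectorField, ← sub_eq_add_neg] at h
  simpa only [subst_sum hs, subst_mul hs, subst_C'] using h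

end Antipode

section LinearParts

variable (co : CoStructure k n m)

theorem coeff_single_mul (ρ : Fin m) (f g : PS (Fin m) k) :
    coeff (single ρ 1) (f * g) = constantCoeff f * coeff (single ρ 1) g +
      constantCoeff g * coeff (single ρ 1) f := by
  have e : ∀ f : PS (Fin m) k, coeff (single ρ 1) f = constantCoeff (pderiv k ρ f) := by
    intro f
    rw [← coeff_zero_eq_constantCoeff_apply, coeff_pderiv]
    simp
  rw [e, e, e, Derivation.leibniz, map_add, smul_eq_mul, smul_eq_mul, map_mul, map_mul]

theorem coeff_single_vectorField (ρ : Fin m) {c : Fin m → PS (Fin m) k}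
    (hc : InMax c) (f : PS (Fin m) k) :
    coeff (single ρ 1) (vectorField c f) =
      ∑ ν, coeff (single ρ 1) (c ν) * coeff (single ν 1) f := by
  rw [vectorField_apply, map_sum]
  refine sum_congr rfl fun ν _ => ?_
  rw [coeff_single_mul, mem_degIdeal_one.1 (hc ν), zero_mul, zero_add, mul_comm,
    ← coeff_zero_eq_constantCoeff_apply, coeff_pderiv]
  simp

theorem coeff_expAlpha (ρ : Fin m) (j q : Fin n) :
    coeff (single ρ 1) (co.expAlpha j q) = co.α ρ j q := by
  have h := congrArg (coeff (single ρ 1)) (euler_expAlpha co j q)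
  rw [coeff_euler, map_sum] at h
  simp only [coeff_single_mul, constantCoeff_expAlpha] at h
  have h0 : ∀ s, constantCoeff (repMat (alphaRep co) (X : Fin m → PS (Fin m) k) j s) = 0 :=
    fun s => mem_degIdeal_one.1 (matMem_repMat _ X_mem_degIdeal j s)
  have h1 : ∀ s, coeff (single ρ 1)
      (repMat (alphaRep co) (X : Fin m → PS (Fin m) k) j s) = co.α ρ j s := by
    intro s
    rw [repMat_apply, map_sum, sum_eq_single ρ]
    · simp [alphaRep, coeff_X]
    · intro b _ hb; simp [coeff_X, Finsupp.single_left_inj, hb.symm]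
    · simp
  simpa [h0, h1, one_apply] using h

theorem cond2_of_structure {C₀ : Fin n → Fin n → Fin n → k}
    {As : Fin n → Fin m → PS (Fin m) k} (hA : ∀ i μ, As i μ ∈ degIdeal k _ 1)
    (h : ∀ i j q, ∑ l, C (C₀ i j l) * co.expAlpha l q =
      ∑ l, ∑ p, co.expAlpha i l * co.expAlpha j p * C (C₀ l p q) +
      vectorField (As i) (co.expAlpha j q) - vectorField (As j) (co.expAlpha i q)) (i j μ l) :
    ∑ q, (co.α μ q l * C₀ i j q - C₀ i q l * co.α μ j q - C₀ q j l * co.α μ i q) =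
      ∑ ν, (co.α ν j l * coeff (single μ 1) (As i ν) -
        co.α ν i l * coeff (single μ 1) (As j ν)) := by
  have h1 := congrArg (coeff (single μ 1)) (h i j l)
  have hC : ∀ c : k, coeff (single μ 1) (C c : PS (Fin m) k) = 0 := by
    intro c
    classical
    rw [coeff_C, if_neg (by simp)]
  simp only [map_sum, map_add, map_sub, coeff_single_mul, coeff_single_vectorField μ (hA _),
    coeff_expAlpha, constantCoeff_expAlpha, constantCoeff_C, map_mul, one_apply, hC] at h1
  simp only [mul_zero, zero_mul, add_zero, zero_add, ite_mul, one_mul, mul_ite, mul_one,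
    mul_add, sum_add_distrib, sum_ite_eq, mem_univ, if_true] at h1
  simp only [sum_sub_distrib]
  have e1 : ∑ x, ∑ y, (if i = x then C₀ x y l * co.α μ j y else 0) = ∑ y,
    C₀ i y l * co.α μ j y := by
    rw [sum_comm]; simp
  simp only [mul_comm (C₀ _ _ _), mul_comm (coeff _ _)] at h1 e1 ⊢
  rw [e1] at h1
  linear_combination h1

theorem A_rep_of_structure {C₀ : Fin n → Fin n → Fin n → k}
    {As : Fin n → Fin m → PS (Fin m) k} (hA : ∀ i μ, As i μ ∈ degIdeal k _ 1)
    (h : ∀ i j μ, vectorField (As i) (As j μ) - vectorField (As j) (As i μ) =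
      ∑ l, C (C₀ i j l) * As l μ) (i j ρ μ) :
    ∑ ν, (coeff (single ν 1) (As j μ) * coeff (single ρ 1) (As i ν) -
      coeff (single ν 1) (As i μ) * coeff (single ρ 1) (As j ν)) =
      ∑ l, C₀ i j l * coeff (single ρ 1) (As l μ) := by
  have h1 := congrArg (coeff (single ρ 1)) (h i j μ)
  rw [map_sub, coeff_single_vectorField ρ (hA _), coeff_single_vectorField ρ (hA _), map_sum] at h1
  simp only [coeff_C_mul] at h1
  rw [← h1, sum_sub_distrib]
  simp only [mul_comm]

end LinearParts

section Naturality

/-- The matrices `p`, `q` define a morphism of inhomogeneous Lie bialgebras. -/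
structure IsBialgMap (L M : InhomLieBialgebra k) (p : Matrix (Fin L.n) (Fin M.n) k)
    (q : Matrix (Fin L.m) (Fin M.m) k) : Prop where
  map_C : ∀ i j s, ∑ l, L.C i j l * p l s = ∑ a, ∑ b, p i a * p j b * M.C a b s
  map_A : ∀ i μ ρ, ∑ ν, L.A i ν μ * q ν ρ = ∑ j, ∑ ν, p i j * q μ ν * M.A j ρ ν
  map_γ : IsLieMap L.co M.co q
  map_α : ∀ i ρ s, ∑ σ, ∑ l, L.co.α σ i l * (q σ ρ * p l s) = ∑ j, p i j * M.co.α ρ j s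

variable {L M : InhomLieBialgebra k} {p : Matrix (Fin L.n) (Fin M.n) k}
  {q : Matrix (Fin L.m) (Fin M.m) k} {τ : Type}

theorem IsBialgMap.alpha_intertwine (h : IsBialgMap L M p q) (u : Fin M.m → PS τ k) :
    constMat (τ := τ) p * repMat (alphaRep M.co) u =
      repMat (alphaRep L.co) ((constMat (τ := τ) q).mulVec u) * constMat (τ := τ) p := by
  ext1 i s
  have e1 : (constMat (τ := τ) p * repMat (alphaRep M.co) u) i s =
      ∑ ρ, (∑ j, p i j * M.co.α ρ j s) • u ρ := by
    simp only [mul_apply, constMat, Matrix.map_apply, repMat_apply, alphaRep,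
      Matrix.of_apply, ← smul_eq_C_mul, smul_sum, smul_smul, sum_smul]
    exact sum_comm
  have e2 : (repMat (alphaRep L.co) ((constMat (τ := τ) q).mulVec u) * constMat (τ := τ) p) i s =
      ∑ ρ, (∑ σ, ∑ l, L.co.α σ i l * (q σ ρ * p l s)) • u ρ := by
    simp only [mul_apply, constMat, Matrix.map_apply, repMat_apply, alphaRep,
      Matrix.of_apply, mul_comm _ (C _), ← smul_eq_C_mul, smul_sum, smul_smul,
      sum_smul, mulVec, dotProduct]
    rw [sum_comm]
    refine (sum_congr rfl fun _ _ => sum_comm).trans ?_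
    rw [sum_comm]
    refine sum_congr rfl fun _ _ => sum_congr rfl fun _ _ =>
      sum_congr rfl fun _ _ => ?_
    congr 1
    ring
  rw [e1, e2]
  simp only [h.map_α]

/-- The point `q X` of `V*`. -/
def qX (q : Matrix (Fin L.m) (Fin M.m) k) : Fin L.m → PS (Fin M.m) k :=
  (constMat (τ := Fin M.m) q).mulVec X

theorem qX_mem (μ : Fin L.m) : qX q μ ∈ degIdeal k _ 1 := constMat_mulVec_mem q X_mem_degIdeal μ

theorem IsBialgMap.expAlpha_natural (h : IsBialgMap L M p q) (i : Fin L.n) (s : Fin M.n) :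
    ∑ l, subst (qX q) (L.co.expAlpha i l) * C (p l s) = ∑ j, C (p i j) * M.co.expAlpha j s := by
  have hX := X_mem_degIdeal (k := k) (τ := Fin M.m)
  have h1 := matrixSeries_intertwine (expSeries k) (matMem_repMat _ hX)
    (matMem_repMat _ (qX_mem (q := q))) (h.alpha_intertwine X)
  have h2 := congrFun (congrFun h1 i) s
  rw [mul_apply, mul_apply] at h2
  refine Eq.trans (sum_congr rfl fun l _ => ?_) h2.symm
  have := congrFun (congrFun (expRep_eq_map_subst (alphaRep L.co) (qX_mem (q := q))) i) l
  rw [Matrix.map_apply] at this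
  change _ * _ = expRep (alphaRep L.co) (qX q) i l * _
  rw [this]
  rfl

/-- `p ⊗ q`. -/
def kronMat (p : Matrix (Fin L.n) (Fin M.n) k) (q : Matrix (Fin L.m) (Fin M.m) k) (τ : Type) :
    Matrix (Fin L.n × Fin L.m) (Fin M.n × Fin M.m) (PS τ k) :=
  kroneckerMap (· * ·) (constMat p) (constMat q)

theorem repMat_tensorRep {n m : ℕ} (co : CoStructure k n m) (u : Fin m → PS τ k) :
    repMat (tensorRep co) u = kroneckerMap (· * ·) (repMat (alphaRep co) u) 1 +
      kroneckerMap (· * ·) 1 (repMat (adj co) u) := by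
  ext1 ⟨i, μ⟩ ⟨l, ν⟩
  exact repMat_tensorRep_apply co u i l μ ν

theorem IsBialgMap.tensor_intertwine (h : IsBialgMap L M p q) (u : Fin M.m → PS τ k) :
    kronMat p q τ * repMat (tensorRep M.co) u =
      repMat (tensorRep L.co) ((constMat (τ := τ) q).mulVec u) * kronMat p q τ := by
  have e : ∀ {a b c a' b' c' : Type} [Fintype b] [Fintype b']
      (A : Matrix a b (PS τ k)) (B : Matrix b c (PS τ k))
      (A' : Matrix a' b' (PS τ k)) (B' : Matrix b' c' (PS τ k)),
      kroneckerMap (· * ·) A A' * kroneckerMap (· * ·) B B' =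
        kroneckerMap (· * ·) (A * B) (A' * B') := fun A B A' B' =>
    (Matrix.mul_kronecker_mul A B A' B').symm
  rw [repMat_tensorRep, repMat_tensorRep, kronMat, Matrix.mul_add, Matrix.add_mul, e, e, e, e,
    h.alpha_intertwine, ad_constMat h.map_γ]
  simp

theorem IsBialgMap.cocycle_natural (h : IsBialgMap L M p q) :
    cocycleOf (tensorRep L.co) (linCocycle L) (qX q) =
      (kronMat p q (Fin M.m)).mulVec (cocycleOf (tensorRep M.co) (linCocycle M) X) := by
  have hX := X_mem_degIdeal (k := k) (τ := Fin M.m)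
  have h1 := matrixSeries_intertwine (expQuotSeries k) (matMem_repMat _ hX)
    (matMem_repMat _ (qX_mem (q := q))) (h.tensor_intertwine X)
  have h2 : linVec (linCocycle L) (qX q) =
      (kronMat p q (Fin M.m)).mulVec (linVec (linCocycle M) X) := by
    funext ⟨i, μ⟩
    have e1 : linVec (linCocycle L) (qX q) (i, μ) = ∑ ρ, (∑ ν, L.A i ν μ * q ν ρ) •
        (X ρ : PS (Fin M.m) k) := by
      simp only [linVec, linCocycle, qX, constMat, mulVec, dotProduct, Matrix.map_apply,
        ← smul_eq_C_mul, smul_sum, smul_smul, sum_smul]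
      exact sum_comm
    have e2 : (kronMat p q (Fin M.m)).mulVec (linVec (linCocycle M) X) (i, μ) =
        ∑ ρ, (∑ j, ∑ ν, p i j * q μ ν * M.A j ρ ν) • (X ρ : PS (Fin M.m) k) := by
      rw [mulVec, dotProduct, Fintype.sum_prod_type]
      simp only [kronMat, kroneckerMap_apply, constMat, Matrix.map_apply, ← map_mul,
        ← smul_eq_C_mul, linVec, linCocycle, smul_sum, smul_smul, sum_smul]
      refine (sum_congr rfl fun _ _ => sum_comm).trans ?_
      exact sum_comm
    rw [e1, e2]
    simp only [h.map_A]
  rw [cocycleOf, cocycleOf, h2, mulVec_mulVec, mulVec_mulVec, h1]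

theorem IsBialgMap.seriesA_natural (h : IsBialgMap L M p q) (i : Fin L.n) (μ : Fin L.m) :
    subst (qX q) (L.seriesA i μ) = ∑ j, ∑ ν, C (p i j * q μ ν) * M.seriesA j ν := by
  have hX := X_mem_degIdeal (k := k) (τ := Fin M.m)
  have hq := qX_mem (q := q) (L := L) (M := M)
  have hs := hasSubst_of_mem hq
  have e1 : (fun μ => subst (qX q) (cocycleVec L i μ)) =
      (constMat (τ := Fin M.m) q).mulVec (∑ j, (C (p i j) : PS (Fin M.m) k) • cocycleVec M j) := by
    funext μ
    have h1 := congrFun h.cocycle_natural (i, μ)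
    have h2 := cocycleOf_subst hq (tensorRep L.co) (linCocycle L)
      (X_mem_degIdeal (k := k) (τ := Fin L.m)) (i, μ)
    simp only [subst_X hs] at h2
    rw [← h2, ← cocycle_eq, mulVec, dotProduct, Fintype.sum_prod_type, sum_comm] at h1
    refine h1.trans ?_
    rw [mulVec, dotProduct]
    refine sum_congr rfl fun ν _ => ?_
    rw [Finset.sum_apply, mul_sum]
    refine sum_congr rfl fun j _ => ?_
    rw [← cocycle_eq, kronMat, kroneckerMap_apply, Pi.smul_apply, smul_eq_mul]
    change _ = _ * (_ * M.cocycle j ν)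
    simp only [constMat, Matrix.map_apply]
    ring
  have e2 := series_constMat (toddSeries k) h.map_γ hX
  have e3 : subst (qX q) (L.seriesA i μ) =
      ((ThetaInv L.co (qX q)).mulVec (fun μ => subst (qX q) (cocycleVec L i μ))) μ := by
    rw [seriesA_eq, subst_mulVec hs, ThetaInv_map_subst hq _ X_mem_degIdeal]
    simp only [subst_X hs]
  rw [e3, e1, mulVec_mulVec, ThetaInv, qX, ← e2, ← mulVec_mulVec, mulVec_sum]
  simp only [mulVec_smul]
  change (constMat (τ := Fin M.m) q).mulVec (∑ j, (C (p i j) : PS (Fin M.m) k) • M.seriesA j) μ = _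
  rw [mulVec, dotProduct]
  simp only [Finset.sum_apply, mul_sum, Pi.smul_apply, smul_eq_mul, constMat,
    Matrix.map_apply, map_mul]
  rw [sum_comm]
  exact sum_congr rfl fun _ _ => sum_congr rfl fun _ _ => by ring

theorem IsBialgMap.campbellHausdorff_natural (h : IsBialgMap L M p q) (μ : Fin L.m) :
    chComp L.co ((constMat q).mulVec (XL k M.m)) ((constMat q).mulVec (XR k M.m)) μ =
      ∑ ν, C (q μ ν) * M.co.campbellHausdorff ν := by
  rw [chComp_constMat h.map_γ XL_mem XR_mem, chComp_XL_XR]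
  rfl

end Naturality

section Evaluation

variable [Fintype τ] {B : Type*} [Ring B] [Algebra k B]

theorem linearMap_ext_of_polynomial {E : Type*} [AddCommGroup E] [Module k E]
    {S T : PS τ k →ₗ[k] E} {N : ℕ}
    (hS : ∀ f ∈ degIdeal k τ N, S f = 0) (hT : ∀ f ∈ degIdeal k τ N, T f = 0)
    (h : ∀ p : MvPolynomial τ k, S p = T p) : S = T := by
  ext f
  have h1 := sub_truncTotal_mem_degIdeal N f
  have h2 := hS _ h1
  have h3 := hT _ h1
  rw [map_sub, sub_eq_zero] at h2 h3
  rw [h2, h3, h]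

theorem linearMap_ext_of_monomial {E : Type*} [AddCommGroup E] [Module k E]
    {S T : PS τ k →ₗ[k] E} {N : ℕ}
    (hS : ∀ f ∈ degIdeal k τ N, S f = 0) (hT : ∀ f ∈ degIdeal k τ N, T f = 0)
    (h : ∀ d, S (monomial d 1) = T (monomial d 1)) : S = T :=
  linearMap_ext_of_polynomial hS hT fun p => by
    induction p using MvPolynomial.induction_on' with
    | add p q hp hq => rw [MvPolynomial.coe_add, map_add, map_add, hp, hq]
    | monomial d s =>
      rw [MvPolynomial.coe_monomial, ← mul_one s, ← smul_eq_mul, map_smul, map_smul, map_smul, h]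

theorem exists_sumElim {α β : Type*} (c : α ⊕ β →₀ ℕ) : ∃ d e, c = sumElim d e :=
  ⟨_, _, (Finsupp.sumFinsuppEquivProdFinsupp.symm_apply_apply c).symm⟩

theorem algHom_ext_of_X {ev ev' : PS τ k →ₐ[k] B} {N : ℕ}
    (hev : ∀ f ∈ degIdeal k τ N, ev f = 0) (hev' : ∀ f ∈ degIdeal k τ N, ev' f = 0)
    (h : ∀ i, ev (X i) = ev' (X i)) : ev = ev' := by
  have h1 : ev.comp (MvPolynomial.coeToMvPowerSeries.algHom k) =
      ev'.comp (MvPolynomial.coeToMvPowerSeries.algHom k) :=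
    MvPolynomial.algHom_ext fun i => by simpa using h i
  have h2 := linearMap_ext_of_polynomial (S := ev.toLinearMap)
    (T := ev'.toLinearMap) hev hev' fun p => by
    simpa using congr_fun h1 p
  ext f
  exact congr_fun h2 f

open scoped IsMulCommutative in
theorem exists_algHom_of_commute (x : τ → B) (hx : ∀ i j, x i * x j = x j * x i) :
    ∃ g : MvPolynomial τ k →ₐ[k] B, ∀ i, g (MvPolynomial.X i) = x i := by
  have := Algebra.isMulCommutative_adjoin k (s := Set.range x)
    (by rintro _ ⟨i, rfl⟩ _ ⟨j, rfl⟩; exact hx i j)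
  let y : τ → Algebra.adjoin k (Set.range x) := fun i => ⟨x i, Algebra.subset_adjoin ⟨i, rfl⟩⟩
  refine ⟨(Algebra.adjoin k (Set.range x)).val.comp (MvPolynomial.aeval y), fun i => ?_⟩
  rw [AlgHom.comp_apply, MvPolynomial.aeval_X]
  rfl

theorem exists_eval (g : MvPolynomial τ k →ₐ[k] B) (N : ℕ)
    (hN : ∀ d : τ →₀ ℕ, N ≤ d.degree → g (MvPolynomial.monomial d 1) = 0) :
    ∃ ev : PS τ k →ₐ[k] B, (∀ p : MvPolynomial τ k, ev p = g p) ∧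
      ∀ f ∈ degIdeal k τ N, ev f = 0 := by
  have hg : ∀ p : MvPolynomial τ k, (p : PS τ k) ∈ degIdeal k τ N → g p = 0 := by
    intro p hp
    rw [p.as_sum, map_sum]
    refine sum_eq_zero fun d _ => ?_
    rcases lt_or_ge d.degree N with h | h
    · have := hp d h
      rw [MvPolynomial.coeff_coe] at this
      rw [this, map_zero, map_zero]
    · rw [← mul_one (MvPolynomial.coeff d p), ← smul_eq_mul, ← MvPolynomial.smul_monomial, map_smul,
        hN d h, smul_zero]
  have hg2 : ∀ p q : MvPolynomial τ k, (p : PS τ k) - q ∈ degIdeal k τ N → g p = g q := by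
    intro p q h
    rw [← sub_eq_zero, ← map_sub]
    refine hg _ ?_
    have e : ((p - q : MvPolynomial τ k) : PS τ k) = p - q :=
      map_sub (MvPolynomial.coeToMvPowerSeries.ringHom (R := k)) p q
    rwa [e]
  have ht := sub_truncTotal_mem_degIdeal (k := k) (τ := τ) N
  refine ⟨AlgHom.ofLinearMap (g.toLinearMap ∘ₗ truncTotal N) ?_ ?_, fun p => ?_, fun f hf => ?_⟩
  · refine (hg2 _ 1 ?_).trans (map_one g)
    rw [← neg_mem_iff, neg_sub, MvPolynomial.coe_one]
    exact ht 1
  · intro f h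
    refine (hg2 _ (truncTotal N f * truncTotal N h) ?_).trans (map_mul g _ _)
    have h1 := ht (f * h)
    have h2 : f * h - ((truncTotal N f * truncTotal N h : MvPolynomial τ k) : PS τ k) ∈
        degIdeal k τ N := by
      have h3 := add_mem (Ideal.mul_mem_right h _ (ht f))
        (Ideal.mul_mem_left _ (truncTotal N f : PS τ k) (ht h))
      convert h3 using 1
      rw [MvPolynomial.coe_mul]
      ring
    have h3 := sub_mem h2 h1
    rwa [sub_sub_sub_cancel_left] at h3
  · refine hg2 _ _ ?_
    rw [← neg_mem_iff, neg_sub]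
    exact ht p
  · refine hg _ ?_
    have := sub_mem hf (ht f)
    rwa [sub_sub_cancel] at this

theorem commutator_eval {ev : PS τ k →ₐ[k] B} {N : ℕ}
    (hev : ∀ f ∈ degIdeal k τ N, ev f = 0) (h : B) (c : τ → PS τ k)
    (hX : ∀ i, h * ev (X i) - ev (X i) * h = ev (c i)) (f : PS τ k) :
    h * ev f - ev f * h = ev (vectorField c f) := by
  let S : PS τ k →ₗ[k] B :=
    (LinearMap.mulLeft k h - LinearMap.mulRight k h) ∘ₗ ev.toLinearMap
  let T : PS τ k →ₗ[k] B := ev.toLinearMap ∘ₗ (vectorField c : _ →ₗ[k] _)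
  have hS : ∀ f, S f = h * ev f - ev f * h := fun _ => rfl
  have hT : ∀ f, T f = ev (vectorField c f) := fun _ => rfl
  have := linearMap_ext_of_polynomial (S := S) (T := T) (N := N + 1) (fun f hf => by
    rw [hS, hev f (degIdeal_mono (Nat.le_succ N) hf), mul_zero, zero_mul, sub_zero]) (fun f hf => by
    rw [hT, hev _ (vectorField_mem_degIdeal c hf)]) fun p => by
      induction p using MvPolynomial.induction_on with
      | C a =>
        rw [hS, hT, MvPolynomial.coe_C]
        have h1 : ev (C a) = algebraMap k B a := ev.commutes a
        have h2 : vectorField c (C a : PS τ k) = 0 := (vectorField c).map_algebraMap a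
        rw [h1, h2, map_zero, Algebra.commutes, sub_self]
      | add p q hp hq => rw [MvPolynomial.coe_add, map_add, map_add, hp, hq]
      | mul_X p i hp =>
        rw [hS, hT] at hp ⊢
        rw [MvPolynomial.coe_mul, MvPolynomial.coe_X, map_mul, Derivation.leibniz, vectorField_X,
          smul_eq_mul, smul_eq_mul, mul_comm (X i), map_add, map_mul, map_mul, ← hp, ← hX]
        noncomm_ring
  exact congr_fun this f

end Evaluation

section Ordering

variable {B : Type u} [Ring B] [Algebra k B] {n : ℕ}

theorem orderedMonomial_eq_word (h : Fin n → B) (d : Fin n →₀ ℕ) : orderedMonomial h d =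
    (((List.ofFn fun j => List.replicate (d j) j).flatten).map h).prod := by
  rw [orderedMonomial, List.map_flatten, List.prod_flatten, List.map_map, List.map_ofFn]
  congr 2
  funext j
  simp

theorem count_sortedWord (d : Fin n →₀ ℕ) (i : Fin n) :
    (List.ofFn fun j => List.replicate (d j) j).flatten.count i = d i := by
  rw [List.count_flatten, List.map_ofFn, List.sum_ofFn, sum_eq_single i]
  · simp
  · intro j _ hj; simp [List.count_replicate, hj]
  · simp

theorem perm_sortedWord (w : List (Fin n)) : ∃ d : Fin n →₀ ℕ,
    w.Perm (List.ofFn fun j => List.replicate (d j) j).flatten :=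
  ⟨Finsupp.equivFunOnFinite.symm fun j => w.count j, List.perm_iff_count.2 fun i => by
    rw [count_sortedWord]; rfl⟩

/-- The span of the words of length less than `r`. -/
def wordSpan (k : Type u) [Field k] [Algebra k B] (h : Fin n → B) (r : ℕ) : Submodule k B :=
  span k {b | ∃ w : List (Fin n), w.length < r ∧ b = (w.map h).prod}

theorem word_mem_wordSpan (h : Fin n → B) {w : List (Fin n)} {r : ℕ} (hw : w.length < r) :
    (w.map h).prod ∈ wordSpan k h r := subset_span ⟨w, hw, rfl⟩

theorem wordSpan_mono (h : Fin n → B) {r s : ℕ} (hr : r ≤ s) : wordSpan k h r ≤ wordSpan k h s :=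
  Submodule.span_mono fun _ ⟨w, hw, e⟩ => ⟨w, hw.trans_le hr, e⟩

theorem mul_mem_wordSpan (h : Fin n → B) (i : Fin n) {r : ℕ} {b : B} (hb : b ∈ wordSpan k h r) :
    h i * b ∈ wordSpan k h (r + 1) := by
  induction hb using Submodule.span_induction with
  | mem b hb =>
    obtain ⟨w, hw, rfl⟩ := hb
    rw [← List.prod_cons, ← List.map_cons]
    exact word_mem_wordSpan h (by simpa using hw)
  | zero => rw [mul_zero]; exact zero_mem _
  | add a b _ _ ha hb => rw [mul_add]; exact add_mem ha hb
  | smul c b _ hb => rw [mul_smul_comm]; exact Submodule.smul_mem _ _ hb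

theorem perm_sub_mem_wordSpan {h : Fin n → B} {C : Fin n → Fin n → Fin n → k}
    (hC : ∀ i j, h i * h j - h j * h i = ∑ l, C i j l • h l) {v w : List (Fin n)} (hp : v.Perm w) :
    (v.map h).prod - (w.map h).prod ∈ wordSpan k h v.length := by
  induction hp with
  | nil => simp
  | cons i _ ih =>
    rw [List.map_cons, List.map_cons, List.prod_cons, List.prod_cons, ← mul_sub]
    exact mul_mem_wordSpan h i ih
  | swap i j l =>
    simp only [List.map_cons, List.prod_cons, ← mul_assoc]
    rw [← sub_mul, hC, sum_mul]
    refine sum_mem fun p _ => ?_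
    rw [smul_mul_assoc, ← List.prod_cons, ← List.map_cons]
    exact Submodule.smul_mem _ _ (word_mem_wordSpan h (by simp))
  | trans h1 _ ih1 ih2 =>
    rw [← h1.length_eq] at ih2
    simpa using add_mem ih1 ih2

theorem word_mem_span_orderedMonomial {h : Fin n → B} {C : Fin n → Fin n → Fin n → k}
    (hC : ∀ i j, h i * h j - h j * h i = ∑ l, C i j l • h l) (w : List (Fin n)) :
    (w.map h).prod ∈ span k (Set.range (orderedMonomial h)) := by
  suffices H : ∀ r, wordSpan k h r ≤ span k (Set.range (orderedMonomial h)) from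
    H _ (word_mem_wordSpan h (Nat.lt_succ_self _))
  intro r
  induction r with
  | zero => exact Submodule.span_le.2 fun b ⟨w, hw, _⟩ => absurd hw (Nat.not_lt_zero _)
  | succ r ih =>
    refine Submodule.span_le.2 ?_
    rintro _ ⟨w, hw, rfl⟩
    obtain ⟨d, hd⟩ := perm_sortedWord w
    have h1 := ih (wordSpan_mono h (Nat.le_of_lt_succ hw) (perm_sub_mem_wordSpan hC hd))
    have h2 := add_mem h1 (subset_span (s := Set.range (orderedMonomial h)) ⟨d, rfl⟩)
    rw [← orderedMonomial_eq_word, sub_add_cancel] at h2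
    exact h2

theorem orderedMonomial_zero (h : Fin n → B) : orderedMonomial h 0 = 1 := by simp [orderedMonomial]

end Ordering

section Span

variable {B : Type u} [Ring B] [Algebra k B]

theorem orderedMonomial_eval (ev : PS (Fin m) k →ₐ[k] B) (d : Fin m →₀ ℕ) :
    orderedMonomial (fun μ => ev (X μ)) d = ev (monomial d 1) := by
  rw [monomial_eq_prod, one_smul, ← List.prod_ofFn, map_list_prod, List.map_ofFn, orderedMonomial]
  congr 2
  funext j
  simp

/-- The span of the products of formal series in the `X^μ` and of ordered monomials in the `H_i`. -/
def pbwSpan (ev : PS (Fin m) k →ₐ[k] B) (h : Fin n → B) : Submodule k B :=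
  span k (Set.range fun p : PS (Fin m) k × (Fin n →₀ ℕ) =>
    ev p.1 * orderedMonomial h p.2)

variable {ev : PS (Fin m) k →ₐ[k] B} {h : Fin n → B} {C : Fin n → Fin n → Fin n → k}

theorem eval_mul_mem_pbwSpan (f : PS (Fin m) k) {b : B} (hb : b ∈ pbwSpan ev h) :
    ev f * b ∈ pbwSpan ev h := by
  induction hb using Submodule.span_induction with
  | mem b hb =>
    obtain ⟨p, rfl⟩ := hb
    exact subset_span ⟨(f * p.1, p.2), by simp [mul_assoc]⟩
  | zero => rw [mul_zero]; exact zero_mem _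
  | add a b _ _ ha hb => rw [mul_add]; exact add_mem ha hb
  | smul c b _ hb => rw [mul_smul_comm]; exact Submodule.smul_mem _ _ hb

theorem word_mem_pbwSpan (hC : ∀ i j, h i * h j - h j * h i = ∑ l, C i j l • h l)
    (w : List (Fin n)) : (w.map h).prod ∈ pbwSpan ev h := by
  refine Submodule.span_le.2 ?_ (word_mem_span_orderedMonomial hC w)
  rintro _ ⟨d, rfl⟩
  exact subset_span ⟨(1, d), by simp⟩

theorem gen_mul_mem_pbwSpan (hC : ∀ i j, h i * h j - h j * h i = ∑ l, C i j l • h l)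
    {v : Fin n → PS (Fin m) k → PS (Fin m) k}
    (hv : ∀ i f, h i * ev f - ev f * h i = ev (v i f)) (i : Fin n) {b : B} (hb : b ∈ pbwSpan ev h) :
    h i * b ∈ pbwSpan ev h := by
  induction hb using Submodule.span_induction with
  | mem b hb =>
    obtain ⟨⟨f, d⟩, rfl⟩ := hb
    have e : h i * (ev f * orderedMonomial h d) =
        ev f * (h i * orderedMonomial h d) + ev (v i f) * orderedMonomial h d := by
      rw [← hv]; noncomm_ring
    rw [e]
    refine add_mem (eval_mul_mem_pbwSpan f ?_) (subset_span ⟨(v i f, d), rfl⟩)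
    rw [orderedMonomial_eq_word, ← List.prod_cons, ← List.map_cons]
    exact word_mem_pbwSpan hC _
  | zero => rw [mul_zero]; exact zero_mem _
  | add a b _ _ ha hb => rw [mul_add]; exact add_mem ha hb
  | smul c b _ hb => rw [mul_smul_comm]; exact Submodule.smul_mem _ _ hb

theorem mul_mem_pbwSpan (hC : ∀ i j, h i * h j - h j * h i = ∑ l, C i j l • h l)
    {v : Fin n → PS (Fin m) k → PS (Fin m) k}
    (hv : ∀ i f, h i * ev f - ev f * h i = ev (v i f)) {a b : B} (ha : a ∈ pbwSpan ev h)
    (hb : b ∈ pbwSpan ev h) : a * b ∈ pbwSpan ev h := by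
  induction ha using Submodule.span_induction with
  | mem a ha =>
    obtain ⟨⟨f, d⟩, rfl⟩ := ha
    simp only [mul_assoc]
    refine eval_mul_mem_pbwSpan f ?_
    rw [orderedMonomial_eq_word]
    generalize (List.ofFn fun j => List.replicate (d j) j).flatten = w
    induction w with
    | nil => simpa using hb
    | cons i w ih =>
      rw [List.map_cons, List.prod_cons, mul_assoc]
      exact gen_mul_mem_pbwSpan hC hv i ih
  | zero => rw [zero_mul]; exact zero_mem _
  | add a b _ _ ha hb => rw [add_mul]; exact add_mem ha hb
  | smul c b _ hb => rw [smul_mul_assoc]; exact Submodule.smul_mem _ _ hb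

theorem one_mem_pbwSpan : (1 : B) ∈ pbwSpan ev h :=
  subset_span ⟨(1, 0), by simp [orderedMonomial_zero]⟩

/-- The ordered monomials of degree less than `N` in the `X^μ`. -/
def pbwMonomial (N : ℕ) (x : Fin m → B) (h : Fin n → B)
    (p : {d : Fin m →₀ ℕ // d.degree < N} × (Fin n →₀ ℕ)) : B :=
  orderedMonomial x p.1 * orderedMonomial h p.2

theorem pbwSpan_eq {N : ℕ} (hev : ∀ f ∈ degIdeal k (Fin m) N, ev f = 0) : pbwSpan ev h =
    span k (Set.range (pbwMonomial N (fun μ => ev (X μ)) h)) := by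
  refine le_antisymm (Submodule.span_le.2 ?_) (Submodule.span_le.2 ?_)
  · rintro _ ⟨⟨f, e⟩, rfl⟩
    have h1 := hev _ (sub_truncTotal_mem_degIdeal N f)
    rw [map_sub, sub_eq_zero] at h1
    simp only [h1, SetLike.mem_coe]
    rw [(truncTotal N f).as_sum,
      ← MvPolynomial.coeToMvPowerSeries.ringHom_apply, map_sum, map_sum, sum_mul]
    refine sum_mem fun d hd => ?_
    have hd' : d.degree < N := by
      by_contra hN
      exact MvPolynomial.mem_support_iff.1 hd (coeff_truncTotal_eq_zero _ (not_lt.1 hN))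
    have e1 : ∀ c : k, monomial d c = c • (monomial d 1 : PS (Fin m) k) := fun c => by
      rw [← map_smul, smul_eq_mul, mul_one]
    rw [MvPolynomial.coeToMvPowerSeries.ringHom_apply, MvPolynomial.coe_monomial, e1, map_smul,
      ← orderedMonomial_eval, smul_mul_assoc]
    exact Submodule.smul_mem _ _ (subset_span ⟨(⟨d, hd'⟩, e), rfl⟩)
  · rintro _ ⟨⟨d, e⟩, rfl⟩
    exact subset_span ⟨(monomial d 1, e), by simp [pbwMonomial, orderedMonomial_eval]⟩

end Span

section UniversalProperty

variable {L : InhomLieBialgebra k} {A B : Type u} [Ring A]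
  [Algebra k A] [Ring B] [Algebra k B]

theorem map_orderedMonomial (F : A →ₐ[k] B) {r : ℕ} (x : Fin r → A) (d : Fin r →₀ ℕ) :
    F (orderedMonomial x d) = orderedMonomial (fun i => F (x i)) d := by
  rw [orderedMonomial, map_list_prod, List.map_ofFn, orderedMonomial]
  congr 2
  funext j
  simp

/-- The commutation relations of the quantization of `L`. -/
structure PBWRel (L : InhomLieBialgebra k) (h : Fin L.n → B)
    (ev : PS (Fin L.m) k →ₐ[k] B) : Prop where
  comm_hh : ∀ i j, h i * h j - h j * h i = ∑ l, L.C i j l • h l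
  comm_ev : ∀ i f, h i * ev f - ev f * h i = ev (vectorField (L.seriesA i) f)

theorem PBWRel.mk_of_X {h : Fin L.n → B} {ev : PS (Fin L.m) k →ₐ[k] B} {N : ℕ}
    (hev : ∀ f ∈ degIdeal k _ N, ev f = 0)
    (hh : ∀ i j, h i * h j - h j * h i = ∑ l, L.C i j l • h l)
    (hX : ∀ i μ, h i * ev (X μ) - ev (X μ) * h i = ev (L.seriesA i μ)) : PBWRel L h ev :=
  ⟨hh, fun i f => commutator_eval hev (h i) (L.seriesA i) (hX i) f⟩

theorem gen_mem_pbwSpan {n m : ℕ} {h : Fin n → B} {ev : PS (Fin m) k →ₐ[k] B}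
    {C : Fin n → Fin n → Fin n → k}
    (hC : ∀ i j, h i * h j - h j * h i = ∑ l, C i j l • h l) (i : Fin n) :
    h i ∈ pbwSpan ev h := by
  simpa using word_mem_pbwSpan (ev := ev) hC [i]

theorem eval_mem_pbwSpan {n m : ℕ} {h : Fin n → B} {ev : PS (Fin m) k →ₐ[k] B}
    (f : PS (Fin m) k) : ev f ∈ pbwSpan ev h := by
  simpa using eval_mul_mem_pbwSpan f (one_mem_pbwSpan (ev := ev) (h := h))

theorem PBWRel.exists_algHom {h : Fin L.n → A} {ev : PS (Fin L.m) k →ₐ[k] A}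
    {h' : Fin L.n → B} {ev' : PS (Fin L.m) k →ₐ[k] B} {N : ℕ} (hA : PBWRel L h ev)
    (hB : PBWRel L h' ev') (hev : ∀ f ∈ degIdeal k _ N, ev f = 0)
    (hev' : ∀ f ∈ degIdeal k _ N, ev' f = 0)
    (hi : LinearIndependent k (pbwMonomial N (fun μ => ev (X μ)) h))
    (hs : span k (Set.range (pbwMonomial N (fun μ => ev (X μ)) h)) = ⊤) :
    ∃ F : A →ₐ[k] B, (∀ i, F (h i) = h' i) ∧ ∀ f, F (ev f) = ev' f := by
  let b := Module.Basis.mk hi hs.ge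
  let evP := ev.prod ev'
  let hP : Fin L.n → A × B := fun i => (h i, h' i)
  have hevP : ∀ f ∈ degIdeal k _ N, evP f = 0 := fun f hf => Prod.ext (hev f hf) (hev' f hf)
  have hC : ∀ i j, hP i * hP j - hP j * hP i = ∑ l, L.C i j l • hP l := fun i j =>
    Prod.ext (by simpa [hP, Prod.fst_sum] using hA.comm_hh i j)
      (by simpa [hP, Prod.snd_sum] using hB.comm_hh i j)
  have hv : ∀ i f, hP i * evP f - evP f * hP i = evP (vectorField (L.seriesA i) f) := fun i f =>
    Prod.ext (hA.comm_ev i f) (hB.comm_ev i f)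
  let T : A →ₗ[k] A × B := b.constr k (pbwMonomial N (fun μ => evP (X μ)) hP)
  have hT : LinearMap.range T = pbwSpan evP hP := by
    rw [pbwSpan_eq hevP]
    exact b.constr_range k
  have hfst : ∀ a, (T a).1 = a := by
    have : LinearMap.fst k A B ∘ₗ T = LinearMap.id := b.ext fun p => by
      rw [LinearMap.comp_apply, Module.Basis.constr_basis, LinearMap.id_apply,
        Module.Basis.mk_apply]
      change AlgHom.fst k A B _ = _
      rw [pbwMonomial, map_mul, map_orderedMonomial, map_orderedMonomial]
      rfl
    exact fun a => LinearMap.congr_fun this a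
  have hy : ∀ y ∈ pbwSpan evP hP, T y.1 = y := by
    intro y hy
    rw [← hT] at hy
    obtain ⟨a, rfl⟩ := hy
    rw [hfst]
  have hmem : ∀ a, T a ∈ pbwSpan evP hP := fun a => hT ▸ LinearMap.mem_range_self T a
  refine ⟨AlgHom.ofLinearMap (LinearMap.snd k A B ∘ₗ T) ?_ ?_, fun i => ?_, fun f => ?_⟩
  · exact congrArg Prod.snd (hy 1 one_mem_pbwSpan)
  · intro a c
    have := hy _ (mul_mem_pbwSpan hC hv (hmem a) (hmem c))
    rw [Prod.fst_mul, hfst, hfst] at this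
    exact congrArg Prod.snd this
  · exact congrArg Prod.snd (hy _ (gen_mem_pbwSpan hC i))
  · exact congrArg Prod.snd (hy _ (eval_mem_pbwSpan f))

theorem algHom_ext_of_pbw {n m : ℕ} {I : Ideal A} [I.IsTwoSided] {x : Fin m → A} {h : Fin n → A}
    {N : ℕ}
    (hs : span k (Set.range fun p : {d : Fin m →₀ ℕ // d.degree < N} × (Fin n →₀ ℕ) =>
      mkₐ k (I ^ N) (orderedMonomial x p.1 * orderedMonomial h p.2)) = ⊤)
    {F G : A →ₐ[k] B} (hF : ∀ a ∈ I ^ N, F a = 0) (hG : ∀ a ∈ I ^ N, G a = 0)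
    (hh : ∀ i, F (h i) = G (h i)) (hx : ∀ μ, F (x μ) = G (x μ)) : F = G := by
  let F' := Ideal.Quotient.liftₐ (I ^ N) F hF
  let G' := Ideal.Quotient.liftₐ (I ^ N) G hG
  have key : F'.toLinearMap = G'.toLinearMap := by
    refine LinearMap.ext_on hs ?_
    rintro _ ⟨p, rfl⟩
    change F _ = G _
    rw [map_mul, map_mul, map_orderedMonomial, map_orderedMonomial, map_orderedMonomial,
      map_orderedMonomial]
    simp only [hh, hx]
  ext a
  exact LinearMap.congr_fun key (mkₐ k (I ^ N) a)

end UniversalProperty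

section XIdeal

/-- The degree in the variables `X^μ`. -/
def xdeg (c : Fin m ⊕ Fin n →₀ ℕ) : ℕ := ∑ μ, c (Sum.inl μ)

theorem xdeg_add (c d : Fin m ⊕ Fin n →₀ ℕ) : xdeg (c + d) = xdeg c + xdeg d := by
  simp [xdeg, sum_add_distrib]

theorem xdeg_sumElim (d : Fin m →₀ ℕ) (e : Fin n →₀ ℕ) : xdeg (sumElim d e) = d.degree := by
  simp [xdeg, Finsupp.degree_eq_sum]

/-- The ideal of formal series all of whose terms have degree at least `N` in the `X^μ`. -/
def xIdeal (k : Type u) [Field k] (m n N : ℕ) : Ideal (PS (Fin m ⊕ Fin n) k) where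
  carrier := {f | ∀ c, xdeg c < N → coeff c f = 0}
  zero_mem' _ _ := map_zero _
  add_mem' hf hg c hc := by rw [map_add, hf c hc, hg c hc, add_zero]
  smul_mem' f g hg c hc := by
    classical
    rw [smul_eq_mul, coeff_mul]
    refine sum_eq_zero fun p hp => ?_
    have := congrArg xdeg (mem_antidiagonal.1 hp)
    rw [xdeg_add] at this
    rw [hg _ (by omega), mul_zero]

theorem xIdeal_mono {M N : ℕ} (h : N ≤ M) : xIdeal k m n M ≤ xIdeal k m n N :=
  fun _ hf c hc => hf c (hc.trans_le h)

theorem mem_xIdeal_zero (f : PS (Fin m ⊕ Fin n) k) : f ∈ xIdeal k m n 0 :=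
  fun _ h => absurd h (Nat.not_lt_zero _)

variable {f : PS (Fin m ⊕ Fin n) k}

theorem eq_zero_of_mem_xIdeal (h : ∀ N, f ∈ xIdeal k m n N) : f = 0 := by
  ext c
  exact h (xdeg c + 1) c (Nat.lt_succ_self _)

theorem smul_mem_xIdeal {N : ℕ} (a : k) (hf : f ∈ xIdeal k m n N) : a • f ∈ xIdeal k m n N := by
  rw [smul_eq_C_mul]; exact Ideal.mul_mem_left _ _ hf

theorem mul_mem_xIdeal {M N : ℕ} {f g : PS (Fin m ⊕ Fin n) k} (hf : f ∈ xIdeal k m n M)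
    (hg : g ∈ xIdeal k m n N) : f * g ∈ xIdeal k m n (M + N) := by
  classical
  intro c hc
  rw [coeff_mul]
  refine sum_eq_zero fun p hp => ?_
  have := congrArg xdeg (mem_antidiagonal.1 hp)
  rw [xdeg_add] at this
  rcases lt_or_ge (xdeg p.1) M with h | h
  · rw [hf _ h, zero_mul]
  · rw [hg _ (by omega), mul_zero]

theorem X_inl_mem_xIdeal (μ : Fin m) : (X (Sum.inl μ) : PS (Fin m ⊕ Fin n) k) ∈ xIdeal k m n 1 := by
  classical
  intro c hc
  rw [coeff_X, if_neg]
  rintro rfl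
  simp [xdeg, Finsupp.single_apply] at hc

theorem prod_X_inl_mem_xIdeal (d : Fin m →₀ ℕ) :
    (∏ μ, X (Sum.inl μ) ^ d μ : PS (Fin m ⊕ Fin n) k) ∈ xIdeal k m n d.degree := by
  have hp : ∀ (μ : Fin m) (r : ℕ), (X (Sum.inl μ) ^ r : PS (Fin m ⊕ Fin n) k) ∈ xIdeal k m n r := by
    intro μ r
    induction r with
    | zero => exact mem_xIdeal_zero _
    | succ r ih => rw [pow_succ]; exact mul_mem_xIdeal ih (X_inl_mem_xIdeal μ)
  rw [Finsupp.degree_eq_sum]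
  induction (Finset.univ : Finset (Fin m)) using Finset.induction_on with
  | empty => exact mem_xIdeal_zero _
  | insert a s ha ih =>
    rw [Finset.prod_insert ha, Finset.sum_insert ha]
    exact mul_mem_xIdeal (hp a _) ih

theorem pderiv_inr_mem_xIdeal {N : ℕ}
    (hf : f ∈ xIdeal k m n N) (j : Fin n) : pderiv k (Sum.inr j) f ∈ xIdeal k m n N := by
  intro c hc
  rw [coeff_pderiv, hf _ (by rw [xdeg_add]; simpa [xdeg, Finsupp.single_apply] using hc), zero_mul]

theorem pderiv_inl_mem_xIdeal {N : ℕ}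
    (hf : f ∈ xIdeal k m n (N + 1)) (μ : Fin m) : pderiv k (Sum.inl μ) f ∈ xIdeal k m n N := by
  intro c hc
  rw [coeff_pderiv, hf _ (by rw [xdeg_add]; simpa [xdeg, Finsupp.single_apply] using hc), zero_mul]

theorem vectorField_mem_xIdeal {c : Fin m ⊕ Fin n → PS (Fin m ⊕ Fin n) k}
    (hc : ∀ μ, c (Sum.inl μ) ∈ xIdeal k m n 1) {N : ℕ}
    (hf : f ∈ xIdeal k m n N) : vectorField c f ∈ xIdeal k m n N := by
  cases N with
  | zero => exact mem_xIdeal_zero _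
  | succ N =>
    rw [vectorField_apply, Fintype.sum_sum_type]
    refine add_mem (sum_mem fun μ _ => ?_) (sum_mem fun j _ => ?_)
    · rw [add_comm N]
      exact mul_mem_xIdeal (hc μ) (pderiv_inl_mem_xIdeal hf μ)
    · exact Ideal.mul_mem_left _ _ (pderiv_inr_mem_xIdeal hf j)

theorem inl_mem (μ : Fin m) : (X (Sum.inl μ) : PS (Fin m ⊕ Fin n) k) ∈ degIdeal k _ 1 :=
  X_mem_degIdeal _

/-- A series in the `X^μ` as a series in all variables. -/
def renX (k : Type u) [Field k] [CharZero k] (m n : ℕ) : PS (Fin m) k →ₐ[k] PS (Fin m ⊕ Fin n) k :=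
  substAlgHom (hasSubst_of_mem inl_mem)

theorem renX_apply (f : PS (Fin m) k) : renX k m n f = subst (fun μ => X (Sum.inl μ)) f := by
  rw [renX, coe_substAlgHom]

theorem renX_mem {N : ℕ} {f : PS (Fin m) k} (hf : f ∈ degIdeal k (Fin m) N) :
    renX k m n f ∈ xIdeal k m n N := by
  intro c hc
  rw [renX_apply, coeff_subst (hasSubst_of_mem inl_mem), finsum_eq_zero_of_forall_eq_zero]
  intro d
  rcases lt_or_ge d.degree N with h | h
  · rw [hf d h, zero_smul]
  · rw [Finsupp.prod_fintype _ _ (by simp), prod_X_inl_mem_xIdeal d c (hc.trans_le h), smul_zero]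

theorem renX_monomial (d : Fin m →₀ ℕ) : renX k m n (monomial d 1) = monomial (sumElim d 0) 1 := by
  rw [monomial_eq_prod, monomial_eq_prod, one_smul, one_smul, map_prod, Fintype.prod_sum_type]
  simp only [map_pow, renX_apply, subst_X (hasSubst_of_mem (inl_mem (k := k) (n := n)))]
  simp

end XIdeal

section Model

variable (L : InhomLieBialgebra k)

/-- The Lie algebra `H`. -/
def coC : CoStructure k 0 L.n where
  γ := L.C
  α _ i := i.elim0
  γ_skew := L.C_skew
  γ_jacobi := L.C_jacobi
  α_rep _ _ j := j.elim0

/-- The right-invariant vector fields on `exp H`. -/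
def rightField (i : Fin L.n) : Fin L.n → PS (Fin L.n) k :=
  (ThetaInv (coC L) X).mulVec (Pi.single i 1)

theorem rightField_sub_mem (i j : Fin L.n) :
    rightField L i j - Pi.single (M := fun _ => PS (Fin L.n) k) i 1 j ∈
      degIdeal k _ 1 := by
  have h1 := matrixSeries_sub_coeff_zero (toddSeries k)
    (matMem_repMat (adj (coC L)) (X_mem_degIdeal (k := k) (τ := Fin L.n)))
  rw [constantCoeff_toddSeries, one_smul] at h1
  have := mulVec_mem h1 (v := Pi.single i 1) (N := 0) (fun _ => mem_degIdeal_zero _) j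
  rwa [sub_mulVec, one_mulVec] at this

theorem vectorField_rightField (i j q : Fin L.n) :
    vectorField (rightField L i) (rightField L j q) - vectorField (rightField L j)
      (rightField L i q) =
      -∑ l, L.C i j l • rightField L l q := by
  have hw : ∀ i, logDeriv (coC L) (rightField L i) X = Pi.single i 1 := by
    intro i
    rw [logDeriv]
    simp only [vectorField_X]
    rw [rightField, mulVec_mulVec, Theta_mul_ThetaInv _ X_mem_degIdeal, one_mulVec]
  have hD : ∀ (D : Derivation k (PS (Fin L.n) k) (PS (Fin L.n) k))
      (i : Fin L.n), (fun μ => D ((Pi.single i 1 : Fin L.n → PS (Fin L.n) k) μ)) = 0 := by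
    intro D i
    funext μ
    rcases eq_or_ne μ i with rfl | h
    · simp
    · simp [h]
  have hmc := maurerCartan (coC L) (rightField L i) (rightField L j)
    (X_mem_degIdeal (k := k) (τ := Fin L.n))
  rw [hw, hw, hD, hD, sub_zero] at hmc
  simp only [vectorField_X] at hmc
  have h1 := congrArg (ThetaInv (coC L) X).mulVec (eq_neg_of_add_eq_zero_left hmc.symm)
  rw [mulVec_mulVec, ThetaInv_mul_Theta _ X_mem_degIdeal, one_mulVec] at h1
  have h2 := congrFun h1 q
  have h3 : brk (coC L) (Pi.single i 1) (Pi.single j 1 : Fin L.n → PS (Fin L.n) k) =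
      ∑ l, L.C i j l • (Pi.single l 1 : Fin L.n → PS (Fin L.n) k) := by
    funext q
    rw [brk_apply, sum_eq_single i, sum_eq_single j]
    · simp [Pi.single_apply, coC]
    · intro b _ hb; simp [hb]
    · simp
    · intro b _ hb; simp [hb]
    · simp
  rw [h2, h3, mulVec_neg, mulVec_sum, Pi.neg_apply, Finset.sum_apply]
  simp only [mulVec_smul]
  rfl

theorem inr_mem {m n : ℕ} (j : Fin n) :
    (X (Sum.inr j) : PS (Fin m ⊕ Fin n) k) ∈ degIdeal k _ 1 := X_mem_degIdeal _

/-- The coefficients of the vector field which represents `H_i`. -/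
def modelField (i : Fin L.n) : Fin L.m ⊕ Fin L.n → PS (Fin L.m ⊕ Fin L.n) k :=
  Sum.elim (fun μ => renX k L.m L.n (L.seriesA i μ))
    fun j => -subst (fun j => X (Sum.inr j)) (rightField L i j)

theorem modelField_renX (i : Fin L.n) (f : PS (Fin L.m) k) :
    vectorField (modelField L i) (renX k L.m L.n f) =
      renX k L.m L.n (vectorField (L.seriesA i) f) := by
  rw [renX_apply, vectorField_subst _ inl_mem, derivation_apply_eq, map_sum]
  refine sum_congr rfl fun μ _ => ?_
  rw [vectorField_X, map_mul, renX_apply]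
  rfl

theorem modelField_comm (i j : Fin L.n) (p : Fin L.m ⊕ Fin L.n) :
    vectorField (modelField L i) (modelField L j p) - vectorField (modelField L j)
      (modelField L i p) =
      ∑ l, L.C i j l • modelField L l p := by
  rcases p with μ | q
  · change vectorField (modelField L i) (renX k L.m L.n _) -
      vectorField (modelField L j) (renX k L.m L.n _) = _
    rw [modelField_renX, modelField_renX, ← map_sub, vectorField_seriesA_comm, map_sum]
    refine sum_congr rfl fun l _ => ?_
    rw [← smul_eq_C_mul, map_smul]
    rfl
  · have hs := hasSubst_of_mem (inr_mem (k := k) (m := L.m) (n := L.n))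
    have e : ∀ i j, vectorField (modelField L i) (modelField L j (Sum.inr q)) =
        subst (fun j => X (Sum.inr j)) (vectorField (rightField L i) (rightField L j q)) := by
      intro i j
      change vectorField (modelField L i) (-subst _ _) = _
      rw [map_neg, vectorField_subst _ inr_mem, derivation_apply_eq, subst_sum hs,
        ← sum_neg_distrib]
      refine sum_congr rfl fun μ _ => ?_
      rw [vectorField_X, subst_mul hs, ← mul_neg]
      congr 1
      exact neg_neg _
    rw [e, e, sub_eq_add_neg, ← subst_neg hs, ← subst_add hs, ← sub_eq_add_neg,
      vectorField_rightField, subst_neg hs, subst_sum hs, ← sum_neg_distrib]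
    refine sum_congr rfl fun l _ => ?_
    rw [subst_smul hs, ← smul_neg]
    rfl

/-- The linear operators on formal series in all generators. -/
abbrev ModelEnd := Module.End k (PS (Fin L.m ⊕ Fin L.n) k)

/-- The operator which represents `H_i`. -/
def opH (i : Fin L.n) : ModelEnd L :=
  (vectorField (modelField L i) : _ →ₗ[k] _)

/-- The operators which represent the formal series in the `X^μ`. -/
def opEv : PS (Fin L.m) k →ₐ[k] ModelEnd L :=
  (Algebra.lmul k _).comp (renX k L.m L.n)

theorem opH_apply (i : Fin L.n) (g : PS (Fin L.m ⊕ Fin L.n) k) :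
    opH L i g = vectorField (modelField L i) g := rfl

theorem opEv_apply (f : PS (Fin L.m) k) (g : PS (Fin L.m ⊕ Fin L.n) k) :
    opEv L f g = renX k L.m L.n f * g := rfl

theorem pbwRel_op : PBWRel L (opH L) (opEv L) where
  comm_hh i j := by
    ext1 g
    rw [LinearMap.sub_apply, Module.End.mul_apply, Module.End.mul_apply]
    simp only [opH_apply, LinearMap.sum_apply, LinearMap.smul_apply]
    rw [vectorField_comm, vectorField_apply]
    simp only [modelField_comm]
    simp only [vectorField_apply, sum_mul, smul_mul_assoc, smul_sum]
    exact sum_comm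
  comm_ev i f := by
    ext1 g
    rw [LinearMap.sub_apply, Module.End.mul_apply, Module.End.mul_apply]
    simp only [opH_apply, opEv_apply]
    rw [Derivation.leibniz, modelField_renX, smul_eq_mul, smul_eq_mul]
    ring

theorem opH_mem_xIdeal (i : Fin L.n) {N : ℕ} {g : PS (Fin L.m ⊕ Fin L.n) k}
    (hg : g ∈ xIdeal k _ _ N) : opH L i g ∈ xIdeal k _ _ N :=
  vectorField_mem_xIdeal (fun μ => renX_mem (seriesA_mem L i μ)) hg

theorem pbwSpan_mem_xIdeal {s : ModelEnd L}
    (hs : s ∈ pbwSpan (opEv L) (opH L)) {N : ℕ} {g : PS (Fin L.m ⊕ Fin L.n) k}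
    (hg : g ∈ xIdeal k _ _ N) : s g ∈ xIdeal k _ _ N := by
  induction hs using Submodule.span_induction with
  | mem s hs =>
    obtain ⟨⟨f, d⟩, rfl⟩ := hs
    refine Ideal.mul_mem_left _ _ ?_
    simp only
    rw [orderedMonomial_eq_word]
    generalize (List.ofFn fun j => List.replicate (d j) j).flatten = w
    induction w with
    | nil => exact hg
    | cons i w ih => exact opH_mem_xIdeal L i ih
  | zero => exact (xIdeal k _ _ N).zero_mem
  | add a b _ _ ha hb => exact (xIdeal k _ _ N).add_mem ha hb
  | smul c b _ hb => exact smul_mem_xIdeal c hb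

/-- The iterated derivative with respect to the coordinates on `exp H`. -/
def derivWord {m n : ℕ} (w : List (Fin n)) (f : PS (Fin m ⊕ Fin n) k) :
    PS (Fin m ⊕ Fin n) k := w.foldr (fun i g => pderiv k (Sum.inr i) g) f

theorem derivWord_mem {m n : ℕ} (w : List (Fin n)) {s : ℕ} {f : PS (Fin m ⊕ Fin n) k}
    (hf : f ∈ degIdeal k _ (w.length + s)) : derivWord w f ∈ degIdeal k _ s := by
  induction w generalizing s with
  | nil => simpa [derivWord] using hf
  | cons i w ih =>
    refine pderiv_mem_degIdeal (ih ?_) _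
    rwa [List.length_cons, add_assoc, add_comm 1] at hf

theorem coeff_derivWord {m n : ℕ} (w : List (Fin n)) (c : Fin m ⊕ Fin n →₀ ℕ) : ∃ K : k, K ≠ 0 ∧
    ∀ f, coeff c (derivWord w f) = K * coeff (c + (w.map fun i => single (Sum.inr i) 1).sum) f := by
  induction w generalizing c with
  | nil => exact ⟨1, one_ne_zero, fun f => by simp [derivWord]⟩
  | cons i w ih =>
    obtain ⟨K, hK, h⟩ := ih (c + single (Sum.inr i) 1)
    refine ⟨K * (c (Sum.inr i) + 1), mul_ne_zero hK (Nat.cast_add_one_ne_zero _), fun f => ?_⟩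
    have e : derivWord (i :: w) f = pderiv k (Sum.inr i) (derivWord w f) := rfl
    rw [e, coeff_pderiv, h, List.map_cons, List.sum_cons, ← add_assoc]
    ring

theorem opH_add_pderiv_mem (i : Fin L.n) {s : ℕ} {q : PS (Fin L.m ⊕ Fin L.n) k}
    (hq : q ∈ degIdeal k _ s) : opH L i q + pderiv k (Sum.inr i) q ∈ degIdeal k _ s := by
  have e : opH L i q + pderiv k (Sum.inr i) q =
      vectorField (modelField L i + Pi.single (Sum.inr i) 1) q := by
    rw [← vectorField_single, opH_apply, vectorField_apply, vectorField_apply, vectorField_apply,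
      ← sum_add_distrib]
    exact sum_congr rfl fun _ _ => by rw [Pi.add_apply, add_mul]
  rw [e]
  refine vectorField_mem_degIdeal' (fun p => ?_) hq
  rcases p with μ | j
  · have := subst_mem_degIdeal (inl_mem (k := k) (n := L.n)) (seriesA_mem L i μ)
    rw [← renX_apply] at this
    simpa [modelField] using this
  · have h1 := neg_mem (subst_mem_degIdeal (inr_mem (k := k) (m := L.m)) (rightField_sub_mem L i j))
    have hs := hasSubst_of_mem (inr_mem (k := k) (m := L.m) (n := L.n))
    rw [sub_eq_add_neg, subst_add hs, subst_neg hs, neg_add, neg_neg] at h1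
    convert h1 using 1
    rw [Pi.add_apply]
    congr 1
    rcases eq_or_ne j i with rfl | hj
    · rw [Pi.single_eq_same, Pi.single_eq_same, subst_one hs]
    · rw [Pi.single_eq_of_ne hj, Pi.single_eq_of_ne (by simpa using hj), subst_zero hs]

theorem word_sub_derivWord_mem (w : List (Fin L.n)) {s : ℕ}
    {f : PS (Fin L.m ⊕ Fin L.n) k} (hf : f ∈ degIdeal k _ (w.length + s)) :
    (w.map (opH L)).prod f - (-1 : k) ^ w.length • derivWord w f ∈ degIdeal k _ (s + 1) := by
  induction w generalizing s with
  | nil => simp [derivWord]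
  | cons i w ih =>
    rw [List.length_cons, add_assoc, add_comm 1] at hf
    have h1 := ih hf
    have h2 := derivWord_mem w hf
    have h3 : opH L i ((w.map (opH L)).prod f - (-1 : k) ^ w.length • derivWord w f) ∈
        degIdeal k _ (s + 1) := vectorField_mem_degIdeal _ h1
    have h4 := smul_mem_degIdeal ((-1 : k) ^ w.length) (opH_add_pderiv_mem L i h2)
    have h5 := add_mem h3 h4
    convert h5 using 1
    rw [map_sub, map_smul, List.map_cons, List.prod_cons, Module.End.mul_apply, List.length_cons,
      pow_succ, smul_add, mul_neg_one, neg_smul]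
    change _ - -((-1 : k) ^ w.length • pderiv k (Sum.inr i) (derivWord w f)) = _
    abel

theorem sum_single_sortedWord {m n : ℕ} (e : Fin n →₀ ℕ) :
    ((List.ofFn fun j => List.replicate (e j) j).flatten.map
      fun i => (single (Sum.inr i) 1 : Fin m ⊕ Fin n →₀ ℕ)).sum = sumElim 0 e := by
  have h : ∀ (w : List (Fin n)) (p : Fin m ⊕ Fin n),
      ((w.map fun i => (single (Sum.inr i) 1 : Fin m ⊕ Fin n →₀ ℕ)).sum) p =
        Sum.elim (fun _ => 0) (fun i => w.count i) p := by
    intro w p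
    induction w with
    | nil => rcases p with p | p <;> simp
    | cons i w ih =>
      rw [List.map_cons, List.sum_cons, Finsupp.add_apply, ih]
      rcases p with p | p
      · simp
      · simp [List.count_cons, Finsupp.single_apply, add_comm]
  ext p
  rw [h]
  rcases p with p | p
  · simp
  · simp [count_sortedWord]

/-- The operators which represent the polynomials in the `H_i`. -/
def opPol : ((Fin L.n →₀ ℕ) →₀ k) →ₗ[k] ModelEnd L :=
  Finsupp.linearCombination k (orderedMonomial (opH L))

theorem eq_zero_of_opPol {p : (Fin L.n →₀ ℕ) →₀ k}
    (hp : ∀ g, constantCoeff (opPol L p g) = 0) : p = 0 := by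
  by_contra h
  obtain ⟨e₀, he₀, hmax⟩ := Finset.exists_max_image p.support (fun e => e.degree)
    (Finsupp.support_nonempty_iff.2 h)
  set g : PS (Fin L.m ⊕ Fin L.n) k := monomial (sumElim 0 e₀) 1 with hg
  have hdeg : (sumElim (0 : Fin L.m →₀ ℕ) e₀).degree = e₀.degree := by simp [Finsupp.degree_eq_sum]
  have hgm : g ∈ degIdeal k _ e₀.degree := hdeg ▸ monomial_mem_degIdeal _ _
  have key : ∀ e ∈ p.support, ∃ K : k, K ≠ 0 ∧
      constantCoeff (orderedMonomial (opH L) e g) = if e = e₀ then K else 0 := by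
    intro e he
    obtain ⟨K, hK, hd⟩ := coeff_derivWord (k := k)
      (List.ofFn fun j => List.replicate (e j) j).flatten (0 : Fin L.m ⊕ Fin L.n →₀ ℕ)
    have hlen : (List.ofFn fun j => List.replicate (e j) j).flatten.length = e.degree := by
      rw [List.length_flatten, List.map_ofFn, List.sum_ofFn, Finsupp.degree_eq_sum]
      simp
    refine ⟨(-1) ^ e.degree * K, mul_ne_zero (pow_ne_zero _ (by simp)) hK, ?_⟩
    have h1 := word_sub_derivWord_mem L (List.ofFn fun j => List.replicate (e j) j).flatten
      (s := e₀.degree - e.degree) (f := g) (by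
        rw [hlen, Nat.add_sub_cancel' (hmax e he)]; exact hgm)
    have h2 := mem_degIdeal_one.1 (degIdeal_mono (Nat.le_add_left 1 _) h1)
    rw [map_sub, sub_eq_zero, ← orderedMonomial_eq_word, hlen, ← coeff_zero_eq_constantCoeff_apply,
      ← coeff_zero_eq_constantCoeff_apply, coeff_smul, hd, sum_single_sortedWord, zero_add] at h2
    rw [← coeff_zero_eq_constantCoeff_apply, h2, hg, coeff_monomial]
    have : (sumElim (0 : Fin L.m →₀ ℕ) e = sumElim 0 e₀) ↔ e = e₀ := by
      refine ⟨fun h => ?_, fun h => by rw [h]⟩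
      ext j
      simpa using congr_fun h (Sum.inr j)
    simp only [this]
    split_ifs <;> simp
  have h1 := hp g
  rw [opPol, Finsupp.linearCombination_apply, Finsupp.sum, LinearMap.sum_apply, map_sum,
    sum_eq_single e₀] at h1
  · obtain ⟨K, hK, h2⟩ := key e₀ he₀
    rw [LinearMap.smul_apply, constantCoeff_smul, h2, if_pos rfl, smul_eq_mul] at h1
    exact mul_ne_zero (Finsupp.mem_support_iff.1 he₀) hK h1
  · intro e he hne
    obtain ⟨K, hK, h2⟩ := key e he
    rw [LinearMap.smul_apply, constantCoeff_smul, h2, if_neg hne, smul_zero]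
  · exact fun h => absurd he₀ h

end Model

section Division

variable [Fintype τ]

/-- The division by the degree. -/
def divDegree (k : Type u) [Field k] (τ : Type) : PS τ k →ₗ[k] PS τ k where
  toFun f := fun d => coeff d f / d.degree
  map_add' f g := by
    ext d
    exact add_div _ _ _
  map_smul' c f := by
    ext d
    exact mul_div_assoc _ _ _

theorem coeff_divDegree (d : τ →₀ ℕ) (f : PS τ k) :
    coeff d (divDegree k τ f) = coeff d f / d.degree := rfl

/-- Linear maps `f ↦ f_i` such that `f = ∑ x_i f_i` if `f` has no constant term. -/
def divX (i : τ) : PS τ k →ₗ[k] PS τ k :=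
  (pderiv k i).toLinearMap ∘ₗ divDegree k τ

theorem divX_mem_degIdeal {N : ℕ} {f : PS τ k} (hf : f ∈ degIdeal k τ (N + 1)) (i : τ) :
    divX i f ∈ degIdeal k τ N :=
  pderiv_mem_degIdeal (fun d hd => by rw [coeff_divDegree, hf d hd, zero_div]) i

theorem sum_X_mul_divX {f : PS τ k} (hf : f ∈ degIdeal k τ 1) : ∑ i, X i * divX i f = f := by
  have e : ∑ i, X i * divX i f = euler k τ (divDegree k τ f) := (vectorField_apply _ _).symm
  rw [e]
  ext d
  rw [coeff_euler, coeff_divDegree]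
  rcases Nat.eq_zero_or_pos d.degree with h | h
  · rw [hf d (by omega), zero_div, mul_zero]
  · exact mul_div_cancel₀ _ (Nat.cast_ne_zero.2 h.ne')

end Division

section Model

variable (L : InhomLieBialgebra k)

/-- The operator which represents `∑ f_e H^e`. -/
def pbwMap : ((Fin L.n →₀ ℕ) →₀ PS (Fin L.m) k) →ₗ[k] ModelEnd L :=
  Finsupp.lsum k fun e =>
    LinearMap.mulRight k (orderedMonomial (opH L) e) ∘ₗ (opEv L).toLinearMap

theorem pbwMap_eq (f : (Fin L.n →₀ ℕ) →₀ PS (Fin L.m) k) :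
    pbwMap L f = f.sum fun e a => opEv L a * orderedMonomial (opH L) e := rfl

theorem pbwMap_apply (f : (Fin L.n →₀ ℕ) →₀ PS (Fin L.m) k)
    (g : PS (Fin L.m ⊕ Fin L.n) k) : pbwMap L f g =
      ∑ e ∈ f.support, renX k L.m L.n (f e) * orderedMonomial (opH L) e g := by
  rw [pbwMap_eq, Finsupp.sum, LinearMap.sum_apply]
  rfl

theorem pbwMap_single (e : Fin L.n →₀ ℕ) (a : PS (Fin L.m) k) :
    pbwMap L (single e a) = opEv L a * orderedMonomial (opH L) e := by
  rw [pbwMap, Finsupp.lsum_single]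
  rfl

theorem pbwMap_mem_pbwSpan (f : (Fin L.n →₀ ℕ) →₀ PS (Fin L.m) k) :
    pbwMap L f ∈ pbwSpan (opEv L) (opH L) := by
  rw [pbwMap_eq]
  exact sum_mem fun e _ => subset_span ⟨(f e, e), rfl⟩

theorem exists_pbwMap {s : ModelEnd L}
    (hs : s ∈ pbwSpan (opEv L) (opH L)) : ∃ f, pbwMap L f = s := by
  have : pbwSpan (opEv L) (opH L) ≤ LinearMap.range (pbwMap L) := by
    refine Submodule.span_le.2 ?_
    rintro _ ⟨⟨a, e⟩, rfl⟩
    exact ⟨single e a, pbwMap_single L e a⟩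
  exact this hs

theorem pbwMap_mem_xIdeal {N : ℕ} {f : (Fin L.n →₀ ℕ) →₀ PS (Fin L.m) k}
    (hf : ∀ e, f e ∈ degIdeal k _ N) (g : PS (Fin L.m ⊕ Fin L.n) k) :
    pbwMap L f g ∈ xIdeal k _ _ N := by
  rw [pbwMap_apply]
  exact sum_mem fun e _ => Ideal.mul_mem_right _ _ (renX_mem (hf e))

theorem coeff_renX {m n : ℕ} (f : PS (Fin m) k) (d : Fin m →₀ ℕ) :
    coeff (sumElim d 0) (renX k m n f) = coeff d f := by
  classical
  refine LinearMap.congr_fun (linearMap_ext_of_monomial (S := coeff _ ∘ₗ (renX k m n).toLinearMap)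
    (T := coeff d) (N := d.degree + 1) (fun f hf => renX_mem hf _ ?_)
    (fun f hf => hf d (Nat.lt_succ_self _)) fun e => ?_) f
  · rw [xdeg_sumElim]
    exact Nat.lt_succ_self _
  · rw [LinearMap.comp_apply, AlgHom.toLinearMap_apply, renX_monomial, coeff_monomial,
      coeff_monomial]
    refine if_congr ⟨fun h => ?_, fun h => by rw [h]⟩ rfl rfl
    ext j
    simpa using congr_fun h (Sum.inl j)

theorem coeff_renX_mul {m n r : ℕ} {f : PS (Fin m) k} (hf : f ∈ degIdeal k _ r)
    {d : Fin m →₀ ℕ} (hd : d.degree = r) (g : PS (Fin m ⊕ Fin n) k) :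
    coeff (sumElim d 0) (renX k m n f * g) = coeff d f * constantCoeff g := by
  classical
  rw [coeff_mul, sum_eq_single (sumElim d 0, 0)]
  · rw [coeff_renX, coeff_zero_eq_constantCoeff_apply]
  · rintro ⟨p, q⟩ hp hne
    have h1 := mem_antidiagonal.1 hp
    have h2 := congrArg xdeg h1
    rw [xdeg_add, xdeg_sumElim, hd] at h2
    rcases lt_or_ge (xdeg p) r with h | h
    · rw [renX_mem hf p h, zero_mul]
    · exfalso
      have h3 : xdeg q = 0 := by simp only at h2; omega
      have hq : q = 0 := by
        ext c
        rcases c with c | c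
        · exact (Finset.sum_eq_zero_iff.1 h3) c (mem_univ _)
        · have := congr_fun h1 (Sum.inr c)
          simp at this
          exact this.2
      subst hq
      rw [add_zero] at h1
      exact hne (Prod.ext h1 rfl)
  · intro h
    exact absurd (mem_antidiagonal.2 (add_zero _)) h

theorem mem_degIdeal_of_pbwMap {N : ℕ} {f : (Fin L.n →₀ ℕ) →₀ PS (Fin L.m) k}
    (hf : ∀ g, pbwMap L f g ∈ xIdeal k _ _ N) (e : Fin L.n →₀ ℕ) : f e ∈ degIdeal k _ N := by
  induction N generalizing e with
  | zero => exact mem_degIdeal_zero _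
  | succ N ih =>
    have ih' := ih fun g => xIdeal_mono (Nat.le_succ N) (hf g)
    intro d hd
    rcases (Nat.le_of_lt_succ hd).lt_or_eq with h | h
    · exact ih' e d h
    have h1 := eq_zero_of_opPol L (p := f.mapRange (coeff d) (map_zero _)) fun g => by
      have h2 := hf g (sumElim d 0) (by rw [xdeg_sumElim]; exact hd)
      rw [pbwMap_apply, map_sum] at h2
      rw [opPol, Finsupp.linearCombination_apply, Finsupp.sum_mapRange_index (by simp), Finsupp.sum,
        LinearMap.sum_apply, map_sum, ← h2]
      refine sum_congr rfl fun e _ => ?_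
      rw [coeff_renX_mul (ih' e) h, LinearMap.smul_apply, constantCoeff_smul, smul_eq_mul]
    have := congr_fun h1 e
    simpa using this

theorem exists_limit (u : ℕ → ModelEnd L)
    (hu : ∀ N g, (u (N + 1) - u N) g ∈ xIdeal k _ _ N) :
    ∃ T : ModelEnd L, ∀ N g, (T - u N) g ∈ xIdeal k _ _ N := by
  have hle : ∀ N r g, (u (N + r) - u N) g ∈ xIdeal k _ _ N := by
    intro N r g
    induction r with
    | zero => simp
    | succ r ih =>
      have := add_mem (xIdeal_mono (Nat.le_add_right N r) (hu (N + r) g)) ih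
      rwa [← LinearMap.add_apply, sub_add_sub_cancel] at this
  refine ⟨{ toFun := fun g c => coeff c (u (xdeg c + 1) g)
            map_add' := fun f g => by
              ext c
              change coeff c (u _ (f + g)) = coeff c (u _ f) + coeff c (u _ g)
              rw [map_add, map_add]
            map_smul' := fun a f => by
              ext c
              change coeff c (u _ (a • f)) = a • coeff c (u _ f)
              rw [map_smul, map_smul] }, fun N g c hc => ?_⟩
  have h1 := hle (xdeg c + 1) (N - (xdeg c + 1)) g c (Nat.lt_succ_self _)
  rw [Nat.add_sub_cancel' hc, LinearMap.sub_apply, map_sub, sub_eq_zero] at h1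
  rw [LinearMap.sub_apply, map_sub, sub_eq_zero]
  exact h1.symm

/-- The completion of the algebra of operators generated by the `H_i` and `X^μ`. -/
def modelAlgebra : Subalgebra k (ModelEnd L) where
  carrier := {T | ∀ N, ∃ s ∈ pbwSpan (opEv L) (opH L), ∀ g, (T - s) g ∈ xIdeal k _ _ N}
  add_mem' hS hT N := by
    obtain ⟨s, hs, h1⟩ := hS N
    obtain ⟨t, ht, h2⟩ := hT N
    refine ⟨s + t, add_mem hs ht, fun g => ?_⟩
    rw [add_sub_add_comm, LinearMap.add_apply]
    exact add_mem (h1 g) (h2 g)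
  mul_mem' {S T} hS hT N := by
    obtain ⟨s, hs, h1⟩ := hS N
    obtain ⟨t, ht, h2⟩ := hT N
    refine ⟨s * t, mul_mem_pbwSpan (pbwRel_op L).comm_hh (pbwRel_op L).comm_ev hs ht, fun g => ?_⟩
    have e : S * T - s * t = (S - s) * T + s * (T - t) := by
      rw [sub_mul, mul_sub, sub_add_sub_cancel]
    rw [e, LinearMap.add_apply, Module.End.mul_apply, Module.End.mul_apply]
    exact add_mem (h1 _) (pbwSpan_mem_xIdeal L hs (h2 g))
  algebraMap_mem' c N := by
    refine ⟨_, eval_mem_pbwSpan (algebraMap k _ c), fun g => ?_⟩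
    rw [AlgHom.commutes, sub_self]
    exact zero_mem _

theorem mem_modelAlgebra_of_mem_pbwSpan {s : ModelEnd L}
    (hs : s ∈ pbwSpan (opEv L) (opH L)) : s ∈ modelAlgebra L :=
  fun _ => ⟨s, hs, fun g => by rw [sub_self]; exact zero_mem _⟩

variable {T : ModelEnd L}

theorem modelAlgebra_mem_xIdeal (hT : T ∈ modelAlgebra L) {N : ℕ} {g : PS (Fin L.m ⊕ Fin L.n) k}
    (hg : g ∈ xIdeal k _ _ N) : T g ∈ xIdeal k _ _ N := by
  obtain ⟨s, hs, h⟩ := hT N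
  have := add_mem (h g) (pbwSpan_mem_xIdeal L hs hg)
  rwa [← LinearMap.add_apply, sub_add_cancel] at this

theorem mem_modelAlgebra_of_limit
    {u : ℕ → ModelEnd L} (hu : ∀ N, u N ∈ modelAlgebra L)
    (h : ∀ N g, (T - u N) g ∈ xIdeal k _ _ N) : T ∈ modelAlgebra L := by
  intro N
  obtain ⟨s, hs, hN⟩ := hu N N
  refine ⟨s, hs, fun g => ?_⟩
  have := add_mem (h N g) (hN g)
  rwa [← LinearMap.add_apply, sub_add_sub_cancel] at this

theorem exists_eq_sum_X_mul {N : ℕ}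
    (hT : T ∈ modelAlgebra L) (hN : ∀ g, T g ∈ xIdeal k _ _ (N + 1)) :
    ∃ S : Fin L.m → ModelEnd L,
      (∀ μ, S μ ∈ modelAlgebra L) ∧ (∀ μ g, S μ g ∈ xIdeal k _ _ N) ∧
      T = ∑ μ, opEv L (X μ) * S μ := by
  have h1 : ∀ K, ∃ f, ∀ g, (T - pbwMap L f) g ∈ xIdeal k _ _ K := by
    intro K
    obtain ⟨s, hs, h⟩ := hT K
    obtain ⟨f, rfl⟩ := exists_pbwMap L hs
    exact ⟨f, h⟩
  choose f hf using h1
  have hsub : ∀ K e, (f (K + 1) - f K) e ∈ degIdeal k _ K := fun K => mem_degIdeal_of_pbwMap L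
    fun g => by
      have := sub_mem (hf K g) (xIdeal_mono (Nat.le_succ K) (hf (K + 1) g))
      rwa [← LinearMap.sub_apply, sub_sub_sub_cancel_left, ← map_sub] at this
  have hmem : ∀ K, K ≤ N + 1 → ∀ e, f K e ∈ degIdeal k _ K := fun K hK => mem_degIdeal_of_pbwMap L
    fun g => by
      have := sub_mem (xIdeal_mono hK (hN g)) (hf K g)
      rwa [← LinearMap.sub_apply, sub_sub_cancel] at this
  have hmem1 : ∀ K e, f (K + 1) e ∈ degIdeal k _ 1 := fun K => mem_degIdeal_of_pbwMap L fun g => by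
      have := sub_mem (xIdeal_mono (Nat.le_add_left 1 N) (hN g))
        (xIdeal_mono (Nat.le_add_left 1 K) (hf (K + 1) g))
      rwa [← LinearMap.sub_apply, sub_sub_cancel] at this
  let u : Fin L.m → ℕ → ModelEnd L := fun μ K =>
    pbwMap L ((f (K + 1)).mapRange (divX μ) (map_zero _))
  have hlim : ∀ μ, ∃ S, ∀ K g, (S - u μ K) g ∈ xIdeal k _ _ K := fun μ =>
    exists_limit L (u μ) fun K g => by
      rw [← map_sub, ← Finsupp.mapRange_sub (fun _ _ => map_sub _ _ _)]
      refine pbwMap_mem_xIdeal L (fun e => ?_) g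
      rw [Finsupp.mapRange_apply]
      exact divX_mem_degIdeal (hsub (K + 1) e) μ
  choose S hS using hlim
  have hu : ∀ K, pbwMap L (f (K + 1)) = ∑ μ, opEv L (X μ) * u μ K := by
    intro K
    ext1 g
    rw [LinearMap.sum_apply, pbwMap_apply]
    simp only [Module.End.mul_apply, opEv_apply, u]
    have e : ∀ μ, pbwMap L ((f (K + 1)).mapRange (divX μ) (map_zero _)) g =
        ∑ e ∈ (f (K + 1)).support, renX k L.m L.n (divX μ (f (K + 1) e)) *
          orderedMonomial (opH L) e g := by
      intro μ
      rw [pbwMap_eq, Finsupp.sum_mapRange_index (by simp), Finsupp.sum, LinearMap.sum_apply]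
      rfl
    simp only [e, mul_sum]
    rw [sum_comm]
    refine sum_congr rfl fun e _ => ?_
    simp only [← mul_assoc, ← map_mul]
    rw [← sum_mul, ← map_sum, sum_X_mul_divX (hmem1 K e)]
  refine ⟨S, fun μ => mem_modelAlgebra_of_limit L
    (fun K => mem_modelAlgebra_of_mem_pbwSpan L (pbwMap_mem_pbwSpan L _)) (hS μ), fun μ g => ?_, ?_⟩
  · have h1 := hS μ N g
    have h2 := pbwMap_mem_xIdeal L (f := (f (N + 1)).mapRange (divX μ) (map_zero _)) (N := N)
      (fun e => divX_mem_degIdeal (hmem (N + 1) le_rfl e) μ) g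
    have := add_mem h1 h2
    rwa [← LinearMap.add_apply, sub_add_cancel] at this
  · ext1 g
    refine sub_eq_zero.1 (eq_zero_of_mem_xIdeal fun K => ?_)
    have h1 := xIdeal_mono (Nat.le_succ K) (hf (K + 1) g)
    have h2 : ∑ μ, renX k L.m L.n (X μ) * (S μ - u μ K) g ∈ xIdeal k L.m L.n K :=
      sum_mem fun μ _ => Ideal.mul_mem_left _ _ (hS μ K g)
    have h3 := sub_mem h1 h2
    convert h3 using 1
    rw [hu, LinearMap.sub_apply, LinearMap.sum_apply, LinearMap.sum_apply]
    simp only [LinearMap.sub_apply, mul_sub, sum_sub_distrib, Module.End.mul_apply, opEv_apply]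
    abel

end Model

section TwoSided

variable {U : Type*} [Ring U] {ι : Type*} (x : ι → U)

theorem isTwoSided_span : (Ideal.span {y | ∃ a b μ, y = a * x μ * b}).IsTwoSided := by
  refine ⟨fun {a} c ha => ?_⟩
  induction ha using Submodule.span_induction with
  | mem y hy =>
    obtain ⟨a, b, μ, rfl⟩ := hy
    exact Ideal.subset_span ⟨a, b * c, μ, by simp only [mul_assoc]⟩
  | zero => rw [zero_mul]; exact zero_mem _
  | add y z _ _ hy hz => rw [add_mul]; exact add_mem hy hz
  | smul a y _ hy => rw [smul_mul_assoc]; exact Submodule.smul_mem _ _ hy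

theorem mem_span_of_gen (μ : ι) : x μ ∈ Ideal.span {y | ∃ a b μ, y = a * x μ * b} :=
  Ideal.subset_span ⟨1, 1, μ, by simp⟩

end TwoSided

section TruncEval

variable {U : Type u} [Ring U] [Algebra k U] {r : ℕ}

theorem truncTotal_eq_sum (N : ℕ) (f : PS (Fin r) k) : truncTotal N f =
    ∑ a ∈ Finset.range N, ∑ d ∈ finsuppAntidiag Finset.univ a,
      MvPolynomial.monomial d (coeff d f) := by
  classical
  ext d
  have h : ∀ a, ∑ e ∈ finsuppAntidiag Finset.univ a,
      MvPolynomial.coeff d (MvPolynomial.monomial e (coeff e f)) =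
        if a = d.degree then coeff d f else 0 := by
    intro a
    simp only [MvPolynomial.coeff_monomial]
    rw [Finset.sum_ite_eq']
    simp only [Finset.mem_finsuppAntidiag, Finset.subset_univ, and_true, Finsupp.degree_eq_sum,
      eq_comm]
  simp only [MvPolynomial.coeff_sum, h]
  rw [Finset.sum_ite_eq']
  split_ifs with hd
  · exact coeff_truncTotal f (Finset.mem_range.1 hd)
  · exact coeff_truncTotal_eq_zero _ (by simpa using hd)

theorem orderedMonomial_eq_algHom (g : MvPolynomial (Fin r) k →ₐ[k] U) (d : Fin r →₀ ℕ) :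
    orderedMonomial (fun μ => g (MvPolynomial.X μ)) d = g (MvPolynomial.monomial d 1) := by
  rw [MvPolynomial.monomial_eq, MvPolynomial.C_1, one_mul, Finsupp.prod_fintype _ _ (by simp),
    ← List.prod_ofFn, map_list_prod, List.map_ofFn, orderedMonomial]
  congr 2
  funext j
  simp

theorem truncEval_eq_algHom (g : MvPolynomial (Fin r) k →ₐ[k] U) (N : ℕ) (f : PS (Fin r) k) :
    truncEval N f (fun μ => g (MvPolynomial.X μ)) = g (truncTotal N f) := by
  rw [truncTotal_eq_sum, truncEval, map_sum]
  refine sum_congr rfl fun a _ => ?_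
  rw [map_sum]
  refine sum_congr rfl fun d _ => ?_
  rw [orderedMonomial_eq_algHom, ← map_smul, MvPolynomial.smul_monomial, smul_eq_mul, mul_one]

theorem mem_pow_zero (I : Ideal U) (a : U) : a ∈ I ^ 0 := by
  rw [Submodule.pow_zero, Ideal.one_eq_top]
  exact Submodule.mem_top

theorem algHom_monomial_mem {I : Ideal U} [I.IsTwoSided] {g : MvPolynomial (Fin r) k →ₐ[k] U}
    (hg : ∀ μ, g (MvPolynomial.X μ) ∈ I) (d : Fin r →₀ ℕ) :
    g (MvPolynomial.monomial d 1) ∈ I ^ d.degree := by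
  induction d using Finsupp.induction_linear with
  | zero => rw [map_zero]; exact mem_pow_zero I _
  | add d e hd he =>
    have : (MvPolynomial.monomial (d + e) 1 : MvPolynomial (Fin r) k) =
        MvPolynomial.monomial d 1 * MvPolynomial.monomial e 1 := by
      rw [MvPolynomial.monomial_mul, one_mul]
    rw [this, map_mul, map_add, Ideal.IsTwoSided.pow_add]
    exact Ideal.mul_mem_mul hd he
  | single i s =>
    rw [← MvPolynomial.X_pow_eq_monomial, map_pow, Finsupp.degree_single]
    exact Submodule.pow_mem_pow I (hg i) s

/-- The evaluation of formal series modulo `I ^ N`. -/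
theorem exists_modEval {I : Ideal U} [I.IsTwoSided] {x : Fin r → U} (hx : ∀ μ, x μ ∈ I)
    (hc : ∀ μ ν, x μ * x ν - x ν * x μ = 0) (N : ℕ) :
    ∃ ev : PS (Fin r) k →ₐ[k] U ⧸ I ^ N, (∀ f ∈ degIdeal k _ N, ev f = 0) ∧
      (∀ f, ev f = mkₐ k (I ^ N) (truncEval N f x)) ∧
      ∀ μ, ev (X μ) = mkₐ k (I ^ N) (x μ) := by
  obtain ⟨g, hg⟩ := exists_algHom_of_commute (k := k) x fun i j => sub_eq_zero.1 (hc i j)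
  obtain ⟨ev, hev, h0⟩ := exists_eval ((mkₐ k (I ^ N)).comp g) N fun d hd =>
    eq_zero_iff_mem.2 (Ideal.pow_le_pow_right hd
      (algHom_monomial_mem (fun μ => by rw [hg]; exact hx μ) d))
  refine ⟨ev, h0, fun f => ?_, fun μ => by rw [← MvPolynomial.coe_X, hev, ← hg]; rfl⟩
  have h := h0 _ (sub_truncTotal_mem_degIdeal N f)
  rw [map_sub, sub_eq_zero] at h
  rw [h, hev, ← funext hg, truncEval_eq_algHom]
  rfl

end TruncEval

section PBW

/-- The complete algebra `U` has the commutation relations and the size of the quantization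
of `L`. -/
structure IsPBW (L : InhomLieBialgebra k) {U : Type u} [Ring U] [Algebra k U] (I : Ideal U)
    [I.IsTwoSided] (h : Fin L.n → U) (x : Fin L.m → U) : Prop where
  ideal_eq : I = Ideal.span {y | ∃ a b μ, y = a * x μ * b}
  separated : ∀ a : U, (∀ N, a ∈ I ^ N) → a = 0
  complete : ∀ a : ℕ → U, (∀ N, a (N + 1) - a N ∈ I ^ N) → ∃ v, ∀ N, v - a N ∈ I ^ N
  basis_indep : ∀ N, LinearIndependent k
    fun p : {d : Fin L.m →₀ ℕ // d.degree < N} × (Fin L.n →₀ ℕ) =>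
      mkₐ k (I ^ N) (orderedMonomial x p.1 * orderedMonomial h p.2)
  basis_span : ∀ N, span k (Set.range fun p : {d : Fin L.m →₀ ℕ // d.degree < N} × (Fin L.n →₀ ℕ) =>
      mkₐ k (I ^ N) (orderedMonomial x p.1 * orderedMonomial h p.2)) = ⊤
  comm_xx : ∀ μ ν, x μ * x ν - x ν * x μ = 0
  comm_hh : ∀ i j, h i * h j - h j * h i = ∑ l, L.C i j l • h l
  comm_hx : ∀ N i μ, h i * x μ - x μ * h i - truncEval N (L.seriesA i μ) x ∈ I ^ N

variable (L : InhomLieBialgebra k)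

/-- The model of the quantization of `L`. -/
def Model : Type u := modelAlgebra L

instance : Ring (Model L) := inferInstanceAs (Ring (modelAlgebra L))

instance : Algebra k (Model L) := inferInstanceAs (Algebra k (modelAlgebra L))

/-- The representation of the model by operators. -/
def Model.val : Model L →ₐ[k] ModelEnd L :=
  (modelAlgebra L).val

theorem Model.val_mem (T : Model L) : Model.val L T ∈ modelAlgebra L := T.2

theorem Model.val_injective : Function.Injective (Model.val L) := Subtype.val_injective

theorem Model.exists_val {T : ModelEnd L}
    (hT : T ∈ modelAlgebra L) : ∃ S : Model L, Model.val L S = T := ⟨⟨T, hT⟩, rfl⟩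

/-- The generators `H_i` of the model. -/
def modelH (i : Fin L.n) : Model L :=
  ⟨opH L i, mem_modelAlgebra_of_mem_pbwSpan L (gen_mem_pbwSpan (pbwRel_op L).comm_hh i)⟩

/-- The formal series in the `X^μ` in the model. -/
def modelEv : PS (Fin L.m) k →ₐ[k] Model L :=
  (opEv L).codRestrict (modelAlgebra L) fun f =>
    mem_modelAlgebra_of_mem_pbwSpan L (eval_mem_pbwSpan f)

/-- The generators `X^μ` of the model. -/
def modelX (μ : Fin L.m) : Model L := modelEv L (X μ)

theorem val_modelH (i : Fin L.n) : Model.val L (modelH L i) = opH L i := rfl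

theorem val_modelEv (f : PS (Fin L.m) k) : Model.val L (modelEv L f) = opEv L f := rfl

/-- The ideal generated by the `X^μ` in the model. -/
def modelIdeal : Ideal (Model L) := Ideal.span {y | ∃ a b μ, y = a * modelX L μ * b}

instance : (modelIdeal L).IsTwoSided := isTwoSided_span (modelX L)

/-- The operators which raise the `X`-degree by `N`. -/
def raiseIdeal (N : ℕ) : Ideal (Model L) where
  carrier := {T | ∀ M, ∀ g ∈ xIdeal k _ _ M, Model.val L T g ∈ xIdeal k _ _ (M + N)}
  add_mem' {S T} hS hT M g hg := by
    rw [map_add]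
    exact add_mem (hS M g hg) (hT M g hg)
  zero_mem' _ _ _ := by
    rw [map_zero]
    exact zero_mem _
  smul_mem' S T hT M g hg := by
    rw [smul_eq_mul, map_mul]
    exact modelAlgebra_mem_xIdeal L (Model.val_mem L S) (hT M g hg)

theorem modelIdeal_pow_le (N : ℕ) : modelIdeal L ^ N ≤ raiseIdeal L N := by
  induction N with
  | zero => exact fun T _ M g hg => modelAlgebra_mem_xIdeal L (Model.val_mem L T) hg
  | succ N ih =>
    rw [Submodule.pow_succ]
    refine Ideal.mul_le.2 fun S hS T hT M g hg => ?_
    have h1 : modelIdeal L ≤ raiseIdeal L 1 := by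
      refine Ideal.span_le.2 ?_
      rintro _ ⟨a, b, μ, rfl⟩ M g hg
      rw [map_mul, map_mul]
      refine modelAlgebra_mem_xIdeal L (T := Model.val L a) (Model.val_mem L a) ?_
      rw [add_comm]
      exact mul_mem_xIdeal (renX_mem (X_mem_degIdeal μ))
        (modelAlgebra_mem_xIdeal L (Model.val_mem L b) hg)
    have := ih hS _ _ (h1 hT M g hg)
    rw [map_mul]
    rwa [add_assoc, add_comm 1] at this

theorem mem_modelIdeal_pow {N : ℕ} {T : Model L} :
    T ∈ modelIdeal L ^ N ↔ ∀ g, Model.val L T g ∈ xIdeal k _ _ N := by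
  refine ⟨fun h g => ?_, fun h => ?_⟩
  · have := modelIdeal_pow_le L N h 0 g (mem_xIdeal_zero g)
    rwa [zero_add] at this
  · induction N generalizing T with
    | zero => exact mem_pow_zero _ _
    | succ N ih =>
      obtain ⟨S, hS, hN, e⟩ := exists_eq_sum_X_mul L (Model.val_mem L T) h
      choose S' hS' using fun μ => Model.exists_val L (hS μ)
      have : T = ∑ μ, modelX L μ * S' μ := by
        refine Model.val_injective L (e.trans ?_)
        rw [map_sum]
        exact sum_congr rfl fun μ _ => by rw [map_mul, hS']; rfl
      rw [this, Ideal.IsTwoSided.pow_succ]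
      refine sum_mem fun μ _ => Ideal.mul_mem_mul (mem_span_of_gen (modelX L) μ) (ih fun g => ?_)
      rw [hS']
      exact hN μ g

theorem modelEv_mem {N : ℕ} {f : PS (Fin L.m) k} (hf : f ∈ degIdeal k _ N) :
    modelEv L f ∈ modelIdeal L ^ N :=
  (mem_modelIdeal_pow L).2 fun _ => Ideal.mul_mem_right _ _ (renX_mem hf)

theorem val_orderedMonomial_modelX (d : Fin L.m →₀ ℕ) :
    Model.val L (orderedMonomial (modelX L) d) = opEv L (monomial d 1) := by
  have : orderedMonomial (modelX L) d = modelEv L (monomial d 1) := orderedMonomial_eval _ _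
  rw [this, val_modelEv]

theorem val_orderedMonomial_modelH (e : Fin L.n →₀ ℕ) :
    Model.val L (orderedMonomial (modelH L) e) = orderedMonomial (opH L) e :=
  map_orderedMonomial (Model.val L) (modelH L) e

theorem model_basis_indep (N : ℕ) : LinearIndependent k
    fun p : {d : Fin L.m →₀ ℕ // d.degree < N} × (Fin L.n →₀ ℕ) =>
      mkₐ k (modelIdeal L ^ N)
        (orderedMonomial (modelX L) p.1 * orderedMonomial (modelH L) p.2) := by
  classical
  rw [linearIndependent_iff]
  intro c hc
  let f : (Fin L.n →₀ ℕ) →₀ PS (Fin L.m) k :=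
    ∑ p ∈ c.support, single p.2 (monomial p.1.1 (c p))
  have hf : ∀ g, pbwMap L f g ∈ xIdeal k _ _ N := by
    have h1 : (∑ p ∈ c.support, c p • (orderedMonomial (modelX L) p.1.1 *
        orderedMonomial (modelH L) p.2)) ∈ modelIdeal L ^ N := by
      refine eq_zero_iff_mem.1 ?_
      rw [← hc, Finsupp.linearCombination_apply, Finsupp.sum]
      change mkₐ k _ _ = _
      rw [map_sum]
      exact sum_congr rfl fun p _ => map_smul _ _ _
    have h2 := (mem_modelIdeal_pow L).1 h1
    convert h2 using 3
    rw [map_sum, map_sum]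
    refine sum_congr rfl fun p _ => ?_
    rw [pbwMap_single, map_smul, map_mul, val_orderedMonomial_modelX,
      val_orderedMonomial_modelH, ← smul_mul_assoc, ← map_smul, ← map_smul, smul_eq_mul, mul_one]
  ext p
  have h3 := mem_degIdeal_of_pbwMap L hf p.2 p.1.1 p.1.2
  rw [Finsupp.coe_zero, Pi.zero_apply, ← h3]
  simp only [f, Finsupp.finsetSum_apply, map_sum, Finsupp.single_apply]
  rw [sum_eq_single p]
  · simp
  · rintro ⟨d, e⟩ _ hne
    split_ifs with he
    · simp only at he
      subst he
      rw [coeff_monomial, if_neg]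
      exact fun h => hne (Prod.ext (Subtype.ext h.symm) rfl)
    · exact map_zero _
  · intro h
    rw [Finsupp.notMem_support_iff.1 h]
    simp

theorem model_basis_span (N : ℕ) : span k (Set.range
    fun p : {d : Fin L.m →₀ ℕ // d.degree < N} × (Fin L.n →₀ ℕ) =>
      mkₐ k (modelIdeal L ^ N)
        (orderedMonomial (modelX L) p.1 * orderedMonomial (modelH L) p.2)) = ⊤ := by
  let π := mkₐ k (modelIdeal L ^ N)
  have hker : ∀ f ∈ degIdeal k _ N, (π.comp (modelEv L)) f = 0 := fun f hf =>
    eq_zero_iff_mem.2 (modelEv_mem L hf)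
  have hs := pbwSpan_eq (h := fun i => π (modelH L i)) hker
  have he : (fun p : {d : Fin L.m →₀ ℕ // d.degree < N} × (Fin L.n →₀ ℕ) =>
      π (orderedMonomial (modelX L) p.1 * orderedMonomial (modelH L) p.2)) =
      pbwMonomial N (fun μ => (π.comp (modelEv L)) (X μ)) fun i => π (modelH L i) := by
    funext p
    rw [map_mul, map_orderedMonomial, map_orderedMonomial]
    rfl
  rw [he, ← hs, eq_top_iff]
  intro a _
  obtain ⟨T, rfl⟩ := Ideal.Quotient.mk_surjective a
  obtain ⟨s, hsp, hT⟩ := Model.val_mem L T N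
  obtain ⟨f, rfl⟩ := exists_pbwMap L hsp
  have h1 : Ideal.Quotient.mk (modelIdeal L ^ N) T =
      π (f.sum fun e a => modelEv L a * orderedMonomial (modelH L) e) := by
    refine Ideal.Quotient.eq.2 ((mem_modelIdeal_pow L).2 fun g => ?_)
    convert hT g using 2
    rw [pbwMap_eq, map_sub, Finsupp.sum, map_sum]
    congr 1
    exact sum_congr rfl fun e _ => by rw [map_mul, val_orderedMonomial_modelH, val_modelEv]
  rw [h1, Finsupp.sum, map_sum]
  refine sum_mem fun e _ => subset_span ⟨(f e, e), ?_⟩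
  simp only
  rw [map_mul, map_orderedMonomial]
  rfl

theorem isPBW_model : IsPBW L (modelIdeal L) (modelH L) (modelX L) where
  ideal_eq := rfl
  separated T hT := Model.val_injective L (LinearMap.ext fun g => by
    rw [map_zero]
    exact eq_zero_of_mem_xIdeal fun N => (mem_modelIdeal_pow L).1 (hT N) g)
  complete a ha := by
    obtain ⟨T, hT⟩ := exists_limit L (fun N => Model.val L (a N)) fun N g => by
      rw [← map_sub]
      exact (mem_modelIdeal_pow L).1 (ha N) g
    obtain ⟨S, rfl⟩ := Model.exists_val L
      (mem_modelAlgebra_of_limit L (fun N => Model.val_mem L (a N)) hT)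
    refine ⟨S, fun N => (mem_modelIdeal_pow L).2 fun g => ?_⟩
    rw [map_sub]
    exact hT N g
  basis_indep := model_basis_indep L
  basis_span := model_basis_span L
  comm_xx μ ν := by rw [modelX, modelX, ← map_mul, ← map_mul, mul_comm, sub_self]
  comm_hh i j := Model.val_injective L (by
    rw [map_sub, map_mul, map_mul, map_sum]
    simp only [map_smul, val_modelH]
    exact (pbwRel_op L).comm_hh i j)
  comm_hx N i μ := by
    have h1 : modelH L i * modelX L μ - modelX L μ * modelH L i = modelEv L (L.seriesA i μ) :=
      Model.val_injective L (by
        rw [map_sub, map_mul, map_mul, modelX, val_modelEv, val_modelEv, val_modelH,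
          (pbwRel_op L).comm_ev, vectorField_X])
    have h2 : ∀ f, truncEval N f (modelX L) = modelEv L (truncTotal N f : MvPolynomial _ k) := by
      intro f
      have := truncEval_eq_algHom ((modelEv L).comp (MvPolynomial.coeToMvPowerSeries.algHom k)) N f
      have e : modelX L = fun μ => modelEv L (X μ) := rfl
      rw [e]
      simpa using this
    rw [h1, h2, ← map_sub]
    exact modelEv_mem L (sub_truncTotal_mem_degIdeal N _)

end PBW

section TensorEval

variable {σ τ : Type} [Fintype σ] [Fintype τ] {A B : Type u} [Ring A]
  [Algebra k A] [Ring B] [Algebra k B]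

variable {v : σ → PS τ k}

theorem eval_subst_ext {ev : PS τ k →ₐ[k] B} {ev' : PS σ k →ₐ[k] B} {M N : ℕ}
    (hev : ∀ f ∈ degIdeal k τ M, ev f = 0) (hev' : ∀ f ∈ degIdeal k σ N, ev' f = 0) (hv : InMax v)
      (h : ∀ i, ev (v i) = ev' (X i))
    (f : PS σ k) : ev (subst v f) = ev' f := by
  have hs := hasSubst_of_mem hv
  have := algHom_ext_of_X (ev := ev.comp (substAlgHom hs)) (ev' := ev') (N := M + N) (fun f hf => by
      rw [AlgHom.comp_apply, coe_substAlgHom]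
      exact hev _ (degIdeal_mono (Nat.le_add_right M N) (subst_mem_degIdeal hv hf)))
    (fun f hf => hev' f (degIdeal_mono (Nat.le_add_left N M) hf))
    (fun i => by rw [AlgHom.comp_apply, coe_substAlgHom, subst_X hs, h])
  have := congr_fun this f
  rwa [AlgHom.comp_apply, coe_substAlgHom] at this

/-- The composition of an evaluation with a substitution. -/
def evalSubst (ev : PS τ k →ₐ[k] B) (hv : InMax v) : PS σ k →ₐ[k] B :=
  ev.comp (substAlgHom (hasSubst_of_mem hv))

theorem evalSubst_apply (ev : PS τ k →ₐ[k] B) (hv : InMax v) (f : PS σ k) :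
    evalSubst ev hv f = ev (subst v f) := by
  rw [evalSubst, AlgHom.comp_apply, coe_substAlgHom]

theorem evalSubst_X (ev : PS τ k →ₐ[k] B)
    (hv : InMax v) (i : σ) : evalSubst ev hv (X i) = ev (v i) := by
  rw [evalSubst_apply, subst_X (hasSubst_of_mem hv)]

theorem evalSubst_kill {ev : PS τ k →ₐ[k] B} {N : ℕ} (hev : ∀ f ∈ degIdeal k τ N, ev f = 0)
    (hv : InMax v) : ∀ f ∈ degIdeal k σ N, evalSubst ev hv f = 0 := fun f hf => by
  rw [evalSubst_apply]
  exact hev _ (subst_mem_degIdeal hv hf)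

theorem exists_tensorEval {evA : PS σ k →ₐ[k] A} {evB : PS τ k →ₐ[k] B}
    {M N : ℕ} (hA : ∀ f ∈ degIdeal k σ M, evA f = 0) (hB : ∀ f ∈ degIdeal k τ N, evB f = 0) :
    ∃ ev : PS (σ ⊕ τ) k →ₐ[k] A ⊗[k] B, (∀ f ∈ degIdeal k (σ ⊕ τ) (M + N), ev f = 0) ∧
      (∀ d e, ev (monomial (sumElim d e) 1) = evA (monomial d 1) ⊗ₜ evB (monomial e 1)) ∧
      (∀ f, ev (subst (fun i => X (Sum.inl i)) f) = evA f ⊗ₜ 1) ∧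
      ∀ f, ev (subst (fun i => X (Sum.inr i)) f) = 1 ⊗ₜ evB f := by
  obtain ⟨g, hg⟩ := exists_algHom_of_commute (k := k) (τ := σ ⊕ τ) (B := A ⊗[k] B)
    (Sum.elim (fun i => evA (X i) ⊗ₜ 1) fun j => 1 ⊗ₜ evB (X j)) (by
      rintro (i | i) (j | j) <;> simp only [Sum.elim_inl, Sum.elim_inr,
        tmul_mul_tmul, one_mul, mul_one, ← map_mul, mul_comm])
  have hmon : ∀ d e, g (MvPolynomial.monomial (sumElim d e) 1) =
      evA (monomial d 1) ⊗ₜ evB (monomial e 1) := by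
    intro d e
    rw [MvPolynomial.monomial_eq, MvPolynomial.C_1, one_mul, Finsupp.prod_fintype _ _ (by simp),
      Fintype.prod_sum_type, map_mul, monomial_eq_prod, monomial_eq_prod, one_smul, one_smul]
    have h1 : g (∏ i, MvPolynomial.X (Sum.inl i) ^ d i) =
        (includeLeft : A →ₐ[k] A ⊗[k] B) (evA (∏ i, X i ^ d i)) := by
      have : (g.comp (MvPolynomial.rename Sum.inl)) = (includeLeft : A →ₐ[k] A ⊗[k] B).comp
            (evA.comp (MvPolynomial.coeToMvPowerSeries.algHom k)) :=
        MvPolynomial.algHom_ext fun i => by simp [hg]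
      have := congr_fun this (∏ i, MvPolynomial.X i ^ d i)
      simpa using this
    have h2 : g (∏ i, MvPolynomial.X (Sum.inr i) ^ e i) =
        (includeRight : B →ₐ[k] A ⊗[k] B) (evB (∏ i, X i ^ e i)) := by
      have : (g.comp (MvPolynomial.rename Sum.inr)) = (includeRight : B →ₐ[k] A ⊗[k] B).comp
            (evB.comp (MvPolynomial.coeToMvPowerSeries.algHom k)) :=
        MvPolynomial.algHom_ext fun i => by simp [hg]
      have := congr_fun this (∏ i, MvPolynomial.X i ^ e i)
      simpa using this
    simp only [Finsupp.sumElim_inl, Finsupp.sumElim_inr]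
    rw [h1, h2]
    simp
  obtain ⟨ev, hev, h0⟩ := exists_eval g (M + N) fun c hc => by
    obtain ⟨d, e, rfl⟩ := exists_sumElim c
    rw [hmon]
    have : (sumElim d e).degree = d.degree + e.degree := by simp [Finsupp.degree_eq_sum]
    rcases le_or_gt M d.degree with h | h
    · rw [hA _ (degIdeal_mono h (monomial_mem_degIdeal d 1)), zero_tmul]
    · rw [hB _ (degIdeal_mono (by omega) (monomial_mem_degIdeal e 1)), tmul_zero]
  have hX : ∀ i, ev (X i) = Sum.elim (fun i => evA (X i) ⊗ₜ 1) (fun j => 1 ⊗ₜ evB (X j)) i :=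
    fun i => by rw [← MvPolynomial.coe_X, hev, hg]
  have hl : ∀ i, (X (Sum.inl i) : PS (σ ⊕ τ) k) ∈ degIdeal k _ 1 :=
    fun i => X_mem_degIdeal _
  have hr : ∀ i, (X (Sum.inr i) : PS (σ ⊕ τ) k) ∈ degIdeal k _ 1 :=
    fun i => X_mem_degIdeal _
  refine ⟨ev, h0, fun d e => ?_, fun f => ?_, fun f => ?_⟩
  · rw [← hmon, ← hev, MvPolynomial.coe_monomial]
  · exact eval_subst_ext h0 (ev' := (includeLeft : A →ₐ[k] A ⊗[k] B).comp evA) (fun f hf => by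
        rw [AlgHom.comp_apply, hA f (degIdeal_mono (Nat.le_add_right M N) hf), map_zero]) hl
      (fun i => hX (Sum.inl i)) f
  · exact eval_subst_ext h0 (ev' := (includeRight : B →ₐ[k] A ⊗[k] B).comp evB) (fun f hf => by
        rw [AlgHom.comp_apply, hB f (degIdeal_mono (Nat.le_add_left N M) hf), map_zero]) hr
      (fun i => hX (Sum.inr i)) f

/-- The evaluation of formal series in two sets of variables in a tensor product. -/
def tensorEval {evA : PS σ k →ₐ[k] A} {evB : PS τ k →ₐ[k] B}
    {M N : ℕ} (hA : ∀ f ∈ degIdeal k σ M, evA f = 0) (hB : ∀ f ∈ degIdeal k τ N, evB f = 0) :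
    PS (σ ⊕ τ) k →ₐ[k] A ⊗[k] B := (exists_tensorEval hA hB).choose

variable {evA : PS σ k →ₐ[k] A} {evB : PS τ k →ₐ[k] B}
    {M N : ℕ} (hA : ∀ f ∈ degIdeal k σ M, evA f = 0) (hB : ∀ f ∈ degIdeal k τ N, evB f = 0)

theorem tensorEval_kill : ∀ f ∈ degIdeal k (σ ⊕ τ) (M + N), tensorEval hA hB f = 0 :=
  (exists_tensorEval hA hB).choose_spec.1

theorem tensorEval_monomial (d e) : tensorEval hA hB (monomial (sumElim d e) 1) =
    evA (monomial d 1) ⊗ₜ evB (monomial e 1) :=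
  (exists_tensorEval hA hB).choose_spec.2.1 d e

theorem tensorEval_inl (f) : tensorEval hA hB (subst (fun i => X (Sum.inl i)) f) = evA f ⊗ₜ 1 :=
  (exists_tensorEval hA hB).choose_spec.2.2.1 f

theorem tensorEval_inr (f) : tensorEval hA hB (subst (fun i => X (Sum.inr i)) f) = 1 ⊗ₜ evB f :=
  (exists_tensorEval hA hB).choose_spec.2.2.2 f

theorem tensorEval_X_inl (i : σ) : tensorEval hA hB (X (Sum.inl i)) = evA (X i) ⊗ₜ 1 := by
  rw [← tensorEval_inl hA hB, subst_X (hasSubst_of_mem fun i => X_mem_degIdeal _)]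

theorem tensorEval_X_inr (i : τ) : tensorEval hA hB (X (Sum.inr i)) = 1 ⊗ₜ evB (X i) := by
  rw [← tensorEval_inr hA hB, subst_X (hasSubst_of_mem fun i => X_mem_degIdeal _)]

end TensorEval

section Coproduct

variable {A : Type u} [Ring A] [Algebra k A]

theorem sum_finsuppAntidiag_ite {E : Type*} [AddCommMonoid E] {r : ℕ} (N : ℕ) (d₀ : Fin r →₀ ℕ)
    (F : (Fin r →₀ ℕ) → E) :
    ∑ a ∈ Finset.range N, ∑ d ∈ finsuppAntidiag Finset.univ a, (if d = d₀ then F d else 0) =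
      if d₀.degree < N then F d₀ else 0 := by
  have h : ∀ a, ∑ d ∈ finsuppAntidiag Finset.univ a, (if d = d₀ then F d else 0) =
      if a = d₀.degree then F d₀ else 0 := by
    intro a
    rw [Finset.sum_ite_eq']
    simp only [Finset.mem_finsuppAntidiag, Finset.subset_univ, and_true, Finsupp.degree_eq_sum,
      eq_comm]
  simp only [h]
  rw [Finset.sum_ite_eq']
  simp only [Finset.mem_range]

theorem tensorEval_eq_sum {ev : PS (Fin m) k →ₐ[k] A} {N : ℕ}
    (hev : ∀ f ∈ degIdeal k _ N, ev f = 0) (f : PS (Fin m ⊕ Fin m) k) :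
    tensorEval hev hev f = ∑ a ∈ Finset.range N, ∑ d ∈ finsuppAntidiag Finset.univ a,
      ∑ b ∈ Finset.range N, ∑ e ∈ finsuppAntidiag Finset.univ b,
        coeff (sumElim d e) f • (ev (monomial d 1) ⊗ₜ[k] ev (monomial e 1)) := by
  let T : PS (Fin m ⊕ Fin m) k →ₗ[k] A ⊗[k] A :=
    ∑ a ∈ Finset.range N, ∑ d ∈ finsuppAntidiag Finset.univ a,
      ∑ b ∈ Finset.range N, ∑ e ∈ finsuppAntidiag Finset.univ b,
        (coeff (sumElim d e)).smulRight (ev (monomial d 1) ⊗ₜ[k] ev (monomial e 1))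
  have hT : ∀ f, T f = ∑ a ∈ Finset.range N, ∑ d ∈ finsuppAntidiag Finset.univ a,
      ∑ b ∈ Finset.range N, ∑ e ∈ finsuppAntidiag Finset.univ b,
        coeff (sumElim d e) f • (ev (monomial d 1) ⊗ₜ[k] ev (monomial e 1)) := by
    intro f
    simp only [T, LinearMap.sum_apply, LinearMap.smulRight_apply]
  rw [← hT]
  refine LinearMap.congr_fun (linearMap_ext_of_monomial
    (S := (tensorEval hev hev).toLinearMap) (T := T) (tensorEval_kill hev hev) (fun f hf => ?_)
    fun c => ?_) f
  · rw [hT]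
    refine sum_eq_zero fun a ha => sum_eq_zero fun d hd => sum_eq_zero
      fun b hb => sum_eq_zero fun e he => ?_
    rw [hf, zero_smul]
    have h1 : d.degree = a := (Finsupp.degree_eq_sum d).trans (Finset.mem_finsuppAntidiag.1 hd).1
    have h2 : e.degree = b := (Finsupp.degree_eq_sum e).trans (Finset.mem_finsuppAntidiag.1 he).1
    have h3 : (sumElim d e).degree = d.degree + e.degree := by simp [Finsupp.degree_eq_sum]
    rw [Finset.mem_range] at ha hb
    omega
  · obtain ⟨d₀, e₀, rfl⟩ := exists_sumElim c
    have e2 : ∀ d e : Fin m →₀ ℕ, (sumElim d e = sumElim d₀ e₀) ↔ (d = d₀ ∧ e = e₀) := by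
      refine fun d e => ⟨fun h => ⟨?_, ?_⟩, fun h => by rw [h.1, h.2]⟩
      · ext i; simpa using congr_fun h (Sum.inl i)
      · ext i; simpa using congr_fun h (Sum.inr i)
    classical
    rw [AlgHom.toLinearMap_apply, tensorEval_monomial, hT]
    simp only [coeff_monomial, e2, ite_and, ite_smul, one_smul, zero_smul]
    have e3 : ∀ d : Fin m →₀ ℕ, ∑ b ∈ Finset.range N, ∑ e ∈ finsuppAntidiag Finset.univ b,
        (if d = d₀ then if e = e₀ then ev (monomial d 1) ⊗ₜ[k] ev (monomial e 1) else 0 else 0) =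
        if d = d₀ then if e₀.degree < N then ev (monomial d 1) ⊗ₜ[k] ev (monomial e₀ 1) else 0
          else 0 := by
      intro d
      by_cases h1 : d = d₀
      · simp only [if_pos h1, sum_finsuppAntidiag_ite]
      · simp only [if_neg h1, sum_const_zero]
    simp only [e3]
    rw [sum_finsuppAntidiag_ite]
    split_ifs with h1 h2
    · rfl
    · rw [hev _ (degIdeal_mono (not_lt.1 h2) (monomial_mem_degIdeal e₀ 1)), tmul_zero]
    · rw [hev _ (degIdeal_mono (not_lt.1 h1) (monomial_mem_degIdeal d₀ 1)), zero_tmul]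

variable (co : CoStructure k n m)

/-- The coproducts of the `H_i`. -/
def coprodH (ev : PS (Fin m) k →ₐ[k] A) (h : Fin n → A) (i : Fin n) : A ⊗[k] A :=
  ∑ l, ev (co.expAlpha i l) ⊗ₜ h l + h i ⊗ₜ 1

variable {ev : PS (Fin m) k →ₐ[k] A} {h : Fin n → A}
  {As : Fin n → Fin m → PS (Fin m) k}

theorem coprodH_comm_tensorEval {N : ℕ} (hev : ∀ f ∈ degIdeal k _ N, ev f = 0)
    (hv : ∀ i f, h i * ev f - ev f * h i = ev (vectorField (As i) f)) (i : Fin n)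
    (f : PS (Fin m ⊕ Fin m) k) :
    coprodH co ev h i * tensorEval hev hev f - tensorEval hev hev f * coprodH co ev h i =
      tensorEval hev hev (vectorField (comulField co As i) f) := by
  refine commutator_eval (tensorEval_kill hev hev) _ _ (fun p => ?_) f
  rcases p with μ | μ
  · rw [tensorEval_X_inl, coprodH, comulField, Sum.elim_inl, add_mul, mul_add, sum_mul, mul_sum]
    simp only [tmul_mul_tmul, mul_one, one_mul, ← map_mul]
    rw [add_sub_add_comm, ← sum_sub_distrib, ← sub_tmul, hv, vectorField_X]
    simp only [mul_comm, sub_self, sum_const_zero, zero_add]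
    exact (tensorEval_inl hev hev _).symm
  · rw [tensorEval_X_inr, coprodH, comulField, Sum.elim_inr, add_mul, mul_add, sum_mul,
      mul_sum, map_sum]
    simp only [tmul_mul_tmul, mul_one, one_mul]
    rw [add_sub_add_comm, sub_self, add_zero, ← sum_sub_distrib]
    refine sum_congr rfl fun l _ => ?_
    rw [← tmul_sub, hv, vectorField_X, map_mul]
    have h1 := tensorEval_inl hev hev (co.expAlpha i l)
    have h2 := tensorEval_inr hev hev (As l μ)
    have e1 : tensorEval hev hev (subst (XL k m) (co.expAlpha i l)) = _ := h1
    have e2 : tensorEval hev hev (subst (XR k m) (As l μ)) = _ := h2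
    rw [e1, e2, tmul_mul_tmul, one_mul, mul_one]

theorem coprodH_comm (hv : ∀ i f, h i * ev f - ev f * h i = ev (vectorField (As i) f))
    (i j : Fin n) : coprodH co ev h i * coprodH co ev h j - coprodH co ev h j * coprodH co ev h i =
      ∑ l, ∑ p, ev (co.expAlpha i l * co.expAlpha j p) ⊗ₜ (h l * h p - h p * h l) +
      ∑ q, ev (vectorField (As i) (co.expAlpha j q) - vectorField (As j) (co.expAlpha i q)) ⊗ₜ h q +
      (h i * h j - h j * h i) ⊗ₜ 1 := by
  have e : ∀ i j, coprodH co ev h i * coprodH co ev h j =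
      ∑ l, ∑ p, ev (co.expAlpha i l * co.expAlpha j p) ⊗ₜ (h l * h p) +
      ∑ q, (ev (co.expAlpha i q) * h j) ⊗ₜ h q + ∑ q, (h i * ev (co.expAlpha j q)) ⊗ₜ h q +
      (h i * h j) ⊗ₜ 1 := by
    intro i j
    rw [coprodH, coprodH, add_mul, mul_add, mul_add, sum_mul_sum, sum_mul, mul_sum]
    simp only [tmul_mul_tmul, mul_one, one_mul, map_mul]
    abel
  have e2 : ∑ l, ∑ p, ev (co.expAlpha j l * co.expAlpha i p) ⊗ₜ[k] (h l * h p) =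
      ∑ l, ∑ p, ev (co.expAlpha i l * co.expAlpha j p) ⊗ₜ[k] (h p * h l) := by
    rw [sum_comm]
    simp only [mul_comm (co.expAlpha j _)]
  rw [e, e, e2]
  simp only [map_sub, ← hv, tmul_sub, sub_tmul, sum_sub_distrib]
  abel

end Coproduct

section Completion

variable {U : Type u} [Ring U] [Algebra k U] {I : Ideal U} [I.IsTwoSided]
  {B B' : Type u} [Ring B] [Algebra k B] [Ring B'] [Algebra k B']

/-- The factorization of a map through `U / I ^ N`. -/
def quotLift {N : ℕ} (F : U →ₐ[k] B) (hF : ∀ a ∈ I ^ N, F a = 0) : U ⧸ I ^ N →ₐ[k] B :=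
  Ideal.Quotient.liftₐ (I ^ N) F hF

theorem quotLift_mk {N : ℕ} (F : U →ₐ[k] B) (hF : ∀ a ∈ I ^ N, F a = 0) (a : U) :
    quotLift F hF (mkₐ k (I ^ N) a) = F a := rfl

theorem map_eq_of_approx {N : ℕ} {F : U →ₐ[k] B} (hF : ∀ a ∈ I ^ N, F a = 0) {G : U →ₐ[k] B'}
    (hG : ∀ a ∈ I ^ N, G a = 0) (t : U ⊗[k] U) : tmap F G t =
      tmap (quotLift F hF) (quotLift G hG) (approxTensor k I N t) := by
  have : tmap F G = (tmap (quotLift F hF) (quotLift G hG)).comp (approxTensor k I N) := by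
    rw [approxTensor, ← Algebra.TensorProduct.map_comp]
    rfl
  exact congr_fun this t

theorem mk_eq_zero_of_le {M N : ℕ} (hMN : N ≤ M) : ∀ a ∈ I ^ M, mkₐ k (I ^ N) a = 0 :=
  fun _ ha => eq_zero_iff_mem.2 (Ideal.pow_le_pow_right hMN ha)

theorem mk_eq_mk_iff {N : ℕ} {a b : U} : mkₐ k (I ^ N) a =
    mkₐ k (I ^ N) b ↔ a - b ∈ I ^ N := Ideal.Quotient.eq

theorem eq_of_mk_eq (hsep : ∀ a : U, (∀ N, a ∈ I ^ N) → a = 0) {a b : U}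
    (h : ∀ N, mkₐ k (I ^ N) a = mkₐ k (I ^ N) b) : a = b :=
  sub_eq_zero.1 (hsep _ fun N => mk_eq_mk_iff.1 (h N))

theorem exists_linear_limit {E : Type*} [AddCommGroup E] [Module k E]
    (hsep : ∀ a : U, (∀ N, a ∈ I ^ N) → a = 0)
    (hcomp : ∀ a : ℕ → U, (∀ N, a (N + 1) - a N ∈ I ^ N) → ∃ v, ∀ N, v - a N ∈ I ^ N)
    (F : ∀ N, E →ₗ[k] U ⧸ I ^ N) (hF : ∀ N e a, mkₐ k (I ^ (N + 1)) a = F (N + 1) e →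
      mkₐ k (I ^ N) a = F N e) :
    ∃ G : E →ₗ[k] U, ∀ N e, mkₐ k (I ^ N) (G e) = F N e := by
  have h1 : ∀ e, ∃ v, ∀ N, mkₐ k (I ^ N) v = F N e := by
    intro e
    choose a ha using fun N => Ideal.Quotient.mkₐ_surjective k (I ^ N) (F N e)
    obtain ⟨v, hv⟩ := hcomp a fun N => (mk_eq_mk_iff (k := k)).1 (by rw [hF N e _ (ha (N + 1)), ha])
    exact ⟨v, fun N => by rw [(mk_eq_mk_iff (k := k)).2 (hv N), ha]⟩
  choose G hG using h1
  exact ⟨{ toFun := G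
           map_add' := fun e e' => eq_of_mk_eq (k := k) hsep fun N => by
             rw [map_add, hG, hG, hG, map_add]
           map_smul' := fun c e => eq_of_mk_eq (k := k) hsep fun N => by
             rw [map_smul, hG, hG, map_smul, RingHom.id_apply] }, fun N e => hG e N⟩

end Completion

namespace IsPBW

variable {L : InhomLieBialgebra k} {U : Type u} [Ring U]
  [Algebra k U] {I : Ideal U} [I.IsTwoSided] {h : Fin L.n → U} {x : Fin L.m → U}
  (hP : IsPBW L I h x) {B : Type u} [Ring B] [Algebra k B]

theorem x_mem (hP : IsPBW L I h x) (μ : Fin L.m) : x μ ∈ I := by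
  rw [hP.ideal_eq]
  exact mem_span_of_gen x μ

/-- The evaluation of formal series modulo `I ^ N`. -/
def ev (N : ℕ) : PS (Fin L.m) k →ₐ[k] U ⧸ I ^ N :=
  (exists_modEval hP.x_mem hP.comm_xx N).choose

theorem ev_kill (N : ℕ) : ∀ f ∈ degIdeal k _ N, hP.ev N f = 0 :=
  (exists_modEval hP.x_mem hP.comm_xx N).choose_spec.1

theorem ev_eq (N : ℕ) (f : PS (Fin L.m) k) : hP.ev N f = mkₐ k (I ^ N) (truncEval N f x) :=
  (exists_modEval hP.x_mem hP.comm_xx N).choose_spec.2.1 f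

theorem ev_X (N : ℕ) (μ : Fin L.m) : hP.ev N (X μ) = mkₐ k (I ^ N) (x μ) :=
  (exists_modEval hP.x_mem hP.comm_xx N).choose_spec.2.2 μ

theorem rel (N : ℕ) : PBWRel L (fun i => mkₐ k (I ^ N) (h i)) (hP.ev N) :=
  PBWRel.mk_of_X (hP.ev_kill N)
    (fun i j => by simp only [← map_mul, ← map_sub, hP.comm_hh, map_sum, map_smul])
    fun i μ => by
      rw [hP.ev_X, hP.ev_eq, ← map_mul, ← map_mul, ← map_sub]
      exact mk_eq_mk_iff.2 (hP.comm_hx N i μ)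


theorem exists_algHom (hP : IsPBW L I h x) {N : ℕ} {h' : Fin L.n → B}
    {ev' : PS (Fin L.m) k →ₐ[k] B} (hB : PBWRel L h' ev')
    (hev' : ∀ f ∈ degIdeal k _ N, ev' f = 0) : ∃ F : U →ₐ[k] B, (∀ a ∈ I ^ N, F a = 0) ∧
      (∀ i, F (h i) = h' i) ∧ ∀ μ, F (x μ) = ev' (X μ) := by
  have e : pbwMonomial N (fun μ => hP.ev N (X μ)) (fun i => mkₐ k (I ^ N) (h i)) =
      fun p => mkₐ k (I ^ N) (orderedMonomial x p.1 * orderedMonomial h p.2) := by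
    funext p
    rw [map_mul, map_orderedMonomial, map_orderedMonomial, pbwMonomial]
    simp only [hP.ev_X]
  obtain ⟨F, h1, h2⟩ := (hP.rel N).exists_algHom hB (hP.ev_kill N) hev'
    (by rw [e]; exact hP.basis_indep N) (by rw [e]; exact hP.basis_span N)
  refine ⟨F.comp (mkₐ k (I ^ N)), fun a ha => ?_, h1, fun μ => ?_⟩
  · rw [AlgHom.comp_apply, mk_eq_zero_of_le le_rfl a ha, map_zero]
  · rw [AlgHom.comp_apply, ← hP.ev_X, h2]

theorem algHom_ext (hP : IsPBW L I h x) {N : ℕ} {F G : U →ₐ[k] B} (hF : ∀ a ∈ I ^ N, F a = 0)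
    (hG : ∀ a ∈ I ^ N, G a = 0) (hh : ∀ i, F (h i) = G (h i)) (hx : ∀ μ, F (x μ) = G (x μ)) :
    F = G := algHom_ext_of_pbw (hP.basis_span N) hF hG hh hx

theorem quotLift_ev {M N : ℕ} {F : U →ₐ[k] B} (hF : ∀ a ∈ I ^ N, F a = 0)
    {ev' : PS (Fin L.m) k →ₐ[k] B} (hev' : ∀ f ∈ degIdeal k _ M, ev' f = 0)
    (hx : ∀ μ, F (x μ) = ev' (X μ)) (f : PS (Fin L.m) k) :
    quotLift F hF (hP.ev N f) = ev' f := by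
  have := eval_subst_ext (ev := (quotLift F hF).comp (hP.ev N)) (v := X) (N := M) (M := N)
    (fun f hf => by rw [AlgHom.comp_apply, hP.ev_kill N f hf, map_zero]) hev' X_mem_degIdeal
    (fun μ => by rw [AlgHom.comp_apply, hP.ev_X, quotLift_mk, hx]) f
  rwa [subst_X_self] at this

/-- The evaluation of formal series in two sets of variables. -/
def tev (N : ℕ) : PS (Fin L.m ⊕ Fin L.m) k →ₐ[k] (U ⧸ I ^ N) ⊗[k] (U ⧸ I ^ N) :=
  tensorEval (hP.ev_kill N) (hP.ev_kill N)

theorem tev_kill (N : ℕ) : ∀ f ∈ degIdeal k _ (N + N), hP.tev N f = 0 := tensorEval_kill _ _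

theorem tev_XL (N : ℕ) (f) : hP.tev N (subst (XL k L.m) f) = hP.ev N f ⊗ₜ 1 := tensorEval_inl _ _ f

theorem tev_XR (N : ℕ) (f) : hP.tev N (subst (XR k L.m) f) = 1 ⊗ₜ hP.ev N f := tensorEval_inr _ _ f

/-- The evaluation at the product of two points. -/
def Dev (N : ℕ) : PS (Fin L.m) k →ₐ[k] (U ⧸ I ^ N) ⊗[k] (U ⧸ I ^ N) :=
  evalSubst (hP.tev N) (campbellHausdorff_mem L.co)

theorem Dev_kill (N : ℕ) : ∀ f ∈ degIdeal k _ (N + N), hP.Dev N f = 0 :=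
  evalSubst_kill (hP.tev_kill N) _

/-- The coproducts of the `H_i` modulo `I ^ N`. -/
def Dh (N : ℕ) : Fin L.n → (U ⧸ I ^ N) ⊗[k] (U ⧸ I ^ N) :=
  coprodH L.co (hP.ev N) fun i => mkₐ k (I ^ N) (h i)

theorem subst_expAlpha_chComp {τ : Type} [Fintype τ] {V W : Fin L.m → PS τ k}
    (hV : InMax V) (hW : InMax W) (i l : Fin L.n) :
    subst (chComp L.co V W) (L.co.expAlpha i l) =
      ∑ p, subst V (L.co.expAlpha i p) * subst W (L.co.expAlpha p l) := by
  have e := expRep_chComp (isRep_alphaRep L.co) hV hW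
  rw [expRep_eq_map_subst _ (chComp_mem L.co hV hW), expRep_eq_map_subst _ hV,
    expRep_eq_map_subst _ hW, ← expAlpha_eq] at e
  simpa [mul_apply] using congrFun (congrFun e i) l

theorem Dev_expAlpha (N : ℕ) (i l : Fin L.n) : hP.Dev N (L.co.expAlpha i l) =
    ∑ p, hP.ev N (L.co.expAlpha i p) ⊗ₜ hP.ev N (L.co.expAlpha p l) := by
  rw [Dev, evalSubst_apply, ← chComp_XL_XR, subst_expAlpha_chComp XL_mem XR_mem, map_sum]
  refine sum_congr rfl fun p _ => ?_
  rw [map_mul, tev_XL, tev_XR, tmul_mul_tmul, one_mul, mul_one]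

theorem rel_comul (N : ℕ) : PBWRel L (hP.Dh N) (hP.Dev N) where
  comm_ev i f := by
    rw [Dev, evalSubst_apply, evalSubst_apply]
    refine (coprodH_comm_tensorEval L.co (hP.ev_kill N) (hP.rel N).comm_ev i _).trans ?_
    change hP.tev N _ = _
    rw [vectorField_subst _ (campbellHausdorff_mem L.co), vectorField_apply,
      subst_sum (hasSubst_of_mem (campbellHausdorff_mem L.co))]
    refine congrArg _ (sum_congr rfl fun μ _ => ?_)
    rw [vectorField_campbellHausdorff, mul_comm,
      subst_mul (hasSubst_of_mem (campbellHausdorff_mem L.co))]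
  comm_hh i j := by
    refine (coprodH_comm L.co (hP.rel N).comm_ev i j).trans ?_
    simp only [(hP.rel N).comm_hh, tmul_sum, tmul_smul, sum_tmul, ← smul_tmul']
    have e1 : ∀ q, (∑ l, L.C i j l • hP.ev N (L.co.expAlpha l q) : U ⧸ I ^ N) =
        ∑ l, ∑ p, L.C l p q • hP.ev N (L.co.expAlpha i l * L.co.expAlpha j p) +
        hP.ev N (vectorField (L.seriesA i) (L.co.expAlpha j q) -
          vectorField (L.seriesA j) (L.co.expAlpha i q)) := by
      intro q
      have := congrArg (hP.ev N) (structure_expAlpha L i j q)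
      rw [add_sub_assoc, map_add] at this
      simpa only [map_sum, ← smul_eq_C_mul, map_smul, mul_comm _ (C _)] using this
    have e2 : ∑ l, L.C i j l • hP.Dh N l = ∑ q, (∑ l, L.C i j l • hP.ev N (L.co.expAlpha l q)) ⊗ₜ
        mkₐ k (I ^ N) (h q) +
        ∑ l, L.C i j l • (mkₐ k (I ^ N) (h l) ⊗ₜ 1) := by
      simp only [Dh, coprodH, smul_add, sum_add_distrib, smul_sum, sum_tmul, smul_tmul']
      rw [sum_comm]
    rw [e2]
    simp only [e1, add_tmul, sum_add_distrib, sum_tmul]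
    congr 2
    refine (sum_congr rfl fun _ _ => sum_comm).trans ?_
    rw [sum_comm]
    refine sum_congr rfl fun q _ => sum_congr rfl fun l _ =>
      sum_congr rfl fun p _ => ?_
    rw [smul_tmul']

theorem exists_comul (N : ℕ) : ∃ Δ : U →ₐ[k] (U ⧸ I ^ N) ⊗[k] (U ⧸ I ^ N),
    (∀ a ∈ I ^ (N + N), Δ a = 0) ∧ (∀ i, Δ (h i) = hP.Dh N i) ∧ ∀ μ, Δ (x μ) = hP.Dev N (X μ) :=
  hP.exists_algHom (hP.rel_comul N) (hP.Dev_kill N)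

/-- The comultiplication modulo `I ^ N`. -/
def comul (N : ℕ) : U →ₐ[k] (U ⧸ I ^ N) ⊗[k] (U ⧸ I ^ N) := (hP.exists_comul N).choose

theorem comul_kill (N : ℕ) : ∀ a ∈ I ^ (N + N), hP.comul N a = 0 :=
    (hP.exists_comul N).choose_spec.1

theorem comul_h (N : ℕ) (i) : hP.comul N (h i) = hP.Dh N i := (hP.exists_comul N).choose_spec.2.1 i

theorem comul_x (N : ℕ) (μ) : hP.comul N (x μ) = hP.Dev N (X μ) :=
  (hP.exists_comul N).choose_spec.2.2 μ

theorem comul_x' (N : ℕ) (μ) : hP.comul N (x μ) = hP.tev N (L.co.campbellHausdorff μ) := by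
  rw [comul_x, Dev, evalSubst_X]

/-- The composition of `Δ` and of a map of `U / I ^ M ⊗ U / I ^ M`, on the generators. -/
theorem map_comul_h {M : ℕ} {B' : Type u} [Ring B'] [Algebra k B'] (F : U ⧸ I ^ M →ₐ[k] B)
    (G : U ⧸ I ^ M →ₐ[k] B') (i : Fin L.n) :
    tmap F G (hP.comul M (h i)) = ∑ l, F (hP.ev M (L.co.expAlpha i l)) ⊗ₜ G (mkₐ k (I ^ M) (h l)) +
        F (mkₐ k (I ^ M) (h i)) ⊗ₜ 1 := by
  rw [comul_h, Dh, coprodH, map_add, map_sum]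
  simp only [map_tmul, map_one]

theorem map_tev {M N : ℕ} (Φ : (U ⧸ I ^ M) ⊗[k] (U ⧸ I ^ M) →ₐ[k] B) {τ : Type} [Fintype τ]
    {E : PS τ k →ₐ[k] B} (hE : ∀ f ∈ degIdeal k τ N, E f = 0)
    {V W : Fin L.m → PS τ k} (hV : InMax V)
    (hW : InMax W)
    (h1 : ∀ μ, Φ (mkₐ k (I ^ M) (x μ) ⊗ₜ 1) = E (V μ))
    (h2 : ∀ μ, Φ (1 ⊗ₜ mkₐ k (I ^ M) (x μ)) = E (W μ))
    (f : PS (Fin L.m ⊕ Fin L.m) k) : Φ (hP.tev M f) = E (subst (Sum.elim V W) f) := by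
  refine (eval_subst_ext hE (ev' := Φ.comp (hP.tev M)) (N := M + M) (fun f hf => by
    rw [AlgHom.comp_apply, hP.tev_kill M f hf, map_zero]) (sumElim_mem hV hW) (fun i => ?_) f).symm
  rcases i with i | i
  · rw [AlgHom.comp_apply, tev, tensorEval_X_inl, hP.ev_X, h1]
    rfl
  · rw [AlgHom.comp_apply, tev, tensorEval_X_inr, hP.ev_X, h2]
    rfl

theorem approx_comul {M N : ℕ} (hMN : N ≤ M) : (tmap
      (quotLift (mkₐ k (I ^ N)) (mk_eq_zero_of_le hMN))
      (quotLift (mkₐ k (I ^ N)) (mk_eq_zero_of_le hMN))).comp (hP.comul M) =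
      hP.comul N := by
  have hq : ∀ f, quotLift (mkₐ k (I ^ N)) (mk_eq_zero_of_le hMN) (hP.ev M f) =
      hP.ev N f := hP.quotLift_ev _ (hP.ev_kill N) fun μ => (hP.ev_X N μ).symm
  refine hP.algHom_ext (N := M + M) (fun a ha => ?_) (fun a ha => ?_) (fun i => ?_) fun μ => ?_
  · rw [AlgHom.comp_apply, hP.comul_kill M a ha, map_zero]
  · exact hP.comul_kill N a (Ideal.pow_le_pow_right (by omega) ha)
  · rw [AlgHom.comp_apply, map_comul_h, comul_h, Dh, coprodH]
    simp only [hq, quotLift_mk]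
  · rw [AlgHom.comp_apply, comul_x', comul_x', hP.map_tev _ (hP.tev_kill N) XL_mem XR_mem
      (fun μ => ?_) (fun μ => ?_)]
    · exact congrArg (hP.tev N) (congrFun (chComp_XL_XR L.co) μ)
    · rw [map_tmul, quotLift_mk, map_one, XL, tev, tensorEval_X_inl, hP.ev_X]
    · rw [map_tmul, quotLift_mk, map_one, XR, tev, tensorEval_X_inr, hP.ev_X]

theorem comul_compat (M N : ℕ) (hMN : N ≤ M) (a : U) (t : U ⊗[k] U)
    (ht : approxTensor k I M t = hP.comul M a) : approxTensor k I N t = hP.comul N a := by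
  rw [← hP.approx_comul hMN, AlgHom.comp_apply, ← ht, ← map_eq_of_approx]
  rfl

theorem exists_counit (hP : IsPBW L I h x) : ∃ ε : U →ₐ[k] k, (∀ a ∈ I ^ 1, ε a = 0) ∧
    (∀ i, ε (h i) = 0) ∧ ∀ μ, ε (x μ) = 0 := by
  let c : PS (Fin L.m) k →ₐ[k] k :=
    { constantCoeff (σ := Fin L.m) (R := k) with commutes' := fun a => constantCoeff_C a }
  have hc : ∀ f, c f = constantCoeff f := fun _ => rfl
  obtain ⟨ε, h1, h2, h3⟩ := hP.exists_algHom (N := 1) (h' := fun _ => 0) (ev' := c)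
    ⟨fun i j => by simp, fun i f => by
      rw [zero_mul, mul_zero, sub_zero, hc]
      refine (mem_degIdeal_one.1 ?_).symm
      rw [vectorField_apply]
      exact sum_mem fun μ _ => Ideal.mul_mem_right _ _ (seriesA_mem L i μ)⟩
    fun f hf => mem_degIdeal_one.1 hf
  exact ⟨ε, h1, h2, fun μ => by rw [h3, hc, constantCoeff_X]⟩

/-- The counit. -/
def counit (hP : IsPBW L I h x) : U →ₐ[k] k := hP.exists_counit.choose

theorem counit_kill : ∀ a ∈ I ^ 1, hP.counit a = 0 := hP.exists_counit.choose_spec.1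

theorem counit_h (i) : hP.counit (h i) = 0 := hP.exists_counit.choose_spec.2.1 i

theorem counit_x (μ) : hP.counit (x μ) = 0 := hP.exists_counit.choose_spec.2.2 μ

theorem counit_kill' {M : ℕ} (hM : 1 ≤ M) : ∀ a ∈ I ^ M, hP.counit a = 0 := fun a ha =>
  hP.counit_kill a (Ideal.pow_le_pow_right hM ha)

theorem quotLift_counit_ev {M : ℕ} (hM : 1 ≤ M) (f : PS (Fin L.m) k) :
    quotLift hP.counit (hP.counit_kill' hM) (hP.ev M f) = constantCoeff f := by
  let c : PS (Fin L.m) k →ₐ[k] k :=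
    { constantCoeff (σ := Fin L.m) (R := k) with commutes' := fun a => constantCoeff_C a }
  exact hP.quotLift_ev _ (ev' := c) (M := 1) (fun f hf => mem_degIdeal_one.1 hf)
    (fun μ => (hP.counit_x μ).trans (constantCoeff_X μ).symm) f

theorem comp_comul_eq_mk {M N : ℕ} (hMN : N ≤ M) (F : (U ⧸ I ^ M) ⊗[k] (U ⧸ I ^ M) →ₐ[k] U ⧸ I ^ N)
    (hh : ∀ i, F (hP.Dh M i) = mkₐ k (I ^ N) (h i)) {V W : Fin L.m → PS (Fin L.m) k}
    (hV : InMax V) (hW : InMax W) (hVW : chComp L.co V W = X)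
    (h1 : ∀ μ, F (mkₐ k (I ^ M) (x μ) ⊗ₜ 1) = hP.ev N (V μ))
    (h2 : ∀ μ, F (1 ⊗ₜ mkₐ k (I ^ M) (x μ)) = hP.ev N (W μ)) :
    F.comp (hP.comul M) = mkₐ k (I ^ N) := by
  refine hP.algHom_ext (N := M + M) (fun a ha => ?_) (mk_eq_zero_of_le (by omega))
    (fun i => (congrArg F (hP.comul_h M i)).trans (hh i)) fun μ => ?_
  · rw [AlgHom.comp_apply, hP.comul_kill M a ha, map_zero]
  · rw [AlgHom.comp_apply, comul_x', hP.map_tev F (hP.ev_kill N) hV hW h1 h2]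
    exact (congrArg (hP.ev N) (congrFun hVW μ)).trans (hP.ev_X N μ)

theorem counit_left (N : ℕ) (a : U) : ∃ M₀, ∀ M ≥ M₀, ∀ t : U ⊗[k] U,
    approxTensor k I M t = hP.comul M a → Algebra.TensorProduct.lid k U
      (tmap hP.counit (AlgHom.id k U) t) - a ∈ I ^ N := by
  refine ⟨N + 1, fun M hM t ht => ?_⟩
  have hM1 : 1 ≤ M := by omega
  have hMN : N ≤ M := by omega
  let F : (U ⧸ I ^ M) ⊗[k] (U ⧸ I ^ M) →ₐ[k] U ⧸ I ^ N :=
    (Algebra.TensorProduct.lid k (U ⧸ I ^ N)).toAlgHom.comp (tmap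
      (quotLift hP.counit (hP.counit_kill' hM1))
      (quotLift (mkₐ k (I ^ N)) (mk_eq_zero_of_le hMN)))
  have hF : ∀ b c, F (b ⊗ₜ c) = quotLift hP.counit (hP.counit_kill' hM1) b •
      quotLift (mkₐ k (I ^ N)) (mk_eq_zero_of_le hMN) c := fun _ _ => rfl
  have h1 := congr_fun (hP.comp_comul_eq_mk hMN F (fun i => by
    rw [Dh, coprodH, map_add, map_sum]
    simp only [hF, hP.quotLift_counit_ev hM1, constantCoeff_expAlpha, quotLift_mk, hP.counit_h,
      one_apply, ite_smul, one_smul, zero_smul, add_zero]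
    exact sum_ite_eq _ _ _ |>.trans (if_pos (mem_univ _))) (V := 0) (W := X)
    (fun i => zero_mem _) X_mem_degIdeal (chComp_zero_left L.co X_mem_degIdeal)
    (fun μ => by rw [hF, quotLift_mk, hP.counit_x, zero_smul, Pi.zero_apply, map_zero])
    fun μ => by rw [hF, map_one, one_smul, quotLift_mk, hP.ev_X]) a
  rw [AlgHom.comp_apply, ← ht] at h1
  rw [← mk_eq_mk_iff (k := k), ← h1]
  exact congr_fun (Algebra.TensorProduct.ext' fun b c => map_smul (mkₐ k (I ^ N)) _ _ :
    (mkₐ k (I ^ N)).comp ((Algebra.TensorProduct.lid k U).toAlgHom.comp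
      (tmap hP.counit (AlgHom.id k U))) = F.comp (approxTensor k I M)) t

theorem counit_right (N : ℕ) (a : U) : ∃ M₀, ∀ M ≥ M₀, ∀ t : U ⊗[k] U,
    approxTensor k I M t = hP.comul M a → Algebra.TensorProduct.rid k k U
      (tmap (AlgHom.id k U) hP.counit t) - a ∈ I ^ N := by
  refine ⟨N + 1, fun M hM t ht => ?_⟩
  have hM1 : 1 ≤ M := by omega
  have hMN : N ≤ M := by omega
  let F : (U ⧸ I ^ M) ⊗[k] (U ⧸ I ^ M) →ₐ[k] U ⧸ I ^ N :=
    (Algebra.TensorProduct.rid k k (U ⧸ I ^ N)).toAlgHom.comp (tmap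
      (quotLift (mkₐ k (I ^ N)) (mk_eq_zero_of_le hMN))
      (quotLift hP.counit (hP.counit_kill' hM1)))
  have hF : ∀ b c, F (b ⊗ₜ c) = quotLift hP.counit (hP.counit_kill' hM1) c •
      quotLift (mkₐ k (I ^ N)) (mk_eq_zero_of_le hMN) b := fun _ _ => rfl
  have h1 := congr_fun (hP.comp_comul_eq_mk hMN F (fun i => by
    rw [Dh, coprodH, map_add, map_sum]
    simp only [hF, quotLift_mk, hP.counit_h, zero_smul, sum_const_zero, zero_add, map_one,
      one_smul]) (V := X) (W := 0)
    X_mem_degIdeal (fun i => zero_mem _) (chComp_zero_right L.co X_mem_degIdeal)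
    (fun μ => by rw [hF, map_one, one_smul, quotLift_mk, hP.ev_X])
    fun μ => by rw [hF, quotLift_mk, hP.counit_x, zero_smul, Pi.zero_apply, map_zero]) a
  rw [AlgHom.comp_apply, ← ht] at h1
  rw [← mk_eq_mk_iff (k := k), ← h1]
  exact congr_fun (Algebra.TensorProduct.ext' fun b c => map_smul (mkₐ k (I ^ N)) _ _ :
    (mkₐ k (I ^ N)).comp ((Algebra.TensorProduct.rid k k U).toAlgHom.comp
      (tmap (AlgHom.id k U) hP.counit)) = F.comp (approxTensor k I M)) t

theorem coassoc (N : ℕ) (a : U) : ∃ M₀, ∀ M ≥ M₀, ∀ t : U ⊗[k] U,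
    approxTensor k I M t = hP.comul M a → Algebra.TensorProduct.assoc k k k _ _ _
      (tmap (hP.comul N) (mkₐ k (I ^ N)) t) =
      tmap (mkₐ k (I ^ N)) (hP.comul N) t := by
  refine ⟨N + N, fun M hM t ht => ?_⟩
  have hMN : N ≤ M := by omega
  have hc : ∀ a ∈ I ^ M, hP.comul N a = 0 := fun a ha =>
    hP.comul_kill N a (Ideal.pow_le_pow_right hM ha)
  let q := quotLift (mkₐ k (I ^ N)) (mk_eq_zero_of_le (I := I) hMN)
  let c := quotLift (hP.comul N) hc
  have hq : ∀ f, q (hP.ev M f) = hP.ev N f :=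
    hP.quotLift_ev _ (hP.ev_kill N) fun μ => (hP.ev_X N μ).symm
  have hcD : ∀ f, c (hP.ev M f) = hP.Dev N f :=
    hP.quotLift_ev _ (hP.Dev_kill N) (hP.comul_x N)
  let α := (Algebra.TensorProduct.assoc k k k (U ⧸ I ^ N) (U ⧸ I ^ N) (U ⧸ I ^ N)).toAlgHom
  let E := tensorEval (hP.ev_kill N) (hP.tev_kill N)
  have hE : ∀ f ∈ degIdeal k _ (N + (N + N)), E f = 0 := tensorEval_kill _ _
  let V₁ : Fin L.m → PS (Fin L.m ⊕ (Fin L.m ⊕ Fin L.m)) k := fun i => X (Sum.inl i)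
  let V₂ : Fin L.m → PS (Fin L.m ⊕ (Fin L.m ⊕ Fin L.m)) k := fun i => X (Sum.inr (Sum.inl i))
  let V₃ : Fin L.m → PS (Fin L.m ⊕ (Fin L.m ⊕ Fin L.m)) k := fun i => X (Sum.inr (Sum.inr i))
  have h1 : InMax V₁ := fun i => X_mem_degIdeal _
  have h2 : InMax V₂ := fun i => X_mem_degIdeal _
  have h3 : InMax V₃ := fun i => X_mem_degIdeal _
  have hE1 : ∀ i, E (V₁ i) = mkₐ k (I ^ N) (x i) ⊗ₜ 1 := fun i => by
    rw [← hP.ev_X]; exact tensorEval_X_inl _ _ i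
  have hE2 : ∀ i, E (V₂ i) = 1 ⊗ₜ (mkₐ k (I ^ N) (x i) ⊗ₜ 1) := fun i => by
    rw [← hP.ev_X]
    exact (tensorEval_X_inr _ _ _).trans (congrArg _ (tensorEval_X_inl _ _ i))
  have hE3 : ∀ i, E (V₃ i) = 1 ⊗ₜ (1 ⊗ₜ mkₐ k (I ^ N) (x i)) := fun i => by
    rw [← hP.ev_X]
    exact (tensorEval_X_inr _ _ _).trans (congrArg _ (tensorEval_X_inr _ _ i))
  have hD12 : ∀ i, α (hP.comul N (x i) ⊗ₜ 1) = E (chComp L.co V₁ V₂ i) := fun i => by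
    rw [comul_x']
    exact hP.map_tev (α.comp includeLeft) hE h1 h2 (fun μ => (hE1 μ).symm) (fun μ => (hE2 μ).symm) _
  have hD23 : ∀ i, 1 ⊗ₜ hP.comul N (x i) = E (chComp L.co V₂ V₃ i) := fun i => by
    rw [comul_x']
    exact hP.map_tev (includeRight : _ →ₐ[k] (U ⧸ I ^ N) ⊗[k] _) hE h2 h3
      (fun μ => (hE2 μ).symm) (fun μ => (hE3 μ).symm) _
  have key : (α.comp (tmap c q)).comp (hP.comul M) = (tmap q c).comp (hP.comul M) := by
    refine hP.algHom_ext (N := M + M) (fun a ha => ?_) (fun a ha => ?_) (fun i => ?_) fun μ => ?_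
    · rw [AlgHom.comp_apply, hP.comul_kill M a ha, map_zero]
    · rw [AlgHom.comp_apply, hP.comul_kill M a ha, map_zero]
    · rw [AlgHom.comp_apply, AlgHom.comp_apply, AlgHom.comp_apply, map_comul_h, map_comul_h]
      simp only [hq, hcD, Dev_expAlpha]
      simp only [c, q, quotLift_mk, comul_h, Dh, coprodH, sum_tmul, add_tmul,
        tmul_sum, tmul_add, map_sum, map_add, sum_add_distrib]
      rw [add_assoc, sum_comm]
      rfl
    · rw [AlgHom.comp_apply, AlgHom.comp_apply (tmap q c), comul_x',
        hP.map_tev (α.comp (tmap c q)) hE (chComp_mem L.co h1 h2) h3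
          (fun μ => hD12 μ) (fun μ => (hE3 μ).symm ▸ ?_),
        hP.map_tev (tmap q c) hE h1 (chComp_mem L.co h2 h3)
          (fun μ => (hE1 μ).symm ▸ ?_) (fun μ => (hD23 μ).symm ▸ ?_)]
      · exact congrArg E (congrFun (chComp_assoc L.co h1 h2 h3) μ)
      · rw [map_tmul, map_one, quotLift_mk]
      · rw [map_tmul, map_one, quotLift_mk]
      · rw [AlgHom.comp_apply, map_tmul, map_one, quotLift_mk]
        rfl
  have h4 := congr_fun key a
  simp only [AlgHom.comp_apply, ← ht] at h4
  rw [map_eq_of_approx hc (mk_eq_zero_of_le hMN), map_eq_of_approx (mk_eq_zero_of_le hMN) hc]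
  exact h4

end IsPBW

theorem chComp_neg_X (co : CoStructure k n m) :
    chComp co (-X : Fin m → PS (Fin m) k) X = 0 := by
  funext μ
  have h1 : (fun ρ => subst (-X) ((-X : Fin m → PS (Fin m) k) ρ)) = (X : Fin m → PS (Fin m) k) := by
    funext ρ
    rw [Pi.neg_apply, ← coe_substAlgHom hasSubst_neg_X, map_neg, coe_substAlgHom,
      subst_X hasSubst_neg_X, Pi.neg_apply, neg_neg]
  have h2 : (fun ρ => subst (-X) ((X : Fin m → PS (Fin m) k) ρ)) =
      (-X : Fin m → PS (Fin m) k) := funext fun ρ => subst_X hasSubst_neg_X ρ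
  have h := subst_chComp co (k := k) neg_X_mem X_mem_degIdeal neg_X_mem μ
  rw [h1, h2, chComp_X_neg] at h
  rw [← h, Pi.zero_apply, ← coe_substAlgHom hasSubst_neg_X, map_zero]

namespace IsPBW

open MulOpposite

variable {L : InhomLieBialgebra k} {U : Type u} [Ring U]
  [Algebra k U] {I : Ideal U} [I.IsTwoSided] {h : Fin L.n → U} {x : Fin L.m → U}
  (hP : IsPBW L I h x) {B : Type u} [Ring B] [Algebra k B]

/-- The evaluation of formal series at `-X` modulo `I ^ N`. -/
def nev (N : ℕ) : PS (Fin L.m) k →ₐ[k] U ⧸ I ^ N := evalSubst (hP.ev N) neg_X_mem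

/-- The evaluation of formal series at `-X`, with values in the opposite algebra. -/
def nevOp (N : ℕ) : PS (Fin L.m) k →ₐ[k] (U ⧸ I ^ N)ᵐᵒᵖ :=
  (hP.nev N).toOpposite fun f g => by rw [Commute, SemiconjBy, ← map_mul, ← map_mul, mul_comm]

theorem nevOp_apply (N : ℕ) (f) : hP.nevOp N f = op (hP.ev N (subst (-X) f)) :=
  congrArg op (evalSubst_apply _ _ _)

theorem nevOp_kill (N : ℕ) : ∀ f ∈ degIdeal k _ N, hP.nevOp N f = 0 := fun f hf =>
  congrArg op (evalSubst_kill (hP.ev_kill N) _ f hf)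

/-- The antipodes of the `H_i` modulo `I ^ N`. -/
def antipodeH (N : ℕ) (i : Fin L.n) : U ⧸ I ^ N :=
  -∑ l, hP.ev N (subst (-X) (L.co.expAlpha i l)) * mkₐ k (I ^ N) (h l)

theorem antipodeH_comm (N : ℕ) (i j : Fin L.n) :
    hP.antipodeH N j * hP.antipodeH N i - hP.antipodeH N i * hP.antipodeH N j =
      ∑ l, L.C i j l • hP.antipodeH N l := by
  have hr := hP.rel N
  set g : Fin L.n → U ⧸ I ^ N := fun l => mkₐ k (I ^ N) (h l) with hg
  set F : Fin L.n → Fin L.n → PS (Fin L.m) k := fun i l => subst (-X) (L.co.expAlpha i l) with hF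
  have ha : ∀ i, hP.antipodeH N i = -∑ l, hP.ev N (F i l) * g l := fun _ => rfl
  have e : ∀ i j, hP.antipodeH N i * hP.antipodeH N j =
      ∑ l, ∑ p, hP.ev N (F i l * F j p) * (g l * g p) +
      ∑ q, hP.ev N (∑ l, F i l * vectorField (L.seriesA l) (F j q)) * g q := by
    intro i j
    rw [ha, ha, neg_mul_neg, sum_mul_sum]
    simp only [map_sum, sum_mul]
    rw [sum_comm (s := Finset.univ) (f := fun q l =>
      hP.ev N (F i l * vectorField (L.seriesA l) (F j q)) * g q), ← sum_add_distrib]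
    refine sum_congr rfl fun l _ => ?_
    rw [← sum_add_distrib]
    refine sum_congr rfl fun p _ => ?_
    rw [map_mul, map_mul, ← hr.comm_ev]
    noncomm_ring
  have e2 : ∑ l, ∑ p, hP.ev N (F j l * F i p) * (g l * g p) =
      ∑ l, ∑ p, hP.ev N (F i l * F j p) * (g p * g l) := by
    rw [sum_comm]
    simp only [mul_comm (F j _)]
  have e3 : ∑ l, ∑ p, hP.ev N (F i l * F j p) * (g l * g p) -
      ∑ l, ∑ p, hP.ev N (F i l * F j p) * (g p * g l) =
      ∑ q, hP.ev N (∑ l, ∑ p, F i l * F j p * C (L.C l p q)) * g q := by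
    simp only [← sum_sub_distrib, ← mul_sub, hr.comm_hh, map_sum, sum_mul, mul_sum]
    symm
    rw [sum_comm]
    refine sum_congr rfl fun l _ => ?_
    rw [sum_comm]
    refine sum_congr rfl fun p _ => sum_congr rfl fun q _ => ?_
    rw [mul_comm _ (C _), ← smul_eq_C_mul, map_smul, smul_mul_assoc, mul_smul_comm]
  rw [← neg_sub, e, e, e2, add_sub_add_comm, e3, ← sum_sub_distrib, ← sum_add_distrib]
  simp only [← sub_mul, ← add_mul, ← map_sub, ← map_add]
  have e4 : ∀ q, ∑ l, ∑ p, F i l * F j p * C (L.C l p q) +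
      (∑ l, F i l * vectorField (L.seriesA l) (F j q) -
        ∑ l, F j l * vectorField (L.seriesA l) (F i q)) = ∑ l, C (L.C i j l) * F l q := by
    intro q
    rw [← add_sub_assoc]
    exact (structure_expAlpha_neg L i j q).symm
  simp only [e4, ha, map_sum, ← smul_eq_C_mul, map_smul, sum_mul, smul_neg, smul_sum,
    sum_neg_distrib, smul_mul_assoc]
  rw [sum_comm]

theorem rel_antipode (N : ℕ) : PBWRel L (fun i => op (hP.antipodeH N i)) (hP.nevOp N) := by
  refine PBWRel.mk_of_X (hP.nevOp_kill N) (fun i j => ?_) fun i μ => ?_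
  · rw [← op_mul, ← op_mul, ← MulOpposite.op_sub, antipodeH_comm]
    exact (map_sum (opLinearEquiv k) _ _)
  · rw [nevOp_apply, nevOp_apply, ← op_mul, ← op_mul, ← MulOpposite.op_sub, seriesA_neg,
      subst_X hasSubst_neg_X, antipodeH, Pi.neg_apply, map_neg, map_neg]
    congr 1
    rw [neg_mul_neg, neg_mul_neg, sum_mul, mul_sum, ← sum_sub_distrib, map_sum, ← sum_neg_distrib]
    refine sum_congr rfl fun l _ => ?_
    have := (hP.rel N).comm_ev l (X μ)
    rw [vectorField_X] at this
    rw [map_mul, ← this, ← mul_assoc, ← map_mul, mul_comm (X μ), map_mul]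
    noncomm_ring

theorem exists_antipodeMod (N : ℕ) : ∃ S : U →ₐ[k] (U ⧸ I ^ N)ᵐᵒᵖ, (∀ a ∈ I ^ N, S a = 0) ∧
    (∀ i, S (h i) = op (hP.antipodeH N i)) ∧ ∀ μ, S (x μ) = hP.nevOp N (X μ) :=
  hP.exists_algHom (hP.rel_antipode N) (hP.nevOp_kill N)

/-- The antipode modulo `I ^ N`. -/
def antipodeMod (N : ℕ) : U →ₐ[k] (U ⧸ I ^ N)ᵐᵒᵖ := (hP.exists_antipodeMod N).choose

theorem antipodeMod_kill (N : ℕ) : ∀ a ∈ I ^ N, hP.antipodeMod N a = 0 :=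
  (hP.exists_antipodeMod N).choose_spec.1

theorem antipodeMod_kill' {M N : ℕ} (hMN : N ≤ M) : ∀ a ∈ I ^ M, hP.antipodeMod N a = 0 :=
  fun a ha => hP.antipodeMod_kill N a (Ideal.pow_le_pow_right hMN ha)

theorem antipodeMod_h (N : ℕ) (i) : hP.antipodeMod N (h i) = op (hP.antipodeH N i) :=
  (hP.exists_antipodeMod N).choose_spec.2.1 i

theorem antipodeMod_x (N : ℕ) (μ) : hP.antipodeMod N (x μ) = hP.nevOp N (X μ) :=
  (hP.exists_antipodeMod N).choose_spec.2.2 μ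

theorem quotLift_antipodeMod_ev {M N : ℕ} (hMN : N ≤ M) (f : PS (Fin L.m) k) :
    quotLift (hP.antipodeMod N) (hP.antipodeMod_kill' hMN) (hP.ev M f) =
      op (hP.ev N (subst (-X) f)) := by
  rw [hP.quotLift_ev _ (hP.nevOp_kill N) (hP.antipodeMod_x N), nevOp_apply]

theorem quotLift_mk_ev {M N : ℕ} (hMN : N ≤ M) (f : PS (Fin L.m) k) :
    quotLift (mkₐ k (I ^ N)) (mk_eq_zero_of_le hMN) (hP.ev M f) = hP.ev N f :=
  hP.quotLift_ev _ (hP.ev_kill N) (fun μ => (hP.ev_X N μ).symm) f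

theorem antipodeMod_compat (N : ℕ) :
    (AlgHom.op (quotLift (mkₐ k (I ^ N)) (mk_eq_zero_of_le (Nat.le_succ N)))).comp
      (hP.antipodeMod (N + 1)) = hP.antipodeMod N := by
  refine hP.algHom_ext (N := N + 1) (fun a ha => ?_) (hP.antipodeMod_kill' (Nat.le_succ N))
    (fun i => ?_) fun μ => ?_
  · rw [AlgHom.comp_apply, hP.antipodeMod_kill _ a ha, map_zero]
  · rw [AlgHom.comp_apply, antipodeMod_h, antipodeMod_h]
    refine congrArg op ?_
    change quotLift (mkₐ k (I ^ N)) (mk_eq_zero_of_le (Nat.le_succ N)) (hP.antipodeH (N + 1) i) = _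
    rw [antipodeH, map_neg, map_sum]
    simp only [map_mul, hP.quotLift_mk_ev (Nat.le_succ N), quotLift_mk]
    rfl
  · rw [AlgHom.comp_apply, antipodeMod_x, antipodeMod_x, nevOp_apply, nevOp_apply]
    exact congrArg op (hP.quotLift_mk_ev (Nat.le_succ N) _)

theorem exists_antipode : ∃ S : U →ₗ[k] U, ∀ N a, mkₐ k (I ^ N) (S a) = unop (hP.antipodeMod N a) :=
  exists_linear_limit hP.separated hP.complete
    (fun N => (opLinearEquiv k).symm.toLinearMap ∘ₗ
      (hP.antipodeMod N).toLinearMap) fun N e a ha => by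
      have h1 : unop (hP.antipodeMod N e) = quotLift (mkₐ k (I ^ N))
          (mk_eq_zero_of_le (Nat.le_succ N)) (unop (hP.antipodeMod (N + 1) e)) := by
        rw [← hP.antipodeMod_compat]; rfl
      have ha' : mkₐ k (I ^ (N + 1)) a = unop (hP.antipodeMod (N + 1) e) := ha
      refine Eq.trans ?_ h1.symm
      rw [← ha', quotLift_mk]

/-- The antipode. -/
def antipode : U →ₗ[k] U := hP.exists_antipode.choose

theorem mk_antipode (N : ℕ) (a : U) : mkₐ k (I ^ N) (hP.antipode a) = unop (hP.antipodeMod N a) :=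
  hP.exists_antipode.choose_spec N a

theorem mem_of_subalgebra (hP : IsPBW L I h x) (P : Subalgebra k U) {N : ℕ}
    (hN : ∀ a ∈ I ^ N, a ∈ P) (hh : ∀ i, h i ∈ P) (hx : ∀ μ, x μ ∈ P) (a : U) : a ∈ P := by
  have hm : ∀ {r : ℕ} {y : Fin r → U} (_ : ∀ i, y i ∈ P) (d : Fin r →₀ ℕ),
    orderedMonomial y d ∈ P :=
    fun hy d => P.list_prod_mem fun b hb => by
      obtain ⟨j, rfl⟩ := (List.mem_ofFn' _ _).1 hb
      exact P.pow_mem (hy j) _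
  have h1 : (⊤ : Submodule k (U ⧸ I ^ N)) ≤ P.toSubmodule.map (mkₐ k (I ^ N)).toLinearMap := by
    rw [← hP.basis_span N, Submodule.span_le]
    rintro _ ⟨p, rfl⟩
    exact ⟨_, P.mul_mem (hm hx p.1) (hm hh p.2), rfl⟩
  obtain ⟨b, hb, e⟩ := h1 (Submodule.mem_top (x := mkₐ k (I ^ N) a))
  have := P.add_mem (hN _ (mk_eq_mk_iff.1 e.symm)) hb
  rwa [sub_add_cancel] at this

theorem monomial_sumElim (d e : Fin L.m →₀ ℕ) : (monomial (sumElim d e) 1 :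
    PS (Fin L.m ⊕ Fin L.m) k) = subst (XL k L.m) (monomial d (1 : k) : PS (Fin L.m) k) *
        subst (XR k L.m) (monomial e (1 : k) : PS (Fin L.m) k) := by
  have h1 := hasSubst_of_mem (XL_mem (k := k) (m := L.m))
  have h2 := hasSubst_of_mem (XR_mem (k := k) (m := L.m))
  rw [monomial_eq_prod, monomial_eq_prod, monomial_eq_prod, one_smul, one_smul, one_smul,
    Fintype.prod_sum_type, ← coe_substAlgHom h1, ← coe_substAlgHom h2, map_prod, map_prod]
  simp only [map_pow, coe_substAlgHom, subst_X h1, subst_X h2]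
  rfl

theorem linear_tev {M N : ℕ} (G : (U ⧸ I ^ M) ⊗[k] (U ⧸ I ^ M) →ₗ[k] B) {τ : Type} [Fintype τ]
    {E : PS τ k →ₐ[k] B} (hE : ∀ f ∈ degIdeal k τ N, E f = 0)
    {V W : Fin L.m → PS τ k} (hV : InMax V)
    (hW : InMax W)
    (hG : ∀ f g, G (hP.ev M f ⊗ₜ hP.ev M g) = E (subst V f) * E (subst W g))
    (f : PS (Fin L.m ⊕ Fin L.m) k) : G (hP.tev M f) = E (subst (Sum.elim V W) f) := by
  have hVW := hasSubst_of_mem (sumElim_mem hV hW)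
  rw [← evalSubst_apply E (sumElim_mem hV hW)]
  refine LinearMap.congr_fun (linearMap_ext_of_monomial (S := G ∘ₗ (hP.tev M).toLinearMap)
    (T := (evalSubst E (sumElim_mem hV hW)).toLinearMap) (N := (M + M) + N) (fun f hf => ?_)
    (fun f hf => evalSubst_kill hE (sumElim_mem hV hW) f (degIdeal_mono
      (Nat.le_add_left _ _) hf)) fun c => ?_) f
  · rw [LinearMap.comp_apply, AlgHom.toLinearMap_apply,
      hP.tev_kill M f (degIdeal_mono (Nat.le_add_right _ _) hf), map_zero]
  · obtain ⟨d, e, rfl⟩ := exists_sumElim c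
    rw [LinearMap.comp_apply, AlgHom.toLinearMap_apply, AlgHom.toLinearMap_apply, tev,
      tensorEval_monomial, hG, evalSubst_apply, monomial_sumElim, subst_mul hVW, map_mul,
      subst_comp_subst_apply (hasSubst_of_mem XL_mem) hVW,
      subst_comp_subst_apply (hasSubst_of_mem XR_mem) hVW, subst_XL hV hW, subst_XR hV hW]

theorem comul_eq_counit {M : ℕ} (hM : 1 ≤ M) (G : (U ⧸ I ^ M) ⊗[k] (U ⧸ I ^ M) →ₗ[k] B)
    (h1 : G 1 = 1) (hmul : ∀ s t (c d : k), G s = algebraMap k B c → G t = algebraMap k B d →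
      G (s * t) = algebraMap k B (c * d)) (hh : ∀ i, G (hP.Dh M i) = 0)
    (hx : ∀ μ, G (hP.tev M (L.co.campbellHausdorff μ)) = 0) (a : U) :
    G (hP.comul M a) = algebraMap k B (hP.counit a) :=
  let P : Subalgebra k U :=
    { carrier := {a | G (hP.comul M a) = algebraMap k B (hP.counit a)}
      mul_mem' := fun {a b} ha hb => by
        change G _ = _
        rw [map_mul (hP.comul M), hmul _ _ _ _ ha hb, map_mul hP.counit]
      add_mem' := fun {a b} ha hb => by
        change G _ = _
        rw [map_add, map_add, ha, hb, map_add, map_add]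
      algebraMap_mem' := fun c => by
        change G _ = _
        rw [AlgHom.commutes, AlgHom.commutes, Algebra.algebraMap_eq_smul_one, map_smul, h1,
          ← Algebra.algebraMap_eq_smul_one]
        rfl }
  hP.mem_of_subalgebra P (N := M + M) (fun a ha => by
    change G _ = _
    rw [hP.comul_kill M a ha, hP.counit_kill' (by omega) a ha, map_zero, map_zero])
    (fun i => (congrArg G (hP.comul_h M i)).trans (by rw [hh, hP.counit_h, map_zero]))
    (fun μ => (congrArg G (hP.comul_x' M μ)).trans (by rw [hx, hP.counit_x, map_zero])) a

theorem antipode_left (N : ℕ) (a : U) : ∃ M₀, ∀ M ≥ M₀, ∀ t : U ⊗[k] U,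
    approxTensor k I M t = hP.comul M a → LinearMap.mul' k U
      (TensorProduct.map hP.antipode LinearMap.id t) - algebraMap k U (hP.counit a) ∈ I ^ N := by
  refine ⟨N + 1, fun M hM t ht => ?_⟩
  have hMN : N ≤ M := by omega
  let q := quotLift (mkₐ k (I ^ N)) (mk_eq_zero_of_le (I := I) hMN)
  let S := quotLift (hP.antipodeMod N) (hP.antipodeMod_kill' hMN)
  let G : (U ⧸ I ^ M) ⊗[k] (U ⧸ I ^ M) →ₗ[k] U ⧸ I ^ N := LinearMap.mul' k _ ∘ₗ
    TensorProduct.map ((opLinearEquiv k).symm.toLinearMap ∘ₗ S.toLinearMap) q.toLinearMap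
  have hG : ∀ b c, G (b ⊗ₜ c) = unop (S b) * q c := fun _ _ => rfl
  have hmul : ∀ s b c, G (s * b ⊗ₜ c) = unop (S b) * G s * q c := by
    intro s b c
    induction s using TensorProduct.induction_on with
    | zero => simp
    | add s t hs ht => rw [add_mul, map_add, hs, ht, map_add, mul_add, add_mul]
    | tmul d e =>
      rw [tmul_mul_tmul, hG, hG, map_mul, unop_mul, map_mul]
      noncomm_ring
  have hmul' : ∀ s (c : k), G s = algebraMap k _ c → ∀ t, G (s * t) = algebraMap k _ c * G t := by
    intro s c hs t
    induction t using TensorProduct.induction_on with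
    | zero => simp
    | add t u ht hu => rw [mul_add, map_add, ht, hu, map_add, mul_add]
    | tmul d e => rw [hmul, hs, hG, ← Algebra.commutes, mul_assoc]
  have h1 := hP.comul_eq_counit (by omega) G
    (by rw [Algebra.TensorProduct.one_def, hG, map_one, map_one, unop_one, mul_one])
    (fun s t c d hs ht => by rw [hmul' s c hs, ht, map_mul]) (fun i => by
    rw [Dh, coprodH, map_add, map_sum]
    simp only [hG]
    rw [map_one, mul_one]
    simp only [S, hP.quotLift_antipodeMod_ev hMN, unop_op, quotLift_mk, antipodeMod_h]
    exact add_neg_cancel _) (fun μ => by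
    rw [hP.linear_tev G (hP.ev_kill N) neg_X_mem X_mem_degIdeal (fun f g => by
        rw [hG, subst_X_self]
        simp only [S, q, hP.quotLift_antipodeMod_ev hMN, hP.quotLift_mk_ev hMN, unop_op])]
    exact (congrArg (hP.ev N) (congrFun (chComp_neg_X L.co) μ)).trans (map_zero _)) a
  rw [← ht] at h1
  refine (mk_eq_mk_iff (k := k)).1 ?_
  rw [AlgHom.commutes, ← h1]
  exact LinearMap.congr_fun (TensorProduct.ext' fun b c => by
    change mkₐ k (I ^ N) (hP.antipode b * c) = _
    rw [map_mul, mk_antipode]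
    rfl : (mkₐ k (I ^ N)).toLinearMap ∘ₗ LinearMap.mul' k U ∘ₗ
      TensorProduct.map hP.antipode LinearMap.id = G ∘ₗ (approxTensor k I M).toLinearMap) t

theorem antipode_right (N : ℕ) (a : U) : ∃ M₀, ∀ M ≥ M₀, ∀ t : U ⊗[k] U,
    approxTensor k I M t = hP.comul M a → LinearMap.mul' k U
      (TensorProduct.map LinearMap.id hP.antipode t) - algebraMap k U (hP.counit a) ∈ I ^ N := by
  refine ⟨N + 1, fun M hM t ht => ?_⟩
  have hMN : N ≤ M := by omega
  let q := quotLift (mkₐ k (I ^ N)) (mk_eq_zero_of_le (I := I) hMN)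
  let S := quotLift (hP.antipodeMod N) (hP.antipodeMod_kill' hMN)
  let G : (U ⧸ I ^ M) ⊗[k] (U ⧸ I ^ M) →ₗ[k] U ⧸ I ^ N := LinearMap.mul' k _ ∘ₗ
    TensorProduct.map q.toLinearMap ((opLinearEquiv k).symm.toLinearMap ∘ₗ S.toLinearMap)
  have hG : ∀ b c, G (b ⊗ₜ c) = q b * unop (S c) := fun _ _ => rfl
  have hmul : ∀ s b c, G (b ⊗ₜ c * s) = q b * G s * unop (S c) := by
    intro s b c
    induction s using TensorProduct.induction_on with
    | zero => simp
    | add s t hs ht => rw [mul_add, map_add, hs, ht, map_add, mul_add, add_mul]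
    | tmul d e =>
      rw [tmul_mul_tmul, hG, hG, map_mul, map_mul, unop_mul]
      noncomm_ring
  have hmul' : ∀ s (c : k), G s = algebraMap k _ c → ∀ t, G (t * s) = algebraMap k _ c * G t := by
    intro s c hs t
    induction t using TensorProduct.induction_on with
    | zero => simp
    | add t u ht hu => rw [add_mul, map_add, ht, hu, map_add, mul_add]
    | tmul d e => rw [hmul, hs, hG, ← Algebra.commutes, mul_assoc]
  have h1 := hP.comul_eq_counit (by omega) G
    (by rw [Algebra.TensorProduct.one_def, hG, map_one, map_one, unop_one, mul_one])
    (fun s t c d hs ht => by rw [hmul' t d ht, hs, ← map_mul, mul_comm]) (fun i => by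
    rw [Dh, coprodH, map_add, map_sum]
    simp only [hG]
    rw [map_one, unop_one, mul_one]
    simp only [S, q, quotLift_mk, hP.quotLift_mk_ev hMN, unop_op, antipodeMod_h, antipodeH, mul_neg,
      sum_neg_distrib, mul_sum, ← mul_assoc, ← map_mul]
    rw [sum_comm]
    simp only [← sum_mul, ← map_sum]
    have e : ∀ p, ∑ l, L.co.expAlpha i l * subst (-X) (L.co.expAlpha l p) =
        (1 : Matrix _ _ (PS (Fin L.m) k)) i p := fun p => by
      rw [← expAlpha_mul_neg L.co]; rfl
    simp only [e, one_apply, apply_ite (hP.ev N), map_one, map_zero,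
      ite_mul, one_mul, zero_mul, sum_ite_eq, mem_univ, if_true]
    exact neg_add_cancel _) (fun μ => by
    rw [hP.linear_tev G (hP.ev_kill N) X_mem_degIdeal neg_X_mem (fun f g => by
        rw [hG, subst_X_self]
        simp only [S, q, hP.quotLift_antipodeMod_ev hMN, hP.quotLift_mk_ev hMN, unop_op])]
    exact (congrArg (hP.ev N) (congrFun (chComp_X_neg L.co) μ)).trans (map_zero _)) a
  rw [← ht] at h1
  refine (mk_eq_mk_iff (k := k)).1 ?_
  rw [AlgHom.commutes, ← h1]
  exact LinearMap.congr_fun (TensorProduct.ext' fun b c => by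
    change mkₐ k (I ^ N) (b * hP.antipode c) = _
    rw [map_mul, mk_antipode]
    rfl : (mkₐ k (I ^ N)).toLinearMap ∘ₗ LinearMap.mul' k U ∘ₗ
      TensorProduct.map LinearMap.id hP.antipode = G ∘ₗ (approxTensor k I M).toLinearMap) t

/-- The topological Hopf algebra structure. -/
def hopf : AdicHopfAlgebra k where
  carrier := U
  I := I
  separated := hP.separated
  complete := hP.complete
  comul := hP.comul
  counit := hP.counit
  antipode := hP.antipode
  comul_compat := hP.comul_compat
  comul_continuous N := ⟨N + N, hP.comul_kill N⟩
  counit_continuous := ⟨1, hP.counit_kill⟩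
  antipode_continuous N := ⟨N, fun a ha => eq_zero_iff_mem.1
    ((hP.mk_antipode N a).trans (by rw [hP.antipodeMod_kill N a ha, unop_zero]))⟩
  coassoc := hP.coassoc
  counit_left := hP.counit_left
  counit_right := hP.counit_right
  antipode_left := hP.antipode_left
  antipode_right := hP.antipode_right

theorem comm_hh_trunc (hP : IsPBW L I h x) (N : ℕ) (i j : Fin L.n) :
    h i * h j - h j * h i - ∑ l, truncEval N (L.seriesC i j l) x * h l ∈ I ^ N := by
  refine (mk_eq_mk_iff (k := k)).1 ?_
  rw [hP.comm_hh, map_sum, map_sum]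
  refine sum_congr rfl fun l _ => ?_
  rw [map_smul, map_mul, ← hP.ev_eq, InhomLieBialgebra.seriesC, ← mul_one (C _), ← smul_eq_C_mul,
    map_smul, map_one, smul_mul_assoc, one_mul]

theorem ev_monomial (N : ℕ) (d : Fin L.m →₀ ℕ) :
    hP.ev N (monomial d 1) = mkₐ k (I ^ N) (orderedMonomial x d) := by
  rw [← orderedMonomial_eval, map_orderedMonomial]
  simp only [hP.ev_X]

theorem isQuantumAlgebra_hopf : IsQuantumAlgebra L.co L.seriesC L.seriesA hP.hopf h x where
  ideal_eq := hP.ideal_eq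
  basis_indep := hP.basis_indep
  basis_span := hP.basis_span
  comm_xx := hP.comm_xx
  comm_hh := hP.comm_hh_trunc
  comm_hx := hP.comm_hx
  comul_x N μ := by
    refine (hP.comul_x' N μ).trans ((tensorEval_eq_sum _ _).trans ?_)
    simp only [ev_monomial]
    rfl
  comul_h N i := by
    refine (hP.comul_h N i).trans ?_
    rw [Dh, coprodH]
    simp only [ev_eq]
    rfl

theorem isQuantization_hopf : IsQuantization L hP.hopf h x :=
  ⟨_, _, hP.isQuantumAlgebra_hopf, fun _ _ _ => constantCoeff_C _, coeff_seriesA L⟩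

end IsPBW

section Functionals

variable {A : Type u} [Ring A] [Algebra k A] {N : ℕ}
  {ev : PS (Fin m) k →ₐ[k] A} {h : Fin n → A}

theorem exists_functional (hev : ∀ f ∈ degIdeal k _ N, ev f = 0)
    (hi : LinearIndependent k (pbwMonomial N (fun μ => ev (X μ)) h)) {d : Fin m →₀ ℕ}
    (hd : d.degree < N) (p : Fin n →₀ ℕ) : ∃ w : A →ₗ[k] k, ∀ f r,
      w (ev f * orderedMonomial h r) = if r = p then coeff d f else 0 := by
  classical
  obtain ⟨g, hg⟩ := (hi.repr).exists_extend
  let w := Finsupp.lapply (⟨d, hd⟩, p) ∘ₗ g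
  have h1 : ∀ (c : Fin m →₀ ℕ) (hc : c.degree < N) r, w (ev (monomial c 1) * orderedMonomial h r) =
      if c = d ∧ r = p then 1 else 0 := by
    intro c hc r
    have e : ev (monomial c 1) * orderedMonomial h r =
        pbwMonomial N (fun μ => ev (X μ)) h (⟨c, hc⟩, r) := by
      rw [pbwMonomial, orderedMonomial_eval]
    have e2 := LinearMap.congr_fun hg ⟨_, subset_span ⟨(⟨c, hc⟩, r), rfl⟩⟩
    rw [e, LinearMap.comp_apply]
    refine (congrArg (Finsupp.lapply (R := k) (⟨d, hd⟩, p)) e2).trans ?_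
    refine (congrArg (Finsupp.lapply (R := k) (⟨d, hd⟩, p)) (hi.repr_eq_single (⟨c, hc⟩, r)
      ⟨_, subset_span ⟨_, rfl⟩⟩ rfl)).trans ?_
    rw [Finsupp.lapply_apply, Finsupp.single_apply]
    simp only [Prod.mk.injEq, Subtype.mk.injEq]
  refine ⟨w, fun f r => ?_⟩
  let T : PS (Fin m) k →ₗ[k] k := if r = p then coeff d else 0
  have hT : ∀ f, T f = if r = p then coeff d f else 0 := fun f => by
    simp only [T]; split_ifs <;> rfl
  rw [← hT]
  refine LinearMap.congr_fun (linearMap_ext_of_monomial (N := N)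
    (S := w ∘ₗ LinearMap.mulRight k (orderedMonomial h r) ∘ₗ ev.toLinearMap) (T := T)
    (fun f hf => ?_) (fun f hf => ?_) fun c => ?_) f
  · simp [hev f hf]
  · rw [hT, mem_degIdeal.1 hf d hd, ite_self]
  · rw [hT, coeff_monomial]
    change w (ev (monomial c 1) * _) = _
    by_cases hc : c.degree < N
    · rw [h1 c hc]
      simp only [eq_comm (a := d), ite_and]
      split_ifs <;> rfl
    · rw [hev _ (degIdeal_mono (not_lt.1 hc) (monomial_mem_degIdeal c 1)), zero_mul, map_zero,
        if_neg fun e : d = c => hc (e ▸ hd), ite_self]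

theorem exists_functional₂ (hev : ∀ f ∈ degIdeal k _ N, ev f = 0)
    (hi : LinearIndependent k (pbwMonomial N (fun μ => ev (X μ)) h)) {d e : Fin m →₀ ℕ}
    (hd : d.degree < N) (he : e.degree < N) (p q : Fin n →₀ ℕ) :
    ∃ w : A ⊗[k] A →ₗ[k] k, ∀ f r s,
      w (tensorEval hev hev f * (orderedMonomial h r ⊗ₜ orderedMonomial h s)) =
        if r = p ∧ s = q then coeff (sumElim d e) f else 0 := by
  classical
  obtain ⟨w, hw⟩ := exists_functional hev hi hd p
  obtain ⟨w', hw2⟩ := exists_functional hev hi he q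
  refine ⟨LinearMap.mul' k k ∘ₗ TensorProduct.map w w', fun f r s => ?_⟩
  have h0 : ∀ a b, (LinearMap.mul' k k ∘ₗ TensorProduct.map w w') (a ⊗ₜ b) = w a * w' b :=
    fun _ _ => rfl
  rw [tensorEval_eq_sum]
  simp only [sum_mul, map_sum, smul_mul_assoc, map_smul, tmul_mul_tmul,
    h0, hw, hw2, coeff_monomial, smul_eq_mul]
  by_cases hr : r = p ∧ s = q
  · have e0 : ∀ a b : Fin m →₀ ℕ, coeff (sumElim a b) f *
        ((if d = a then 1 else 0) * if e = b then 1 else 0) =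
        if b = e then if a = d then coeff (sumElim a b) f else 0 else 0 := fun a b => by
      simp only [eq_comm (a := d), eq_comm (a := e)]
      split_ifs <;> simp
    simp only [if_pos hr.1, if_pos hr.2, e0, sum_finsuppAntidiag_ite, if_pos he, if_pos hd,
      if_pos hr]
  · rw [if_neg hr]
    refine sum_eq_zero fun _ _ => sum_eq_zero fun _ _ => sum_eq_zero fun _ _ =>
      sum_eq_zero fun _ _ => ?_
    by_cases h1 : r = p
    · rw [if_neg fun h2 => hr ⟨h1, h2⟩, mul_zero, mul_zero]
    · rw [if_neg h1, zero_mul, mul_zero]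

end Functionals

theorem orderedMonomial_single {B : Type u} [Ring B] (h : Fin n → B) (i : Fin n) :
    orderedMonomial h (single i 1) = h i := by
  have e : (List.ofFn fun j => List.replicate (single i 1 j) j).flatten = [i] :=
    List.perm_singleton.1 (List.perm_iff_count.2 fun j => by
      rw [count_sortedWord, List.count_singleton, Finsupp.single_apply]; simp)
  rw [orderedMonomial_eq_word, e, List.map_singleton, List.prod_singleton]

/-- The image of `H_i` modulo `I ^ N`. -/
abbrev modH {U : AdicHopfAlgebra k} (h : Fin n → U.carrier) (N : ℕ) (i : Fin n) :
    U.carrier ⧸ U.I ^ N :=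
  mkₐ k (U.I ^ N) (h i)

end InhomQuant

namespace IsQuantumAlgebra
open InhomQuant

variable {co : CoStructure k n m}
  {Cs : Fin n → Fin n → Fin n → PS (Fin m) k}
  {As : Fin n → Fin m → PS (Fin m) k} {U : AdicHopfAlgebra k} {h : Fin n → U.carrier}
  {x : Fin m → U.carrier} (hU : IsQuantumAlgebra co Cs As U h x)

theorem x_mem (hU : IsQuantumAlgebra co Cs As U h x) (μ : Fin m) :
    x μ ∈ U.I := by
  rw [hU.ideal_eq]
  exact mem_span_of_gen x μ

/-- The evaluation of formal series modulo `I ^ N`. -/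
def ev (N : ℕ) : PS (Fin m) k →ₐ[k] U.carrier ⧸ U.I ^ N :=
  (exists_modEval hU.x_mem hU.comm_xx N).choose

theorem ev_kill (N : ℕ) : ∀ f ∈ degIdeal k _ N, hU.ev N f = 0 :=
  (exists_modEval hU.x_mem hU.comm_xx N).choose_spec.1

theorem ev_eq (N : ℕ) (f : PS (Fin m) k) :
    hU.ev N f = mkₐ k (U.I ^ N) (truncEval N f x) :=
  (exists_modEval hU.x_mem hU.comm_xx N).choose_spec.2.1 f

theorem ev_X (N : ℕ) (μ : Fin m) : hU.ev N (X μ) = mkₐ k (U.I ^ N) (x μ) :=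
  (exists_modEval hU.x_mem hU.comm_xx N).choose_spec.2.2 μ

theorem ev_monomial (N : ℕ) (d : Fin m →₀ ℕ) :
    hU.ev N (monomial d 1) = mkₐ k (U.I ^ N) (orderedMonomial x d) := by
  rw [← orderedMonomial_eval, map_orderedMonomial]
  simp only [hU.ev_X]

theorem indep (N : ℕ) :
    LinearIndependent k (pbwMonomial N (fun μ => hU.ev N (X μ)) (modH h N)) := by
  have e : pbwMonomial N (fun μ => hU.ev N (X μ)) (modH h N) = fun p =>
      mkₐ k (U.I ^ N) (orderedMonomial x p.1 * orderedMonomial h p.2) := by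
    funext p
    rw [map_mul, map_orderedMonomial, map_orderedMonomial, pbwMonomial]
    simp only [hU.ev_X]
  rw [e]
  exact hU.basis_indep N

theorem exists_coeff (d : Fin m →₀ ℕ) (p : Fin n →₀ ℕ) :
    ∃ N, ∃ w : U.carrier ⧸ U.I ^ N →ₗ[k] k, ∀ f r,
      w (hU.ev N f * orderedMonomial (modH h N) r) = if r = p then coeff d f else 0 :=
  ⟨_, exists_functional (hU.ev_kill _) (hU.indep _) (Nat.lt_succ_self d.degree) p⟩

theorem eq_of_ev {f g : PS (Fin m) k}
    (hfg : ∀ N, hU.ev N f = hU.ev N g) : f = g := by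
  ext d
  obtain ⟨N, w, hw⟩ := hU.exists_coeff d 0
  have h1 := hw f 0
  rwa [hfg, hw, if_pos rfl, if_pos rfl, eq_comm] at h1

theorem eq_of_sum_smul (hU : IsQuantumAlgebra co Cs As U h x)
    {c c' : Fin n → k}
    (hc : ∑ l, c l • h l = ∑ l, c' l • h l) : c = c' := by
  funext i
  obtain ⟨N, w, hw⟩ := hU.exists_coeff 0 (single i 1)
  have e : ∀ l, w (modH h N l) = if l = i then 1 else 0 := fun l => by
    have := hw 1 (single l 1)
    simpa only [map_one, one_mul, orderedMonomial_single, coeff_zero_one,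
      (Finsupp.single_left_injective one_ne_zero).eq_iff] using this
  have h2 := congrArg (fun a => w (mkₐ k (U.I ^ N) a)) hc
  simp only [map_sum, map_smul, e] at h2
  simpa using h2

theorem algebraMap_injective (hU : IsQuantumAlgebra co Cs As U h x) {c : k}
    (hc : algebraMap k U.carrier c ∈ U.I) : c = 0 := by
  have h1 := exists_functional (hU.ev_kill 1) (hU.indep 1) (d := 0) (by simp) 0
  obtain ⟨w, hw⟩ := h1
  have h2 := hw (C c) 0
  rw [if_pos rfl, orderedMonomial_zero, mul_one, coeff_zero_C] at h2
  have h3 : hU.ev 1 (C c) = 0 := by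
    rw [← Submodule.pow_one U.I] at hc
    refine Eq.trans ?_ (eq_zero_iff_mem.2 hc)
    rw [← mul_one (C c), ← smul_eq_C_mul, map_smul, map_one, ← Algebra.algebraMap_eq_smul_one]
    rfl
  rw [← h2, h3, map_zero]

theorem As_mem (hU : IsQuantumAlgebra co Cs As U h x)
    (i : Fin n) (μ : Fin m) : As i μ ∈ degIdeal k _ 1 := by
  refine mem_degIdeal_one.2 (hU.algebraMap_injective ?_)
  have h1 := hU.comm_hx 1 i μ
  have e : truncEval 1 (As i μ) x = algebraMap k _ (constantCoeff (As i μ)) := by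
    rw [truncEval, Finset.sum_range_one, Finset.finsuppAntidiag_zero, Finset.sum_singleton,
      orderedMonomial_zero, Algebra.algebraMap_eq_smul_one]
    rfl
  rw [e, Submodule.pow_one] at h1
  have h2 := U.I.sub_mem (U.I.sub_mem (U.I.mul_mem_left (h i) (hU.x_mem μ))
    (U.I.mul_mem_right (h i) (hU.x_mem μ))) h1
  rwa [sub_sub_cancel] at h2

theorem comm_ev (N : ℕ) (i : Fin n) (f : PS (Fin m) k) :
    modH h N i * hU.ev N f - hU.ev N f * modH h N i = hU.ev N (vectorField (As i) f) :=
  commutator_eval (hU.ev_kill N) _ _ (fun μ => by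
    rw [hU.ev_X, hU.ev_eq, ← map_mul, ← map_mul, ← map_sub]
    exact (mk_eq_mk_iff (k := k)).2 (hU.comm_hx N i μ)) f

theorem comm_modH (N : ℕ) (i j : Fin n) :
    modH h N i * modH h N j - modH h N j * modH h N i = ∑ l, hU.ev N (Cs i j l) * modH h N l := by
  simp only [hU.ev_eq, ← map_mul, ← map_sub, ← map_sum]
  exact (mk_eq_mk_iff (k := k)).2 (hU.comm_hh N i j)

/-- The evaluation of formal series in two sets of variables. -/
def tev (N : ℕ) : PS (Fin m ⊕ Fin m) k →ₐ[k]
    (U.carrier ⧸ U.I ^ N) ⊗[k] (U.carrier ⧸ U.I ^ N) :=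
  tensorEval (hU.ev_kill N) (hU.ev_kill N)

theorem comul_x' (N : ℕ) (μ : Fin m) :
    U.comul N (x μ) = hU.tev N (co.campbellHausdorff μ) := by
  refine (hU.comul_x N μ).trans (Eq.trans ?_ (tensorEval_eq_sum _ _).symm)
  simp only [hU.ev_monomial]

theorem comul_h' (N : ℕ) (i : Fin n) :
    U.comul N (h i) = coprodH co (hU.ev N) (modH h N) i := by
  rw [hU.comul_h, coprodH]
  simp only [hU.ev_eq]

theorem comul_truncEval (N : ℕ) : ∃ M, (∀ a ∈ U.I ^ M, U.comul N a = 0) ∧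
    ∀ f : PS (Fin m) k, U.comul N (truncEval M f x) = hU.tev N (subst co.campbellHausdorff f) := by
  obtain ⟨M, hM⟩ := U.comul_continuous N
  refine ⟨M, hM, fun f => ?_⟩
  have := eval_subst_ext (tensorEval_kill (hU.ev_kill N) (hU.ev_kill N))
    (ev' := (quotLift (U.comul N) hM).comp (hU.ev M)) (N := M)
    (fun f hf => by rw [AlgHom.comp_apply, hU.ev_kill M f hf, map_zero])
    (campbellHausdorff_mem co) (fun μ => by
      rw [AlgHom.comp_apply, hU.ev_X, quotLift_mk, hU.comul_x']; rfl) f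
  rw [AlgHom.comp_apply, hU.ev_eq, quotLift_mk] at this
  exact this.symm

theorem exists_coeff₂ (c : Fin m ⊕ Fin m →₀ ℕ) (p q : Fin n →₀ ℕ) :
    ∃ N, ∃ w : (U.carrier ⧸ U.I ^ N) ⊗[k] (U.carrier ⧸ U.I ^ N) →ₗ[k] k, ∀ f r s,
      w (hU.tev N f * (orderedMonomial (modH h N) r ⊗ₜ orderedMonomial (modH h N) s)) =
        if r = p ∧ s = q then coeff c f else 0 := by
  obtain ⟨d, e, rfl⟩ := exists_sumElim c
  exact ⟨d.degree + e.degree + 1, exists_functional₂ (hU.ev_kill _) (hU.indep _)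
    (d := d) (e := e) (by omega) (by omega) p q⟩

theorem eq_of_tev {f g : PS (Fin m ⊕ Fin m) k}
    (hfg : ∀ N, hU.tev N f = hU.tev N g) : f = g := by
  ext c
  obtain ⟨N, w, hw⟩ := hU.exists_coeff₂ c 0 0
  have h1 := hw f 0 0
  rwa [hfg, hw, if_pos ⟨rfl, rfl⟩, if_pos ⟨rfl, rfl⟩, eq_comm] at h1

theorem comulField_eq (hU : IsQuantumAlgebra co Cs As U h x)
    (i : Fin n) (μ : Fin m) :
    vectorField (comulField co As i) (co.campbellHausdorff μ) =
      subst co.campbellHausdorff (As i μ) := hU.eq_of_tev fun N => by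
  obtain ⟨M, hM, e⟩ := hU.comul_truncEval N
  refine (coprodH_comm_tensorEval co (hU.ev_kill N) (hU.comm_ev N) i _).symm.trans ?_
  have h1 := hM _ (hU.comm_hx M i μ)
  rw [map_sub, map_sub, map_mul, map_mul, hU.comul_x', hU.comul_h', e, sub_eq_zero] at h1
  exact h1

theorem eq_of_tev_sum {P Q F G : Fin n → PS (Fin m ⊕ Fin m) k}
    (he : ∀ N, ∑ q, hU.tev N (P q) * (1 ⊗ₜ modH h N q) + ∑ l, hU.tev N (F l) * (modH h N l ⊗ₜ 1) =
      ∑ q, hU.tev N (Q q) * (1 ⊗ₜ modH h N q) + ∑ l, hU.tev N (G l) * (modH h N l ⊗ₜ 1)) :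
    P = Q ∧ F = G := by
  have hs : ∀ l i : Fin n, (single l 1 : Fin n →₀ ℕ) = single i 1 ↔ l = i :=
    fun l i => (Finsupp.single_left_injective one_ne_zero).eq_iff
  have hz : ∀ i : Fin n, (0 : Fin n →₀ ℕ) ≠ single i 1 := fun i e =>
    one_ne_zero (Finsupp.single_eq_zero.1 e.symm)
  constructor <;> funext i <;> ext c
  · obtain ⟨N, w, hw⟩ := hU.exists_coeff₂ c 0 (single i 1)
    have h1 := fun f l => hw f 0 (single l 1)
    have h2 := fun f l => hw f (single l 1) 0
    simp only [orderedMonomial_single, orderedMonomial_zero, hs, true_and, hz, and_false] at h1 h2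
    simpa [map_add, map_sum, h1, h2] using congrArg w (he N)
  · obtain ⟨N, w, hw⟩ := hU.exists_coeff₂ c (single i 1) 0
    have h1 := fun f l => hw f 0 (single l 1)
    have h2 := fun f l => hw f (single l 1) 0
    simp only [orderedMonomial_single, orderedMonomial_zero, hs, and_true, hz, false_and] at h1 h2
    simpa [map_add, map_sum, h1, h2] using congrArg w (he N)

theorem comul_comm (hU : IsQuantumAlgebra co Cs As U h x) (i j : Fin n) :
    ((fun q => ∑ l, ∑ p, subst (XL k m) (co.expAlpha i l * co.expAlpha j p) *
        subst (XR k m) (Cs l p q) + subst (XL k m) (vectorField (As i) (co.expAlpha j q) -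
          vectorField (As j) (co.expAlpha i q))) =
      fun q => ∑ l, subst co.campbellHausdorff (Cs i j l) * subst (XL k m) (co.expAlpha l q)) ∧
    (fun l => subst (XL k m) (Cs i j l)) = fun l => subst co.campbellHausdorff (Cs i j l) :=
  hU.eq_of_tev_sum fun N => by
  have eL : ∀ f, hU.tev N (subst (XL k m) f) = hU.ev N f ⊗ₜ 1 := tensorEval_inl _ _
  have eR : ∀ f, hU.tev N (subst (XR k m) f) = 1 ⊗ₜ hU.ev N f := tensorEval_inr _ _
  obtain ⟨M, hM, e⟩ := hU.comul_truncEval N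
  have h1 := hM _ (hU.comm_hh M i j)
  rw [map_sub, map_sub, map_mul, map_mul, hU.comul_h', hU.comul_h', sub_eq_zero,
    coprodH_comm co (hU.comm_ev N), map_sum] at h1
  simp only [map_mul (U.comul N), e, hU.comul_h', coprodH, hU.comm_modH] at h1
  refine Eq.trans ?_ (h1.trans ?_)
  · simp only [map_add, map_sum, map_mul, eL, eR, sum_add_distrib, add_mul, sum_mul,
      tmul_sum, sum_tmul, tmul_mul_tmul, one_mul,
      mul_one]
    refine congrArg₂ (· + ·) (congrArg₂ (· + ·) ?_ rfl) rfl
    exact sum_comm.trans (sum_congr rfl fun _ _ => sum_comm)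
  · simp only [map_sum, map_mul, eL, mul_add, mul_sum, sum_mul, mul_assoc,
      sum_add_distrib, tmul_mul_tmul, one_mul, mul_one]
    rw [sum_comm]

theorem Cs_eq (hU : IsQuantumAlgebra co Cs As U h x) (i j l : Fin n) :
    Cs i j l = C (constantCoeff (Cs i j l)) := by
  have h1 := congrArg (subst (Sum.elim 0 (X : Fin m → PS (Fin m) k)))
    (congrFun (hU.comul_comm i j).2 l)
  have h0 : ∀ i, (0 : Fin m → PS (Fin m) k) i ∈ degIdeal k _ 1 := fun i => zero_mem _
  have hs := hasSubst_of_mem (sumElim_mem h0 (X_mem_degIdeal (k := k)))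
  rw [subst_comp_subst_apply (hasSubst_of_mem XL_mem) hs,
    subst_comp_subst_apply (hasSubst_of_mem (campbellHausdorff_mem co)) hs,
    subst_XL h0 X_mem_degIdeal, subst_zero_fun] at h1
  rw [h1]
  have h2 := chComp_zero_left co (X_mem_degIdeal (k := k) (τ := Fin m))
  change _ = subst (chComp co 0 X) _
  rw [h2, subst_X_self]

theorem structure_eq (hU : IsQuantumAlgebra co Cs As U h x)
    (i j q : Fin n) : ∑ l, C (constantCoeff (Cs i j l)) * co.expAlpha l q =
      ∑ l, ∑ p, co.expAlpha i l * co.expAlpha j p * C (constantCoeff (Cs l p q)) +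
        vectorField (As i) (co.expAlpha j q) - vectorField (As j) (co.expAlpha i q) := by
  have h0 : ∀ i, (0 : Fin m → PS (Fin m) k) i ∈ degIdeal k _ 1 := fun i => zero_mem _
  have hs := hasSubst_of_mem (sumElim_mem (X_mem_degIdeal (k := k)) h0)
  have hL : ∀ f, substAlgHom hs (subst (XL k m) f) = f := fun f => by
    rw [coe_substAlgHom, subst_comp_subst_apply (hasSubst_of_mem XL_mem) hs,
      subst_XL X_mem_degIdeal h0, subst_X_self]
  have hR : ∀ f, substAlgHom hs (subst (XR k m) f) = C (constantCoeff f) := fun f => by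
    rw [coe_substAlgHom, subst_comp_subst_apply (hasSubst_of_mem XR_mem) hs,
      subst_XR X_mem_degIdeal h0, subst_zero_fun]
  have hD : ∀ f, substAlgHom hs (subst co.campbellHausdorff f) = f := fun f => by
    rw [coe_substAlgHom, subst_comp_subst_apply (hasSubst_of_mem (campbellHausdorff_mem co)) hs]
    have h2 := chComp_zero_right co (X_mem_degIdeal (k := k) (τ := Fin m))
    change subst (chComp co X 0) _ = _
    rw [h2, subst_X_self]
  have h1 := congrArg (substAlgHom hs) (congrFun (hU.comul_comm i j).1 q)
  simp only [map_add, map_sum, map_mul, hL, hR, hD] at h1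
  rw [add_sub_assoc, h1]
  exact sum_congr rfl fun l _ => by rw [← hU.Cs_eq]

theorem vectorField_comm (hU : IsQuantumAlgebra co Cs As U h x)
    (i j : Fin n) (μ : Fin m) : vectorField (As i) (As j μ) - vectorField (As j) (As i μ) =
      ∑ l, C (constantCoeff (Cs i j l)) * As l μ := hU.eq_of_ev fun N => by
  have e : ∀ i j, hU.ev N (vectorField (As i) (As j μ)) =
      modH h N i * (modH h N j * hU.ev N (X μ) - hU.ev N (X μ) * modH h N j) -
        (modH h N j * hU.ev N (X μ) - hU.ev N (X μ) * modH h N j) * modH h N i := fun i j => by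
    rw [hU.comm_ev, hU.comm_ev, vectorField_X]
  have e2 : modH h N i * modH h N j - modH h N j * modH h N i =
      ∑ l, constantCoeff (Cs i j l) • modH h N l := by
    rw [hU.comm_modH]
    refine sum_congr rfl fun l _ => ?_
    rw [hU.Cs_eq, constantCoeff_C, ← mul_one (C _), ← smul_eq_C_mul, map_smul, map_one,
      smul_one_mul]
  have e3 : hU.ev N (∑ l, C (constantCoeff (Cs i j l)) * As l μ) =
      (∑ l, constantCoeff (Cs i j l) • modH h N l) * hU.ev N (X μ) -
        hU.ev N (X μ) * ∑ l, constantCoeff (Cs i j l) • modH h N l := by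
    rw [map_sum, sum_mul, mul_sum, ← sum_sub_distrib]
    refine sum_congr rfl fun l _ => ?_
    rw [← smul_eq_C_mul, map_smul, smul_mul_assoc, mul_smul_comm, ← smul_sub, hU.comm_ev,
      vectorField_X]
  rw [map_sub, e, e, e3, ← e2]
  noncomm_ring

theorem comm_hh' (hU : IsQuantumAlgebra co Cs As U h x) (i j : Fin n) :
    h i * h j - h j * h i = ∑ l, constantCoeff (Cs i j l) • h l :=
  eq_of_mk_eq (k := k) U.separated fun N => by
    rw [map_sub, map_mul, map_mul, map_sum]
    refine (hU.comm_modH N i j).trans (sum_congr rfl fun l _ => ?_)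
    rw [hU.Cs_eq, constantCoeff_C, ← mul_one (C _), ← smul_eq_C_mul, map_smul, map_one,
      smul_one_mul, map_smul]

/-- The classical limit of a quantum algebra. -/
def limit (hU : IsQuantumAlgebra co Cs As U h x) : InhomLieBialgebra k where
  n := n
  m := m
  co := co
  C i j l := constantCoeff (Cs i j l)
  A i ν μ := coeff (single ν 1) (As i μ)
  C_skew i j := congrFun (hU.eq_of_sum_smul (c := fun l => constantCoeff (Cs i j l))
    (c' := fun l => -constantCoeff (Cs j i l)) (by
      simp only [neg_smul, sum_neg_distrib, ← hU.comm_hh', neg_sub]))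
  C_jacobi i j p := congrFun (hU.eq_of_sum_smul (c' := 0) (by
    have e : ∀ i j p, ∑ l, (∑ q, constantCoeff (Cs i j q) * constantCoeff (Cs q p l)) • h l =
        (h i * h j - h j * h i) * h p - h p * (h i * h j - h j * h i) := fun i j p => by
      simp only [hU.comm_hh' i j, sum_mul, mul_sum, ← sum_sub_distrib,
        smul_mul_assoc, mul_smul_comm, ← smul_sub, hU.comm_hh', smul_sum, smul_smul,
        sum_smul]
      exact sum_comm
    simp only [sum_add_distrib, add_smul, e, Pi.zero_apply, zero_smul, sum_const_zero]
    noncomm_ring))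
  A_rep := A_rep_of_structure hU.As_mem hU.vectorField_comm
  cond1 := isLieCocycle_tensorRep_iff.1 (by
    have h1 := ((comulField_iff co As).1 hU.comulField_eq).isLieCocycle (isRep_tensorRep co)
    rwa [linPart_thetaA co As hU.As_mem] at h1)
  cond2 := cond2_of_structure co hU.As_mem hU.structure_eq

theorem isQuantization_limit (hU : IsQuantumAlgebra co Cs As U h x) :
    IsQuantization hU.limit U h x := ⟨Cs, As, hU, fun _ _ _ => rfl, fun _ _ _ => rfl⟩

end IsQuantumAlgebra

namespace InhomQuant

section Quantization

variable {L : InhomLieBialgebra k} {U : AdicHopfAlgebra k}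
  {h : Fin L.n → U.carrier} {x : Fin L.m → U.carrier}

theorem series_unique {Cs : Fin L.n → Fin L.n → Fin L.n → PS (Fin L.m) k}
    {As : Fin L.n → Fin L.m → PS (Fin L.m) k} (hU : IsQuantumAlgebra L.co Cs As U h x)
    (hl : HasClassicalLimit L Cs As) : Cs = L.seriesC ∧ As = L.seriesA :=
  ⟨funext fun i => funext fun j => funext fun l => by
    rw [hU.Cs_eq, hl.1, InhomLieBialgebra.seriesC],
    eq_seriesA L hU.As_mem hU.comulField_eq hl.2⟩

theorem isQuantumAlgebra_of_isQuantization (hU : IsQuantization L U h x) :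
    IsQuantumAlgebra L.co L.seriesC L.seriesA U h x := by
  obtain ⟨Cs, As, h1, h2⟩ := hU
  obtain ⟨rfl, rfl⟩ := series_unique h1 h2
  exact h1

theorem isPBW_of_isQuantization (hU : IsQuantization L U h x) : IsPBW L U.I h x :=
  have hQ := isQuantumAlgebra_of_isQuantization hU
  { ideal_eq := hQ.ideal_eq
    separated := U.separated
    complete := U.complete
    basis_indep := hQ.basis_indep
    basis_span := hQ.basis_span
    comm_xx := hQ.comm_xx
    comm_hh := fun i j => (hQ.comm_hh' i j).trans (by
      simp only [InhomLieBialgebra.seriesC, constantCoeff_C])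
    comm_hx := hQ.comm_hx }

theorem comul_eq (hU : IsQuantization L U h x) (N : ℕ) :
    U.comul N = (isPBW_of_isQuantization hU).comul N := by
  have hQ := isQuantumAlgebra_of_isQuantization hU
  have hP := isPBW_of_isQuantization hU
  obtain ⟨M, hM⟩ := U.comul_continuous N
  refine hP.algHom_ext (N := M + (N + N))
    (fun a ha => hM a (Ideal.pow_le_pow_right (Nat.le_add_right _ _) ha))
    (fun a ha => hP.comul_kill N a (Ideal.pow_le_pow_right (Nat.le_add_left _ _) ha))
    (fun i => ?_) fun μ => ?_
  · rw [hQ.comul_h', hP.comul_h]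
    rfl
  · rw [hQ.comul_x', hP.comul_x']
    rfl

theorem counit_x_eq_zero (hU : IsQuantization L U h x) (μ : Fin L.m) : U.counit (x μ) = 0 := by
  obtain ⟨M, hM⟩ := U.counit_continuous
  have h1 := hM _ (Submodule.pow_mem_pow U.I ((isPBW_of_isQuantization hU).x_mem μ) M)
  rw [map_pow] at h1
  exact eq_zero_of_pow_eq_zero h1

theorem counit_h_eq_zero (hU : IsQuantization L U h x) (i : Fin L.n) : U.counit (h i) = 0 := by
  have hQ := isQuantumAlgebra_of_isQuantization hU
  have hP := isPBW_of_isQuantization hU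
  obtain ⟨M₁, hM₁⟩ := U.counit_continuous
  obtain ⟨M₀, hM₀⟩ := U.counit_left 1 (h i)
  set M := M₀ + M₁ + 1 with hM
  have hk : ∀ a ∈ U.I ^ M, U.counit a = 0 := fun a ha =>
    hM₁ a (Ideal.pow_le_pow_right (by omega) ha)
  have e : ∀ f, U.counit (truncEval M f x) = constantCoeff f := fun f => by
    let c : PS (Fin L.m) k →ₐ[k] k :=
      { constantCoeff (σ := Fin L.m) (R := k) with commutes' := fun a => constantCoeff_C a }
    have := hP.quotLift_ev hk (ev' := c) (M := 1) (fun f hf => mem_degIdeal_one.1 hf)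
      (fun μ => (counit_x_eq_zero hU μ).trans (constantCoeff_X μ).symm) f
    rw [hP.ev_eq, quotLift_mk] at this
    exact this
  have h1 := hM₀ M (by omega) (∑ l, truncEval M (L.co.expAlpha i l) x ⊗ₜ h l + h i ⊗ₜ 1) (by
    rw [hQ.comul_h, map_add, map_sum]
    rfl)
  refine hQ.algebraMap_injective ?_
  rw [map_add, map_sum, map_add, map_sum] at h1
  simp only [map_tmul, Algebra.TensorProduct.lid_tmul, e,
    constantCoeff_expAlpha, AlgHom.id_apply, one_apply, ite_smul, one_smul, zero_smul,
    sum_ite_eq, mem_univ, if_true, Submodule.pow_one] at h1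
  rwa [add_sub_cancel_left, ← Algebra.algebraMap_eq_smul_one] at h1

theorem counit_eq (hU : IsQuantization L U h x) : U.counit =
    (isPBW_of_isQuantization hU).counit := by
  have hP := isPBW_of_isQuantization hU
  obtain ⟨M, hM⟩ := U.counit_continuous
  refine hP.algHom_ext (N := M + 1)
    (fun a ha => hM a (Ideal.pow_le_pow_right (Nat.le_add_right _ _) ha))
    (hP.counit_kill' (Nat.le_add_left _ _)) (fun i => ?_) fun μ => ?_
  · rw [counit_h_eq_zero hU, hP.counit_h]
  · rw [counit_x_eq_zero hU, hP.counit_x]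

end Quantization

section Morphisms

variable {L M : InhomLieBialgebra k}

theorem hom_ext_of_gen {U W : AdicHopfAlgebra k} {h : Fin L.n → U.carrier}
    {x : Fin L.m → U.carrier} (hU : IsQuantization L U h x) {f g : U ⟶ W}
    (hh : ∀ i, f.toAlg (h i) = g.toAlg (h i)) (hx : ∀ μ, f.toAlg (x μ) = g.toAlg (x μ)) :
    f = g := by
  refine AdicHopfAlgebra.Hom.ext (AlgHom.ext fun a => eq_of_mk_eq (k := k) W.separated fun N => ?_)
  obtain ⟨M₁, h1⟩ := f.continuous N
  obtain ⟨M₂, h2⟩ := g.continuous N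
  exact congr_fun ((isPBW_of_isQuantization hU).algHom_ext (N := M₁ + M₂)
    (F := (mkₐ k (W.I ^ N)).comp f.toAlg)
    (G := (mkₐ k (W.I ^ N)).comp g.toAlg)
    (fun a ha => eq_zero_iff_mem.2 (h1 a (Ideal.pow_le_pow_right (Nat.le_add_right _ _) ha)))
    (fun a ha => eq_zero_iff_mem.2 (h2 a (Ideal.pow_le_pow_right (Nat.le_add_left _ _) ha)))
    (fun i => congrArg _ (hh i)) fun μ => congrArg _ (hx μ)) a

variable {p : Matrix (Fin L.n) (Fin M.n) k} {q : Matrix (Fin L.m) (Fin M.m) k} {U : Type u} [Ring U]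
  [Algebra k U] {I : Ideal U} [I.IsTwoSided] {h : Fin L.n → U} {x : Fin L.m → U} {W : Type u}
  [Ring W] [Algebra k W] {J : Ideal W} [J.IsTwoSided] {g : Fin M.n → W} {y : Fin M.m → W}

theorem subst_qX {τ : Type} {w : Fin M.m → PS τ k} (hw : InMax w)
    (μ : Fin L.m) : subst w (qX q μ) = (constMat (τ := τ) q).mulVec w μ := by
  have hs := hasSubst_of_mem hw
  simp only [qX, mulVec, dotProduct, constMat, Matrix.map_apply, ← smul_eq_C_mul]
  rw [← coe_substAlgHom hs, map_sum]
  simp only [map_smul, coe_substAlgHom, subst_X hs]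

theorem exists_algHom_of_isBialgMap (hpq : IsBialgMap L M p q) (hP : IsPBW L I h x)
    (hQ : IsPBW M J g y) : ∃ F : U →ₐ[k] W, (∀ N, ∀ a ∈ I ^ N, F a ∈ J ^ N) ∧
      (∀ i, F (h i) = ∑ j, p i j • g j) ∧ ∀ μ, F (x μ) = ∑ ν, q μ ν • y ν := by
  have hr : ∀ N, PBWRel L (fun i => ∑ j, p i j • mkₐ k (J ^ N) (g j))
      (evalSubst (hQ.ev N) (qX_mem (q := q))) := fun N => by
    refine PBWRel.mk_of_X (evalSubst_kill (hQ.ev_kill N) _) (fun i j => ?_) fun i μ => ?_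
    · simp only [sum_mul_sum, smul_mul_smul_comm]
      rw [sum_comm (s := Finset.univ) (f := fun a b => (p j a * p i b) •
        (mkₐ k (J ^ N) (g a) * mkₐ k (J ^ N) (g b)))]
      simp only [← sum_sub_distrib, mul_comm (p j _), ← smul_sub, (hQ.rel N).comm_hh,
        smul_sum, smul_smul]
      rw [sum_comm (s := Finset.univ) (f := fun l s => (L.C i j l * p l s) • mkₐ k (J ^ N) (g s))]
      simp only [← sum_smul, hpq.map_C]
      simp only [sum_smul]
      exact ((sum_congr rfl fun _ _ => sum_comm).trans sum_comm)
    · rw [evalSubst_X, evalSubst_apply, hpq.seriesA_natural, sum_mul, mul_sum,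
        ← sum_sub_distrib, map_sum]
      refine sum_congr rfl fun j _ => ?_
      rw [smul_mul_assoc, mul_smul_comm, ← smul_sub, (hQ.rel N).comm_ev, map_sum, qX,
        mulVec, dotProduct, map_sum, map_sum, smul_sum]
      refine sum_congr rfl fun ν _ => ?_
      rw [constMat, Matrix.map_apply, ← smul_eq_C_mul, ← smul_eq_C_mul, Derivation.map_smul,
        vectorField_X, map_smul, map_smul, smul_smul]
  choose F hF1 hF2 hF3 using fun N => hP.exists_algHom (hr N) (evalSubst_kill (hQ.ev_kill N) _)
  have hF3' : ∀ N μ, F N (x μ) = ∑ ν, q μ ν • mkₐ k (J ^ N) (y ν) := fun N μ => by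
    rw [hF3, evalSubst_X, qX, mulVec, dotProduct, map_sum]
    refine sum_congr rfl fun ν _ => ?_
    rw [constMat, Matrix.map_apply, ← smul_eq_C_mul, map_smul, hQ.ev_X]
  have hc : ∀ N, (quotLift (mkₐ k (J ^ N)) (mk_eq_zero_of_le (Nat.le_succ N))).comp
      (F (N + 1)) = F N := fun N => by
    refine hP.algHom_ext (N := N + 1) (fun a ha => ?_)
      (fun a ha => hF1 N a (Ideal.pow_le_pow_right (Nat.le_succ N) ha)) (fun i => ?_) fun μ => ?_
    · rw [AlgHom.comp_apply, hF1 _ a ha, map_zero]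
    · rw [AlgHom.comp_apply, hF2, hF2, map_sum]
      simp only [map_smul, quotLift_mk]
    · rw [AlgHom.comp_apply, hF3', hF3', map_sum]
      simp only [map_smul, quotLift_mk]
  obtain ⟨G, hG⟩ := exists_linear_limit hQ.separated hQ.complete (fun N => (F N).toLinearMap)
    fun N e a ha => by
      have ha' : mkₐ k (J ^ (N + 1)) a = F (N + 1) e := ha
      rw [AlgHom.toLinearMap_apply, ← hc, AlgHom.comp_apply, ← ha', quotLift_mk]
  have hG' : ∀ N a, mkₐ k (J ^ N) (G a) = F N a := hG
  refine ⟨AlgHom.ofLinearMap G (eq_of_mk_eq (k := k) hQ.separated fun N => by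
    rw [hG', map_one, map_one]) fun a b => eq_of_mk_eq (k := k) hQ.separated fun N => by
    rw [hG', map_mul, map_mul, hG', hG'], fun N a ha => ?_, fun i => ?_, fun μ => ?_⟩
  · exact eq_zero_iff_mem.1 ((hG' N a).trans (hF1 N a ha))
  · refine eq_of_mk_eq (k := k) hQ.separated fun N => (hG' N _).trans ?_
    rw [hF2, map_sum]
    simp only [map_smul]
  · refine eq_of_mk_eq (k := k) hQ.separated fun N => (hG' N _).trans ?_
    rw [hF3', map_sum]
    simp only [map_smul]

theorem approx_map_eq (hpq : IsBialgMap L M p q) (hP : IsPBW L I h x) (hQ : IsPBW M J g y)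
    {F : U →ₐ[k] W} (hF : ∀ N, ∀ a ∈ I ^ N, F a ∈ J ^ N) (hh : ∀ i, F (h i) = ∑ j, p i j • g j)
    (hx : ∀ μ, F (x μ) = ∑ ν, q μ ν • y ν) (N M' : ℕ) (hN : N ≤ M') (a : U) (t : U ⊗[k] U)
    (ht : approxTensor k I M' t = hP.comul M' a) :
    approxTensor k J N (tmap F F t) = hQ.comul N (F a) := by
  have hk : ∀ a ∈ I ^ N, (mkₐ k (J ^ N)).comp F a = 0 := fun a ha =>
    eq_zero_iff_mem.2 (hF N a ha)
  let G := quotLift _ hk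
  have hG : ∀ f, G (hP.ev N f) = hQ.ev N (subst (qX q) f) := fun f => by
    rw [← evalSubst_apply _ qX_mem]
    refine hP.quotLift_ev hk (evalSubst_kill (hQ.ev_kill N) _) (fun μ => ?_) f
    rw [evalSubst_X, qX, mulVec, dotProduct, map_sum, AlgHom.comp_apply, hx, map_sum]
    refine sum_congr rfl fun ν _ => ?_
    rw [constMat, Matrix.map_apply, ← smul_eq_C_mul, map_smul, map_smul, hQ.ev_X]
  have hGh : ∀ i, G (mkₐ k (I ^ N) (h i)) = ∑ j, p i j • mkₐ k (J ^ N) (g j) := fun i => by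
    rw [quotLift_mk, AlgHom.comp_apply, hh, map_sum]
    simp only [map_smul]
  have key : (tmap G G).comp (hP.comul N) = (hQ.comul N).comp F := by
    refine hP.algHom_ext (N := N + N) (fun a ha => ?_)
      (fun a ha => hQ.comul_kill N _ (hF _ a ha)) (fun i => ?_) fun μ => ?_
    · rw [AlgHom.comp_apply, hP.comul_kill N a ha, map_zero]
    · rw [AlgHom.comp_apply, AlgHom.comp_apply, hP.map_comul_h, hh, map_sum]
      simp only [map_smul, hQ.comul_h, IsPBW.Dh, coprodH, smul_add, sum_add_distrib, hG, hGh,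
        sum_tmul, tmul_sum, ← smul_tmul',
        smul_sum]
      refine congrArg₂ (· + ·) (sum_comm.trans (Eq.trans ?_ sum_comm)) rfl
      refine sum_congr rfl fun s _ => ?_
      have e := congrArg (hQ.ev N) (hpq.expAlpha_natural i s)
      simp only [mul_comm _ (C _), ← smul_eq_C_mul, map_sum, map_smul] at e
      simp only [tmul_smul, smul_tmul', ← sum_tmul, e]
    · rw [AlgHom.comp_apply, AlgHom.comp_apply, hP.comul_x', hx, map_sum,
        hP.map_tev _ (hQ.tev_kill N) (constMat_mulVec_mem q XL_mem) (constMat_mulVec_mem q XR_mem)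
          (fun μ => ?_) fun μ => ?_]
      · refine (congrArg (hQ.tev N) (hpq.campbellHausdorff_natural μ)).trans ?_
        rw [map_sum]
        refine sum_congr rfl fun ν _ => ?_
        rw [← smul_eq_C_mul, map_smul, map_smul, hQ.comul_x']
      · rw [map_tmul, map_one, ← hP.ev_X, hG, subst_X (hasSubst_of_mem qX_mem),
          ← hQ.tev_XL, subst_qX XL_mem]
      · rw [map_tmul, map_one, ← hP.ev_X, hG, subst_X (hasSubst_of_mem qX_mem),
          ← hQ.tev_XR, subst_qX XR_mem]
  have h1 := congr_fun key a
  rw [AlgHom.comp_apply, ← hP.comul_compat M' N hN a t ht] at h1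
  refine Eq.trans ?_ h1
  rw [← map_eq_of_approx hk hk, Algebra.TensorProduct.map_comp]
  rfl

end Morphisms

section LieBialgebraMaps

theorem sum_comm₃ {α β ι E : Type*} [Fintype α] [Fintype β] [Fintype ι] [AddCommMonoid E]
    (F : α → β → ι → E) : ∑ a, ∑ b, ∑ i, F a b i = ∑ b, ∑ i, ∑ a, F a b i :=
  sum_comm.trans (sum_congr rfl fun _ _ => sum_comm)

theorem sum_comm₄ {α β ι κ E : Type*} [Fintype α] [Fintype β] [Fintype ι] [Fintype κ]
    [AddCommMonoid E] (F : α → β → ι → κ → E) :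
    ∑ a, ∑ b, ∑ i, ∑ j, F a b i j = ∑ i, ∑ j, ∑ a, ∑ b, F a b i j :=
  (sum_congr rfl fun _ _ => sum_comm₃ _).trans (sum_comm₃ _)

variable {L M : InhomLieBialgebra k}

/-- The linear map `L → M` with the matrices `p` and `q`. -/
def linOf (p : Matrix (Fin L.n) (Fin M.n) k) (q : Matrix (Fin L.m) (Fin M.m) k) :
    L.Space →ₗ[k] M.Space := p.vecMulLinear.prodMap q.vecMulLinear

variable {p : Matrix (Fin L.n) (Fin M.n) k} {q : Matrix (Fin L.m) (Fin M.m) k}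

theorem linOf_fst (v : L.Space) (j : Fin M.n) : (linOf p q v).1 j = ∑ i, v.1 i * p i j := rfl

theorem linOf_snd (v : L.Space) (ν : Fin M.m) : (linOf p q v).2 ν = ∑ μ, v.2 μ * q μ ν := rfl

theorem sum_basisH (c : Fin L.n → k) : ∑ i, c i • L.basisH i = (c, 0) := by
  ext j <;> simp [basisH, Prod.fst_sum, Prod.snd_sum, Finset.sum_apply, Pi.single_apply]

theorem sum_basisX (c : Fin L.m → k) : ∑ i, c i • L.basisX i = (0, c) := by
  ext j <;> simp [basisX, Prod.fst_sum, Prod.snd_sum, Finset.sum_apply, Pi.single_apply]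

theorem linOf_basisH (i : Fin L.n) : linOf p q (L.basisH i) = ∑ j, p i j • M.basisH j := by
  rw [sum_basisH]
  ext j <;> simp [linOf_fst, linOf_snd, basisH, Pi.single_apply]

theorem linOf_basisX (μ : Fin L.m) : linOf p q (L.basisX μ) = ∑ ν, q μ ν • M.basisX ν := by
  rw [sum_basisX]
  ext j <;> simp [linOf_fst, linOf_snd, basisX, Pi.single_apply]

theorem linOf_bracket (hpq : IsBialgMap L M p q) (v w : L.Space) :
    linOf p q (L.bracket v w) = M.bracket (linOf p q v) (linOf p q w) := by
  refine Prod.ext (funext fun s => ?_) (funext fun ρ => ?_)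
  · rw [linOf_fst]
    simp only [InhomLieBialgebra.bracket, linOf_fst, sum_mul_sum]
    simp only [sum_mul]
    rw [sum_comm₃, sum_comm₄]
    refine sum_congr rfl fun i _ => sum_congr rfl fun j _ => ?_
    have e := congrArg (v.1 i * w.1 j * ·) (hpq.map_C i j s)
    simp only [mul_sum] at e
    exact Eq.trans (sum_congr rfl fun _ _ => by ring) (e.trans
      (sum_congr rfl fun _ _ => sum_congr rfl fun _ _ => by ring))
  · rw [linOf_snd]
    simp only [InhomLieBialgebra.bracket, linOf_fst, linOf_snd, sum_mul_sum, ← sum_sub_distrib]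
    simp only [sum_mul]
    rw [sum_comm₃, sum_comm₄]
    refine sum_congr rfl fun i _ => sum_congr rfl fun μ _ => ?_
    have e := congrArg ((v.1 i * w.2 μ - w.1 i * v.2 μ) * ·) (hpq.map_A i μ ρ)
    simp only [mul_sum] at e
    exact Eq.trans (sum_congr rfl fun _ _ => by ring) (e.trans
      (sum_congr rfl fun _ _ => sum_congr rfl fun _ _ => by ring))

theorem linOf_cobracket (hpq : IsBialgMap L M p q) (v : L.Space) :
    TensorProduct.map (linOf p q) (linOf p q) (L.cobracket v) = M.cobracket (linOf p q v) := by
  have hX : ∀ μ, TensorProduct.map (linOf p q) (linOf p q) (∑ ρ, ∑ σ, L.co.γ ρ σ μ •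
      (L.basisX ρ ⊗ₜ[k] L.basisX σ)) = ∑ ν, q μ ν • ∑ ρ, ∑ σ, M.co.γ ρ σ ν •
      (M.basisX ρ ⊗ₜ[k] M.basisX σ) := fun μ => by
    have e : ∀ ρ σ, linOf p q (L.basisX ρ) ⊗ₜ[k] linOf p q (L.basisX σ) =
        ∑ a, ∑ b, (q ρ a * q σ b) • (M.basisX a ⊗ₜ[k] M.basisX b) := fun ρ σ => by
      simp only [linOf_basisX, sum_tmul, tmul_sum, TensorProduct.smul_tmul_smul]
      exact sum_comm
    simp only [map_sum, map_smul, TensorProduct.map_tmul, e, smul_sum, smul_smul]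
    refine (sum_comm₄ _).trans (Eq.trans ?_ (sum_comm₃ _).symm)
    simp only [← sum_smul]
    exact sum_congr rfl fun a _ => sum_congr rfl fun b _ =>
      congrArg (· • _) (hpq.map_γ a b μ)
  have hH : ∀ i, TensorProduct.map (linOf p q) (linOf p q) (∑ ρ, ∑ l, L.co.α ρ i l •
      (L.basisX ρ ⊗ₜ[k] L.basisH l - L.basisH l ⊗ₜ[k] L.basisX ρ)) =
      ∑ j, p i j • ∑ ρ, ∑ l, M.co.α ρ j l •
      (M.basisX ρ ⊗ₜ[k] M.basisH l - M.basisH l ⊗ₜ[k] M.basisX ρ) := fun i => by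
    have e : ∀ ρ l, linOf p q (L.basisX ρ) ⊗ₜ[k] linOf p q (L.basisH l) -
        linOf p q (L.basisH l) ⊗ₜ[k] linOf p q (L.basisX ρ) = ∑ a, ∑ b, (q ρ a * p l b) •
          (M.basisX a ⊗ₜ[k] M.basisH b - M.basisH b ⊗ₜ[k] M.basisX a) := fun ρ l => by
      simp only [linOf_basisX, linOf_basisH, sum_tmul, tmul_sum,
        TensorProduct.smul_tmul_smul, smul_sub, sum_sub_distrib, mul_comm (p _ _)]
      rw [sum_comm]
    simp only [map_sum, map_smul, map_sub, TensorProduct.map_tmul, e, smul_sum, smul_smul]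
    refine (sum_comm₄ _).trans (Eq.trans ?_ (sum_comm₃ _).symm)
    simp only [← sum_smul]
    exact sum_congr rfl fun a _ => sum_congr rfl fun b _ =>
      congrArg (· • _) (hpq.map_α i a b)
  have e : ∀ {a b : ℕ} (v : Fin a → k) (r : Matrix (Fin a) (Fin b) k) (D : Fin b →
    M.Space ⊗[k] M.Space),
      ∑ i, v i • ∑ j, r i j • D j = ∑ j, (∑ i, v i * r i j) • D j := fun v r D => by
    simp only [smul_sum, sum_smul, mul_smul]
    exact sum_comm
  rw [InhomLieBialgebra.cobracket, InhomLieBialgebra.cobracket, map_add, map_sum, map_sum]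
  simp only [map_smul, hX, hH]
  exact congrArg₂ (· + ·) (e _ _ _) (e _ _ _)

theorem linOf_invol (v : L.Space) : linOf p q (L.invol v) = M.invol (linOf p q v) :=
  Prod.ext (map_neg p.vecMulLinear v.1) rfl

/-- The morphism with the matrices `p` and `q`. -/
def homOf (hpq : IsBialgMap L M p q) : L ⟶ M :=
  InhomLieBialgebra.Hom.mk (linOf p q) (linOf_bracket hpq) (linOf_cobracket hpq) linOf_invol

/-- The matrix of a morphism on `H`. -/
def matH (f : L ⟶ M) : Matrix (Fin L.n) (Fin M.n) k := Matrix.of fun i j =>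
  (InhomLieBialgebra.Hom.toLin f (L.basisH i)).1 j

/-- The matrix of a morphism on `V`. -/
def matX (f : L ⟶ M) : Matrix (Fin L.m) (Fin M.m) k := Matrix.of fun μ ν =>
  (InhomLieBialgebra.Hom.toLin f (L.basisX μ)).2 ν

theorem toLin_eq (f : L ⟶ M) : InhomLieBialgebra.Hom.toLin f = linOf (matH f) (matX f) := by
  have hH : ∀ i, InhomLieBialgebra.Hom.toLin f (L.basisH i) = linOf (matH f) (matX f)
    (L.basisH i) :=
    fun i => by
      rw [linOf_basisH, sum_basisH]
      refine Prod.ext rfl ?_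
      have h1 := congrArg Prod.snd (InhomLieBialgebra.Hom.map_invol f (L.basisH i))
      have h2 : L.invol (L.basisH i) = -L.basisH i := Prod.ext rfl neg_zero.symm
      rw [h2, map_neg] at h1
      exact self_eq_neg.1 h1.symm
  have hX : ∀ i, InhomLieBialgebra.Hom.toLin f (L.basisX i) = linOf (matH f) (matX f)
    (L.basisX i) :=
    fun i => by
      rw [linOf_basisX, sum_basisX]
      refine Prod.ext ?_ rfl
      have h1 := congrArg Prod.fst (InhomLieBialgebra.Hom.map_invol f (L.basisX i))
      have h2 : L.invol (L.basisX i) = L.basisX i := Prod.ext neg_zero rfl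
      rw [h2] at h1
      exact self_eq_neg.1 h1
  refine LinearMap.ext fun v => ?_
  have hv : v = ∑ i, v.1 i • L.basisH i + ∑ i, v.2 i • L.basisX i := by
    rw [sum_basisH, sum_basisX]; simp
  rw [hv]
  simp only [map_add, map_sum, map_smul, hH, hX]

theorem isBialgMap_of_hom (f : L ⟶ M) : IsBialgMap L M (matH f) (matX f) := by
  have hb := InhomLieBialgebra.Hom.map_bracket f
  have hc := InhomLieBialgebra.Hom.map_cobracket f
  rw [toLin_eq f] at hb hc
  have hw : ∀ (w w' : M.Space →ₗ[k] k) v, LinearMap.mul' k k (TensorProduct.map w w'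
    (M.cobracket v)) =
      ∑ μ, v.2 μ * ∑ ρ, ∑ σ, M.co.γ ρ σ μ * (w (M.basisX ρ) * w' (M.basisX σ)) +
      ∑ i, v.1 i * ∑ ρ, ∑ l, M.co.α ρ i l *
        (w (M.basisX ρ) * w' (M.basisH l) - w (M.basisH l) * w' (M.basisX ρ)) := fun w w' v => by
    simp [InhomLieBialgebra.cobracket]
  have hw2 : ∀ (w w' : M.Space →ₗ[k] k) v, LinearMap.mul' k k (TensorProduct.map w w'
      (TensorProduct.map (linOf (matH f) (matX f)) (linOf (matH f) (matX f)) (L.cobracket v))) =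
      ∑ μ, v.2 μ * ∑ ρ, ∑ σ, L.co.γ ρ σ μ * (w (linOf (matH f) (matX f) (L.basisX ρ)) *
        w' (linOf (matH f) (matX f) (L.basisX σ))) +
      ∑ i, v.1 i * ∑ ρ, ∑ l, L.co.α ρ i l *
        (w (linOf (matH f) (matX f) (L.basisX ρ)) * w' (linOf (matH f) (matX f) (L.basisH l)) -
          w (linOf (matH f) (matX f) (L.basisH l)) * w' (linOf (matH f) (matX f) (L.basisX ρ))) :=
    fun w w' v => by simp [InhomLieBialgebra.cobracket]
  constructor
  · intro i j s
    simpa [InhomLieBialgebra.bracket, linOf_fst, basisH, Pi.single_apply, ite_and] using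
      congrFun (congrArg Prod.fst (hb (L.basisH i) (L.basisH j))) s
  · intro i μ ρ
    simpa [InhomLieBialgebra.bracket, linOf_fst, linOf_snd, basisH, basisX, Pi.single_apply,
      ite_and] using
      congrFun (congrArg Prod.snd (hb (L.basisH i) (L.basisX μ))) ρ
  · intro a b μ
    have h1 := hw (LinearMap.proj a ∘ₗ LinearMap.snd k _ _)
      (LinearMap.proj b ∘ₗ LinearMap.snd k _ _)
      (linOf (matH f) (matX f) (L.basisX μ))
    rw [← hc, hw2] at h1
    simpa [linOf_fst, linOf_snd, basisH, basisX, Pi.single_apply, ite_and] using h1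
  · intro i ρ s
    have h1 := hw (LinearMap.proj ρ ∘ₗ LinearMap.snd k _ _)
      (LinearMap.proj s ∘ₗ LinearMap.fst k _ _)
      (linOf (matH f) (matX f) (L.basisH i))
    rw [← hc, hw2] at h1
    simpa [linOf_fst, linOf_snd, basisH, basisX, Pi.single_apply, ite_and] using h1

end LieBialgebraMaps

section QuantizationMaps

variable {L M : InhomLieBialgebra k} {U W : AdicHopfAlgebra k}
  {h : Fin L.n → U.carrier} {x : Fin L.m → U.carrier} {g : Fin M.n → W.carrier}
  {y : Fin M.m → W.carrier} {p : Matrix (Fin L.n) (Fin M.n) k} {q : Matrix (Fin L.m) (Fin M.m) k}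

theorem exists_hom (hpq : IsBialgMap L M p q) (hU : IsQuantization L U h x)
    (hW : IsQuantization M W g y) : ∃ f : U ⟶ W, (∀ i, f.toAlg (h i) = ∑ j, p i j • g j) ∧
      ∀ μ, f.toAlg (x μ) = ∑ ν, q μ ν • y ν := by
  have hP := isPBW_of_isQuantization hU
  have hQ := isPBW_of_isQuantization hW
  obtain ⟨F, h1, h2, h3⟩ := exists_algHom_of_isBialgMap hpq hP hQ
  refine ⟨AdicHopfAlgebra.Hom.mk F (fun N => ⟨N, h1 N⟩) (congr_fun (?_ :
    W.counit.comp F = U.counit)) fun N a => ⟨N, fun M' hM t ht => ?_⟩, h2, h3⟩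
  · rw [counit_eq hU, counit_eq hW]
    refine hP.algHom_ext (N := 1) (fun a ha => hQ.counit_kill _ (h1 1 a ha)) hP.counit_kill
      (fun i => ?_) fun μ => ?_
    · rw [AlgHom.comp_apply, h2, map_sum, hP.counit_h]
      simp only [map_smul, hQ.counit_h, smul_zero, sum_const_zero]
    · rw [AlgHom.comp_apply, h3, map_sum, hP.counit_x]
      simp only [map_smul, hQ.counit_x, smul_zero, sum_const_zero]
  · rw [comul_eq hU] at ht
    rw [comul_eq hW]
    exact approx_map_eq hpq hP hQ h1 h2 h3 N M' hM a t ht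

theorem constantCoeff_subst_of_mem {σ τ : Type} [Finite σ] [Finite τ] {u : σ → PS τ k}
    (hu : InMax u) (f : PS σ k) :
    constantCoeff (subst u f) = constantCoeff f := by
  have hz : HasSubst (0 : τ → PS τ k) := hasSubst_of_mem fun _ => zero_mem _
  have h1 := subst_comp_subst_apply (hasSubst_of_mem hu) hz f
  simp only [subst_zero_fun, mem_degIdeal_one.1 (hu _), map_zero] at h1
  have h2 : subst (fun _ => 0) f = (C (constantCoeff f) : PS τ k) := subst_zero_fun f
  rw [h2] at h1
  simpa using congrArg constantCoeff h1

theorem coeff_single_subst_qX (f : PS (Fin L.m) k) (ρ : Fin M.m) :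
    coeff (single ρ 1) (subst (qX q) f) = ∑ σ, q σ ρ * coeff (single σ 1) f := by
  have e : ∀ {a : ℕ} (ρ : Fin a) (f : PS (Fin a) k),
      coeff (single ρ 1) f = constantCoeff (pderiv k ρ f) := fun ρ f => by
    rw [← coeff_zero_eq_constantCoeff_apply, coeff_pderiv]
    simp
  rw [e, ← vectorField_single, vectorField_subst _ qX_mem, map_sum]
  refine sum_congr rfl fun σ _ => ?_
  rw [map_mul, constantCoeff_subst_of_mem qX_mem, ← e, mul_comm, vectorField_single, ← e, qX,
    mulVec, dotProduct, map_sum]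
  simp [constMat, ← smul_eq_C_mul, coeff_X, Finsupp.single_left_inj]

theorem coeff_inl_inr (c : Fin M.m → Fin M.m → k) (a b : Fin M.m) :
    coeff (single (Sum.inl a) 1 + single (Sum.inr b) 1)
      (∑ ρ, ∑ σ, c ρ σ • (XL k M.m ρ * XR k M.m σ)) = c a b := by
  classical
  have e : ∀ ρ σ, coeff (single (Sum.inl a) 1 + single (Sum.inr b) 1)
      (XL k M.m ρ * XR k M.m σ) = if a = ρ then if b = σ then 1 else 0 else 0 := fun ρ σ => by
    rw [XL, XR, X, X, monomial_mul_monomial, coeff_monomial, mul_one, ← ite_and]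
    refine if_congr ⟨fun h => ?_, fun h => by rw [h.1, h.2]⟩ rfl rfl
    have h1 := congr_fun h (Sum.inl a)
    have h2 := congr_fun h (Sum.inr b)
    simp [Finsupp.single_apply] at h1 h2
    exact ⟨h1.symm, h2.symm⟩
  simp [e]

theorem isBialgMap_of_gen (hU : IsQuantization L U h x) (hW : IsQuantization M W g y) {f : U ⟶ W}
    (hh : ∀ i, f.toAlg (h i) = ∑ j, p i j • g j) (hx : ∀ μ, f.toAlg (x μ) = ∑ ν, q μ ν • y ν) :
    IsBialgMap L M p q := by
  have hP := isPBW_of_isQuantization hU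
  have hQ := isPBW_of_isQuantization hW
  have hW' := isQuantumAlgebra_of_isQuantization hW
  have hk : ∀ N M', ∃ M₁ ≥ M', ∀ a ∈ U.I ^ M₁, (mkₐ k (W.I ^ N)).comp f.toAlg a = 0 :=
    fun N M' => by
      obtain ⟨M₁, h1⟩ := f.continuous N
      exact ⟨M₁ + M', Nat.le_add_left _ _, fun a ha => eq_zero_iff_mem.2
        (h1 a (Ideal.pow_le_pow_right (Nat.le_add_right _ _) ha))⟩
  have hev : ∀ {N M₁} (h1 : ∀ a ∈ U.I ^ M₁, (mkₐ k (W.I ^ N)).comp f.toAlg a = 0)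
      r, quotLift _ h1 (hP.ev M₁ r) = hW'.ev N (subst (qX q) r) := fun {N M₁} h1 r => by
    rw [← evalSubst_apply _ qX_mem]
    refine hP.quotLift_ev h1 (evalSubst_kill (hW'.ev_kill N) _) (fun μ => ?_) r
    rw [evalSubst_X, qX, mulVec, dotProduct, map_sum, AlgHom.comp_apply, hx, map_sum]
    refine sum_congr rfl fun ν _ => ?_
    rw [constMat, Matrix.map_apply, ← smul_eq_C_mul, map_smul, map_smul, hW'.ev_X]
  have hcom : ∀ N a, ∃ M₁, ∃ h1 : ∀ a ∈ U.I ^ M₁, (mkₐ k (W.I ^ N)).comp f.toAlg a = 0,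
      tmap (quotLift _ h1) (quotLift _ h1) (hP.comul M₁ a) = hQ.comul N (f.toAlg a) := fun N a => by
    obtain ⟨M₀, h0⟩ := f.map_comul N a
    obtain ⟨M₁, hM, h1⟩ := hk N M₀
    refine ⟨M₁, h1, ?_⟩
    obtain ⟨t, ht⟩ := (TensorProduct.map_surjective (g := (mkₐ k (U.I ^ M₁)).toLinearMap)
      (g' := (mkₐ k (U.I ^ M₁)).toLinearMap)
      (Ideal.Quotient.mkₐ_surjective k (U.I ^ M₁)) (Ideal.Quotient.mkₐ_surjective k (U.I ^ M₁)))
        (U.comul M₁ a)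
    have ht' : approxTensor k U.I M₁ t = U.comul M₁ a := ht
    rw [← comul_eq hU, ← ht', ← map_eq_of_approx, ← comul_eq hW, ← h0 M₁ hM t ht',
      Algebra.TensorProduct.map_comp]
    rfl
  have hlin : ∀ N (i : Fin L.n), mkₐ k (W.I ^ N) (f.toAlg (h i)) =
      ∑ j, p i j • modH g N j := fun N i => by
    rw [hh, map_sum]
    simp only [map_smul]
  constructor
  · intro i j s
    refine congrFun (hW'.eq_of_sum_smul (c := fun s => ∑ l, L.C i j l * p l s)
      (c' := fun s => ∑ a, ∑ b, p i a * p j b * M.C a b s) ?_) s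
    have h1 := congrArg f.toAlg (hP.comm_hh i j)
    rw [map_sub, map_mul, map_mul, map_sum] at h1
    simp only [map_smul, hh, sum_mul_sum, smul_mul_smul_comm, smul_sum, smul_smul] at h1
    rw [sum_comm (f := fun a b => (p j a * p i b) • (g a * g b))] at h1
    simp only [mul_comm (p j _), ← sum_sub_distrib, ← smul_sub, hQ.comm_hh, smul_sum,
      smul_smul] at h1
    simp only [sum_smul]
    rw [sum_comm, ← h1]
    exact (sum_comm₃ _).symm
  · intro i μ ρ
    have h1 : subst (qX q) (L.seriesA i μ) = ∑ j, ∑ ν, C (p i j * q μ ν) * M.seriesA j ν :=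
      hW'.eq_of_ev fun N => by
        obtain ⟨M₁, -, h1⟩ := hk N 0
        have h2 := congrArg (quotLift _ h1) ((hP.rel M₁).comm_ev i (X μ))
        rw [map_sub, map_mul, map_mul, quotLift_mk, hev h1, hev h1, vectorField_X,
          subst_X (hasSubst_of_mem qX_mem), AlgHom.comp_apply, hlin] at h2
        rw [← h2, sum_mul, mul_sum, ← sum_sub_distrib, map_sum]
        refine sum_congr rfl fun j _ => ?_
        rw [smul_mul_assoc, mul_smul_comm, ← smul_sub, hW'.comm_ev, qX, mulVec, dotProduct,
          map_sum, map_sum, map_sum, smul_sum]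
        refine sum_congr rfl fun ν _ => ?_
        rw [constMat, Matrix.map_apply, ← smul_eq_C_mul, ← smul_eq_C_mul, Derivation.map_smul,
          vectorField_X, map_smul, map_smul, smul_smul]
    have h2 := congrArg (coeff (single ρ 1)) h1
    rw [coeff_single_subst_qX] at h2
    simpa only [map_sum, ← smul_eq_C_mul, map_smul, smul_eq_mul, coeff_seriesA, mul_comm
      (q _ ρ)] using h2
  · intro a b μ
    have h1 : chComp L.co ((constMat q).mulVec (XL k M.m)) ((constMat q).mulVec (XR k M.m)) μ =
        ∑ ν, C (q μ ν) * M.co.campbellHausdorff ν := hW'.eq_of_tev fun N => by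
      obtain ⟨M₁, h1, h2⟩ := hcom N (x μ)
      rw [hP.comul_x', hx, map_sum,
        hP.map_tev _ (hQ.tev_kill N) (constMat_mulVec_mem q XL_mem) (constMat_mulVec_mem q XR_mem)
          (fun μ => ?_) fun μ => ?_] at h2
      · refine h2.trans ?_
        rw [map_sum]
        refine sum_congr rfl fun ν _ => ?_
        rw [← smul_eq_C_mul, map_smul, map_smul, hQ.comul_x']
        rfl
      · rw [map_tmul, map_one, ← hP.ev_X, hev h1, subst_X (hasSubst_of_mem qX_mem),
          ← subst_qX XL_mem]
        exact (hQ.tev_XL N _).symm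
      · rw [map_tmul, map_one, ← hP.ev_X, hev h1, subst_X (hasSubst_of_mem qX_mem),
          ← subst_qX XR_mem]
        exact (hQ.tev_XR N _).symm
    set V := (constMat (τ := Fin M.m ⊕ Fin M.m) q).mulVec (XL k M.m) with hV
    set V' := (constMat (τ := Fin M.m ⊕ Fin M.m) q).mulVec (XR k M.m) with hV'
    set c := single (Sum.inl a : Fin M.m ⊕ Fin M.m) 1 + single (Sum.inr b) 1 with hc
    have hc2 : c.degree = 2 := by simp [c]
    have e : ∀ ρ σ, coeff c (V ρ * V' σ) = q ρ a * q σ b := fun ρ σ => by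
      rw [← coeff_inl_inr (fun a b => q ρ a * q σ b) a b, ← hc, hV, hV', mulVec, dotProduct,
        mulVec, dotProduct, sum_mul_sum]
      simp only [constMat, Matrix.map_apply, ← smul_eq_C_mul, smul_mul_smul_comm]
    have e2 : coeff c (brk L.co V V' μ) = ∑ ρ, ∑ σ, L.co.γ ρ σ μ * (q ρ a * q σ b) := by
      simp only [brk_apply, map_sum, map_smul, e, smul_eq_mul]
    have e3 : ∀ ν, coeff c (brk M.co (XL k M.m) (XR k M.m) ν) = M.co.γ a b ν := fun ν =>
      coeff_inl_inr (fun a b => M.co.γ a b ν) a b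
    have h2 := coeff_chComp_of_degree_eq_two L.co (constMat_mulVec_mem q XL_mem)
      (constMat_mulVec_mem q XR_mem)
      (by simp [mulVec, dotProduct, constMat, XL, ← smul_eq_C_mul])
      (by simp [mulVec, dotProduct, constMat, XR, ← smul_eq_C_mul]) hc2 μ
    have h3 := fun ν => coeff_chComp_of_degree_eq_two M.co XL_mem XR_mem (fun _ => euler_X _)
      (fun _ => euler_X _) hc2 ν
    simp only [chComp_XL_XR, e3] at h3
    rw [h1, e2] at h2
    simp only [map_sum, ← smul_eq_C_mul, map_smul, smul_eq_mul, mul_sum, mul_left_comm (2 : k),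
      h3] at h2
    simp only [h2]
  · intro i ρ s
    have h1 := (hW'.eq_of_tev_sum
      (P := fun s => ∑ l, subst (XL k M.m) (subst (qX q) (L.co.expAlpha i l)) * C (p l s))
      (Q := fun s => ∑ j, C (p i j) * subst (XL k M.m) (M.co.expAlpha j s))
      (F := fun j => C (p i j)) (G := fun j => C (p i j)) fun N => ?_).1
    · have e : ∀ f g : PS (Fin M.m) k, subst (XL k M.m) f = subst (XL k M.m) g → f =
          g := fun f g hfg => by
        have h0 : ∀ i, (0 : Fin M.m → PS (Fin M.m) k) i ∈ degIdeal k _ 1 := fun i => zero_mem _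
        have hs := hasSubst_of_mem (sumElim_mem (X_mem_degIdeal (k := k)) h0)
        have h2 := congrArg (subst (Sum.elim (X : Fin M.m → PS (Fin M.m) k) 0)) hfg
        rwa [subst_comp_subst_apply (hasSubst_of_mem XL_mem) hs, subst_comp_subst_apply
          (hasSubst_of_mem XL_mem) hs, subst_XL X_mem_degIdeal h0, subst_X_self, subst_X_self] at h2
      have h2 : ∑ l, p l s • subst (qX q) (L.co.expAlpha i l) = ∑ j,
        p i j • M.co.expAlpha j s := e _ _ (by
        have h3 := congrFun h1 s
        simp only [mul_comm _ (C _), ← smul_eq_C_mul] at h3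
        rw [← coe_substAlgHom (hasSubst_of_mem XL_mem), map_sum, map_sum]
        simpa only [map_smul, coe_substAlgHom] using h3)
      have h3 := congrArg (coeff (single ρ 1)) h2
      simp only [map_sum, map_smul, coeff_single_subst_qX, coeff_expAlpha, smul_eq_mul,
        mul_sum] at h3
      rw [← h3, sum_comm]
      exact sum_congr rfl fun _ _ => sum_congr rfl fun _ _ => by ring
    · obtain ⟨M₁, h1, h2⟩ := hcom N (h i)
      have eL : ∀ r, hW'.tev N (subst (XL k M.m) r) = hW'.ev N r ⊗ₜ 1 := tensorEval_inl _ _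
      have eC : ∀ r s, hQ.ev N (M.co.expAlpha r s) = hW'.ev N (M.co.expAlpha r s) := fun _ _ => rfl
      rw [hP.map_comul_h, hh, map_sum] at h2
      simp only [hev h1, quotLift_mk, AlgHom.comp_apply, hlin, map_smul, hQ.comul_h, IsPBW.Dh,
        coprodH,
        smul_add, sum_add_distrib, tmul_sum, sum_tmul,
        smul_sum, eC] at h2
      refine congrArg₂ (· + ·) ?_ rfl
      have h3 := add_right_cancel h2
      simp only [mul_comm _ (C _), ← smul_eq_C_mul, map_sum, map_smul, eL, sum_mul,
        smul_mul_assoc, tmul_mul_tmul, one_mul, mul_one]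
      rw [sum_comm]
      refine Eq.trans ?_ (h3.trans sum_comm)
      simp only [tmul_smul]

end QuantizationMaps

section QuantizationFunctor

theorem isBialgMap_one (L : InhomLieBialgebra k) : IsBialgMap L L 1 1 := by
  constructor
  · intro i j s; simp [one_apply]
  · intro i μ ρ; simp [one_apply]
  · intro a b μ; simp [one_apply]
  · intro i ρ s; simp [one_apply]

variable {L : InhomLieBialgebra k}

theorem exists_hom_gen {U W : AdicHopfAlgebra k} {h : Fin L.n → U.carrier}
    {x : Fin L.m → U.carrier} {g : Fin L.n → W.carrier} {y : Fin L.m → W.carrier}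
    (hU : IsQuantization L U h x) (hW : IsQuantization L W g y) :
    ∃ f : U ⟶ W, (∀ i, f.toAlg (h i) = g i) ∧ ∀ μ, f.toAlg (x μ) = y μ := by
  obtain ⟨f, h1, h2⟩ := exists_hom (isBialgMap_one L) hU hW
  exact ⟨f, fun i => by simp [h1, one_apply], fun μ => by simp [h2, one_apply]⟩

theorem existsUnique_iso {U W : AdicHopfAlgebra k}
    {h : Fin L.n → U.carrier} {x : Fin L.m → U.carrier} {g : Fin L.n → W.carrier}
    {y : Fin L.m → W.carrier} (hU : IsQuantization L U h x) (hW : IsQuantization L W g y) :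
    ∃! e : U ≅ W, (∀ i, AdicHopfAlgebra.Hom.toAlg e.hom (h i) = g i) ∧
      ∀ μ, AdicHopfAlgebra.Hom.toAlg e.hom (x μ) = y μ := by
  obtain ⟨f, hf1, hf2⟩ := exists_hom_gen hU hW
  obtain ⟨f', hf1', hf2'⟩ := exists_hom_gen hW hU
  refine ⟨⟨f, f', hom_ext_of_gen hU (fun i => ?_) fun μ => ?_, hom_ext_of_gen hW (fun i => ?_)
    fun μ => ?_⟩, ⟨hf1, hf2⟩, fun e he => Iso.ext (hom_ext_of_gen hU (fun i => ?_) fun μ => ?_)⟩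
  · exact (congrArg _ (hf1 i)).trans (hf1' i)
  · exact (congrArg _ (hf2 μ)).trans (hf2' μ)
  · exact (congrArg _ (hf1' i)).trans (hf1 i)
  · exact (congrArg _ (hf2' μ)).trans (hf2 μ)
  · rw [he.1, hf1]
  · rw [he.2, hf2]

theorem exists_quantHom {L M : InhomLieBialgebra k} {P Q : QuantumAlgebra k}
    {h : Fin L.n → P.hopf.carrier} {x : Fin L.m → P.hopf.carrier} {g : Fin M.n → Q.hopf.carrier}
    {y : Fin M.m → Q.hopf.carrier} (hh : span k (Set.range h) = P.spanH)
    (hx : span k (Set.range x) = P.spanX) (hg : span k (Set.range g) = Q.spanH)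
    (hy : span k (Set.range y) = Q.spanX) {p : Matrix (Fin L.n) (Fin M.n) k}
    {q : Matrix (Fin L.m) (Fin M.m) k} (hpq : IsBialgMap L M p q) (hP : IsQuantization L P.hopf h x)
    (hQ : IsQuantization M Q.hopf g y) : ∃ f : P ⟶ Q, (∀ i, algMap f (h i) = ∑ j, p i j • g j) ∧
      ∀ μ, algMap f (x μ) = ∑ ν, q μ ν • y ν := by
  obtain ⟨f, h1, h2⟩ := exists_hom hpq hP hQ
  have e : ∀ {r s : ℕ} {a : Fin r → P.hopf.carrier} {b : Fin s → Q.hopf.carrier}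
      {c : Matrix (Fin r) (Fin s) k} (_ : ∀ i, f.toAlg (a i) = ∑ j, c i j • b j),
      ∀ z ∈ span k (Set.range a), f.toAlg z ∈ span k (Set.range b) :=
    fun hc z hz => (Submodule.map_span_le f.toAlg.toLinearMap _ _).2 (by
      rintro _ ⟨i, rfl⟩
      refine (hc i).symm ▸ ?_
      exact Submodule.sum_mem _ fun j _ => Submodule.smul_mem _ _ (subset_span ⟨j, rfl⟩))
      (Submodule.mem_map_of_mem hz)
  exact ⟨QuantumAlgebra.Hom.mk f (hh ▸ hg ▸ e h1) (hx ▸ hy ▸ e h2), h1, h2⟩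

theorem quantHom_ext {P Q : QuantumAlgebra k}
    {h : Fin L.n → P.hopf.carrier} {x : Fin L.m → P.hopf.carrier} (hP : IsQuantization L P.hopf h x)
    {f f' : P ⟶ Q} (hh : ∀ i, algMap f (h i) = algMap f' (h i))
    (hx : ∀ μ, algMap f (x μ) = algMap f' (x μ)) : f = f' :=
  QuantumAlgebra.Hom.ext (hom_ext_of_gen hP hh hx)

/-- A choice of a quantization of every inhomogeneous Lie bialgebra. -/
structure Quantizer (k : Type u) [Field k] where
  obj : InhomLieBialgebra k → QuantumAlgebra k
  h : ∀ L, Fin L.n → (obj L).hopf.carrier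
  x : ∀ L, Fin L.m → (obj L).hopf.carrier
  isQuantization : ∀ L, IsQuantization L (obj L).hopf (h L) (x L)
  spanH : ∀ L, span k (Set.range (h L)) = (obj L).spanH
  spanX : ∀ L, span k (Set.range (x L)) = (obj L).spanX

variable (k) in
/-- The quantizations by the model algebras. -/
def modelQuantizer : Quantizer k where
  obj L :=
    { hopf := (isPBW_model L).hopf
      spanH := span k (Set.range (modelH L))
      spanX := span k (Set.range (modelX L))
      exists_generators := ⟨_, _, _, _, _, _, _, (isPBW_model L).isQuantumAlgebra_hopf, rfl, rfl⟩ }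
  h L := modelH L
  x L := modelX L
  isQuantization L := (isPBW_model L).isQuantization_hopf
  spanH _ := rfl
  spanX _ := rfl

namespace Quantizer

variable (Q : Quantizer k)

variable {L M : InhomLieBialgebra k}

theorem exists_map (f : L ⟶ M) : ∃ F : Q.obj L ⟶ Q.obj M,
    (∀ i, algMap F (Q.h L i) = ∑ j, matH f i j • Q.h M j) ∧
      ∀ μ, algMap F (Q.x L μ) = ∑ ν, matX f μ ν • Q.x M ν :=
  exists_quantHom (Q.spanH L) (Q.spanX L) (Q.spanH M) (Q.spanX M) (isBialgMap_of_hom f)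
    (Q.isQuantization L) (Q.isQuantization M)

/-- The quantization of a morphism. -/
def map (f : L ⟶ M) : Q.obj L ⟶ Q.obj M := (Q.exists_map f).choose

theorem map_h (f : L ⟶ M) (i : Fin L.n) : algMap (Q.map f) (Q.h L i) = ∑ j, matH f i j • Q.h M j :=
  (Q.exists_map f).choose_spec.1 i

theorem map_x (f : L ⟶ M) (μ : Fin L.m) : algMap (Q.map f) (Q.x L μ) = ∑ ν, matX f μ ν • Q.x M ν :=
  (Q.exists_map f).choose_spec.2 μ

theorem matH_comp {L M N : InhomLieBialgebra k} (f : L ⟶ M) (g : M ⟶ N) :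
    matH (f ≫ g) = matH f * matH g := by
  ext i j
  change (InhomLieBialgebra.Hom.toLin g (InhomLieBialgebra.Hom.toLin f (L.basisH i))).1 j = _
  rw [toLin_eq g, linOf_fst]
  rfl

theorem matX_comp {L M N : InhomLieBialgebra k} (f : L ⟶ M) (g : M ⟶ N) :
    matX (f ≫ g) = matX f * matX g := by
  ext i j
  change (InhomLieBialgebra.Hom.toLin g (InhomLieBialgebra.Hom.toLin f (L.basisX i))).2 j = _
  rw [toLin_eq g, linOf_snd]
  rfl

/-- The quantization functor. -/
def functor : InhomLieBialgebra k ⥤ QuantumAlgebra k where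
  obj := Q.obj
  map := Q.map
  map_id L := quantHom_ext (Q.isQuantization L) (fun i => (Q.map_h _ i).trans (by
      rw [sum_eq_single_of_mem i (mem_univ i) fun j _ hj => by
        rw [show matH (𝟙 L) i j = 0 from Pi.single_eq_of_ne hj _, zero_smul],
        show matH (𝟙 L) i i = 1 from Pi.single_eq_same i _, one_smul]
      rfl))
    (fun i => (Q.map_x _ i).trans (by
      rw [sum_eq_single_of_mem i (mem_univ i) fun j _ hj => by
        rw [show matX (𝟙 L) i j = 0 from Pi.single_eq_of_ne hj _, zero_smul],
        show matX (𝟙 L) i i = 1 from Pi.single_eq_same i _, one_smul]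
      rfl))
  map_comp {L M N} f g := quantHom_ext (Q.isQuantization L) (fun i => by
      refine (Q.map_h _ i).trans (Eq.trans ?_ (congrArg (algMap (Q.map g)) (Q.map_h f i)).symm)
      rw [map_sum, matH_comp]
      simp only [map_smul, map_h, mul_apply, sum_smul, smul_sum, smul_smul]
      exact sum_comm)
    fun μ => by
      refine (Q.map_x _ μ).trans (Eq.trans ?_ (congrArg (algMap (Q.map g)) (Q.map_x f μ)).symm)
      rw [map_sum, matX_comp]
      simp only [map_smul, map_x, mul_apply, sum_smul, smul_sum, smul_smul]
      exact sum_comm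

theorem full_functor : Q.functor.Full where
  map_surjective {L M} F' := by
    let F : Q.obj L ⟶ Q.obj M := F'
    have hh := fun i => (Submodule.mem_span_range_iff_exists_fun k).1
      ((Q.spanH M).symm ▸ QuantumAlgebra.Hom.map_spanH F _ (by
        rw [← Q.spanH]; exact subset_span ⟨i, rfl⟩ : Q.h L i ∈ (Q.obj L).spanH))
    have hx := fun μ => (Submodule.mem_span_range_iff_exists_fun k).1
      ((Q.spanX M).symm ▸ QuantumAlgebra.Hom.map_spanX F _ (by
        rw [← Q.spanX]; exact subset_span ⟨μ, rfl⟩ : Q.x L μ ∈ (Q.obj L).spanX))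
    choose p hp using hh
    choose q hq using hx
    have hpq : IsBialgMap L M (Matrix.of p) (Matrix.of q) :=
      isBialgMap_of_gen (Q.isQuantization L) (Q.isQuantization M)
        (fun i => (hp i).symm) fun μ => (hq μ).symm
    refine ⟨homOf hpq, quantHom_ext (Q.isQuantization L) (fun i => ?_) fun μ => ?_⟩
    · refine (Q.map_h _ i).trans (Eq.trans ?_ (hp i))
      refine sum_congr rfl fun j _ => congrArg (· • _) ?_
      change (linOf (Matrix.of p) (Matrix.of q) (L.basisH i)).1 j = _
      rw [linOf_basisH, sum_basisH]
      rfl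
    · refine (Q.map_x _ μ).trans (Eq.trans ?_ (hq μ))
      refine sum_congr rfl fun j _ => congrArg (· • _) ?_
      change (linOf (Matrix.of p) (Matrix.of q) (L.basisX μ)).2 j = _
      rw [linOf_basisX, sum_basisX]
      rfl

theorem nonempty_iso {P : QuantumAlgebra k}
    {h : Fin L.n → P.hopf.carrier} {x : Fin L.m → P.hopf.carrier} (hL : IsQuantization L P.hopf h x)
    (hh : span k (Set.range h) = P.spanH)
    (hx : span k (Set.range x) = P.spanX) : Nonempty (Q.obj L ≅ P) := by
  have hM := Q.isQuantization L
  have h1 := isBialgMap_one L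
  obtain ⟨f, hf1, hf2⟩ := exists_quantHom (Q.spanH L) (Q.spanX L) hh hx h1 hM hL
  obtain ⟨f', hf1', hf2'⟩ := exists_quantHom hh hx (Q.spanH L) (Q.spanX L) h1 hL hM
  simp only [one_apply, ite_smul, one_smul, zero_smul, sum_ite_eq, mem_univ,
    if_true] at hf1 hf2 hf1' hf2'
  exact ⟨⟨f, f', quantHom_ext hM (fun i => (congrArg (algMap f') (hf1 i)).trans (hf1' i))
    fun μ => (congrArg (algMap f') (hf2 μ)).trans (hf2' μ), quantHom_ext hL
    (fun i => (congrArg (algMap f) (hf1' i)).trans (hf1 i))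
    fun μ => (congrArg (algMap f) (hf2' μ)).trans (hf2 μ)⟩⟩

theorem essSurj_functor : Q.functor.EssSurj where
  mem_essImage P := by
    obtain ⟨n, m, co, Cs, As, h, x, hU, hh, hx⟩ := P.exists_generators
    exact ⟨hU.limit, Q.nonempty_iso hU.isQuantization_limit hh hx⟩

end Quantizer

end QuantizationFunctor

end InhomQuant
end

theorem mainTheorem1 (k : Type u) [Field k] [CharZero k] :
    -- existence of a quantization
    (∀ L : InhomLieBialgebra k, ∃ (U : AdicHopfAlgebra k) (h : Fin L.n → U.carrier)
      (x : Fin L.m → U.carrier), IsQuantization L U h x) ∧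
    -- uniqueness of the quantization, up to a unique isomorphism respecting the generators
    (∀ (L : InhomLieBialgebra k) (U W : AdicHopfAlgebra k)
      (h : Fin L.n → U.carrier) (x : Fin L.m → U.carrier)
      (g : Fin L.n → W.carrier) (y : Fin L.m → W.carrier),
      IsQuantization L U h x → IsQuantization L W g y →
      ∃! e : U ≅ W, (∀ i, AdicHopfAlgebra.Hom.toAlg e.hom (h i) = g i) ∧
        (∀ μ, AdicHopfAlgebra.Hom.toAlg e.hom (x μ) = y μ)) ∧
    -- the commutation relations: `C(X)` is constant, `A(X)` is the given explicit series
    (∀ (L : InhomLieBialgebra k) (U : AdicHopfAlgebra k)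
      (h : Fin L.n → U.carrier) (x : Fin L.m → U.carrier)
      (Cs : Fin L.n → Fin L.n → Fin L.n → MvPowerSeries (Fin L.m) k)
      (As : Fin L.n → Fin L.m → MvPowerSeries (Fin L.m) k),
      IsQuantumAlgebra L.co Cs As U h x → HasClassicalLimit L Cs As →
      Cs = L.seriesC ∧ As = L.seriesA) ∧
    -- the explicit series comes from a Lie group 1-cocycle with differential `A`
    (∀ L : InhomLieBialgebra k, L.co.IsGroupCocycle L.cocycle ∧
      ∀ i μ ν, MvPowerSeries.coeff (Finsupp.single ν 1) (L.cocycle i μ) = L.A i ν μ) ∧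
    -- the quantization is a functor onto the subcategory of quantum algebras, which is given on the
    -- generators by the same formulas as the morphism of Lie bialgebras
    (∃ (F : InhomLieBialgebra k ⥤ QuantumAlgebra k)
      (h : ∀ L : InhomLieBialgebra k, Fin L.n → (F.obj L).hopf.carrier)
      (x : ∀ L : InhomLieBialgebra k, Fin L.m → (F.obj L).hopf.carrier),
      (∀ L, IsQuantization L (F.obj L).hopf (h L) (x L) ∧
        Submodule.span k (Set.range (h L)) = (F.obj L).spanH ∧
        Submodule.span k (Set.range (x L)) = (F.obj L).spanX) ∧
      (∀ (L M : InhomLieBialgebra k) (f : L ⟶ M),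
        (∀ i, QuantumAlgebra.algMap (F.map f) (h L i) =
          ∑ j, (InhomLieBialgebra.Hom.toLin f (L.basisH i)).1 j • h M j) ∧
        (∀ μ, QuantumAlgebra.algMap (F.map f) (x L μ) =
          ∑ ν, (InhomLieBialgebra.Hom.toLin f (L.basisX μ)).2 ν • x M ν)) ∧
      F.Full ∧ F.EssSurj) := by
  let Q := InhomQuant.modelQuantizer k
  exact ⟨fun L => ⟨_, _, _, (InhomQuant.isPBW_model L).isQuantization_hopf⟩,
    fun L U W h x g y hU hW => InhomQuant.existsUnique_iso hU hW,
    fun L U h x Cs As hU hl => InhomQuant.series_unique hU hl,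
    fun L => ⟨InhomQuant.isGroupCocycle_cocycle L, InhomQuant.coeff_cocycle L⟩,
    Q.functor, Q.h, Q.x, fun L => ⟨Q.isQuantization L, Q.spanH L, Q.spanX L⟩,
    fun L M f => ⟨Q.map_h f, Q.map_x f⟩, Q.full_functor, Q.essSurj_functor⟩
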